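/- **Setting.** Let $\rho,\eta\ge 0$ be measurable densities, symmetric about $0$, of probability laws $\mu,\nu$ on $\mathbb R$ that are integrable and in convex order, $\mu\le_{cx}\nu$. Suppose that for some $\alpha,\beta\in(0,\infty]$ one has $\rho>0$ on $(-\alpha,\alpha)$, $\mu((-\alpha,\alpha))=1$, $\eta>0$ on $(-\beta,\beta)$, $\nu((-\beta,\beta))=1$, and that for some $e\in(0,\alpha)$, $\rho>\eta$ on $(-e,e)$ and $\eta>\rho$ on $(-\beta,-e)\cup(e,\beta)$. Let $a,b:\mathbb R\to[0,\infty)$ be measurable and symmetric about $0$, put $A=a\vee b$, and suppose that $b$ and $A$ are convex and $\lim_{x\to\beta}b(x)>A(0)$. (It is not assumed that $a\ge b$.) A *model* is a filtered probability space with times $0,1,2$ and a martingale $(Z_0,Z_1,Z_2)$ on it with $Z_0=\int x\,d\mu$, $Z_1\sim\mu$, $Z_2\sim\nu$; an *exercise time* is a stopping time with values in $\{1,2\}$. Let $\mathcal P(\mu,\nu;a,b)=\sup\mathbb E[a(Z_1)I_{\{\tau=1\}}+b(Z_2)I_{\{\tau=2\}}]$ over all models and exercise times. A *superhedge* of $(a,b)$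 is a quadruple $(\phi,\psi,\theta_1,\theta_2)$ of functions ($\phi,\psi$ measurable) with $a(x)\le\phi(x)+\psi(y)+\theta_1(x)(y-x)$ and $b(y)\le\phi(x)+\psi(y)+\theta_2(x)(y-x)$ for all $x,y$; its cost is $\int\phi\,d\mu+\int\psi\,d\nu$, with $(-\infty)+(+\infty)=+\infty$, and $\mathcal D(\mu,\nu;a,b)$ is the infimum of the costs. A convex $\psi\ge b$ generates the superhedge $((a-\psi)^+,\psi,-\psi',0)$, with $\psi'$ the right derivative. **Couplings.** Write $\pi_x^{c,d}=\frac{d-x}{d-c}\delta_c+\frac{x-c}{d-c}\delta_d$ for $c<x<d$. Let $f^R<\mathrm{id}<g^R$ map $(-\alpha,e)$ to $(-\beta,\beta)$ with $\int_x^{g^R}z^i\rho\,dz=\int_{f^R}^{g^R}z^i\eta\,dz$, $i=0,1$, and let $f^L<\mathrm{id}<g^L$ map $(-e,\alpha)$ to $(-\beta,\beta)$ with $\int_{f^L}^{x}z^i\rho\,dz=\int_{f^L}^{g^L}z^i\eta\,dz$, $i=0,1$. Put $\pi^R_x=\delta_x$ for $x\ge e$, $\pi^R_x=\pi_x^{f^R(x),g^R(x)}$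 for $x<e$, and $\pi^L_x=\delta_x$ for $x\le -e$, $\pi^L_x=\pi_x^{f^L(x),g^L(x)}$ for $x>-e$. For measures $\chi$ on $(-\gamma,\gamma)$ and $\xi$ on $[-\gamma,\gamma]^c$, let $HK(\chi,\xi)$ be the kernel $\pi_x^{p(x),q(x)}$, where $p<-\gamma$ and $q>\gamma$ are nonincreasing on $(-\gamma,\gamma)$ and $\int_{(-\gamma,x)}z^i\,d\chi=\int_{(p(x),-\gamma)}z^i\,d\xi+\int_{(q(x),\infty)}z^i\,d\xi$, $i=0,1$. Let $x_0\in(0,e)$ satisfy $f^R(x_0)=0$, let $\ell_x$ be the line through $(x,A(x))$ and $(g^R(x),b(g^R(x)))$, and $l=\ell_{x_0}$. Below, $\nu-\mu$ and $\mu-\nu$ denote the measures with densities $\eta-\rho$ and $\rho-\eta$. **Cases.** In each case a model $\mathcal M^*$, an exercise time $\tau^*$ and a function $\psi^*$ are given. In (C1), (C2) the model is the space of pairs $(x,y)$ with law $\mu(dx)\pi^*_x(dy)$, prices $(0,x,y)$ and time-1 information $x$. In (C3) it is the space of triples $(u,x,y)$, $u\in(0,1)$, with law $du\,\mu(dx)\pi^*_{u,x}(dy)$,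 prices $(0,x,y)$ and time-1 information $(u,x)$. The time-0 information is trivial. * (C1) $A(0)\le l(0)\le A(x_0)$. $\pi^*$ is $\pi^L$ on $x\le -x_0$, $\pi^R$ on $x\ge x_0$, and on $(-x_0,x_0)$ it is $HK(\mu|_{(-x_0,x_0)},(\nu-\mu)|_{(-\beta,f^L(-x_0))\cup(g^R(x_0),\beta)})$; $\tau^*=1$ iff $Z_1\notin(-x_0,x_0)$; $\psi^*(x)=\max\{b(x),l(x),l(-x)\}$. * (C2) $l(0)>A(x_0)$. Let $x_1\in(0,x_0)$ and $h_1\in[g^R(x_0),\beta)$ be such that $\mu((x_1,x_0))=(\nu-\mu)((g^R(x_0),h_1))$ and $b(h_1)=A(x_1)$. $\pi^*$ is $\pi^L$ on $x\le -x_0$, $\pi^R$ on $x\ge x_0$, $HK(\mu|_{(-x_0,-x_1)\cup(x_1,x_0)},(\nu-\mu)|_{(-h_1,f^L(-x_0))\cup(g^R(x_0),h_1)})$ on $x_1\le|x|<x_0$, and $HK(\mu|_{(-x_1,x_1)},(\nu-\mu)|_{(-\beta,-h_1)\cup(h_1,\beta)})$ on $(-x_1,x_1)$; $\tau^*=1$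 iff $Z_1\notin(-x_1,x_1)$; $\psi^*=\max\{b,A(x_1)\}$. * (C3) $l(0)<A(0)$, with $A(e)>b(e)$. Let $x_3\in(x_0,e)$ be such that $\ell_{x_3}(f^R(x_3))=A(f^R(x_3))$, and $x_4\in(g^R(x_3),\beta)$ such that $(\mu-\nu)((0,f^R(x_3)))=(\nu-\mu)((x_4,\infty))$. $\pi^*$ is $\pi^L$ on $x\le-x_3$ and $\pi^R$ on $x\ge x_3$; on $(g^L(-x_3),f^R(x_3))$ it is $\delta_x$ if $u\le\eta(x)/\rho(x)$, and otherwise $HK((\mu-\nu)|_{(g^L(-x_3),f^R(x_3))},(\nu-\mu)|_{(-\beta,-x_4)\cup(x_4,\beta)})$; for the remaining $x$ it is $HK(\mu|_{(-x_3,g^L(-x_3))\cup(f^R(x_3),x_3)},(\nu-\mu)|_{(-x_4,f^L(-x_3))\cup(g^R(x_3),x_4)})$. $\tau^*=1$ iff $Z_1\notin(-x_3,x_3)$, or $Z_1\in(g^L(-x_3),f^R(x_3))$ and $U<\eta(Z_1)/\rho(Z_1)$. $\psi^*$ equals $b$ outside $[-g^R(x_3),g^R(x_3)]$, $A$ on $(-f^R(x_3),f^R(x_3))$,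 and $\ell_{x_3}(|x|)$ elsewhere. * (C3) $l(0)<A(0)$, with $A(e)=b(e)$. $\pi^*_{u,x}$ is $HK((\mu-\nu)|_{(-e,e)},(\nu-\mu)|_{(-\beta,-e)\cup(e,\beta)})$ if $x\in(-e,e)$ and $u>\eta(x)/\rho(x)$, and $\delta_x$ otherwise; $\tau^*=2$ iff $Z_1\in(-e,e)$ and $U>\eta(Z_1)/\rho(Z_1)$; $\psi^*=A$ on $[-e,e]$ and $\psi^*=b$ elsewhere. **Theorem.** The functions $f^R,g^R,f^L,g^L$ and the point $x_0$ exist; one of the cases above holds; in the case that holds, the points $x_1,h_1$ (resp. $x_3,x_4$) and the functions $p,q$ of the Hobson–Klimmek kernels exist; and for every choice of them the following holds. Let $\hat\tau^*=2$ on $\{a(Z_1)<b(Z_1)\}$ and $\hat\tau^*=\tau^*$ elsewhere. Then $\mathcal M^*$ is a model, $\tau^*$ and $\hat\tau^*$ are exercise times, $\psi^*$ is convex with $\psi^*\ge b$, and, in $[0,\infty]$, $$\mathbb E^{\mathcal M^*}\big[a(Z_1)I_{\{\hat\tau^*=1\}}+b(Z_2)I_{\{\hat\tau^*=2\}}\big]=\int(a-\psi^*)^+d\mu+\int\psi^*d\nu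 .$$ The pair $(\mathcal M^*,\hat\tau^*)$ gives the highest model-based price of the claim $(a,b)$, and $\psi^*$ generates a cheapest superhedge of it. If $\mathbb P^{\mathcal M^*}(\tau^*=1,\,a(Z_1)<b(Z_1))=0$, the same holds with $\tau^*$ in place of $\hat\tau^*$. The triple $(\mathcal M^*,\tau^*,\psi^*)$ is in the same sense optimal for the claim $(a\vee b,b)$. There is no duality gap: $\mathcal P(\mu,\nu;a,b)=\mathcal D(\mu,\nu;a,b)$. -/

import Mathlib

open MeasureTheory Set
open scoped ENNReal

universe u

noncomputable section

namespace Bermudan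

open Classical in
/-- The integral of a real function with values in `[-∞, ∞]`, with the convention
`(-∞) + (+∞) = +∞`: it is `+∞` as soon as the positive part has infinite integral. -/
def extIntegral (m : Measure ℝ) (f : ℝ → ℝ) : EReal :=
  if ∫⁻ x, ENNReal.ofReal (f x) ∂m = ⊤ then ⊤
  else ((∫⁻ x, ENNReal.ofReal (f x) ∂m : ℝ≥0∞) : EReal)
    - ((∫⁻ x, ENNReal.ofReal (-f x) ∂m : ℝ≥0∞) : EReal)

/-- Convex order of integrable laws on the line. -/
structure ConvexOrder (μ ν : Measure ℝ) : Prop where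
  integrable_left : Integrable (fun x => x) μ
  integrable_right : Integrable (fun x => x) ν
  le : ∀ f : ℝ → ℝ, ConvexOn ℝ univ f → extIntegral μ f ≤ extIntegral ν f

/-! ### Models, exercise rules, the pricing problem -/

/-- A filtered probability space with time set `{0, 1, 2}` and a real process on it
(the data only). -/
structure MarketModel where
  /-- sample space -/
  Ω : Type u
  /-- sigma-algebra -/
  [mΩ : MeasurableSpace Ω]
  /-- probability -/
  P : Measure Ω
  /-- flow of information -/
  F : Filtration (Fin 3) mΩ
  /-- price process -/
  Z : Fin 3 → Ω → ℝ

attribute [instance] MarketModel.mΩ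

/-- `M` belongs to the set of models consistent with the marginals `μ` and `ν`: the price process
is a martingale started from the constant `∫ x dμ`, with `Z₁ ∼ μ` and `Z₂ ∼ ν`. -/
structure MarketModel.Consistent (M : MarketModel.{u}) (μ ν : Measure ℝ) : Prop where
  prob : IsProbabilityMeasure M.P
  martingale : Martingale M.Z M.F M.P
  initial : ∀ ω, M.Z 0 ω = ∫ x, x ∂μ
  law_one : M.P.map (M.Z 1) = μ
  law_two : M.P.map (M.Z 2) = ν

/-- Stopping times with values in `{1, 2}`. -/
def MarketModel.IsExerciseTime (M : MarketModel.{u}) (τ : M.Ω → Fin 3) : Prop :=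
  IsStoppingTime M.F (fun ω => (τ ω : WithTop (Fin 3))) ∧ ∀ ω, τ ω = 1 ∨ τ ω = 2

/-- `E[a(Z₁) 1_{τ = 1} + b(Z₂) 1_{τ = 2}]` for payoffs with values in `[0, ∞)`. -/
def MarketModel.expectedPayoff (M : MarketModel.{u}) (τ : M.Ω → Fin 3) (a b : ℝ → ℝ) : ℝ≥0∞ :=
  ∫⁻ ω, ENNReal.ofReal
    ((if τ ω = 1 then a (M.Z 1 ω) else 0) + (if τ ω = 2 then b (M.Z 2 ω) else 0)) ∂M.P

/-- The highest model-based price. -/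
def primalValue (μ ν : Measure ℝ) (a b : ℝ → ℝ) : ℝ≥0∞ :=
  sSup {v | ∃ (M : MarketModel.{0}) (τ : M.Ω → Fin 3),
    M.Consistent μ ν ∧ M.IsExerciseTime τ ∧ v = M.expectedPayoff τ a b}

open Classical in
/-- Never exercise at time 1 where the time-1 payoff is below `b(Z₁)`; otherwise follow `τ`. -/
def MarketModel.prudent (M : MarketModel.{u}) (a b : ℝ → ℝ) (τ : M.Ω → Fin 3) : M.Ω → Fin 3 :=
  fun ω => if a (M.Z 1 ω) < b (M.Z 1 ω) then 2 else τ ω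

/-! ### Superhedges, the hedging problem -/

/-- Superhedges of the Bermudan claim with payoffs `a` and `b`. -/
structure IsSuperhedge (a b φ ψ θ₁ θ₂ : ℝ → ℝ) : Prop where
  measurable_φ : Measurable φ
  measurable_ψ : Measurable ψ
  first : ∀ x y, a x ≤ φ x + ψ y + θ₁ x * (y - x)
  second : ∀ x y, b y ≤ φ x + ψ y + θ₂ x * (y - x)

open Classical in
/-- Hedging cost `∫ φ dμ + ∫ ψ dν`, equal to `+∞` as soon as one of the terms is. -/
def hedgingCost (μ ν : Measure ℝ) (φ ψ : ℝ → ℝ) : EReal :=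
  if extIntegral μ φ = ⊤ ∨ extIntegral ν ψ = ⊤ then ⊤
  else extIntegral μ φ + extIntegral ν ψ

/-- The cheapest superhedging cost. -/
def dualValue (μ ν : Measure ℝ) (a b : ℝ → ℝ) : EReal :=
  sInf {c | ∃ φ ψ θ₁ θ₂ : ℝ → ℝ, IsSuperhedge a b φ ψ θ₁ θ₂ ∧ c = hedgingCost μ ν φ ψ}

/-- The time-1 option position `(a - ψ)⁺` of the superhedge generated by `ψ`. -/
def generatedPhi (a ψ : ℝ → ℝ) : ℝ → ℝ := fun x => max (a x - ψ x) 0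

/-- The right derivative. -/
def rightDeriv (ψ : ℝ → ℝ) : ℝ → ℝ := fun x => derivWithin ψ (Ioi x) x

/-- The pair `(M, τ)` is a consistent model with an exercise time that attains the highest
model-based price of the claim `(a, b)`, the convex function `ψ` generates a cheapest superhedge
`((a - ψ)⁺, ψ, -ψ', 0)`, and the price equals the cost. -/
structure IsOptimal (μ ν : Measure ℝ) (a b : ℝ → ℝ) (M : MarketModel.{0}) (τ : M.Ω → Fin 3)
    (ψ : ℝ → ℝ) : Prop where
  consistent : M.Consistent μ ν
  exercise : M.IsExerciseTime τ
  payoff_eq_cost : (M.expectedPayoff τ a b : EReal) = hedgingCost μ ν (generatedPhi a ψ) ψ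
  highest : ∀ (M' : MarketModel.{u}) (τ' : M'.Ω → Fin 3), M'.Consistent μ ν → M'.IsExerciseTime τ' →
    M'.expectedPayoff τ' a b ≤ M.expectedPayoff τ a b
  convex : ConvexOn ℝ univ ψ
  dominates : ∀ x, b x ≤ ψ x
  superhedge : IsSuperhedge a b (generatedPhi a ψ) ψ (fun x => -rightDeriv ψ x) (fun _ => 0)
  cheapest : ∀ φ' ψ' θ₁ θ₂ : ℝ → ℝ, IsSuperhedge a b φ' ψ' θ₁ θ₂ →
    hedgingCost μ ν (generatedPhi a ψ) ψ ≤ hedgingCost μ ν φ' ψ'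

/-- Optimality when `a ≥ b` is not assumed. The triple `(M, τ, ψ)` is optimal for `(a ∨ b, b)`;
the triple with `τ` replaced by time 2 on `{a(Z₁) < b(Z₁)}` is optimal for `(a, b)`; and `τ` needs
no such change if it almost surely does not exercise there. -/
def OptimalWithoutOrder (μ ν : Measure ℝ) (a b : ℝ → ℝ) (M : MarketModel.{0})
    (τ : M.Ω → Fin 3) (ψ : ℝ → ℝ) : Prop :=
  IsOptimal.{u} μ ν (a ⊔ b) b M τ ψ ∧
  IsOptimal.{u} μ ν a b M (M.prudent a b τ) ψ ∧
  ((∀ᵐ ω ∂M.P, ¬ (τ ω = 1 ∧ a (M.Z 1 ω) < b (M.Z 1 ω))) →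
    IsOptimal.{u} μ ν a b M τ ψ)

/-! ### The symmetric setting with the dispersion assumption -/

/-- The law on the line with density `ρ`. -/
def law (ρ : ℝ → ℝ) : Measure ℝ := volume.withDensity fun x => ENNReal.ofReal (ρ x)

/-- The measure with density `h` on the set `S`. -/
def densityOn (h : ℝ → ℝ) (S : Set ℝ) : Measure ℝ :=
  (volume.restrict S).withDensity fun x => ENNReal.ofReal (h x)

/-- The interval `(-r, r)`, where `r` may be infinite. -/
def symIoo (r : EReal) : Set ℝ := {x | ((|x| : ℝ) : EReal) < r}

/-- `ρ` and `η` are symmetric densities of laws in convex order, positive on `(-α, α)` and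
`(-β, β)`, which carry the laws, and satisfy the dispersion assumption with parameter `e`. -/
structure IsDispersed (ρ η : ℝ → ℝ) (α β : EReal) (e : ℝ) : Prop where
  measurable_ρ : Measurable ρ
  measurable_η : Measurable η
  nonneg_ρ : ∀ x, 0 ≤ ρ x
  nonneg_η : ∀ x, 0 ≤ η x
  prob_ρ : IsProbabilityMeasure (law ρ)
  prob_η : IsProbabilityMeasure (law η)
  order : ConvexOrder (law ρ) (law η)
  symm_ρ : ∀ x, ρ (-x) = ρ x
  symm_η : ∀ x, η (-x) = η x
  α_pos : 0 < α
  β_pos : 0 < β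
  pos_ρ : ∀ x ∈ symIoo α, 0 < ρ x
  pos_η : ∀ x ∈ symIoo β, 0 < η x
  carrier_ρ : law ρ (symIoo α) = 1
  carrier_η : law η (symIoo β) = 1
  e_pos : 0 < e
  e_lt : (e : EReal) < α
  center : ∀ x ∈ Ioo (-e) e, η x < ρ x
  tails : ∀ x ∈ symIoo β, e < |x| → ρ x < η x

/-- The payoffs: nonnegative and symmetric, with `b` and `a ∨ b` convex, and
`lim_{x → β} b(x) > (a ∨ b)(0)` (as `b` is convex and symmetric, it is nondecreasing and continuous
on `[0, ∞)`, so this says that `b` exceeds `(a ∨ b)(0)` somewhere on `(0, β)`). -/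
structure IsPayoffPair (a b : ℝ → ℝ) (β : EReal) : Prop where
  measurable_a : Measurable a
  nonneg_a : ∀ x, 0 ≤ a x
  nonneg_b : ∀ x, 0 ≤ b x
  symm_a : ∀ x, a (-x) = a x
  symm_b : ∀ x, b (-x) = b x
  convex_b : ConvexOn ℝ univ b
  convex_sup : ConvexOn ℝ univ (a ⊔ b)
  nontrivial : ∃ y : ℝ, 0 < y ∧ (y : EReal) < β ∧ (a ⊔ b) 0 < b y

/-! ### Couplings -/

/-- The law on `{c, d}` with mean `x`, where `c < x < d`. -/
def twoPoint (c d x : ℝ) : Measure ℝ :=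
  ENNReal.ofReal ((d - x) / (d - c)) • Measure.dirac c
    + ENNReal.ofReal ((x - c) / (d - c)) • Measure.dirac d

/-- The functions of the right-curtain coupling on `(-α, e)`. -/
def IsRightCurtain (ρ η : ℝ → ℝ) (α β : EReal) (e : ℝ) (f g : ℝ → ℝ) : Prop :=
  ∀ x ∈ symIoo α, x < e → f x ∈ symIoo β ∧ g x ∈ symIoo β ∧ f x < x ∧ x < g x ∧
    (∫ z in x..g x, ρ z = ∫ z in f x..g x, η z) ∧
    (∫ z in x..g x, z * ρ z = ∫ z in f x..g x, z * η z)

/-- The functions of the left-curtain coupling on `(-e, α)`. -/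
def IsLeftCurtain (ρ η : ℝ → ℝ) (α β : EReal) (e : ℝ) (f g : ℝ → ℝ) : Prop :=
  ∀ x ∈ symIoo α, -e < x → f x ∈ symIoo β ∧ g x ∈ symIoo β ∧ f x < x ∧ x < g x ∧
    (∫ z in f x..x, ρ z = ∫ z in f x..g x, η z) ∧
    (∫ z in f x..x, z * ρ z = ∫ z in f x..g x, z * η z)

/-- The curtain functions `fR, gR, fL, gL` and the point `x₀ ∈ (0, e)` with `fR x₀ = 0`. -/
structure IsCurtainData (ρ η : ℝ → ℝ) (α β : EReal) (e : ℝ) (fR gR fL gL : ℝ → ℝ)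
    (x₀ : ℝ) : Prop where
  right : IsRightCurtain ρ η α β e fR gR
  left : IsLeftCurtain ρ η α β e fL gL
  mem : x₀ ∈ Ioo 0 e
  zero : fR x₀ = 0

open Classical in
/-- The kernel of the right-curtain coupling. -/
def rightKernel (e : ℝ) (f g : ℝ → ℝ) (x : ℝ) : Measure ℝ :=
  if e ≤ x then Measure.dirac x else twoPoint (f x) (g x) x

open Classical in
/-- The kernel of the left-curtain coupling. -/
def leftKernel (e : ℝ) (f g : ℝ → ℝ) (x : ℝ) : Measure ℝ :=
  if x ≤ -e then Measure.dirac x else twoPoint (f x) (g x) x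

/-- The functions of the Hobson–Klimmek coupling of a measure `χ` on `(-γ, γ)` and a measure
`ξ` on the complement of `[-γ, γ]`: the mass of `χ` on `(-γ, x)` is sent to the mass of `ξ` on
`(p x, -γ) ∪ (q x, ∞)`, with the same mean. -/
structure IsHKPair (χ ξ : Measure ℝ) (γ : ℝ) (p q : ℝ → ℝ) : Prop where
  anti_p : AntitoneOn p (Ioo (-γ) γ)
  anti_q : AntitoneOn q (Ioo (-γ) γ)
  p_lt : ∀ x ∈ Ioo (-γ) γ, p x < -γ
  lt_q : ∀ x ∈ Ioo (-γ) γ, γ < q x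
  mass : ∀ x ∈ Ioo (-γ) γ, χ (Ioo (-γ) x) = ξ (Ioo (p x) (-γ)) + ξ (Ioi (q x))
  mean : ∀ x ∈ Ioo (-γ) γ,
    ∫ z in Ioo (-γ) x, z ∂χ = ∫ z in Ioo (p x) (-γ), z ∂ξ + ∫ z in Ioi (q x), z ∂ξ

/-- The kernel of the Hobson–Klimmek coupling. -/
def hkKernel (p q : ℝ → ℝ) (x : ℝ) : Measure ℝ := twoPoint (p x) (q x) x

/-- The measure `μ(dx) κ_x(dy)`. -/
def coupling (μ : Measure ℝ) (κ : ℝ → Measure ℝ) : Measure (ℝ × ℝ) :=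
  μ.bind fun x => (κ x).map fun y => (x, y)

/-- The measure `du μ(dx) κ_{u,x}(dy)` with `u` in `(0, 1)`. -/
def randomizedCoupling (μ : Measure ℝ) (κ : ℝ → ℝ → Measure ℝ) : Measure (ℝ × ℝ × ℝ) :=
  ((volume.restrict (Ioo (0 : ℝ) 1)).prod μ).bind fun w =>
    (κ w.1 w.2).map fun y => (w.1, w.2, y)

/-- Trivial information at time 0, the value of `I` at time 1, everything at time 2. -/
def revealFiltration {Ω E : Type*} [m : MeasurableSpace Ω] [mE : MeasurableSpace E]
    (I : Ω → E) (hI : Measurable I) : Filtration (Fin 3) m where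
  seq := ![⊥, mE.comap I, m]
  mono' := by
    have h := hI.comap_le
    intro i j hij
    fin_cases i <;> fin_cases j <;> simp_all
  le' := by
    have h := hI.comap_le
    intro i
    fin_cases i <;> simp_all

/-- The model on the space of pairs `(x, y)` with law `π`, price process `(0, x, y)` and
time-1 information `x`. -/
def canonicalModel (π : Measure (ℝ × ℝ)) : MarketModel.{0} where
  Ω := ℝ × ℝ
  mΩ := inferInstance
  P := π
  F := revealFiltration Prod.fst measurable_fst
  Z := ![fun _ => 0, fun ω => ω.1, fun ω => ω.2]

/-- The model on the space of triples `(u, x, y)` with law `π`, price process `(0, x, y)` and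
time-1 information `(u, x)`. -/
def randomizedModel (π : Measure (ℝ × ℝ × ℝ)) : MarketModel.{0} where
  Ω := ℝ × ℝ × ℝ
  mΩ := inferInstance
  P := π
  F := revealFiltration (fun ω : ℝ × ℝ × ℝ => (ω.1, ω.2.1))
    (measurable_fst.prodMk (measurable_fst.comp measurable_snd))
  Z := ![fun _ => 0, fun ω => ω.2.1, fun ω => ω.2.2]

open Classical in
/-- Exercise at time 1 exactly if `Z₁ ∉ (-r, r)`. -/
def exerciseOutside (r : ℝ) : ℝ × ℝ → Fin 3 := fun ω => if ω.1 ∈ Ioo (-r) r then 2 else 1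

/-- The line through `(x, u)` and `(y, v)`. -/
def chord (x u y v : ℝ) : ℝ → ℝ := fun t => u + (v - u) / (y - x) * (t - x)

/-- The line through `(x, a x)` and `(g x, b (g x))`. -/
def payoffLine (a b g : ℝ → ℝ) (x : ℝ) : ℝ → ℝ := chord x (a x) (g x) (b (g x))

/-! ### First case -/

/-- `max {b, l, l(-·)}`. -/
def psiOne (b l : ℝ → ℝ) : ℝ → ℝ := fun x => max (b x) (max (l x) (l (-x)))

/-- `χ = μ` on `(-x₀, x₀)`. -/
def chiOne (ρ : ℝ → ℝ) (x₀ : ℝ) : Measure ℝ := densityOn ρ (Ioo (-x₀) x₀)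

/-- `ξ = ν - μ` on `(-β, fL(-x₀)) ∪ (gR x₀, β)`. -/
def xiOne (ρ η : ℝ → ℝ) (β : EReal) (fL gR : ℝ → ℝ) (x₀ : ℝ) : Measure ℝ :=
  densityOn (fun y => η y - ρ y) (symIoo β ∩ (Iio (fL (-x₀)) ∪ Ioi (gR x₀)))

open Classical in
/-- Curtains outside `(-x₀, x₀)`, Hobson–Klimmek inside. -/
def kernelOne (e : ℝ) (fR gR fL gL : ℝ → ℝ) (x₀ : ℝ) (p q : ℝ → ℝ) (x : ℝ) : Measure ℝ :=
  if x ≤ -x₀ then leftKernel e fL gL x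
  else if x₀ ≤ x then rightKernel e fR gR x
  else hkKernel p q x

/-! ### Second case -/

/-- `x₁ ∈ (0, x₀)` and `y₁ = h x₁`, that is, `ν - μ` on `(gR x₀, y₁)` has the mass of `μ` on
`(x₁, x₀)`, are such that `b (h x₁) = a x₁`. -/
structure IsLevel (ρ η a b : ℝ → ℝ) (β : EReal) (gR : ℝ → ℝ) (x₀ x₁ y₁ : ℝ) : Prop where
  mem : x₁ ∈ Ioo 0 x₀
  le : gR x₀ ≤ y₁
  lt : (y₁ : EReal) < β
  mass : (law ρ).real (Ioo x₁ x₀) = (law η).real (Ioo (gR x₀) y₁) - (law ρ).real (Ioo (gR x₀) y₁)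
  level : b y₁ = a x₁

/-- `max {b, a x₁}`. -/
def psiTwo (a b : ℝ → ℝ) (x₁ : ℝ) : ℝ → ℝ := fun x => max (b x) (a x₁)

/-- `χ₀ = μ` on `(-x₀, -x₁) ∪ (x₁, x₀)`. -/
def chiTwoOuter (ρ : ℝ → ℝ) (x₀ x₁ : ℝ) : Measure ℝ :=
  densityOn ρ (Ioo (-x₀) (-x₁) ∪ Ioo x₁ x₀)

/-- `ξ₀ = ν - μ` on `(-y₁, fL(-x₀)) ∪ (gR x₀, y₁)`. -/
def xiTwoOuter (ρ η fL gR : ℝ → ℝ) (x₀ y₁ : ℝ) : Measure ℝ :=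
  densityOn (fun y => η y - ρ y) (Ioo (-y₁) (fL (-x₀)) ∪ Ioo (gR x₀) y₁)

/-- `χ₁ = μ` on `(-x₁, x₁)`. -/
def chiTwoInner (ρ : ℝ → ℝ) (x₁ : ℝ) : Measure ℝ := densityOn ρ (Ioo (-x₁) x₁)

/-- `ν - μ` on `(-β, -y) ∪ (y, β)`. -/
def excessBeyond (ρ η : ℝ → ℝ) (β : EReal) (y : ℝ) : Measure ℝ :=
  densityOn (fun z => η z - ρ z) (symIoo β ∩ (Iio (-y) ∪ Ioi y))

open Classical in
/-- Curtains outside `(-x₀, x₀)`, Hobson–Klimmek on `x₁ ≤ |x| < x₀` and on `(-x₁, x₁)`. -/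
def kernelTwo (e : ℝ) (fR gR fL gL : ℝ → ℝ) (x₀ x₁ : ℝ) (p₀ q₀ p₁ q₁ : ℝ → ℝ) (x : ℝ) :
    Measure ℝ :=
  if x ≤ -x₀ then leftKernel e fL gL x
  else if x₀ ≤ x then rightKernel e fR gR x
  else if x ∈ Ioo (-x₁) x₁ then hkKernel p₁ q₁ x
  else hkKernel p₀ q₀ x

/-! ### Third case, `a e > b e` -/

/-- `x₃ ∈ (x₀, e)` is such that the line through `(x₃, a x₃)` and `(gR x₃, b (gR x₃))` meets `a` at
`fR x₃`, and `x₄ ∈ (gR x₃, β)` is such that the surplus of `μ` over `ν` on `(0, fR x₃)` equals that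
of `ν` over `μ` on `(x₄, ∞)`. -/
structure IsTangency (ρ η a b : ℝ → ℝ) (β : EReal) (e : ℝ) (fR gR : ℝ → ℝ) (x₀ x₃ x₄ : ℝ) :
    Prop where
  mem : x₃ ∈ Ioo x₀ e
  meet : a (fR x₃) = payoffLine a b gR x₃ (fR x₃)
  lt : gR x₃ < x₄
  lt_β : (x₄ : EReal) < β
  mass : (law ρ).real (Ioo 0 (fR x₃)) - (law η).real (Ioo 0 (fR x₃))
    = (law η).real (Ioi x₄) - (law ρ).real (Ioi x₄)

open Classical in
/-- The function equal to `b` outside `[-gR x₃, gR x₃]`, to `a` on `(-fR x₃, fR x₃)`, and to the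
line `l` or its mirror image in between. -/
def psiThree (a b l fR gR : ℝ → ℝ) (x₃ : ℝ) : ℝ → ℝ := fun x =>
  if x < -gR x₃ ∨ gR x₃ < x then b x
  else if x ∈ Ioo (-fR x₃) (fR x₃) then a x
  else if x ≤ -fR x₃ then l (-x)
  else l x

/-- `χ₃ = μ` on `(-x₃, gL(-x₃)) ∪ (fR x₃, x₃)`. -/
def chiThree (ρ gL fR : ℝ → ℝ) (x₃ : ℝ) : Measure ℝ :=
  densityOn ρ (Ioo (-x₃) (gL (-x₃)) ∪ Ioo (fR x₃) x₃)

/-- `ξ₃ = ν - μ` on `(-x₄, fL(-x₃)) ∪ (gR x₃, x₄)`. -/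
def xiThree (ρ η fL gR : ℝ → ℝ) (x₃ x₄ : ℝ) : Measure ℝ :=
  densityOn (fun y => η y - ρ y) (Ioo (-x₄) (fL (-x₃)) ∪ Ioo (gR x₃) x₄)

/-- `χ₄ = μ - ν` on `(gL(-x₃), fR x₃)`. -/
def chiFour (ρ η gL fR : ℝ → ℝ) (x₃ : ℝ) : Measure ℝ :=
  densityOn (fun x => ρ x - η x) (Ioo (gL (-x₃)) (fR x₃))

open Classical in
/-- Curtains outside `(-x₃, x₃)`; on `(gL(-x₃), fR x₃)` stay put if `u ≤ η x / ρ x` and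
Hobson–Klimmek otherwise; Hobson–Klimmek on the rest. -/
def kernelThree (ρ η : ℝ → ℝ) (e : ℝ) (fR gR fL gL : ℝ → ℝ) (x₃ : ℝ) (p₃ q₃ p₄ q₄ : ℝ → ℝ)
    (u x : ℝ) : Measure ℝ :=
  if x ≤ -x₃ then leftKernel e fL gL x
  else if x₃ ≤ x then rightKernel e fR gR x
  else if x ∈ Ioo (gL (-x₃)) (fR x₃) then
    (if u ≤ η x / ρ x then Measure.dirac x else hkKernel p₄ q₄ x)
  else hkKernel p₃ q₃ x

open Classical in
/-- Exercise at time 1 if `Z₁ ∉ (-x₃, x₃)`, or `Z₁ ∈ (gL(-x₃), fR x₃)` and `U < η(Z₁) / ρ(Z₁)`. -/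
def exerciseThree (ρ η gL fR : ℝ → ℝ) (x₃ : ℝ) : ℝ × ℝ × ℝ → Fin 3 := fun ω =>
  if ω.2.1 ∉ Ioo (-x₃) x₃ ∨ (ω.2.1 ∈ Ioo (gL (-x₃)) (fR x₃) ∧ ω.1 < η ω.2.1 / ρ ω.2.1)
  then 1 else 2

/-! ### Third case, `a e = b e` -/

open Classical in
/-- The function equal to `a` on `[-e, e]` and to `b` elsewhere. -/
def psiThreeDegenerate (a b : ℝ → ℝ) (e : ℝ) : ℝ → ℝ := fun x =>
  if x ∈ Icc (-e) e then a x else b x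

/-- `μ - ν` on `(-e, e)`. -/
def chiThreeDegenerate (ρ η : ℝ → ℝ) (e : ℝ) : Measure ℝ :=
  densityOn (fun x => ρ x - η x) (Ioo (-e) e)

open Classical in
/-- Hobson–Klimmek if `x ∈ (-e, e)` and `u > η x / ρ x`; otherwise stay put. -/
def kernelThreeDegenerate (ρ η : ℝ → ℝ) (e : ℝ) (p q : ℝ → ℝ) (u x : ℝ) : Measure ℝ :=
  if x ∈ Ioo (-e) e ∧ η x / ρ x < u then hkKernel p q x else Measure.dirac x

open Classical in
/-- Exercise at time 1 unless `Z₁ ∈ (-e, e)` and `U > η(Z₁) / ρ(Z₁)`. -/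
def exerciseThreeDegenerate (ρ η : ℝ → ℝ) (e : ℝ) : ℝ × ℝ × ℝ → Fin 3 := fun ω =>
  if ω.2.1 ∈ Ioo (-e) e ∧ η ω.2.1 / ρ ω.2.1 < ω.1 then 2 else 1

end Bermudan

end

noncomputable section

namespace Bermudan

/-! ### Extended integrals and convexity -/

/-! Write A = a ∨ b. The proof is complementary slackness for a linear programme and its dual,
followed by the construction of couplings that satisfy the slackness conditions.

Upper bound: let ψ ≥ b be convex. On {τ = 1} the payoff is at most (a - ψ)⁺(Z₁) + ψ(Z₁), and
Jensen's inequality on this time-1 event replaces ψ(Z₁) by ψ(Z₂); on {τ = 2} one has b ≤ ψ. Hence no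
model pays more than the hedge generated by ψ costs (`expectedPayoff_le_of_convex`). Conversely,
integrating the inequalities of an arbitrary superhedge against a given model removes the dynamic
term, so no superhedge costs less than that model pays (`superhedge_lintegral_le`,
`le_hedgingCost`). A model and a function ψ are therefore both optimal once payoff equals cost. For
the claim (A, b) this follows from two conditions. Where the rule exercises, ψ ≤ A at Z₁ and ψ is
affine along the conditional law of Z₂. Where it continues, A ≤ ψ at Z₁ and ψ = b at Z₂. If a < b at
an exercised point x, then ψ(x) = A(x) = b(x), and continuing is worth exactly as much; this is why
the modified rule is optimal for (a, b) (`factorModel_optimalWithoutOrder`).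

Couplings: f < x < g is a curtain point if μ on (-∞, x) has the mass and first moment of ν on (-∞,
f) together with ν - μ on (g, ∞). Because ν - μ changes sign only at ±e, two different solutions
would give equal masses on opposite sides of a point with equal first moments, which is impossible.
This yields uniqueness and monotonicity on the central interval; existence is an intermediate value
argument in the mass put on the lower branch (`exists_isCurtainPoint`). The Hobson–Klimmek functions
are found in the same way (`HKData.exists_isHKPair`). That such two-point kernels carry source to
target is proved backwards (`bind_twoPoint_eq_of_branches`): almost every target point y is an
endpoint for some x, the mass identities say that y ↦ x pushes the target to the source, the moment
identities say that x is the conditional mean of y, and a law on two given points is determined by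
its mean.

Cases: curtains outside (-s, s), with s equal to x₀ or x₃, leave for the middle the target ν on
(-f(s), f(s)) plus ν - μ beyond ±g(s) (`IsDispersed.target_eq`). Curtains starting beyond s have
endpoints in [f(s), g(s)], where ψ* is a line, so exercise there is free of loss; the continuing
part of the middle is sent to points where ψ* = b. Comparing convex functions with chords supplies
the inequalities between ψ*, A and b. The three cases differ in the position of the chord from (x₀,
A(x₀)) to (g(x₀), b(g(x₀))) at 0, and the extra parameters of the last two come from further
intermediate value arguments (`exists_isLevel`, `exists_isTangency`). If A(e) = b(e) in the third
case, no curtain is needed: the common part of μ and ν stays put and the surplus is moved by a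
single Hobson–Klimmek coupling. -/

lemma lintegral_ofReal_neg_eq_zero {m : Measure ℝ} {f : ℝ → ℝ} (hf : ∀ x, 0 ≤ f x) :
    ∫⁻ x, ENNReal.ofReal (-f x) ∂m = 0 := by
  have : (fun x => ENNReal.ofReal (-f x)) = fun _ => 0 := by
    ext x; simp [hf x]
  simp [this]

lemma extIntegral_of_nonneg {m : Measure ℝ} {f : ℝ → ℝ} (hf : ∀ x, 0 ≤ f x) :
    extIntegral m f = ((∫⁻ x, ENNReal.ofReal (f x) ∂m : ℝ≥0∞) : EReal) := by
  unfold extIntegral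
  split_ifs with h
  · rw [h]; rfl
  · rw [lintegral_ofReal_neg_eq_zero hf]; simp

lemma hedgingCost_of_nonneg {μ ν : Measure ℝ} {φ ψ : ℝ → ℝ} (hφ : ∀ x, 0 ≤ φ x)
    (hψ : ∀ x, 0 ≤ ψ x) :
    hedgingCost μ ν φ ψ =
      ((∫⁻ x, ENNReal.ofReal (φ x) ∂μ + ∫⁻ x, ENNReal.ofReal (ψ x) ∂ν : ℝ≥0∞) : EReal) := by
  unfold hedgingCost
  rw [extIntegral_of_nonneg hφ, extIntegral_of_nonneg hψ]
  split_ifs with h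
  · rcases h with h | h <;> rw [EReal.coe_ennreal_eq_top_iff] at h <;> simp [h]
  · rw [EReal.coe_ennreal_add]

lemma generatedPhi_nonneg (a ψ : ℝ → ℝ) (x : ℝ) : 0 ≤ generatedPhi a ψ x := le_max_right _ _

lemma rightDeriv_support {ψ : ℝ → ℝ} (hψ : ConvexOn ℝ univ ψ) (x y : ℝ) :
    ψ x + rightDeriv ψ x * (y - x) ≤ ψ y := by
  rcases lt_trichotomy x y with h | rfl | h
  · have := hψ.rightDeriv_le_slope_of_mem_interior (x := x) (y := y) (by simp) (mem_univ _) h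
    rw [slope_def_field, le_div_iff₀ (sub_pos.2 h)] at this
    unfold rightDeriv; linarith
  · simp
  · have h1 := hψ.slope_le_leftDeriv_of_mem_interior (x := y) (y := x) (mem_univ _) (by simp) h
    have h2 := hψ.leftDeriv_le_rightDeriv_of_mem_interior (x := x) (by simp)
    have h3 := h1.trans h2
    rw [slope_def_field, div_le_iff₀ (sub_pos.2 h)] at h3
    unfold rightDeriv; linarith

lemma continuous_of_convexOn {ψ : ℝ → ℝ} (hψ : ConvexOn ℝ univ ψ) : Continuous ψ :=
  continuousOn_univ.1 (hψ.continuousOn isOpen_univ)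

lemma isSuperhedge_generated {a b ψ : ℝ → ℝ} (ha : Measurable a) (hψ : ConvexOn ℝ univ ψ)
    (hb : ∀ x, b x ≤ ψ x) :
    IsSuperhedge a b (generatedPhi a ψ) ψ (fun x => -rightDeriv ψ x) (fun _ => 0) where
  measurable_φ := (ha.sub (continuous_of_convexOn hψ).measurable).max measurable_const
  measurable_ψ := (continuous_of_convexOn hψ).measurable
  first x y := by
    have := rightDeriv_support hψ x y
    have := le_max_left (a x - ψ x) 0
    unfold generatedPhi; linarith
  second x y := by
    have := generatedPhi_nonneg a ψ x
    have := hb y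
    linarith

/-! ### Weak duality for a convex hedge in an arbitrary model -/

/-- Conditional Jensen on a single event. If the right side is infinite there is nothing to prove;
otherwise ψ(Z) is integrable on S only, and Jensen is applied to the variable that equals Z on S and
0 elsewhere. -/
lemma lintegral_convex_martingale_le {Ω : Type*} {m₀ m : MeasurableSpace Ω} (hm : m ≤ m₀)
    {P : @Measure Ω m₀} [IsProbabilityMeasure P] {Y Z : Ω → ℝ} (hZ : Integrable Z P)
    (hY : P[Z|m] =ᵐ[P] Y) {ψ : ℝ → ℝ} (hψ : ConvexOn ℝ univ ψ) (hψ0 : ∀ x, 0 ≤ ψ x)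
    {S : Set Ω} (hS : MeasurableSet[m] S) :
    ∫⁻ ω in S, ENNReal.ofReal (ψ (Y ω)) ∂P ≤ ∫⁻ ω in S, ENNReal.ofReal (ψ (Z ω)) ∂P := by
  have hc := continuous_of_convexOn hψ
  by_cases hint : Integrable (ψ ∘ Z) (P.restrict S)
  swap
  · have : ∫⁻ ω in S, ENNReal.ofReal (ψ (Z ω)) ∂P = ⊤ := by
      by_contra hne
      apply hint
      refine ⟨(hc.comp_aestronglyMeasurable hZ.aestronglyMeasurable).restrict, ?_⟩
      rw [hasFiniteIntegral_iff_ofReal (f := ψ ∘ Z) (ae_of_all _ fun ω => hψ0 _)]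
      exact lt_top_iff_ne_top.2 hne
    rw [this]; exact le_top
  have hint' : Integrable (S.indicator (ψ ∘ Z)) P := by
    rwa [integrable_indicator_iff (hm _ hS)]
  -- Conditional Jensen for the stopped variable.
  set W : Ω → ℝ := S.indicator Z with hW
  have hWint : Integrable W P := hZ.indicator (hm _ hS)
  have hψW : Integrable (ψ ∘ W) P := by
    have : ψ ∘ W = fun ω => S.indicator (ψ ∘ Z) ω + Sᶜ.indicator (fun _ => ψ 0) ω := by
      ext ω
      by_cases h : ω ∈ S <;> simp [hW, h]
    rw [this]
    exact hint'.add ((integrable_const _).indicator (hm _ hS).compl)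
  have hJ := hψ.map_condExp_le_univ (f := W) hm hc.lowerSemicontinuous hWint hψW
  have hWY : P[W|m] =ᵐ[P] S.indicator Y := by
    refine (condExp_indicator hZ hS).trans ?_
    filter_upwards [hY] with ω hω
    by_cases h : ω ∈ S <;> simp [h, hω]
  calc ∫⁻ ω in S, ENNReal.ofReal (ψ (Y ω)) ∂P
      ≤ ∫⁻ ω in S, ENNReal.ofReal (P[ψ ∘ W|m] ω) ∂P := by
        refine lintegral_mono_ae ?_
        rw [ae_restrict_iff' (hm _ hS)]
        filter_upwards [hJ, hWY] with ω h1 h2 hω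
        refine ENNReal.ofReal_le_ofReal ?_
        simpa [h2, hω] using h1
    _ = ENNReal.ofReal (∫ ω in S, P[ψ ∘ W|m] ω ∂P) := by
        rw [ofReal_integral_eq_lintegral_ofReal integrable_condExp.restrict]
        exact ae_restrict_of_ae (condExp_nonneg (ae_of_all _ fun ω => hψ0 _))
    _ = ENNReal.ofReal (∫ ω in S, (ψ ∘ W) ω ∂P) := by
        rw [setIntegral_condExp hm hψW hS]
    _ = ∫⁻ ω in S, ENNReal.ofReal ((ψ ∘ W) ω) ∂P := by
        rw [ofReal_integral_eq_lintegral_ofReal hψW.restrict]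
        exact ae_of_all _ fun ω => hψ0 _
    _ = ∫⁻ ω in S, ENNReal.ofReal (ψ (Z ω)) ∂P := by
        refine setLIntegral_congr_fun (hm _ hS) fun ω hω => ?_
        simp [hW, hω]

/-- Weak duality against one convex function: Jensen is used only on {τ = 1}, while on {τ = 2} the
bound b ≤ ψ suffices. Everything is nonnegative, so no integrability of ψ under ν is needed. -/
lemma expectedPayoff_le_of_convex {μ ν : Measure ℝ} {a b ψ : ℝ → ℝ} {M : MarketModel.{u}}
    {τ : M.Ω → Fin 3} (hM : M.Consistent μ ν) (hτ : M.IsExerciseTime τ) (ha : Measurable a)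
    (hψ : ConvexOn ℝ univ ψ) (hb : ∀ x, b x ≤ ψ x) (hψ0 : ∀ x, 0 ≤ ψ x) :
    M.expectedPayoff τ a b ≤
      ∫⁻ x, ENNReal.ofReal (generatedPhi a ψ x) ∂μ + ∫⁻ x, ENNReal.ofReal (ψ x) ∂ν := by
  have := hM.prob
  have hmeas : ∀ i, Measurable (M.Z i) := fun i =>
    (hM.martingale.stronglyMeasurable i).measurable.mono (M.F.le i) le_rfl
  set S : Set M.Ω := {ω | τ ω = 1} with hS
  have hSm : MeasurableSet[M.F 1] S := by
    have := hτ.1 1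
    convert this using 1
    ext ω
    simp only [hS, mem_ofPred_eq]
    have h12 := hτ.2 ω
    have : ((τ ω : WithTop (Fin 3)) ≤ ((1 : Fin 3) : WithTop (Fin 3))) ↔ τ ω ≤ 1 :=
      WithTop.coe_le_coe
    erw [this]
    rcases h12 with h | h <;> (rw [h]; decide)
  have hSm' : MeasurableSet S := M.F.le 1 _ hSm
  have hcond := hM.martingale.condExp_ae_eq (show (1 : Fin 3) ≤ 2 by decide)
  have hint := hM.martingale.integrable 2
  have hψc := continuous_of_convexOn hψ
  have hφm : Measurable (generatedPhi a ψ) := (ha.sub hψc.measurable).max measurable_const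
  have key := lintegral_convex_martingale_le (M.F.le 1) hint hcond hψ hψ0 hSm
  have e1 : ∫⁻ x, ENNReal.ofReal (generatedPhi a ψ x) ∂μ
      = ∫⁻ ω, ENNReal.ofReal (generatedPhi a ψ (M.Z 1 ω)) ∂M.P := by
    rw [← hM.law_one, lintegral_map hφm.ennreal_ofReal (hmeas 1)]
  have e2 : ∫⁻ x, ENNReal.ofReal (ψ x) ∂ν = ∫⁻ ω, ENNReal.ofReal (ψ (M.Z 2 ω)) ∂M.P := by
    rw [← hM.law_two, lintegral_map hψc.measurable.ennreal_ofReal (hmeas 2)]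
  rw [e1, e2]
  unfold MarketModel.expectedPayoff
  rw [← lintegral_add_compl _ hSm', ← lintegral_add_compl (fun ω => ENNReal.ofReal (ψ (M.Z 2 ω))) hSm',
    ← add_assoc]
  refine add_le_add ?_ ?_
  · calc _ ≤ ∫⁻ ω in S, (ENNReal.ofReal (generatedPhi a ψ (M.Z 1 ω))
          + ENNReal.ofReal (ψ (M.Z 1 ω))) ∂M.P := by
          refine setLIntegral_mono' hSm' fun ω hω => ?_
          have h1 : τ ω = 1 := hω
          have h2 := le_max_left (a (M.Z 1 ω) - ψ (M.Z 1 ω)) 0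
          rw [h1, if_pos rfl, if_neg (by decide), add_zero,
            ← ENNReal.ofReal_add (generatedPhi_nonneg _ _ _) (hψ0 _)]
          refine ENNReal.ofReal_le_ofReal ?_
          unfold generatedPhi; linarith
      _ ≤ _ := by
          rw [lintegral_add_left (f := fun ω => ENNReal.ofReal (generatedPhi a ψ (M.Z 1 ω)))
            (hφm.comp (hmeas 1)).ennreal_ofReal]
          exact add_le_add (setLIntegral_le_lintegral _ _) key
  · refine setLIntegral_mono' hSm'.compl fun ω hω => ?_
    have h1 : τ ω = 2 := (hτ.2 ω).resolve_left hω
    rw [h1, if_pos rfl, if_neg (by decide), zero_add]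
    exact ENNReal.ofReal_le_ofReal (hb _)

/-! ### Weak duality for kernels -/

/-- The dynamic position integrates to zero because the kernel has mean x. Negative parts are kept
on the left, since the integrals of the two parts of ψ may both be infinite. The function B covers
both inequalities of a superhedge: a constant at exercise, b at continuation. -/
lemma superhedge_lintegral_le {κ : Measure ℝ} [IsProbabilityMeasure κ] {x : ℝ}
    (hint : Integrable (fun y => y) κ) (hmean : ∫ y, y ∂κ = x) {c : ℝ≥0∞} {φ θ : ℝ}
    {B : ℝ → ℝ≥0∞} {ψ : ℝ → ℝ} (hψ : Measurable ψ) (hc : c = ∫⁻ y, B y ∂κ)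
    (h : ∀ y, B y ≤ ENNReal.ofReal (φ + ψ y + θ * (y - x)))
    (h0 : ∀ y, 0 ≤ φ + ψ y + θ * (y - x)) :
    c + (ENNReal.ofReal (-φ) + ∫⁻ y, ENNReal.ofReal (-ψ y) ∂κ)
      ≤ ENNReal.ofReal φ + ∫⁻ y, ENNReal.ofReal (ψ y) ∂κ := by
  have hl : Integrable (fun y => θ * (y - x)) κ := (hint.sub (integrable_const x)).const_mul θ
  have hl0 : ∫ y, θ * (y - x) ∂κ = 0 := by
    rw [integral_const_mul, integral_sub hint (integrable_const x), hmean]; simp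
  -- A vanishing integral means that the two parts of the dynamic term have equal, finite integrals,
  -- so they can be cancelled at the end.
  have hposneg : ∫⁻ y, ENNReal.ofReal (θ * (y - x)) ∂κ = ∫⁻ y, ENNReal.ofReal (-(θ * (y - x))) ∂κ := by
    have h1 := integral_eq_lintegral_pos_part_sub_lintegral_neg_part hl
    rw [hl0] at h1
    have h2 := hl.lintegral_lt_top
    have h3 := hl.neg.lintegral_lt_top
    rw [← ENNReal.toReal_eq_toReal_iff' h2.ne (by simpa using h3.ne)]
    linarith
  have hfin : ∫⁻ y, ENNReal.ofReal (-(θ * (y - x))) ∂κ ≠ ⊤ := by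
    simpa using hl.neg.lintegral_lt_top.ne
  have hml : Measurable fun y : ℝ => ENNReal.ofReal (θ * (y - x)) := by fun_prop
  have hml' : Measurable fun y : ℝ => ENNReal.ofReal (-(θ * (y - x))) := by fun_prop
  have hconst : ∀ r : ℝ≥0∞, r = ∫⁻ _, r ∂κ := fun r => by simp
  have hpt : ∀ y, B y + (ENNReal.ofReal (-φ) + ENNReal.ofReal (-ψ y))
        + ENNReal.ofReal (-(θ * (y - x)))
      ≤ ENNReal.ofReal φ + ENNReal.ofReal (ψ y) + ENNReal.ofReal (θ * (y - x)) := by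
    intro y
    refine (add_le_add_left (add_le_add_left (h y) _) _).trans ?_
    rw [← ENNReal.toReal_le_toReal (by finiteness) (by finiteness)]
    rw [ENNReal.toReal_add (by finiteness) (by finiteness),
      ENNReal.toReal_add (by finiteness) (by finiteness),
      ENNReal.toReal_add (by finiteness) (by finiteness),
      ENNReal.toReal_add (by finiteness) (by finiteness),
      ENNReal.toReal_add (by finiteness) (by finiteness)]
    simp only [ENNReal.toReal_ofReal', max_eq_left (h0 y)]
    have e : ∀ t : ℝ, max t 0 - max (-t) 0 = t := fun t => by
      rcases le_total 0 t with ht | ht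
      · rw [max_eq_left ht, max_eq_right (by linarith)]; ring
      · rw [max_eq_right ht, max_eq_left (by linarith)]; ring
    linarith [e φ, e (ψ y), e (θ * (y - x))]
  have hI := lintegral_mono (μ := κ) hpt
  rw [lintegral_add_right _ hml', lintegral_add_right _ hml,
    lintegral_add_right _ (by fun_prop), lintegral_add_left (by fun_prop),
    lintegral_add_left (by fun_prop), ← hc, ← hconst, ← hconst, hposneg] at hI
  exact (ENNReal.add_le_add_iff_right hfin).1 hI

/-- If both positive parts are finite, the hypothesis forces c and both negative parts to be finite
as well, and the claim becomes a subtraction of reals. Otherwise the cost is +∞ by convention. -/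
lemma le_hedgingCost {μ ν : Measure ℝ} {φ ψ : ℝ → ℝ} {c : ℝ≥0∞}
    (h : c + (∫⁻ x, ENNReal.ofReal (-φ x) ∂μ + ∫⁻ x, ENNReal.ofReal (-ψ x) ∂ν)
      ≤ ∫⁻ x, ENNReal.ofReal (φ x) ∂μ + ∫⁻ x, ENNReal.ofReal (ψ x) ∂ν) :
    (c : EReal) ≤ hedgingCost μ ν φ ψ := by
  unfold hedgingCost
  split_ifs with htop
  · exact le_top
  push Not at htop
  have h1 : ∫⁻ x, ENNReal.ofReal (φ x) ∂μ ≠ ⊤ := by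
    intro h; exact htop.1 (by simp [extIntegral, h])
  have h2 : ∫⁻ x, ENNReal.ofReal (ψ x) ∂ν ≠ ⊤ := by
    intro h; exact htop.2 (by simp [extIntegral, h])
  unfold extIntegral
  rw [if_neg h1, if_neg h2]
  generalize ∫⁻ x, ENNReal.ofReal (φ x) ∂μ = p at *
  generalize ∫⁻ x, ENNReal.ofReal (ψ x) ∂ν = q at *
  generalize ∫⁻ x, ENNReal.ofReal (-φ x) ∂μ = r at *
  generalize ∫⁻ x, ENNReal.ofReal (-ψ x) ∂ν = s at *
  have hfin : c + (r + s) ≠ ⊤ := (h.trans_lt (by finiteness)).ne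
  have hc : c ≠ ⊤ := by rintro rfl; simp at hfin
  have hr : r ≠ ⊤ := by rintro rfl; simp at hfin
  have hs : s ≠ ⊤ := by rintro rfl; simp at hfin
  lift p to NNReal using h1
  lift q to NNReal using h2
  lift r to NNReal using hr
  lift s to NNReal using hs
  lift c to NNReal using hc
  have h' : (c : ℝ) + (r + s) ≤ p + q := by exact_mod_cast h
  have : ((c : ℝ) : EReal) ≤ (((p : ℝ) - r + (q - s) : ℝ) : EReal) := by
    rw [EReal.coe_le_coe_iff]; linarith
  have e : ∀ r : NNReal, (((r : ℝ≥0∞)) : EReal) = ((r : ℝ) : EReal) := fun _ => rfl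
  simp only [e]
  exact_mod_cast this

/-! ### Models built from a kernel -/

open ProbabilityTheory

/-- The market model with time-1 information `I`, law `P` and prices `0`, `X ∘ I`, `Y`. -/
def factorModel {Ω : Type} [MeasurableSpace Ω] {E : Type} [MeasurableSpace E] (P : Measure Ω)
    (I : Ω → E) (hI : Measurable I) (X : E → ℝ) (Y : Ω → ℝ) : MarketModel.{0} where
  Ω := Ω
  mΩ := inferInstance
  P := P
  F := revealFiltration I hI
  Z := ![fun _ => 0, fun ω => X (I ω), Y]

section factor

variable {Ω : Type} [mΩ : MeasurableSpace Ω] {E : Type} [MeasurableSpace E] {P : Measure Ω}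
    {I : Ω → E} {hI : Measurable I} {X : E → ℝ} {Y : Ω → ℝ} {m : Measure E}
    {K : Kernel E ℝ} {μ ν : Measure ℝ}

/-- Disintegrating the law of (I, Y) turns the condition on the mean of the kernel into E[Y | I] =
X(I). At time 0 only expectations matter, and these vanish because μ is centred. -/
lemma factorModel_consistent [IsProbabilityMeasure m] [IsMarkovKernel K] (hX : Measurable X)
    (hY : Measurable Y) (hP : P.map (fun ω => (I ω, Y ω)) = m ⊗ₘ K) (hμ : m.map X = μ)
    (hν : K ∘ₘ m = ν) (hμint : Integrable (fun x => x) μ) (hνint : Integrable (fun x => x) ν)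
    (hμ0 : ∫ x, x ∂μ = 0) (hmean : ∀ᵐ e ∂m, ∫ y, y ∂(K e) = X e) :
    (factorModel P I hI X Y).Consistent μ ν := by
  have hpair : Measurable fun ω => (I ω, Y ω) := hI.prodMk hY
  have hIm : P.map I = m := by
    have := congrArg (Measure.map Prod.fst) hP
    rw [Measure.map_map measurable_fst hpair] at this
    change P.map I = (m ⊗ₘ K).fst at this
    rwa [Measure.fst_compProd] at this
  have hYm : P.map Y = ν := by
    have := congrArg (Measure.map Prod.snd) hP
    rw [Measure.map_map measurable_snd hpair] at this
    change P.map Y = (m ⊗ₘ K).snd at this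
    rwa [Measure.snd_compProd, hν] at this
  have hXm : P.map (fun ω => X (I ω)) = μ := by
    rw [← hμ, ← hIm, Measure.map_map hX hI]; rfl
  have hprob : IsProbabilityMeasure P := by
    refine ⟨?_⟩
    have : P.map I univ = 1 := by rw [hIm]; simp
    rwa [Measure.map_apply hI MeasurableSet.univ, preimage_univ] at this
  have hXint : Integrable (fun ω => X (I ω)) P := by
    rw [← hXm] at hμint
    exact hμint.comp_measurable (hX.comp hI)
  have hYint : Integrable Y P := by
    rw [← hYm] at hνint
    exact hνint.comp_measurable hY
  have hX0 : ∫ ω, X (I ω) ∂P = 0 := by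
    rw [← hμ0, ← hXm, integral_map (φ := fun ω => X (I ω)) (f := fun x => x)
      (hX.comp hI).aemeasurable aestronglyMeasurable_id]
  -- set integrals of `Y` over time-1 events
  have hset : ∀ B : Set E, MeasurableSet B →
      ∫ ω in I ⁻¹' B, Y ω ∂P = ∫ ω in I ⁻¹' B, X (I ω) ∂P := by
    intro B hB
    have hBp : MeasurableSet (Prod.fst ⁻¹' B : Set (E × ℝ)) := measurable_fst hB
    have hYint' : Integrable (fun p : E × ℝ => p.2) (m ⊗ₘ K) := by
      rw [← hP, integrable_map_measure measurable_snd.aestronglyMeasurable hpair.aemeasurable]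
      exact hYint
    have h1 : ∫ ω in I ⁻¹' B, Y ω ∂P = ∫ p in B ×ˢ univ, p.2 ∂(m ⊗ₘ K) := by
      rw [← hP, setIntegral_map (hB.prod MeasurableSet.univ) measurable_snd.aestronglyMeasurable
        hpair.aemeasurable]
      congr 2
      ext ω; simp
    rw [h1, Measure.setIntegral_compProd hB MeasurableSet.univ hYint'.integrableOn]
    simp only [Measure.restrict_univ]
    have hmI : ∀ᵐ ω ∂P, ∫ y, y ∂(K (I ω)) = X (I ω) :=
      ae_of_ae_map hI.aemeasurable (hIm.symm ▸ hmean)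
    rw [← hIm, setIntegral_map hB _ hI.aemeasurable]
    · refine setIntegral_congr_ae (hI hB) ?_
      filter_upwards [hmI] with ω hω _ using hω
    · exact (measurable_snd.stronglyMeasurable.integral_kernel_prod_right').aestronglyMeasurable
  refine ⟨hprob, ⟨?_, ?_⟩, ?_, hXm, hYm⟩
  · intro i
    fin_cases i
    · exact stronglyMeasurable_const
    · exact (hX.comp (comap_measurable I)).stronglyMeasurable
    · exact hY.stronglyMeasurable
  · intro i j hij
    have c01 : P[fun ω => X (I ω) | (⊥ : MeasurableSpace Ω)] =ᵐ[P] fun _ => 0 := by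
      rw [condExp_bot, hX0]
    have c02 : P[Y | (⊥ : MeasurableSpace Ω)] =ᵐ[P] fun _ => 0 := by
      have := hset univ MeasurableSet.univ
      simp only [preimage_univ, Measure.restrict_univ] at this
      rw [condExp_bot, this, hX0]
    have c12 : P[Y | MeasurableSpace.comap I inferInstance] =ᵐ[P] fun ω => X (I ω) := by
      symm
      refine ae_eq_condExp_of_forall_setIntegral_eq hI.comap_le hYint
        (fun _ _ _ => hXint.integrableOn) ?_
        (hX.comp (comap_measurable I)).stronglyMeasurable.aestronglyMeasurable
      rintro s ⟨B, hB, rfl⟩ _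
      exact (hset B hB).symm
    have cself : ∀ {m' : MeasurableSpace Ω} {f : Ω → ℝ} (h : m' ≤ mΩ),
        StronglyMeasurable[m'] f → Integrable[mΩ] f P → P[f | m'] =ᵐ[P] f :=
      fun h h1 h2 => by rw [condExp_of_stronglyMeasurable h h1 h2]
    fin_cases i <;> fin_cases j
    · exact cself bot_le stronglyMeasurable_const (integrable_const (0 : ℝ))
    · exact c01
    · exact c02
    · simp at hij
    · exact cself hI.comap_le (hX.comp (comap_measurable I)).stronglyMeasurable hXint
    · exact c12
    · simp at hij
    · simp at hij
    · exact cself le_rfl hY.stronglyMeasurable hYint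
  · intro ω
    change (0 : ℝ) = _
    rw [hμ0]

lemma factorModel_isExerciseTime {C : Set E} (hC : MeasurableSet C) {τ : Ω → Fin 3}
    (h1 : ∀ ω, I ω ∈ C → τ ω = 1) (h2 : ∀ ω, I ω ∉ C → τ ω = 2) :
    (factorModel P I hI X Y).IsExerciseTime τ := by
  refine ⟨?_, fun ω => (em (I ω ∈ C)).imp (h1 ω) (h2 ω)⟩
  have hle : ∀ (ω : Ω) (i : Fin 3), ((τ ω : WithTop (Fin 3)) ≤ (i : WithTop (Fin 3))) ↔ τ ω ≤ i :=
    fun _ _ => WithTop.coe_le_coe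
  have hτ : ∀ ω, τ ω = 1 ↔ I ω ∈ C := fun ω =>
    ⟨fun h => by by_contra hn; rw [h2 ω hn] at h; exact absurd h (by decide), h1 ω⟩
  have hdich : ∀ ω, τ ω = 1 ∨ τ ω = 2 := fun ω => (em (I ω ∈ C)).imp (h1 ω) (h2 ω)
  intro i
  have hset : {ω | (τ ω : WithTop (Fin 3)) ≤ (i : WithTop (Fin 3))} = {ω | τ ω ≤ i} := by
    ext ω; exact hle ω i
  erw [hset]
  fin_cases i
  · have : {ω | τ ω ≤ 0} = ∅ := by
      ext ω
      simp only [mem_ofPred_eq, mem_empty_iff_false, iff_false]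
      rcases hdich ω with h | h <;> (rw [h]; decide)
    erw [this]; exact @MeasurableSet.empty _ ((factorModel P I hI X Y).F 0)
  · have : {ω | τ ω ≤ 1} = I ⁻¹' C := by
      ext ω
      simp only [mem_ofPred_eq, mem_preimage, ← hτ]
      rcases hdich ω with h | h <;> (rw [h]; decide)
    erw [this]; exact ⟨C, hC, rfl⟩
  · have : {ω | τ ω ≤ 2} = univ := by
      ext ω
      simp only [mem_ofPred_eq, mem_univ, iff_true]
      rcases hdich ω with h | h <;> simp [h]
    erw [this]; exact @MeasurableSet.univ _ ((factorModel P I hI X Y).F 2)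

open Classical in
lemma factorModel_expectedPayoff [IsProbabilityMeasure m] [IsMarkovKernel K] (hX : Measurable X)
    (hY : Measurable Y) (hP : P.map (fun ω => (I ω, Y ω)) = m ⊗ₘ K) {C : Set E}
    (hC : MeasurableSet C) {τ : Ω → Fin 3} (h1 : ∀ ω, I ω ∈ C → τ ω = 1)
    (h2 : ∀ ω, I ω ∉ C → τ ω = 2) {a b : ℝ → ℝ} (ha : Measurable a) (hb : Measurable b) :
    (factorModel P I hI X Y).expectedPayoff τ a b
      = ∫⁻ e, (if e ∈ C then ENNReal.ofReal (a (X e)) else ∫⁻ y, ENNReal.ofReal (b y) ∂(K e)) ∂m := by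
  set G : E × ℝ → ℝ≥0∞ := fun p =>
    if p.1 ∈ C then ENNReal.ofReal (a (X p.1)) else ENNReal.ofReal (b p.2) with hG
  have hGm : Measurable G := Measurable.ite (measurable_fst hC)
    (ha.comp (hX.comp measurable_fst)).ennreal_ofReal (hb.comp measurable_snd).ennreal_ofReal
  have e1 : (factorModel P I hI X Y).expectedPayoff τ a b = ∫⁻ ω, G (I ω, Y ω) ∂P := by
    unfold MarketModel.expectedPayoff
    refine lintegral_congr fun ω => ?_
    change ENNReal.ofReal ((if τ ω = 1 then a (X (I ω)) else 0) + (if τ ω = 2 then b (Y ω) else 0))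
      = _
    by_cases h : I ω ∈ C
    · rw [h1 ω h]; simp [hG, h]
    · rw [h2 ω h]; simp [hG, h]
  rw [e1, ← lintegral_map (f := G) hGm (hI.prodMk hY), hP, Measure.lintegral_compProd hGm]
  refine lintegral_congr fun e => ?_
  by_cases h : e ∈ C <;> simp [hG, h]

open Classical in
-- Slackness integrates to equality of payoff and cost. Each side then certifies the other: the cost
-- bounds the payoff in every model by Jensen, and the payoff in this model bounds the cost of every
-- superhedge by integration over the kernel.
lemma factorModel_isOptimal [IsProbabilityMeasure m] [IsMarkovKernel K] (hX : Measurable X)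
    (hY : Measurable Y) (hP : P.map (fun ω => (I ω, Y ω)) = m ⊗ₘ K) (hμ : m.map X = μ)
    (hν : K ∘ₘ m = ν) (hμint : Integrable (fun x => x) μ) (hνint : Integrable (fun x => x) ν)
    (hμ0 : ∫ x, x ∂μ = 0) (hKint : ∀ᵐ e ∂m, Integrable (fun y => y) (K e))
    (hmean : ∀ᵐ e ∂m, ∫ y, y ∂(K e) = X e) {C : Set E} (hC : MeasurableSet C) {τ : Ω → Fin 3}
    (h1 : ∀ ω, I ω ∈ C → τ ω = 1) (h2 : ∀ ω, I ω ∉ C → τ ω = 2) {a b ψ : ℝ → ℝ}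
    (ha : Measurable a) (hb : Measurable b) (ha0 : ∀ x, 0 ≤ a x) (hb0 : ∀ x, 0 ≤ b x)
    (hψ : ConvexOn ℝ univ ψ) (hbψ : ∀ x, b x ≤ ψ x)
    (hslack : ∀ᵐ e ∂m,
      (if e ∈ C then ENNReal.ofReal (a (X e)) else ∫⁻ y, ENNReal.ofReal (b y) ∂(K e))
        = ENNReal.ofReal (generatedPhi a ψ (X e)) + ∫⁻ y, ENNReal.ofReal (ψ y) ∂(K e)) :
    IsOptimal.{u} μ ν a b (factorModel P I hI X Y) τ ψ := by
  have hψ0 : ∀ x, 0 ≤ ψ x := fun x => (hb0 x).trans (hbψ x)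
  have hψm : Measurable ψ := (continuous_of_convexOn hψ).measurable
  have hφm : Measurable (generatedPhi a ψ) := (ha.sub hψm).max measurable_const
  have hpay := factorModel_expectedPayoff (hI := hI) hX hY hP hC h1 h2 ha hb
  have iμ : ∀ f : ℝ → ℝ, Measurable f →
      ∫⁻ x, ENNReal.ofReal (f x) ∂μ = ∫⁻ e, ENNReal.ofReal (f (X e)) ∂m := fun f hf => by
    rw [← hμ, lintegral_map hf.ennreal_ofReal hX]
  have iν : ∀ f : ℝ → ℝ, Measurable f →
      ∫⁻ x, ENNReal.ofReal (f x) ∂ν = ∫⁻ e, ∫⁻ y, ENNReal.ofReal (f y) ∂(K e) ∂m := fun f hf => by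
    rw [← hν, Measure.lintegral_bind K.aemeasurable hf.ennreal_ofReal.aemeasurable]
  have mK : ∀ f : ℝ → ℝ, Measurable f → Measurable fun e => ∫⁻ y, ENNReal.ofReal (f y) ∂(K e) :=
    fun f hf => hf.ennreal_ofReal.lintegral_kernel
  have hcost : (factorModel P I hI X Y).expectedPayoff τ a b
      = ∫⁻ x, ENNReal.ofReal (generatedPhi a ψ x) ∂μ + ∫⁻ x, ENNReal.ofReal (ψ x) ∂ν := by
    rw [hpay, lintegral_congr_ae hslack, iμ _ hφm, iν _ hψm,
      lintegral_add_left (f := fun e => ENNReal.ofReal (generatedPhi a ψ (X e)))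
        (hφm.comp hX).ennreal_ofReal]
  have hcost' : ((factorModel P I hI X Y).expectedPayoff τ a b : EReal)
      = hedgingCost μ ν (generatedPhi a ψ) ψ := by
    rw [hcost, hedgingCost_of_nonneg (generatedPhi_nonneg a ψ) hψ0]
  refine ⟨factorModel_consistent hX hY hP hμ hν hμint hνint hμ0 hmean,
    factorModel_isExerciseTime hC h1 h2, hcost', ?_, hψ, hbψ, isSuperhedge_generated ha hψ hbψ, ?_⟩
  · intro M' τ' hM' hτ'
    rw [hcost]
    exact expectedPayoff_le_of_convex hM' hτ' ha hψ hbψ hψ0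
  · intro φ' ψ' θ₁ θ₂ hs
    rw [← hcost']
    refine le_hedgingCost ?_
    have hφ' := hs.measurable_φ
    have hψ' := hs.measurable_ψ
    rw [hpay, iμ _ hφ', iν _ hψ', iμ (fun x => -φ' x) hφ'.neg, iν (fun x => -ψ' x) hψ'.neg,
      ← lintegral_add_right _ (mK _ hψ'), ← lintegral_add_right _ (mK (fun x => -ψ' x) hψ'.neg),
      ← lintegral_add_right _ (g := fun e => ENNReal.ofReal (-φ' (X e))
        + ∫⁻ y, ENNReal.ofReal (-ψ' y) ∂(K e))
        ((hφ'.comp hX).neg.ennreal_ofReal.add (mK (fun x => -ψ' x) hψ'.neg))]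
    refine lintegral_mono_ae ?_
    filter_upwards [hKint, hmean] with e hi he
    by_cases hCe : e ∈ C
    · rw [if_pos hCe]
      exact superhedge_lintegral_le (θ := θ₁ (X e)) (B := fun _ => ENNReal.ofReal (a (X e)))
        hi he hψ' (by simp) (fun y => ENNReal.ofReal_le_ofReal (hs.first _ _))
        (fun y => (ha0 _).trans (hs.first _ _))
    · rw [if_neg hCe]
      exact superhedge_lintegral_le (θ := θ₂ (X e)) (B := fun y => ENNReal.ofReal (b y))
        hi he hψ' rfl (fun y => ENNReal.ofReal_le_ofReal (hs.second _ _))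
        (fun y => (hb0 _).trans (hs.second _ _))

/-- The slackness conditions are stated for a ∨ b, since ψ is built from it. For (a, b) the exercise
set shrinks to the part where b ≤ a, and the removed points have to satisfy the continuation form of
slackness. -/
lemma factorModel_optimalWithoutOrder [IsProbabilityMeasure m] [IsMarkovKernel K]
    (hX : Measurable X) (hY : Measurable Y) (hP : P.map (fun ω => (I ω, Y ω)) = m ⊗ₘ K)
    (hμ : m.map X = μ) (hν : K ∘ₘ m = ν) (hμint : Integrable (fun x => x) μ)
    (hνint : Integrable (fun x => x) ν) (hμ0 : ∫ x, x ∂μ = 0)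
    (hKint : ∀ᵐ e ∂m, Integrable (fun y => y) (K e))
    (hmean : ∀ᵐ e ∂m, ∫ y, y ∂(K e) = X e) {C : Set E} (hC : MeasurableSet C) {τ : Ω → Fin 3}
    (h1 : ∀ ω, I ω ∈ C → τ ω = 1) (h2 : ∀ ω, I ω ∉ C → τ ω = 2) {a b ψ : ℝ → ℝ}
    (ha : Measurable a) (hb : Measurable b) (ha0 : ∀ x, 0 ≤ a x) (hb0 : ∀ x, 0 ≤ b x)
    (hbc : ConvexOn ℝ univ b) (hψ : ConvexOn ℝ univ ψ) (hbψ : ∀ x, b x ≤ ψ x)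
    (hexer : ∀ᵐ e ∂m, e ∈ C → ψ (X e) ≤ (a ⊔ b) (X e) ∧
      ∫⁻ y, ENNReal.ofReal (ψ y) ∂(K e) = ENNReal.ofReal (ψ (X e)))
    (hcont : ∀ᵐ e ∂m, e ∉ C → (a ⊔ b) (X e) ≤ ψ (X e) ∧ ∀ᵐ y ∂(K e), ψ y = b y) :
    OptimalWithoutOrder.{u} μ ν a b (factorModel P I hI X Y) τ ψ := by
  classical
  have hψ0 : ∀ x, 0 ≤ ψ x := fun x => (hb0 x).trans (hbψ x)
  have hle : ∀ x, a x ≤ (a ⊔ b) x := fun x => le_sup_left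
  have hzero : ∀ {a' : ℝ → ℝ} {x : ℝ}, a' x ≤ ψ x → generatedPhi a' ψ x = 0 := fun h =>
    max_eq_right (by linarith)
  have hsum : ∀ {a' : ℝ → ℝ} {x : ℝ}, ψ x ≤ a' x →
      ENNReal.ofReal (a' x) = ENNReal.ofReal (generatedPhi a' ψ x) + ENNReal.ofReal (ψ x) := by
    intro a' x h
    rw [← ENNReal.ofReal_add (generatedPhi_nonneg _ _ _) (hψ0 _), generatedPhi,
      max_eq_left (by linarith)]
    congr 1; ring
  have hprud : IsOptimal.{u} μ ν a b (factorModel P I hI X Y)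
      ((factorModel P I hI X Y).prudent a b τ) ψ := by
    refine factorModel_isOptimal (C := C ∩ X ⁻¹' {x | b x ≤ a x}) hX hY hP hμ hν hμint hνint hμ0
      hKint hmean (hC.inter (hX (measurableSet_le hb ha))) ?_ ?_ ha hb ha0 hb0 hψ hbψ ?_
    · intro ω hω
      have : ¬ a (X (I ω)) < b (X (I ω)) := not_lt.2 hω.2
      change (if a (X (I ω)) < b (X (I ω)) then (2 : Fin 3) else τ ω) = 1
      rw [if_neg this, h1 ω hω.1]
    · intro ω hω
      change (if a (X (I ω)) < b (X (I ω)) then (2 : Fin 3) else τ ω) = 2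
      split_ifs with h
      · rfl
      · exact h2 ω fun hc => hω ⟨hc, not_lt.1 h⟩
    · filter_upwards [hexer, hcont, hKint, hmean] with e hs hc hi hm
      by_cases he : e ∈ C
      · obtain ⟨hs1, hs2⟩ := hs he
        by_cases hab : b (X e) ≤ a (X e)
        · have : (a ⊔ b) (X e) = a (X e) := sup_eq_left.2 hab
          rw [if_pos ⟨he, hab⟩, hs2]
          exact hsum (this ▸ hs1)
        · rw [if_neg fun h => hab h.2]
          -- At an exercised point with a < b the three values ψ, a ∨ b and b coincide, so
          -- continuing yields at least b(X) by Jensen and at most the integral of ψ, which is again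
          -- ψ(X) = b(X).
          have hAb : (a ⊔ b) (X e) = b (X e) := sup_eq_right.2 (not_le.1 hab).le
          have hψb : ψ (X e) = b (X e) := le_antisymm (hAb ▸ hs1) (hbψ _)
          rw [hzero (((not_le.1 hab).le).trans (hbψ _)), ENNReal.ofReal_zero, zero_add]
          refine le_antisymm (lintegral_mono fun y => ENNReal.ofReal_le_ofReal (hbψ y)) ?_
          rw [hs2, hψb]
          -- Jensen for b: the supporting line at X(e) is read as a hedge of the constant payoff
          -- b(X(e)) by the option b.
          have := superhedge_lintegral_le hi hm (c := ENNReal.ofReal (b (X e))) (φ := 0)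
            (θ := -rightDeriv b (X e)) (B := fun _ => ENNReal.ofReal (b (X e))) hb (by simp)
            (fun y => ENNReal.ofReal_le_ofReal ?_) (fun y => (hb0 (X e)).trans ?_)
          · simpa [lintegral_ofReal_neg_eq_zero hb0] using this
          all_goals have := rightDeriv_support hbc (X e) y; linarith
      · obtain ⟨hc1, hc2⟩ := hc he
        rw [if_neg fun h => he h.1, hzero ((hle _).trans hc1), ENNReal.ofReal_zero, zero_add]
        exact lintegral_congr_ae (hc2.mono fun y hy => by simp only [hy])
  refine ⟨?_, hprud, fun hae => ?_⟩
  · refine factorModel_isOptimal hX hY hP hμ hν hμint hνint hμ0 hKint hmean hC h1 h2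
      (ha.sup hb) hb (fun x => (ha0 x).trans (hle x)) hb0 hψ hbψ ?_
    filter_upwards [hexer, hcont] with e hs hc
    by_cases he : e ∈ C
    · rw [if_pos he, (hs he).2]
      exact hsum (hs he).1
    · obtain ⟨hc1, hc2⟩ := hc he
      rw [if_neg he, hzero hc1, ENNReal.ofReal_zero, zero_add]
      exact lintegral_congr_ae (hc2.mono fun y hy => by simp only [hy])
  · have heq : (factorModel P I hI X Y).expectedPayoff τ a b
        = (factorModel P I hI X Y).expectedPayoff ((factorModel P I hI X Y).prudent a b τ) a b := by
      unfold MarketModel.expectedPayoff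
      refine lintegral_congr_ae ?_
      filter_upwards [hae] with ω hω
      have : (factorModel P I hI X Y).prudent a b τ ω = τ ω := by
        unfold MarketModel.prudent
        split_ifs with h
        · by_cases hc : I ω ∈ C
          · exact absurd ⟨h1 ω hc, h⟩ hω
          · exact (h2 ω hc).symm
        · rfl
      rw [this]
    exact ⟨hprud.consistent, factorModel_isExerciseTime hC h1 h2, heq ▸ hprud.payoff_eq_cost,
      fun M' τ' h h' => heq ▸ hprud.highest M' τ' h h', hψ, hbψ, hprud.superhedge, hprud.cheapest⟩

end factor

/-! ### Martingale steps -/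

/-- `κ` is a law with finite mean `x`. -/
structure IsMartingaleStep (κ : Measure ℝ) (x : ℝ) : Prop where
  prob : IsProbabilityMeasure κ
  integrable : Integrable (fun y => y) κ
  mean : ∫ y, y ∂κ = x

lemma isMartingaleStep_dirac (x : ℝ) : IsMartingaleStep (Measure.dirac x) x :=
  ⟨inferInstance, integrable_dirac (by simp), by simp⟩

lemma isMartingaleStep_twoPoint {c d x : ℝ} (hc : c < x) (hd : x < d) :
    IsMartingaleStep (twoPoint c d x) x := by
  have hcd : 0 < d - c := by linarith
  have h1 : 0 ≤ (d - x) / (d - c) := div_nonneg (by linarith) hcd.le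
  have h2 : 0 ≤ (x - c) / (d - c) := div_nonneg (by linarith) hcd.le
  have i1 : Integrable (fun y : ℝ => y) (ENNReal.ofReal ((d - x) / (d - c)) • Measure.dirac c) :=
    (integrable_dirac (by simp)).smul_measure ENNReal.ofReal_ne_top
  have i2 : Integrable (fun y : ℝ => y) (ENNReal.ofReal ((x - c) / (d - c)) • Measure.dirac d) :=
    (integrable_dirac (by simp)).smul_measure ENNReal.ofReal_ne_top
  refine ⟨⟨?_⟩, i1.add_measure i2, ?_⟩
  · simp only [twoPoint, Measure.add_apply, Measure.smul_apply, measure_univ, smul_eq_mul, mul_one]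
    rw [← ENNReal.ofReal_add h1 h2, ← add_div]
    rw [show d - x + (x - c) = d - c by ring, div_self hcd.ne', ENNReal.ofReal_one]
  · rw [twoPoint, integral_add_measure i1 i2, integral_smul_measure, integral_smul_measure,
      integral_dirac, integral_dirac, ENNReal.toReal_ofReal h1, ENNReal.toReal_ofReal h2]
    simp only [smul_eq_mul]
    field_simp
    ring

lemma IsMartingaleStep.lintegral_affine {κ : Measure ℝ} {x q : ℝ} (h : IsMartingaleStep κ x)
    {ψ : ℝ → ℝ} (hψ0 : ∀ y, 0 ≤ ψ y) (hψ : ∀ᵐ y ∂κ, ψ y = ψ x + q * (y - x)) :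
    ∫⁻ y, ENNReal.ofReal (ψ y) ∂κ = ENNReal.ofReal (ψ x) := by
  have := h.prob
  have hi : Integrable (fun y => ψ x + q * (y - x)) κ :=
    (integrable_const _).add ((h.integrable.sub (integrable_const _)).const_mul q)
  have hi' : Integrable ψ κ := hi.congr (hψ.mono fun y hy => hy.symm)
  have hi2 : Integrable (fun y => q * (y - x)) κ :=
    (h.integrable.sub (integrable_const _)).const_mul q
  rw [← ofReal_integral_eq_lintegral_ofReal hi' (ae_of_all _ hψ0), integral_congr_ae hψ,
    integral_add (integrable_const _) hi2,
    integral_const_mul, integral_sub h.integrable (integrable_const _), h.mean]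
  simp

lemma ae_twoPoint {c d x : ℝ} {p : ℝ → Prop} (hc : p c) (hd : p d) :
    ∀ᵐ y ∂(twoPoint c d x), p y := by
  classical
  rw [twoPoint, ae_add_measure_iff]
  constructor
  all_goals
    refine Measure.ae_smul_measure ?_ _
    rw [ae_dirac_eq]
    assumption

lemma measurable_twoPoint {E : Type*} [MeasurableSpace E] {c d x : E → ℝ} (hc : Measurable c)
    (hd : Measurable d) (hx : Measurable x) : Measurable fun e => twoPoint (c e) (d e) (x e) := by
  refine Measure.measurable_of_measurable_coe _ fun s hs => ?_
  simp only [twoPoint, Measure.add_apply, Measure.smul_apply, smul_eq_mul,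
    Measure.dirac_apply' _ hs]
  have hind : Measurable (s.indicator (1 : ℝ → ℝ≥0∞)) := measurable_one.indicator hs
  exact ((((hd.sub hx).div (hd.sub hc)).ennreal_ofReal).mul (hind.comp hc)).add
    ((((hx.sub hc).div (hd.sub hc)).ennreal_ofReal).mul (hind.comp hd))

/-! ### The canonical models -/

/-- The case kernels are probabilities, and measurable, only up to null sets; on the exceptional set
an arbitrary Dirac mass repairs a measurable version. -/
lemma exists_markov_kernel {E : Type*} [MeasurableSpace E] {m : Measure E} {κ : E → Measure ℝ}
    (hκ : AEMeasurable κ m) (hprob : ∀ᵐ e ∂m, IsProbabilityMeasure (κ e)) :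
    ∃ K : Kernel E ℝ, IsMarkovKernel K ∧ κ =ᵐ[m] K := by
  classical
  set S : Set E := {e | hκ.mk κ e univ = 1} with hS
  have hSm : MeasurableSet S :=
    (Measure.measurable_coe MeasurableSet.univ).comp hκ.measurable_mk (measurableSet_singleton 1)
  let K : Kernel E ℝ := ⟨fun e => if e ∈ S then hκ.mk κ e else Measure.dirac 0,
    Measurable.ite hSm hκ.measurable_mk measurable_const⟩
  have hK : ∀ e, K e = if e ∈ S then hκ.mk κ e else Measure.dirac 0 := fun _ => rfl
  refine ⟨K, ⟨fun e => ?_⟩, ?_⟩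
  · rw [hK]
    split_ifs with h
    · exact ⟨h⟩
    · infer_instance
  · filter_upwards [hκ.ae_eq_mk, hprob] with e he hp
    have : e ∈ S := by rw [hS, mem_ofPred_eq, ← he]; exact measure_univ
    rw [hK, if_pos this, he]

lemma bind_map_eq_compProd {E Ω : Type*} [MeasurableSpace E] [MeasurableSpace Ω] {m : Measure E}
    [SFinite m] {κ : E → Measure ℝ} {K : Kernel E ℝ} [IsMarkovKernel K] (hK : κ =ᵐ[m] K)
    {J : E × ℝ → Ω} (hJ : Measurable J) :
    m.bind (fun e => (κ e).map fun y => J (e, y)) = (m ⊗ₘ K).map J := by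
  have h1 : (fun e => (κ e).map fun y => J (e, y)) =ᵐ[m] fun e => (K e).map fun y => J (e, y) :=
    hK.mono fun e he => by simp only [he]
  rw [Measure.bind_congr_right h1]
  have hJe : ∀ e, Measurable fun y => J (e, y) := fun e => hJ.comp measurable_prodMk_left
  have hm : Measurable fun e => (K e).map fun y => J (e, y) := by
    refine Measure.measurable_of_measurable_coe _ fun s hs => ?_
    simp_rw [Measure.map_apply (hJe _) hs]
    exact Kernel.measurable_kernel_prodMk_left (hJ hs)
  ext s hs
  rw [Measure.bind_apply hs hm.aemeasurable, Measure.map_apply hJ hs,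
    Measure.compProd_apply (hJ hs)]
  refine lintegral_congr fun e => ?_
  rw [Measure.map_apply (hJe e) hs]; rfl

section canonical

variable {μ ν : Measure ℝ} {a b ψ : ℝ → ℝ}

/-- This is the form in which the first two cases use slackness: an affine piece of ψ along the
kernel at exercised points, and contact of ψ with b at the endpoints reached from the others. -/
lemma optimal_canonicalModel [IsProbabilityMeasure μ] {κ : ℝ → Measure ℝ}
    (hκ : AEMeasurable κ μ) (hν : μ.bind κ = ν) (hμint : Integrable (fun x => x) μ)
    (hνint : Integrable (fun x => x) ν) (hμ0 : ∫ x, x ∂μ = 0)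
    (hstep : ∀ᵐ x ∂μ, IsMartingaleStep (κ x) x) {C : Set ℝ} (hC : MeasurableSet C)
    {τ : ℝ × ℝ → Fin 3} (h1 : ∀ ω, ω.1 ∈ C → τ ω = 1) (h2 : ∀ ω, ω.1 ∉ C → τ ω = 2)
    (ha : Measurable a) (hb : Measurable b) (ha0 : ∀ x, 0 ≤ a x) (hb0 : ∀ x, 0 ≤ b x)
    (hbc : ConvexOn ℝ univ b) (hψ : ConvexOn ℝ univ ψ) (hbψ : ∀ x, b x ≤ ψ x)
    (hexer : ∀ᵐ x ∂μ, x ∈ C → ψ x ≤ (a ⊔ b) x ∧ ∃ q, ∀ᵐ y ∂(κ x), ψ y = ψ x + q * (y - x))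
    (hcont : ∀ᵐ x ∂μ, x ∉ C → (a ⊔ b) x ≤ ψ x ∧ ∀ᵐ y ∂(κ x), ψ y = b y) :
    OptimalWithoutOrder.{u} μ ν a b (canonicalModel (coupling μ κ)) τ ψ := by
  obtain ⟨K, hK, hκK⟩ := exists_markov_kernel hκ (hstep.mono fun _ h => h.prob)
  have hP : (coupling μ κ).map (fun ω => (ω.1, ω.2)) = μ ⊗ₘ K := by
    have := bind_map_eq_compProd (m := μ) hκK (J := id) measurable_id
    rw [Measure.map_id] at this
    exact (Measure.map_id (μ := coupling μ κ)).trans this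
  have hstep' : ∀ᵐ x ∂μ, IsMartingaleStep (K x) x := by
    filter_upwards [hstep, hκK] with x h1 h2 using h2 ▸ h1
  refine factorModel_optimalWithoutOrder (I := Prod.fst) (hI := measurable_fst) (X := fun x => x)
    (Y := Prod.snd) (K := K) (m := μ) measurable_id measurable_snd hP Measure.map_id' ?_ hμint
    hνint hμ0 (hstep'.mono fun _ h => h.integrable) (hstep'.mono fun _ h => h.mean) hC h1 h2 ha hb
    ha0 hb0 hbc hψ hbψ ?_ ?_
  · rw [← hν]; exact (Measure.bind_congr_right hκK).symm
  · filter_upwards [hexer, hκK, hstep'] with x h3 h4 h5 hx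
    obtain ⟨h6, q, h7⟩ := h3 hx
    exact ⟨h6, h5.lintegral_affine (fun y => (hb0 y).trans (hbψ y)) (h4 ▸ h7)⟩
  · filter_upwards [hcont, hκK] with x h3 h4 hx
    exact ⟨(h3 hx).1, h4 ▸ (h3 hx).2⟩

lemma optimal_randomizedModel [IsProbabilityMeasure μ] {κ : ℝ → ℝ → Measure ℝ}
    (hκ : AEMeasurable (fun w : ℝ × ℝ => κ w.1 w.2) ((volume.restrict (Ioo (0 : ℝ) 1)).prod μ))
    (hν : ((volume.restrict (Ioo (0 : ℝ) 1)).prod μ).bind (fun w => κ w.1 w.2) = ν)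
    (hμint : Integrable (fun x => x) μ)
    (hνint : Integrable (fun x => x) ν) (hμ0 : ∫ x, x ∂μ = 0)
    (hstep : ∀ᵐ w ∂((volume.restrict (Ioo (0 : ℝ) 1)).prod μ), IsMartingaleStep (κ w.1 w.2) w.2)
    {C : Set (ℝ × ℝ)} (hC : MeasurableSet C)
    {τ : ℝ × ℝ × ℝ → Fin 3} (h1 : ∀ ω, (ω.1, ω.2.1) ∈ C → τ ω = 1)
    (h2 : ∀ ω, (ω.1, ω.2.1) ∉ C → τ ω = 2)
    (ha : Measurable a) (hb : Measurable b) (ha0 : ∀ x, 0 ≤ a x) (hb0 : ∀ x, 0 ≤ b x)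
    (hbc : ConvexOn ℝ univ b) (hψ : ConvexOn ℝ univ ψ) (hbψ : ∀ x, b x ≤ ψ x)
    (hexer : ∀ᵐ w ∂((volume.restrict (Ioo (0 : ℝ) 1)).prod μ), w ∈ C → ψ w.2 ≤ (a ⊔ b) w.2 ∧
      ∃ q, ∀ᵐ y ∂(κ w.1 w.2), ψ y = ψ w.2 + q * (y - w.2))
    (hcont : ∀ᵐ w ∂((volume.restrict (Ioo (0 : ℝ) 1)).prod μ), w ∉ C → (a ⊔ b) w.2 ≤ ψ w.2 ∧
      ∀ᵐ y ∂(κ w.1 w.2), ψ y = b y) :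
    OptimalWithoutOrder.{u} μ ν a b (randomizedModel (randomizedCoupling μ κ)) τ ψ := by
  set m : Measure (ℝ × ℝ) := (volume.restrict (Ioo (0 : ℝ) 1)).prod μ with hm
  have hvol : IsProbabilityMeasure (volume.restrict (Ioo (0 : ℝ) 1)) := ⟨by simp⟩
  obtain ⟨K, hK, hκK⟩ := exists_markov_kernel hκ (hstep.mono fun _ h => h.prob)
  have hIY : Measurable fun ω : ℝ × ℝ × ℝ => ((ω.1, ω.2.1), ω.2.2) := by fun_prop
  have hJ : Measurable fun q : (ℝ × ℝ) × ℝ => (q.1.1, q.1.2, q.2) := by fun_prop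
  have hP : (randomizedCoupling μ κ).map (fun ω => ((ω.1, ω.2.1), ω.2.2)) = m ⊗ₘ K := by
    have := bind_map_eq_compProd (m := m) hκK hJ
    have h3 : randomizedCoupling μ κ = (m ⊗ₘ K).map fun q : (ℝ × ℝ) × ℝ => (q.1.1, q.1.2, q.2) :=
      this
    rw [h3, Measure.map_map hIY hJ]
    exact Measure.map_id
  have hstep' : ∀ᵐ w ∂m, IsMartingaleStep (K w) w.2 := by
    filter_upwards [hstep, hκK] with x h1 h2 using h2 ▸ h1
  have hsnd : m.map Prod.snd = μ := by
    change m.snd = μ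
    rw [hm, Measure.snd_prod]
  refine factorModel_optimalWithoutOrder (I := fun ω : ℝ × ℝ × ℝ => (ω.1, ω.2.1))
    (hI := measurable_fst.prodMk (measurable_fst.comp measurable_snd)) (X := Prod.snd)
    (Y := fun ω => ω.2.2) (K := K) (m := m) measurable_snd (by fun_prop) hP hsnd ?_ hμint
    hνint hμ0 (hstep'.mono fun _ h => h.integrable) (hstep'.mono fun _ h => h.mean) hC h1 h2 ha hb
    ha0 hb0 hbc hψ hbψ ?_ ?_
  · rw [← hν]; exact (Measure.bind_congr_right hκK).symm
  · filter_upwards [hexer, hκK, hstep'] with x h3 h4 h5 hx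
    obtain ⟨h6, q, h7⟩ := h3 hx
    exact ⟨h6, h5.lintegral_affine (fun y => (hb0 y).trans (hbψ y)) (h4 ▸ h7)⟩
  · filter_upwards [hcont, hκK] with x h3 h4 hx
    exact ⟨(h3 hx).1, h4 ▸ (h3 hx).2⟩

end canonical

/-! ### Transport along two monotone branches -/

/-- A choice of x with y = f(x) or y = g(x) need not be measurable, but {R < x} agrees almost
everywhere with the Borel set of endpoints used by the points before x: A x on the lower branch, (g
x, ∞) on the upper one. Hence R is null measurable and has a measurable version. The set A x is left
free because the lower branch increases for curtains and decreases for Hobson–Klimmek couplings; c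
separates the branches. -/
lemma exists_measurable_preimage {ξ : Measure ℝ} [NullSingletonClass ξ] {l r c : ℝ} {f g : ℝ → ℝ}
    {A : ℝ → Set ℝ} (hlr : l < r) (hfc : ∀ x ∈ Ioo l r, f x < c) (hgc : ∀ x ∈ Ioo l r, c < g x)
    (hA1 : ∀ x₀ ∈ Ioo l r, ∀ x ∈ Ioo l r, x₀ < x → f x₀ ∈ A x ∨ f x₀ = f x)
    (hA2 : ∀ x₀ ∈ Ioo l r, ∀ x ∈ Ioo l r, x ≤ x₀ → f x₀ ∉ A x)
    (hAm : ∀ x ∈ Ioo l r, MeasurableSet (A x)) (hAc : ∀ x ∈ Ioo l r, A x ⊆ Iio c)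
    (hg : AntitoneOn g (Ioo l r))
    (hrange : ∀ᵐ y ∂ξ, ∃ x ∈ Ioo l r, y = f x ∨ y = g x) :
    ∃ R : ℝ → ℝ, Measurable R ∧ (∀ᵐ y ∂ξ, R y ∈ Ioo l r ∧ (y = f (R y) ∨ y = g (R y))) ∧
      ∀ x ∈ Ioo l r, ∀ᵐ y ∂ξ, (R y < x ↔ y ∈ A x ∪ Ioi (g x)) := by
  classical
  let R : ℝ → ℝ := fun y =>
    if h : ∃ x ∈ Ioo l r, y = f x ∨ y = g x then h.choose else l
  have hR : ∀ y, (∃ x ∈ Ioo l r, y = f x ∨ y = g x) →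
      R y ∈ Ioo l r ∧ (y = f (R y) ∨ y = g (R y)) := by
    intro y h
    have : R y = h.choose := dif_pos h
    rw [this]; exact h.choose_spec
  have hRl : ∀ y, R y ∈ Ico l r := by
    intro y
    by_cases h : ∃ x ∈ Ioo l r, y = f x ∨ y = g x
    · exact Ioo_subset_Ico_self (hR y h).1
    · have : R y = l := dif_neg h
      rw [this]; exact ⟨le_rfl, hlr⟩
  have key : ∀ x ∈ Ioo l r, ∀ᵐ y ∂ξ, (R y < x ↔ y ∈ A x ∪ Ioi (g x)) := by
    intro x hx
    -- Plateaus of f or g make the choice ambiguous only at the values f x and g x, which carry no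
    -- mass.
    have n1 : ∀ᵐ y ∂ξ, y ≠ f x := compl_mem_ae_iff.2 (measure_singleton _)
    have n2 : ∀ᵐ y ∂ξ, y ≠ g x := compl_mem_ae_iff.2 (measure_singleton _)
    filter_upwards [hrange, n1, n2] with y hy h1 h2
    obtain ⟨hRy, hy' | hy'⟩ := hR y hy
    · have hyc : y < c := hy' ▸ hfc _ hRy
      constructor
      · intro hlt
        rcases hA1 _ hRy x hx hlt with h | h
        · exact Or.inl (hy' ▸ h)
        · exact absurd (hy'.trans h) h1
      · rintro (h | h)
        · by_contra hn
          exact hA2 _ hRy x hx (not_lt.1 hn) (hy' ▸ h)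
        · exact absurd (hyc.trans (hgc x hx)) (not_lt.2 (le_of_lt h))
    · have hyc : c < y := hy' ▸ hgc _ hRy
      constructor
      · intro hlt
        have : g x ≤ y := hy' ▸ hg hRy hx hlt.le
        exact Or.inr (lt_of_le_of_ne this (Ne.symm h2))
      · rintro (h | h)
        · exact absurd (hAc x hx h) (not_lt.2 hyc.le)
        · by_contra hn
          have : y ≤ g x := hy' ▸ hg hx hRy (not_lt.1 hn)
          exact absurd this (not_le.2 h)
  have hnull : NullMeasurable R ξ := by
    refine @measurable_of_Iio ℝ (NullMeasurableSpace ℝ ξ) _ _ _ _ _ _ _ R fun x => ?_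
    change NullMeasurableSet (R ⁻¹' Iio x) ξ
    rcases le_or_gt x l with hxl | hxl
    · have : R ⁻¹' Iio x = ∅ := by
        ext y; simp only [mem_preimage, mem_Iio, mem_empty_iff_false, iff_false, not_lt]
        exact hxl.trans (hRl y).1
      rw [this]; exact nullMeasurableSet_empty
    rcases le_or_gt r x with hxr | hxr
    · have : R ⁻¹' Iio x = univ := by
        ext y; simp only [mem_preimage, mem_Iio, mem_univ, iff_true]
        exact (hRl y).2.trans_le hxr
      rw [this]; exact MeasurableSet.univ.nullMeasurableSet
    · refine (((hAm x ⟨hxl, hxr⟩).union (measurableSet_Ioi (a := g x))).nullMeasurableSet (μ := ξ)).congr ?_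
      filter_upwards [key x ⟨hxl, hxr⟩] with y hy
      exact propext hy.symm
  have hae := hnull.aemeasurable
  refine ⟨hae.mk R, hae.measurable_mk, ?_, fun x hx => ?_⟩
  · filter_upwards [hae.ae_eq_mk, hrange] with y h1 h2
    rw [← h1]; exact hR y h2
  · filter_upwards [hae.ae_eq_mk, key x hx] with y h1 h2
    rw [← h1]; exact h2

lemma measure_eq_of_Iio_of_Ioo {m₁ m₂ : Measure ℝ} [IsFiniteMeasure m₁] {l r : ℝ}
    (h1 : ∀ᵐ x ∂m₁, x ∈ Ioo l r) (h2 : ∀ᵐ x ∂m₂, x ∈ Ioo l r)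
    (h : ∀ x ∈ Ioo l r, m₁ (Iio x) = m₂ (Iio x)) (hT : m₁ univ = m₂ univ) : m₁ = m₂ := by
  refine ext_of_generate_finite _ ?_ isPiSystem_Iio ?_ hT
  · rw [← borel_eq_generateFrom_Iio]; exact BorelSpace.measurable_eq
  · rintro _ ⟨x, rfl⟩
    rcases le_or_gt x l with hxl | hxl
    · have : ∀ m : Measure ℝ, (∀ᵐ x ∂m, x ∈ Ioo l r) → m (Iio x) = 0 := fun m hm => by
        refine measure_mono_null (fun y hy => ?_) hm
        exact fun hy' => absurd (hy.trans_le hxl) (not_lt.2 hy'.1.le)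
      rw [this _ h1, this _ h2]
    rcases le_or_gt r x with hxr | hxr
    · have : ∀ m : Measure ℝ, (∀ᵐ x ∂m, x ∈ Ioo l r) → m (Iio x) = m univ := fun m hm => by
        refine measure_congr ?_
        filter_upwards [hm] with y hy
        exact propext ⟨fun _ => trivial, fun _ => hy.2.trans_le hxr⟩
      rw [this _ h1, this _ h2, hT]
    · exact h x ⟨hxl, hxr⟩

/-- If a martingale moves backwards from `y` to `R y`, where `y` is one of two points determined by
`R y`, then its law is given by two-point kernels. -/
lemma bind_twoPoint_of_backward {ξ : Measure ℝ} [IsFiniteMeasure ξ] {f g R : ℝ → ℝ}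
    (hf : Measurable f) (hg : Measurable g) (hR : Measurable R)
    (hfg : ∀ᵐ y ∂ξ, f (R y) < R y ∧ R y < g (R y)) (hy : ∀ᵐ y ∂ξ, y = f (R y) ∨ y = g (R y))
    (hmean : (ξ.withDensity fun y => ENNReal.ofReal (y - R y)).map R
      = (ξ.withDensity fun y => ENNReal.ofReal (R y - y)).map R) :
    (ξ.map R).bind (fun x => twoPoint (f x) (g x) x) = ξ := by
  have hm1 : Measurable fun y => ENNReal.ofReal (y - R y) := by fun_prop
  have hm2 : Measurable fun y => ENNReal.ofReal (R y - y) := by fun_prop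
  -- The hypothesis says that the conditional mean of y - R y given R y is zero; it is kept as
  -- equality of the two parts, tested against a nonnegative function of R y.
  have star : ∀ φ : ℝ → ℝ≥0∞, Measurable φ →
      ∫⁻ y, φ (R y) * ENNReal.ofReal (y - R y) ∂ξ = ∫⁻ y, φ (R y) * ENNReal.ofReal (R y - y) ∂ξ := by
    intro φ hφ
    have := congrArg (lintegral · φ) hmean
    beta_reduce at this
    rw [lintegral_map hφ hR, lintegral_map hφ hR,
      lintegral_withDensity_eq_lintegral_mul _ hm1 (g := fun y => φ (R y)) (hφ.comp hR),
      lintegral_withDensity_eq_lintegral_mul _ hm2 (g := fun y => φ (R y)) (hφ.comp hR)] at this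
    simpa [mul_comm] using this
  have hκ : Measurable fun x => twoPoint (f x) (g x) x := measurable_twoPoint hf hg measurable_id
  ext s hs
  rw [Measure.bind_apply hs hκ.aemeasurable,
    lintegral_map (f := fun x => twoPoint (f x) (g x) x s)
      (Measure.measurable_coe hs |>.comp hκ) hR]
  set ι : ℝ → ℝ≥0∞ := s.indicator 1 with hι
  have hιm : Measurable ι := measurable_one.indicator hs
  have hι1 : ∀ y, ι y ≤ 1 := fun y => by
    by_cases h : y ∈ s <;> simp [hι, h]
  set φ₁ : ℝ → ℝ≥0∞ := fun x => ι (f x) * ENNReal.ofReal (1 / (g x - f x)) with hφ₁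
  set φ₂ : ℝ → ℝ≥0∞ := fun x => ι (g x) * ENNReal.ofReal (1 / (g x - f x)) with hφ₂
  have hφ₁m : Measurable φ₁ :=
    (hιm.comp hf).mul (measurable_const.div (hg.sub hf)).ennreal_ofReal
  have hφ₂m : Measurable φ₂ :=
    (hιm.comp hg).mul (measurable_const.div (hg.sub hf)).ennreal_ofReal
  -- With R = R y and κ the two-point law at R, this is 1_s(y) - κ(s) = (φ₁(R) - φ₂(R)) (R - y),
  -- checked at y = f(R) and at y = g(R) and written without subtraction. The right side has
  -- integral zero by `star`.
  have hpt : ∀ᵐ y ∂ξ, ι y + (φ₂ (R y) * ENNReal.ofReal (R y - y)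
        + φ₁ (R y) * ENNReal.ofReal (y - R y))
      = twoPoint (f (R y)) (g (R y)) (R y) s + (φ₂ (R y) * ENNReal.ofReal (y - R y)
        + φ₁ (R y) * ENNReal.ofReal (R y - y)) := by
    filter_upwards [hfg, hy] with y h1 h2
    have hd : 0 < g (R y) - f (R y) := by linarith [h1.1, h1.2]
    have hw : ENNReal.ofReal ((g (R y) - R y) / (g (R y) - f (R y)))
        + ENNReal.ofReal ((R y - f (R y)) / (g (R y) - f (R y))) = 1 := by
      rw [← ENNReal.ofReal_add (div_nonneg (by linarith) hd.le) (div_nonneg (by linarith) hd.le),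
        ← add_div, show g (R y) - R y + (R y - f (R y)) = g (R y) - f (R y) by ring,
        div_self hd.ne', ENNReal.ofReal_one]
    have hmul : ∀ (w : ℝ≥0∞) (t : ℝ), 0 ≤ t →
        w * ENNReal.ofReal (1 / (g (R y) - f (R y))) * ENNReal.ofReal t
        = w * ENNReal.ofReal (t / (g (R y) - f (R y))) := fun w t ht => by
      rw [mul_assoc, ← ENNReal.ofReal_mul (by positivity)]; congr 2; ring
    have hT : twoPoint (f (R y)) (g (R y)) (R y) s
        = ENNReal.ofReal ((g (R y) - R y) / (g (R y) - f (R y))) * ι (f (R y))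
          + ENNReal.ofReal ((R y - f (R y)) / (g (R y) - f (R y))) * ι (g (R y)) := by
      simp only [twoPoint, Measure.add_apply, Measure.smul_apply, smul_eq_mul,
        Measure.dirac_apply' _ hs, hι]
    rw [hT, hφ₁, hφ₂]
    simp only
    rcases h2 with h2 | h2
    · have e1 : ENNReal.ofReal (y - R y) = 0 := ENNReal.ofReal_of_nonpos (by linarith)
      have e2 : R y - y = R y - f (R y) := by linarith
      rw [e1, e2, hmul _ _ (by linarith), hmul _ _ (by linarith),
        show ι y = ι (f (R y)) * 1 by rw [mul_one, ← h2], ← hw]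
      ring
    · have e1 : ENNReal.ofReal (R y - y) = 0 := ENNReal.ofReal_of_nonpos (by linarith)
      have e2 : y - R y = g (R y) - R y := by linarith
      rw [e1, e2, hmul _ _ (by linarith), hmul _ _ (by linarith),
        show ι y = ι (g (R y)) * 1 by rw [mul_one, ← h2], ← hw]
      ring
  have mA : Measurable fun y => φ₂ (R y) * ENNReal.ofReal (R y - y) := (hφ₂m.comp hR).mul hm2
  have mB : Measurable fun y => φ₁ (R y) * ENNReal.ofReal (y - R y) := (hφ₁m.comp hR).mul hm1
  have mC : Measurable fun y => φ₂ (R y) * ENNReal.ofReal (y - R y) := (hφ₂m.comp hR).mul hm1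
  have hint := lintegral_congr_ae hpt
  rw [lintegral_add_right _ (g := fun y => φ₂ (R y) * ENNReal.ofReal (R y - y)
      + φ₁ (R y) * ENNReal.ofReal (y - R y)) (mA.add mB), lintegral_add_left mA,
    lintegral_add_left (f := fun y => twoPoint (f (R y)) (g (R y)) (R y) s)
      ((Measure.measurable_coe hs).comp (hκ.comp hR)), lintegral_add_left mC,
    star _ hφ₁m, star _ hφ₂m, hι, lintegral_indicator_one hs] at hint
  -- Since y lies between f(R) and g(R), the factor |R - y| / (g(R) - f(R)) is at most 1; finiteness
  -- permits cancelling these terms.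
  have hfin1 : ∫⁻ y, φ₁ (R y) * ENNReal.ofReal (R y - y) ∂ξ ≠ ⊤ := by
    refine ne_top_of_le_ne_top (measure_ne_top ξ univ) ?_
    rw [← lintegral_one]
    refine lintegral_mono_ae ?_
    filter_upwards [hfg, hy] with y h1 h2
    have hd : 0 < g (R y) - f (R y) := by linarith [h1.1, h1.2]
    rw [hφ₁]
    simp only
    rw [mul_assoc, ← ENNReal.ofReal_mul (by positivity)]
    refine mul_le_one' (hι1 _) (ENNReal.ofReal_le_one.2 ?_)
    rw [one_div, inv_mul_le_iff₀ hd]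
    rcases h2 with h2 | h2 <;> linarith
  have hfin2 : ∫⁻ y, φ₂ (R y) * ENNReal.ofReal (R y - y) ∂ξ ≠ ⊤ := by
    refine ne_top_of_le_ne_top (measure_ne_top ξ univ) ?_
    rw [← lintegral_one]
    refine lintegral_mono_ae ?_
    filter_upwards [hfg, hy] with y h1 h2
    have hd : 0 < g (R y) - f (R y) := by linarith [h1.1, h1.2]
    rw [hφ₂]
    simp only
    rw [mul_assoc, ← ENNReal.ofReal_mul (by positivity)]
    refine mul_le_one' (hι1 _) (ENNReal.ofReal_le_one.2 ?_)
    rw [one_div, inv_mul_le_iff₀ hd]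
    rcases h2 with h2 | h2 <;> linarith
  exact ((ENNReal.add_left_inj (ENNReal.add_ne_top.2 ⟨hfin2, hfin1⟩)).1 hint).symm

/-- The mass identities say that the backward map R pushes ξ to χ. The moment identities say that y
- R y has integral zero over every {R < x}, hence conditionally on R. A backward martingale step
with two possible values has two-point conditional laws. -/
lemma bind_twoPoint_eq_of_branches {χ ξ : Measure ℝ} [IsFiniteMeasure χ] [IsFiniteMeasure ξ]
    [NullSingletonClass ξ] {l r c : ℝ} {f g : ℝ → ℝ} {A : ℝ → Set ℝ} (hlr : l < r)
    (hχ : ∀ᵐ x ∂χ, x ∈ Ioo l r) (hξint : Integrable (fun y => y) ξ) (hf : Measurable f)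
    (hgm : Measurable g) (hfx : ∀ x ∈ Ioo l r, f x < x) (hgx : ∀ x ∈ Ioo l r, x < g x)
    (hfc : ∀ x ∈ Ioo l r, f x < c) (hgc : ∀ x ∈ Ioo l r, c < g x)
    (hA1 : ∀ x₀ ∈ Ioo l r, ∀ x ∈ Ioo l r, x₀ < x → f x₀ ∈ A x ∨ f x₀ = f x)
    (hA2 : ∀ x₀ ∈ Ioo l r, ∀ x ∈ Ioo l r, x ≤ x₀ → f x₀ ∉ A x)
    (hAm : ∀ x ∈ Ioo l r, MeasurableSet (A x)) (hAc : ∀ x ∈ Ioo l r, A x ⊆ Iio c)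
    (hg : AntitoneOn g (Ioo l r))
    (hrange : ∀ᵐ y ∂ξ, ∃ x ∈ Ioo l r, y = f x ∨ y = g x)
    (hmass : ∀ x ∈ Ioo l r, χ (Iio x) = ξ (A x ∪ Ioi (g x))) (hmassT : χ univ = ξ univ)
    (hmean : ∀ x ∈ Ioo l r, ∫ z in Iio x, z ∂χ = ∫ y in A x ∪ Ioi (g x), y ∂ξ)
    (hmeanT : ∫ z, z ∂χ = ∫ y, y ∂ξ) :
    χ.bind (fun x => twoPoint (f x) (g x) x) = ξ := by
  obtain ⟨R, hR, hRI, hRA⟩ :=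
    exists_measurable_preimage hlr hfc hgc hA1 hA2 hAm hAc hg hrange
  have hset : ∀ x ∈ Ioo l r, (R ⁻¹' Iio x : Set ℝ) =ᵐ[ξ] (A x ∪ Ioi (g x) : Set ℝ) := by
    intro x hx
    filter_upwards [hRA x hx] with y hy
    exact propext hy
  have hmap : ξ.map R = χ := by
    refine measure_eq_of_Iio_of_Ioo (l := l) (r := r) ?_ hχ (fun x hx => ?_) ?_
    · exact (ae_map_iff (p := fun x => x ∈ Ioo l r) hR.aemeasurable measurableSet_Ioo).2
        (hRI.mono fun y h => h.1)
    · rw [Measure.map_apply hR measurableSet_Iio, hmass x hx, measure_congr (hset x hx)]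
    · rw [Measure.map_apply hR MeasurableSet.univ, preimage_univ, hmassT]
  have hRint : Integrable R ξ := by
    refine Integrable.mono' (integrable_const (max |l| |r|)) hR.aestronglyMeasurable ?_
    filter_upwards [hRI] with y hy
    exact abs_le_max_abs_abs hy.1.1.le hy.1.2.le
  have hdint : Integrable (fun y => y - R y) ξ := hξint.sub hRint
  -- On preimages of s, the integral of R is the first moment of χ on s because χ is the image of ξ;
  -- equal first moments therefore balance the two parts of y - R y.
  have hzero : ∀ s : Set ℝ, MeasurableSet s →
      ∫ y in R ⁻¹' s, y ∂ξ = ∫ z in s, z ∂χ →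
      ∫⁻ y in R ⁻¹' s, ENNReal.ofReal (y - R y) ∂ξ
        = ∫⁻ y in R ⁻¹' s, ENNReal.ofReal (R y - y) ∂ξ := by
    intro s hs h
    have h1 : ∫ y in R ⁻¹' s, (y - R y) ∂ξ = 0 := by
      rw [integral_sub hξint.integrableOn hRint.integrableOn, h, ← hmap,
        setIntegral_map (f := fun z => z) hs aestronglyMeasurable_id hR.aemeasurable, sub_self]
    have h2 := integral_eq_lintegral_pos_part_sub_lintegral_neg_part
      (hdint.integrableOn (s := R ⁻¹' s))
    rw [h1] at h2
    simp only [neg_sub] at h2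
    have h3 := (hdint.integrableOn (s := R ⁻¹' s)).lintegral_lt_top.ne
    have h4 := (hdint.integrableOn (s := R ⁻¹' s)).neg.lintegral_lt_top.ne
    simp only [Pi.neg_apply, neg_sub] at h4
    rw [← ENNReal.toReal_eq_toReal_iff' h3 h4]
    linarith
  have hfinite : ∀ F : ℝ → ℝ, Integrable F ξ →
      IsFiniteMeasure ((ξ.withDensity fun y => ENNReal.ofReal (F y)).map R) := fun F hF => by
    have := isFiniteMeasure_withDensity_ofReal hF.2
    infer_instance
  have hconc : ∀ F : ℝ → ℝ≥0∞, Measurable F → ∀ᵐ x ∂((ξ.withDensity F).map R), x ∈ Ioo l r := by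
    intro F hF
    exact (ae_map_iff (p := fun x => x ∈ Ioo l r) hR.aemeasurable measurableSet_Ioo).2
      ((withDensity_absolutelyContinuous ξ F) (hRI.mono fun y h => h.1))
  have hbal : (ξ.withDensity fun y => ENNReal.ofReal (y - R y)).map R
      = (ξ.withDensity fun y => ENNReal.ofReal (R y - y)).map R := by
    have := hfinite _ hdint
    refine measure_eq_of_Iio_of_Ioo (hconc _ (by fun_prop)) (hconc _ (by fun_prop))
      (fun x hx => ?_) ?_
    · rw [Measure.map_apply hR measurableSet_Iio, Measure.map_apply hR measurableSet_Iio,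
        withDensity_apply _ (hR measurableSet_Iio), withDensity_apply _ (hR measurableSet_Iio)]
      refine hzero _ measurableSet_Iio ?_
      rw [setIntegral_congr_set (hset x hx), hmean x hx]
    · rw [Measure.map_apply hR MeasurableSet.univ, Measure.map_apply hR MeasurableSet.univ,
        withDensity_apply _ (hR MeasurableSet.univ), withDensity_apply _ (hR MeasurableSet.univ)]
      refine hzero _ MeasurableSet.univ ?_
      simpa using hmeanT.symm
  rw [← hmap]
  refine bind_twoPoint_of_backward hf hgm hR ?_ (hRI.mono fun y h => h.2) hbal
  filter_upwards [hRI] with y hy using ⟨hfx _ hy.1, hgx _ hy.1⟩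

/-! ### Distribution functions and lower partial means -/

lemma continuousAt_setIntegral_lt {E : Type*} [MeasurableSpace E] {m : Measure E} {c h : E → ℝ}
    (hc : Measurable c) (hh : Integrable h m) {θ₀ : ℝ} (hθ : ∀ᵐ z ∂m, c z ≠ θ₀) :
    ContinuousAt (fun θ => ∫ z in {z | c z < θ}, h z ∂m) θ₀ := by
  have hms : ∀ θ, MeasurableSet {z | c z < θ} := fun θ => hc measurableSet_Iio
  have : (fun θ => ∫ z in {z | c z < θ}, h z ∂m)
      = fun θ => ∫ z, ({z | c z < θ}.indicator h) z ∂m := by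
    ext θ; rw [integral_indicator (hms θ)]
  rw [this]
  refine continuousAt_of_dominated (bound := fun z => ‖h z‖)
    (Filter.Eventually.of_forall fun θ => hh.aestronglyMeasurable.indicator (hms θ))
    (Filter.Eventually.of_forall fun θ => ae_of_all _ fun z => norm_indicator_le_norm_self _ _)
    hh.norm ?_
  filter_upwards [hθ] with z hz
  rcases lt_or_gt_of_ne hz with h1 | h1
  · have : (fun θ => ({z | c z < θ}.indicator h) z) =ᶠ[nhds θ₀] fun _ => h z := by
      filter_upwards [lt_mem_nhds h1] with θ hθ'
      exact indicator_of_mem (s := {z | c z < θ}) hθ' h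
    exact this.continuousAt
  · have : (fun θ => ({z | c z < θ}.indicator h) z) =ᶠ[nhds θ₀] fun _ => 0 := by
      filter_upwards [gt_mem_nhds h1] with θ hθ'
      exact indicator_of_notMem (s := {z | c z < θ}) (not_lt.2 hθ'.le) h
    exact this.continuousAt

section quantile

variable {m : Measure ℝ} [IsFiniteMeasure m]

lemma continuous_real_Iio [NullSingletonClass m] : Continuous fun y => m.real (Iio y) := by
  refine continuous_iff_continuousAt.2 fun y => ?_
  have := continuousAt_setIntegral_lt (m := m) (c := fun z : ℝ => z) (h := fun _ => (1 : ℝ))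
    measurable_id (integrable_const 1) (θ₀ := y) (compl_mem_ae_iff.2 (measure_singleton _))
  simpa [Iio] using this

lemma monotone_real_Iio : Monotone fun y => m.real (Iio y) := fun _ _ h =>
  measureReal_mono (Iio_subset_Iio h)

lemma tendsto_real_Iio_atBot :  Filter.Tendsto (fun y => m.real (Iio y)) Filter.atBot (nhds 0) := by
  have h1 : Filter.Tendsto (fun y => m (Ici y)) Filter.atBot (nhds (m univ)) :=
    tendsto_measure_Ici_atBot m
  have h2 := ((ENNReal.tendsto_toReal (measure_ne_top m univ)).comp h1).const_sub (m.real univ)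
  simp only [Measure.real, sub_self] at h2
  refine h2.congr fun y => ?_
  have := measureReal_compl (μ := m) (measurableSet_Ici (a := y))
  rw [compl_Ici] at this
  exact this.symm

lemma tendsto_real_Iio_atTop [NullSingletonClass m] :
    Filter.Tendsto (fun y => m.real (Iio y)) Filter.atTop (nhds (m.real univ)) := by
  have h1 : Filter.Tendsto (fun y => m (Iic y)) Filter.atTop (nhds (m univ)) :=
    tendsto_measure_Iic_atTop m
  have h2 := (ENNReal.tendsto_toReal (measure_ne_top m univ)).comp h1
  refine h2.congr fun y => ?_
  simp only [Function.comp, Measure.real]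
  rw [measure_congr Iio_ae_eq_Iic]

lemma exists_real_Iio_eq [NullSingletonClass m] {θ : ℝ} (h0 : 0 < θ) (h1 : θ < m.real univ) :
    ∃ y, m.real (Iio y) = θ := by
  obtain ⟨y₁, hy₁⟩ := ((tendsto_real_Iio_atBot (m := m)).eventually (gt_mem_nhds h0)).exists
  obtain ⟨y₂, hy₂⟩ := ((tendsto_real_Iio_atTop (m := m)).eventually (lt_mem_nhds h1)).exists
  have := intermediate_value_uIcc (f := fun y => m.real (Iio y)) (a := y₁) (b := y₂)
    (continuous_real_Iio.continuousOn)
  obtain ⟨y, -, hy⟩ := this (show θ ∈ uIcc _ _ from mem_uIcc_of_le hy₁.le hy₂.le)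
  exact ⟨y, hy⟩

lemma exists_lowerSet_real_eq [NullSingletonClass m] {θ : ℝ} (h0 : 0 ≤ θ) (h1 : θ ≤ m.real univ) :
    ∃ s : Set ℝ, IsLowerSet s ∧ m.real s = θ := by
  rcases h0.eq_or_lt with rfl | h0
  · exact ⟨∅, isLowerSet_empty, by simp⟩
  rcases h1.eq_or_lt with rfl | h1
  · exact ⟨univ, isLowerSet_univ, rfl⟩
  · obtain ⟨y, hy⟩ := exists_real_Iio_eq h0 h1
    exact ⟨Iio y, isLowerSet_Iio y, hy⟩

/-- The mean of the lowest part of mass `θ`, as a continuous function of `θ`. -/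
lemma exists_lowerMean [NullSingletonClass m] {T : Set ℝ} (hT : ∀ᵐ y ∂m, y ∈ T)
    (hinj : InjOn (fun y => m.real (Iio y)) T) (hint : Integrable (fun y => y) m) :
    ∃ V : ℝ → ℝ, Continuous V ∧ ∀ s, IsLowerSet s → V (m.real s) = ∫ y in s, y ∂m := by
  set F : ℝ → ℝ := fun y => m.real (Iio y) with hF
  have hFm : Measurable F := continuous_real_Iio.measurable
  -- Injectivity on T leaves at most one point of T on each level of the distribution function, so
  -- levels are null. This gives continuity of the mean in θ, and makes any lower set of mass θ
  -- agree with {F < θ} almost everywhere.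
  have hlevel : ∀ θ, ∀ᵐ z ∂m, F z ≠ θ := by
    intro θ
    have hsub : (T ∩ F ⁻¹' {θ}).Subsingleton := fun x hx y hy =>
      hinj hx.1 hy.1 (hx.2.trans hy.2.symm)
    have h0 : m (T ∩ F ⁻¹' {θ}) = 0 := hsub.measure_zero m
    filter_upwards [hT, compl_mem_ae_iff.2 h0] with z h1 h2 h3
    exact h2 ⟨h1, h3⟩
  refine ⟨fun θ => ∫ z in {z | F z < θ}, z ∂m, continuous_iff_continuousAt.2 fun θ =>
    continuousAt_setIntegral_lt hFm hint (hlevel θ), fun s hs => ?_⟩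
  refine setIntegral_congr_set ?_
  filter_upwards [hlevel (m.real s)] with z hz
  refine propext ⟨fun h => ?_, fun h => ?_⟩
  · by_contra hn
    have : s ⊆ Iio z := fun y hy => by
      by_contra hyz
      exact hn (hs (not_lt.1 hyz) hy)
    exact absurd (measureReal_mono this) (not_le.2 h)
  · have : Iio z ⊆ s := fun y hy => hs (le_of_lt hy) h
    exact lt_of_le_of_ne (measureReal_mono this) hz

/-- The mass added between the levels θ and θ' sits at points not below γ. -/
lemma lowerMean_sub_ge [NullSingletonClass m] {V : ℝ → ℝ} (hV : ∀ s, IsLowerSet s → V (m.real s) = ∫ y in s, y ∂m)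
    (hint : Integrable (fun y => y) m) {γ : ℝ} (hγ : ∀ᵐ y ∂m, γ ≤ y) {θ θ' : ℝ} (h0 : 0 ≤ θ)
    (hle : θ ≤ θ') (h1 : θ' ≤ m.real univ) : γ * (θ' - θ) ≤ V θ' - V θ := by
  rcases hle.eq_or_lt with rfl | hlt
  · simp
  obtain ⟨s, hs, rfl⟩ := exists_lowerSet_real_eq (m := m) h0 (hle.trans h1)
  obtain ⟨s', hs', rfl⟩ := exists_lowerSet_real_eq (m := m) (h0.trans hle) h1
  have hsub : s ⊆ s' := (hs.total hs').resolve_right fun h =>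
    absurd (measureReal_mono h) (not_le.2 hlt)
  have hsm : MeasurableSet s := hs.ordConnected.measurableSet
  have hsm' : MeasurableSet s' := hs'.ordConnected.measurableSet
  rw [hV s hs, hV s' hs', ← measureReal_sdiff hsub hsm,
    ← setIntegral_sdiff hsm hint.integrableOn hsub]
  have : ∫ _ in s' \ s, γ ∂m ≤ ∫ y in s' \ s, y ∂m :=
    integral_mono_ae (integrable_const γ) hint.integrableOn (ae_restrict_of_ae hγ)
  simpa [mul_comm] using this

end quantile

/-- Strict monotonicity lets order bounds on F(X y) be read back as bounds on X y; F itself need not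
be continuous. It transfers continuity from masses to the points that cut them off. -/
lemma continuousOn_of_strictMonoOn_comp {F X : ℝ → ℝ} {J s : Set ℝ} (hJ : IsOpen J)
    (hF : StrictMonoOn F J) (hX : MapsTo X s J) (hFX : ContinuousOn (fun y => F (X y)) s) :
    ContinuousOn X s := by
  intro y hy
  have hxJ := hX hy
  rw [ContinuousWithinAt, tendsto_order]
  obtain ⟨ε, hε, hball⟩ := Metric.isOpen_iff.1 hJ _ hxJ
  have hmem : ∀ t, |t - X y| < ε → t ∈ J := fun t ht => hball (by simpa [Real.dist_eq] using ht)
  constructor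
  · intro a ha
    set a' := max a (X y - ε / 2) with ha'
    have h1 : a' < X y := max_lt ha (by linarith)
    have h2 : a' ∈ J := hmem _ (by
      rw [abs_lt]; constructor <;> [linarith [le_max_right a (X y - ε / 2)]; linarith])
    have h3 := (hFX y hy).eventually (lt_mem_nhds (hF h2 hxJ h1))
    filter_upwards [h3, self_mem_nhdsWithin] with z hz hzs
    exact (le_max_left _ _).trans_lt ((hF.lt_iff_lt h2 (hX hzs)).1 hz)
  · intro a ha
    set a' := min a (X y + ε / 2) with ha'
    have h1 : X y < a' := lt_min ha (by linarith)
    have h2 : a' ∈ J := hmem _ (by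
      rw [abs_lt]; constructor <;> [linarith; linarith [min_le_right a (X y + ε / 2)]])
    have h3 := (hFX y hy).eventually (gt_mem_nhds (hF hxJ h2 h1))
    filter_upwards [h3, self_mem_nhdsWithin] with z hz hzs
    exact ((hF.lt_iff_lt (hX hzs) h2).1 hz).trans_le (min_le_left _ _)

lemma measurable_piecewise_of_antitoneOn {f : ℝ → ℝ} {s : Set ℝ} (hs : s.OrdConnected)
    (hf : AntitoneOn f s) : Measurable (s.indicator f) := by
  classical
  have hsm := hs.measurableSet
  refine measurable_of_Iio fun c => ?_
  have h1 : MeasurableSet (s ∩ f ⁻¹' Iio c) := by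
    refine OrdConnected.measurableSet ⟨fun x hx y hy z hz => ?_⟩
    have hzs : z ∈ s := hs.out hx.1 hy.1 hz
    exact ⟨hzs, (hf hx.1 hzs hz.1).trans_lt hx.2⟩
  have : s.indicator f ⁻¹' Iio c = (s ∩ f ⁻¹' Iio c) ∪ (sᶜ ∩ {_x | (0 : ℝ) < c}) := by
    ext x
    by_cases hx : x ∈ s <;> simp [hx]
  rw [this]
  exact h1.union (hsm.compl.inter (MeasurableSet.const _))

lemma measurable_piecewise_of_monotoneOn {f : ℝ → ℝ} {s : Set ℝ} (hs : s.OrdConnected)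
    (hf : MonotoneOn f s) : Measurable (s.indicator f) := by
  have := (measurable_piecewise_of_antitoneOn hs hf.neg).neg
  convert this using 1
  ext x
  by_cases hx : x ∈ s <;> simp [hx]

/-- It applies when M is a sum of two functions monotone in the same direction: each summand
inherits continuity from M. -/
lemma continuousOn_of_increments_le {Φ M : ℝ → ℝ} {s : Set ℝ} (hM : ContinuousOn M s)
    (h : ∀ x ∈ s, ∀ y ∈ s, x ≤ y → |Φ y - Φ x| ≤ |M y - M x|) : ContinuousOn Φ s := by
  intro x hx
  rw [ContinuousWithinAt, tendsto_iff_dist_tendsto_zero]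
  have h0 := tendsto_iff_dist_tendsto_zero.1 (hM x hx)
  refine squeeze_zero' (Filter.Eventually.of_forall fun _ => dist_nonneg) ?_ h0
  filter_upwards [self_mem_nhdsWithin] with y hy
  rw [Real.dist_eq, Real.dist_eq]
  rcases le_total x y with hxy | hxy
  · exact h x hx y hy hxy
  · rw [abs_sub_comm (Φ y), abs_sub_comm (M y)]; exact h y hy x hx hxy

lemma setIntegral_pos_of_ae {m : Measure ℝ} {s : Set ℝ} (hs : MeasurableSet s) {h : ℝ → ℝ}
    (hint : IntegrableOn h s m) (hpos : ∀ᵐ z ∂m, z ∈ s → 0 < h z) (hms : m s ≠ 0) :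
    0 < ∫ z in s, h z ∂m := by
  have hae : ∀ᵐ z ∂(m.restrict s), 0 < h z := (ae_restrict_iff' hs).2 hpos
  rw [integral_pos_iff_support_of_nonneg_ae (hae.mono fun z hz => hz.le) hint]
  have : (m.restrict s) (Function.support h) = m s := by
    rw [← Measure.restrict_apply_univ s]
    refine measure_congr ?_
    filter_upwards [hae] with z hz
    exact propext ⟨fun _ => trivial, fun _ => hz.ne'⟩
  rw [this]
  exact pos_iff_ne_zero.2 hms

/-! ### Hobson–Klimmek couplings -/

/-- Symmetric measures `χ` on `(-γ, γ)` and `ξ` on `{d < |y| < δ}`, where `γ ≤ d`, of the same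
mass. -/
structure HKData (χ ξ : Measure ℝ) (γ d : ℝ) (δ : EReal) : Prop where
  finite_χ : IsFiniteMeasure χ
  finite_ξ : IsFiniteMeasure ξ
  null_χ : NullSingletonClass χ
  null_ξ : NullSingletonClass ξ
  symm_χ : χ.map (fun x => -x) = χ
  symm_ξ : ξ.map (fun x => -x) = ξ
  integrable_ξ : Integrable (fun y => y) ξ
  γ_pos : 0 < γ
  γ_le : γ ≤ d
  carrier_χ : ∀ᵐ x ∂χ, x ∈ Ioo (-γ) γ
  carrier_ξ : ∀ᵐ y ∂ξ, d < |y| ∧ ((|y| : ℝ) : EReal) < δ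
  pos_χ : ∀ x ∈ Ioo (-γ) γ, χ (Iio x) ≠ 0
  pos_ξ : ∀ s t : ℝ, d ≤ s → s < t → (s : EReal) < δ → ξ (Ioo s t) ≠ 0
  mass : χ univ = ξ univ

lemma setIntegral_neg_of_symm {m : Measure ℝ} (hm : m.map (fun x => -x) = m) {s : Set ℝ}
    (hs : MeasurableSet s) (h : ℝ → ℝ) (hh : Measurable h) :
    ∫ z in s, h z ∂m = ∫ z in (fun x => -x) ⁻¹' s, h (-z) ∂m := by
  conv_lhs => rw [← hm]
  rw [setIntegral_map hs hh.aestronglyMeasurable measurable_neg.aemeasurable]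

lemma measure_neg_of_symm {m : Measure ℝ} (hm : m.map (fun x => -x) = m) {s : Set ℝ}
    (hs : MeasurableSet s) : m s = m ((fun x => -x) ⁻¹' s) := by
  conv_lhs => rw [← hm]
  rw [Measure.map_apply measurable_neg hs]

namespace HKData

variable {χ ξ : Measure ℝ} {γ d : ℝ} {δ : EReal}

lemma integrable_χ (h : HKData χ ξ γ d δ) : Integrable (fun x => x) χ := by
  have := h.finite_χ
  refine Integrable.mono' (integrable_const γ) aestronglyMeasurable_id ?_
  filter_upwards [h.carrier_χ] with x hx
  exact abs_le.2 ⟨hx.1.le, hx.2.le⟩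

lemma integral_χ (h : HKData χ ξ γ d δ) : ∫ x, x ∂χ = 0 := by
  have := setIntegral_neg_of_symm h.symm_χ MeasurableSet.univ (fun x => x) measurable_id
  rw [preimage_univ, Measure.restrict_univ, integral_neg] at this
  linarith

lemma integral_ξ (h : HKData χ ξ γ d δ) : ∫ x, x ∂ξ = 0 := by
  have := setIntegral_neg_of_symm h.symm_ξ MeasurableSet.univ (fun x => x) measurable_id
  rw [preimage_univ, Measure.restrict_univ, integral_neg] at this
  linarith

lemma real_restrict_Iio (h : HKData χ ξ γ d δ) {u : ℝ} :
    (ξ.restrict (Ioi 0)).real (Iio u) = ξ.real (Ioo (-u) (-γ)) := by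
  have h1 : ξ (Ioo (-u) (-γ)) = ξ (Ioo γ u) := by
    rw [measure_neg_of_symm h.symm_ξ measurableSet_Ioo]; simp
  rw [Measure.real, Measure.real, h1, Measure.restrict_apply measurableSet_Iio]
  congr 1
  refine measure_congr ?_
  filter_upwards [h.carrier_ξ] with y hy
  refine propext ⟨fun hyu => ⟨?_, hyu.1⟩, fun hyu => ⟨hyu.2, h.γ_pos.trans hyu.1⟩⟩
  have : |y| = y := abs_of_pos hyu.2
  linarith [h.γ_le, hy.1]

lemma setIntegral_restrict_Iio (h : HKData χ ξ γ d δ) {u : ℝ} :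
    ∫ z in Iio u, z ∂(ξ.restrict (Ioi 0)) = -∫ z in Ioo (-u) (-γ), z ∂ξ := by
  rw [setIntegral_neg_of_symm h.symm_ξ measurableSet_Ioo (fun x => x) measurable_id,
    integral_neg, neg_neg, Measure.restrict_restrict measurableSet_Iio]
  refine setIntegral_congr_set ?_
  filter_upwards [h.carrier_ξ] with y hy
  refine propext ⟨fun hyu => ⟨?_, ?_⟩, fun hyu => ⟨?_, ?_⟩⟩
  · exact neg_lt_neg hyu.1
  · have : |y| = y := abs_of_pos hyu.2
    have := h.γ_le
    exact neg_lt_neg (by linarith [hy.1])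
  · exact neg_lt_neg_iff.1 hyu.1
  · exact h.γ_pos.trans (neg_lt_neg_iff.1 hyu.2)

lemma real_Ioi (h : HKData χ ξ γ d δ) {q : ℝ} (hq : γ < q) :
    ξ.real (Ioi q) = (ξ.restrict (Ioi 0)).real univ - (ξ.restrict (Ioi 0)).real (Iio q) := by
  have := h.finite_ξ
  have := h.null_ξ
  have h1 := measureReal_compl (μ := ξ.restrict (Ioi 0)) (measurableSet_Iio (a := q))
  rw [compl_Iio] at h1
  rw [← h1, Measure.real, Measure.real, ← measure_congr Ioi_ae_eq_Ici,
    Measure.restrict_apply measurableSet_Ioi, inter_eq_left.2]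
  exact Ioi_subset_Ioi (h.γ_pos.trans hq).le

lemma setIntegral_Ioi (h : HKData χ ξ γ d δ) {q : ℝ} (hq : γ < q) :
    ∫ z in Ioi q, z ∂ξ = ∫ z, z ∂(ξ.restrict (Ioi 0)) - ∫ z in Iio q, z ∂(ξ.restrict (Ioi 0)) := by
  have := h.null_ξ
  have h1 := integral_add_compl (μ := ξ.restrict (Ioi 0)) (measurableSet_Iio (a := q))
    h.integrable_ξ.restrict
  rw [compl_Iio] at h1
  rw [← h1, add_sub_cancel_left, ← setIntegral_congr_set Ioi_ae_eq_Ici,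
    Measure.restrict_restrict measurableSet_Ioi, inter_eq_left.2]
  exact Ioi_subset_Ioi (h.γ_pos.trans hq).le

lemma real_univ (h : HKData χ ξ γ d δ) : χ.real univ = 2 * (ξ.restrict (Ioi 0)).real univ := by
  have := h.finite_ξ
  have := h.null_ξ
  have h1 : ξ.real (Iio 0) = ξ.real (Ioi 0) := by
    rw [Measure.real, Measure.real, measure_neg_of_symm h.symm_ξ measurableSet_Iio]; simp
  have h2 := measureReal_compl (μ := ξ) (measurableSet_Iio (a := (0 : ℝ)))
  rw [compl_Iio, Measure.real, ← measure_congr Ioi_ae_eq_Ici, ← Measure.real, h1] at h2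
  have h3 : (ξ.restrict (Ioi 0)).real univ = ξ.real (Ioi 0) := by
    simp [Measure.real]
  rw [h3, Measure.real, h.mass, ← Measure.real]; linarith

lemma Iio_ae_eq (h : HKData χ ξ γ d δ) (x : ℝ) : (Ioo (-γ) x : Set ℝ) =ᵐ[χ] Iio x := by
  filter_upwards [h.carrier_χ] with z hz
  exact propext ⟨fun hzx => hzx.2, fun hzx => ⟨hz.1, hzx⟩⟩

/-- Where the distribution function of `ξ` on the half-line is strictly increasing. -/
lemma real_Iio_lt (h : HKData χ ξ γ d δ) {y u : ℝ} (hy : d ≤ y) (hyδ : (y : EReal) < δ)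
    (hyu : y < u) :
    (ξ.restrict (Ioi 0)).real (Iio y) < (ξ.restrict (Ioi 0)).real (Iio u) := by
  have := h.finite_ξ
  have h1 := measureReal_sdiff (μ := ξ.restrict (Ioi 0)) (Iio_subset_Iio hyu.le)
    (measurableSet_Iio (a := y))
  have h2 : 0 < (ξ.restrict (Ioi 0)).real (Iio u \ Iio y) := by
    refine ENNReal.toReal_pos ?_ (measure_ne_top _ _)
    rw [Measure.restrict_apply (measurableSet_Iio.diff measurableSet_Iio)]
    refine fun h0 => h.pos_ξ y u hy hyu hyδ (measure_mono_null (fun z hz => ?_) h0)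
    exact ⟨⟨hz.2, not_lt.2 hz.1.le⟩, (h.γ_pos.trans_le (h.γ_le.trans hy)).trans hz.1⟩
  linarith

lemma real_Iio_d (h : HKData χ ξ γ d δ) : (ξ.restrict (Ioi 0)).real (Iio d) = 0 := by
  rw [Measure.real, Measure.restrict_apply measurableSet_Iio]
  have : ξ (Iio d ∩ Ioi 0) = 0 := by
    refine measure_mono_null (fun y hy => ?_) h.carrier_ξ
    intro hn
    have hn' : d < |y| ∧ _ := hn
    rw [abs_of_pos hy.2] at hn'
    exact absurd hn'.1 (not_lt.2 (le_of_lt hy.1))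
  rw [this]; rfl

lemma real_Iio_of_le (h : HKData χ ξ γ d δ) {u : ℝ} (hu : δ ≤ u) :
    (ξ.restrict (Ioi 0)).real (Iio u) = (ξ.restrict (Ioi 0)).real univ := by
  rw [Measure.real, Measure.real]
  congr 1
  refine measure_congr ?_
  filter_upwards [ae_restrict_of_ae (s := Ioi 0) h.carrier_ξ,
    ae_restrict_mem (μ := ξ) (measurableSet_Ioi (a := (0 : ℝ)))] with y hy hy0
  refine propext ⟨fun _ => trivial, fun _ => ?_⟩
  rw [abs_of_pos hy0] at hy
  exact EReal.coe_lt_coe_iff.1 (hy.2.trans_le hu)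

/-- Points in the support of `ξ` are determined by the mass below them. -/
lemma mem_of_real_Iio (h : HKData χ ξ γ d δ) {y : ℝ} (h0 : 0 < (ξ.restrict (Ioi 0)).real (Iio y))
    (h1 : (ξ.restrict (Ioi 0)).real (Iio y) < (ξ.restrict (Ioi 0)).real univ) :
    d < y ∧ (y : EReal) < δ := by
  have := h.finite_ξ
  constructor
  · by_contra hn
    have := monotone_real_Iio (m := ξ.restrict (Ioi 0)) (not_lt.1 hn)
    simp only at this
    rw [h.real_Iio_d] at this
    linarith
  · by_contra hn
    rw [h.real_Iio_of_le (not_lt.1 hn)] at h1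
    exact lt_irrefl _ h1

lemma eq_of_real_Iio_eq (h : HKData χ ξ γ d δ) {y u : ℝ} (hy : d < y) (hyδ : (y : EReal) < δ)
    (heq : (ξ.restrict (Ioi 0)).real (Iio u) = (ξ.restrict (Ioi 0)).real (Iio y)) : u = y := by
  have := h.finite_ξ
  rcases lt_trichotomy u y with hlt | rfl | hlt
  · have h1 : max u d < y := max_lt hlt hy
    have h2 := h.real_Iio_lt (le_max_right u d) ((EReal.coe_lt_coe_iff.2 h1).trans hyδ) h1
    have h3 := monotone_real_Iio (m := ξ.restrict (Ioi 0)) (le_max_left u d)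
    simp only at h3
    linarith
  · rfl
  · exact absurd heq.symm (h.real_Iio_lt hy.le hyδ hlt).ne

lemma injOn (h : HKData χ ξ γ d δ) :
    InjOn (fun y => (ξ.restrict (Ioi 0)).real (Iio y)) {y | d < y ∧ (y : EReal) < δ} :=
  fun _ _ _ hy hxy => h.eq_of_real_Iio_eq hy.1 hy.2 hxy

lemma carrier_restrict (h : HKData χ ξ γ d δ) :
    ∀ᵐ y ∂(ξ.restrict (Ioi 0)), d < y ∧ (y : EReal) < δ := by
  filter_upwards [ae_restrict_of_ae (s := Ioi 0) h.carrier_ξ,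
    ae_restrict_mem (μ := ξ) (measurableSet_Ioi (a := (0 : ℝ)))] with y hy hy0
  rwa [abs_of_pos hy0] at hy

/-- The mass and mean identities of a Hobson–Klimmek pair in terms of the mass and the mean of `ξ`
on `(0, -p)` and on `(0, q)`. -/
lemma isHKPair_identities_iff (h : HKData χ ξ γ d δ) {x p q : ℝ} (hq : γ < q) :
    (χ (Ioo (-γ) x) = ξ (Ioo p (-γ)) + ξ (Ioi q) ∧
      ∫ z in Ioo (-γ) x, z ∂χ = ∫ z in Ioo p (-γ), z ∂ξ + ∫ z in Ioi q, z ∂ξ) ↔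
    (χ.real (Iio x) = (ξ.restrict (Ioi 0)).real (Iio (-p))
      + ((ξ.restrict (Ioi 0)).real univ - (ξ.restrict (Ioi 0)).real (Iio q)) ∧
      ∫ z in Iio x, z ∂χ = -(∫ z in Iio (-p), z ∂(ξ.restrict (Ioi 0)))
        + (∫ z, z ∂(ξ.restrict (Ioi 0)) - ∫ z in Iio q, z ∂(ξ.restrict (Ioi 0)))) := by
  have := h.finite_ξ
  have := h.finite_χ
  have e1 := h.real_restrict_Iio (u := -p)
  have e3 := h.setIntegral_restrict_Iio (u := -p)
  rw [neg_neg] at e1 e3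
  rw [e1, e3, ← h.real_Ioi hq, ← h.setIntegral_Ioi hq, neg_neg,
    setIntegral_congr_set (h.Iio_ae_eq x), measure_congr (h.Iio_ae_eq x)]
  refine and_congr_left fun _ => ?_
  rw [← ENNReal.toReal_eq_toReal_iff' (measure_ne_top _ _) (by finiteness),
    ENNReal.toReal_add (measure_ne_top _ _) (measure_ne_top _ _)]
  rfl

/-- As χ is centred, its first moment below x is minus that above x. Bounding either part by γ times
its mass gives two pairs of estimates; they fix the signs at the ends of the intermediate value
argument, for a source mass smaller or larger than half the total. -/
lemma mean_bounds (h : HKData χ ξ γ d δ) {x : ℝ} (hx : x ∈ Ioo (-γ) γ) :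
    0 < χ.real (Iio x) ∧ 0 < χ.real univ - χ.real (Iio x) ∧
    -γ * χ.real (Iio x) < ∫ z in Iio x, z ∂χ ∧ ∫ z in Iio x, z ∂χ < γ * χ.real (Iio x) ∧
    -γ * (χ.real univ - χ.real (Iio x)) < ∫ z in Iio x, z ∂χ ∧
    ∫ z in Iio x, z ∂χ < γ * (χ.real univ - χ.real (Iio x)) := by
  have := h.finite_χ
  have := h.null_χ
  have hi := h.integrable_χ
  have hcompl := measureReal_compl (μ := χ) (measurableSet_Iio (a := x))
  have hIci : χ (Ici x) ≠ 0 := by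
    rw [← measure_congr Ioi_ae_eq_Ici, measure_neg_of_symm h.symm_χ measurableSet_Ioi]
    have := h.pos_χ (-x) ⟨by linarith [hx.2], by linarith [hx.1]⟩
    convert this using 2
    ext z; simp
  have hint : ∫ z in Iio x, z ∂χ + ∫ z in Ici x, z ∂χ = 0 := by
    have := integral_add_compl (μ := χ) (measurableSet_Iio (a := x)) hi
    rwa [compl_Iio, h.integral_χ] at this
  rw [compl_Iio] at hcompl
  have hgen : ∀ s : Set ℝ, MeasurableSet s → χ s ≠ 0 →
      -γ * χ.real s < ∫ z in s, z ∂χ ∧ ∫ z in s, z ∂χ < γ * χ.real s := by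
    intro s hs hs0
    have h1 := setIntegral_pos_of_ae (m := χ) (h := fun z => z + γ) hs
      (hi.add (integrable_const γ)).integrableOn
      (h.carrier_χ.mono fun z hz _ => by linarith [hz.1]) hs0
    have h2 := setIntegral_pos_of_ae (m := χ) (h := fun z => γ - z) hs
      ((integrable_const γ).sub hi).integrableOn
      (h.carrier_χ.mono fun z hz _ => by linarith [hz.2]) hs0
    rw [integral_add hi.integrableOn (integrable_const γ)] at h1
    rw [integral_sub (integrable_const γ) hi.integrableOn] at h2
    simp only [integral_const, measureReal_restrict_apply_univ, smul_eq_mul] at h1 h2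
    constructor <;> linarith
  obtain ⟨a1, a2⟩ := hgen _ measurableSet_Iio (h.pos_χ x hx)
  obtain ⟨a3, a4⟩ := hgen _ measurableSet_Ici hIci
  have p1 : 0 < χ.real (Iio x) := ENNReal.toReal_pos (h.pos_χ x hx) (measure_ne_top _ _)
  have p2 : 0 < χ.real (Ici x) := ENNReal.toReal_pos hIci (measure_ne_top _ _)
  rw [← hcompl]
  refine ⟨p1, p2, a1, a2, ?_, ?_⟩ <;> linarith

/-- Once the mass θ sent to the lower branch is chosen, the mass equation determines q, and only the
equation for the first moment remains. -/
lemma exists_point (h : HKData χ ξ γ d δ) {V : ℝ → ℝ} (hV : Continuous V)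
    (hVs : ∀ s, IsLowerSet s →
      V ((ξ.restrict (Ioi 0)).real s) = ∫ y in s, y ∂(ξ.restrict (Ioi 0)))
    {x : ℝ} (hx : x ∈ Ioo (-γ) γ) :
    ∃ u q : ℝ, (d < u ∧ (u : EReal) < δ) ∧ (d < q ∧ (q : EReal) < δ) ∧
      χ.real (Iio x) = (ξ.restrict (Ioi 0)).real (Iio u)
        + ((ξ.restrict (Ioi 0)).real univ - (ξ.restrict (Ioi 0)).real (Iio q)) ∧
      ∫ z in Iio x, z ∂χ = -(∫ z in Iio u, z ∂(ξ.restrict (Ioi 0)))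
        + (∫ z, z ∂(ξ.restrict (Ioi 0)) - ∫ z in Iio q, z ∂(ξ.restrict (Ioi 0))) := by
  have := h.finite_ξ
  have := h.null_ξ
  obtain ⟨b1, b2, b3, b4, b5, b6⟩ := h.mean_bounds hx
  rw [h.real_univ] at b2 b5 b6
  set m := ξ.restrict (Ioi (0 : ℝ)) with hm
  have hV0 : V 0 = 0 := by simpa using hVs ∅ isLowerSet_empty
  have hVC : V (m.real univ) = ∫ y, y ∂m := by simpa using hVs univ isLowerSet_univ
  have hmi : Integrable (fun y => y) m := h.integrable_ξ.restrict
  have hmγ : ∀ᵐ y ∂m, γ ≤ y := h.carrier_restrict.mono fun y hy => h.γ_le.trans hy.1.le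
  have hVge : ∀ {θ θ' : ℝ}, 0 ≤ θ → θ ≤ θ' → θ' ≤ m.real univ →
      γ * (θ' - θ) ≤ V θ' - V θ := fun h0 hle h1 => lowerMean_sub_ge hVs hmi hmγ h0 hle h1
  set C := m.real univ with hC
  set M := χ.real (Iio x) with hM
  set B := ∫ z in Iio x, z ∂χ with hB
  -- First moment of the proposed target minus that of the source, where the reflected lower branch
  -- takes θ and the upper branch takes M - θ.
  set f : ℝ → ℝ := fun θ => V C - V θ - V (θ + C - M) - B with hf
  have hfc : Continuous f := by fun_prop
  have hC0 : 0 ≤ C := measureReal_nonneg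
  -- Feasible values lie between max(0, M - C) and min(M, C). With as little mass as possible on the
  -- lower branch the target moment is too large, with as much as possible it is too small.
  have hex : ∃ θ, 0 < θ ∧ θ < C ∧ M - C < θ ∧ θ < M ∧ f θ = 0 := by
    rcases le_or_gt M C with hMC | hMC
    · have h1 : 0 < f 0 := by
        have := hVge (θ := C - M) (θ' := C) (by linarith) (by linarith) le_rfl
        simp only [hf, hV0, zero_add]; nlinarith
      have h2 : f M < 0 := by
        have := hVge (θ := 0) (θ' := M) le_rfl b1.le hMC
        simp only [hf, add_sub_cancel_left]
        rw [hV0] at this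
        nlinarith
      obtain ⟨θ, hθ, h0⟩ := intermediate_value_Ioo' b1.le hfc.continuousOn ⟨h2, h1⟩
      exact ⟨θ, hθ.1, hθ.2.trans_le hMC, by linarith [hθ.1], hθ.2, h0⟩
    · have h1 : 0 < f (M - C) := by
        have := hVge (θ := M - C) (θ' := C) (by linarith) (by linarith) le_rfl
        have e : M - C + C - M = 0 := by ring
        simp only [hf, e, hV0]
        nlinarith
      have h2 : f C < 0 := by
        have := hVge (θ := 0) (θ' := C + C - M) le_rfl (by linarith) (by linarith)
        simp only [hf]
        rw [hV0] at this
        nlinarith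
      obtain ⟨θ, hθ, h0⟩ := intermediate_value_Ioo' (by linarith) hfc.continuousOn ⟨h2, h1⟩
      exact ⟨θ, by linarith [hθ.1], hθ.2, hθ.1, by linarith [hθ.2], h0⟩
  obtain ⟨θ, h1, h2, h3, h4, h5⟩ := hex
  obtain ⟨u, hu⟩ := exists_real_Iio_eq (m := m) h1 h2
  obtain ⟨q, hq⟩ := exists_real_Iio_eq (m := m) (θ := θ + C - M) (by linarith) (by linarith)
  refine ⟨u, q, h.mem_of_real_Iio ?_ ?_, h.mem_of_real_Iio ?_ ?_, ?_, ?_⟩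
  · rw [← hm, hu]; exact h1
  · rw [← hm, hu]; exact h2
  · rw [← hm, hq]; linarith
  · rw [← hm, hq]; linarith
  · rw [hu, hq]; ring
  · rw [← hVs _ (isLowerSet_Iio u), ← hVs _ (isLowerSet_Iio q), hu, hq, ← hVC]
    simp only [hf] at h5
    linarith

lemma exists_isHKPair (h : HKData χ ξ γ d δ) : ∃ p q : ℝ → ℝ, IsHKPair χ ξ γ p q := by
  have := h.finite_ξ
  have := h.finite_χ
  have := h.null_ξ
  obtain ⟨V, hV, hVs⟩ := exists_lowerMean (m := ξ.restrict (Ioi 0)) h.carrier_restrict h.injOn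
    h.integrable_ξ.restrict
  choose! u q hu hq hmass hmean using fun x (hx : x ∈ Ioo (-γ) γ) => h.exists_point hV hVs hx
  have hmi : Integrable (fun y => y) (ξ.restrict (Ioi 0)) := h.integrable_ξ.restrict
  have hmγ : ∀ᵐ y ∂(ξ.restrict (Ioi 0)), γ ≤ y :=
    h.carrier_restrict.mono fun y hy => h.γ_le.trans hy.1.le
  have hGM : ∀ {y y' : ℝ}, y ≤ y' →
      γ * ((ξ.restrict (Ioi 0)).real (Iio y') - (ξ.restrict (Ioi 0)).real (Iio y))
        ≤ ∫ z in Iio y', z ∂(ξ.restrict (Ioi 0)) - ∫ z in Iio y, z ∂(ξ.restrict (Ioi 0)) := by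
    intro y y' hyy
    rw [← hVs _ (isLowerSet_Iio y), ← hVs _ (isLowerSet_Iio y')]
    exact lowerMean_sub_ge hVs hmi hmγ measureReal_nonneg (monotone_real_Iio hyy)
      (measureReal_mono (subset_univ _))
  have hχM : ∀ {s t : ℝ}, s ≤ t →
      -γ * (χ.real (Iio t) - χ.real (Iio s)) ≤ ∫ z in Iio t, z ∂χ - ∫ z in Iio s, z ∂χ ∧
      ∫ z in Iio t, z ∂χ - ∫ z in Iio s, z ∂χ ≤ γ * (χ.real (Iio t) - χ.real (Iio s)) := by
    intro s t hst
    rw [← measureReal_sdiff (Iio_subset_Iio hst) measurableSet_Iio,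
      ← setIntegral_sdiff measurableSet_Iio h.integrable_χ.integrableOn (Iio_subset_Iio hst)]
    have h1 : ∫ _ in Iio t \ Iio s, -γ ∂χ ≤ ∫ z in Iio t \ Iio s, z ∂χ :=
      integral_mono_ae (integrable_const _) h.integrable_χ.integrableOn
        (ae_restrict_of_ae (h.carrier_χ.mono fun z hz => hz.1.le))
    have h2 : ∫ z in Iio t \ Iio s, z ∂χ ≤ ∫ _ in Iio t \ Iio s, γ ∂χ :=
      integral_mono_ae h.integrable_χ.integrableOn (integrable_const _)
        (ae_restrict_of_ae (h.carrier_χ.mono fun z hz => hz.2.le))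
    simp only [integral_const, measureReal_restrict_apply_univ, smul_eq_mul] at h1 h2
    constructor <;> linarith
  have hγ := h.γ_pos
  -- If one branch moved the wrong way, the target moment would change by at least γ times the sum
  -- of two branch masses, while the source moment changes by at most γ times their difference.
  have hmono : ∀ s ∈ Ioo (-γ) γ, ∀ t ∈ Ioo (-γ) γ, s ≤ t → u s ≤ u t ∧ q t ≤ q s := by
    intro s hs t ht hst
    obtain ⟨m1, m2⟩ := hχM hst
    have hM := monotone_real_Iio (m := χ) hst
    simp only at hM
    have e1 := hmass s hs
    have e2 := hmass t ht
    have e3 := hmean s hs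
    have e4 := hmean t ht
    constructor
    · by_contra hn
      rw [not_le] at hn
      have g1 := h.real_Iio_lt (hu t ht).1.le (hu t ht).2 hn
      have g2 := hGM hn.le
      rcases le_total (q t) (q s) with hq' | hq'
      · have g3 := hGM hq'
        nlinarith
      · have g3 := monotone_real_Iio (m := ξ.restrict (Ioi 0)) hq'
        simp only at g3
        linarith
    · by_contra hn
      rw [not_le] at hn
      have g1 := h.real_Iio_lt (hq s hs).1.le (hq s hs).2 hn
      have g2 := hGM hn.le
      rcases le_total (u s) (u t) with hu' | hu'
      · have g3 := hGM hu'
        nlinarith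
      · have g3 := monotone_real_Iio (m := ξ.restrict (Ioi 0)) hu'
        simp only at g3
        linarith
  have hqγ : ∀ x ∈ Ioo (-γ) γ, γ < q x := fun x hx => h.γ_le.trans_lt (hq x hx).1
  have hid := fun x hx => (h.isHKPair_identities_iff (x := x) (p := -u x) (hqγ x hx)).2
    (by rw [neg_neg]; exact ⟨hmass x hx, hmean x hx⟩)
  exact ⟨fun x => -u x, q,
    { anti_p := fun s hs t ht hst => neg_le_neg (hmono s hs t ht hst).1
      anti_q := fun s hs t ht hst => (hmono s hs t ht hst).2
      p_lt := fun x hx => neg_lt_neg (h.γ_le.trans_lt (hu x hx).1)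
      lt_q := hqγ
      mass := fun x hx => (hid x hx).1
      mean := fun x hx => (hid x hx).2 }⟩

end HKData

lemma exists_measurable_hkKernel {χ ξ : Measure ℝ} {γ : ℝ} {p q : ℝ → ℝ}
    (hpq : IsHKPair χ ξ γ p q) :
    ∃ κ : ℝ → Measure ℝ, Measurable κ ∧ ∀ x ∈ Ioo (-γ) γ, κ x = hkKernel p q x := by
  refine ⟨fun x => twoPoint ((Ioo (-γ) γ).indicator p x) ((Ioo (-γ) γ).indicator q x) x,
    measurable_twoPoint (measurable_piecewise_of_antitoneOn ordConnected_Ioo hpq.anti_p)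
      (measurable_piecewise_of_antitoneOn ordConnected_Ioo hpq.anti_q) measurable_id,
    fun x hx => ?_⟩
  simp only [indicator_of_mem hx, hkKernel]

/-! ### Hobson–Klimmek kernels: exhaustion of the target and transport. -/

namespace HKData

variable {χ ξ : Measure ℝ} {γ d : ℝ} {δ : EReal} {p q : ℝ → ℝ}

lemma mem_of_real_Iio_χ (h : HKData χ ξ γ d δ) {x : ℝ} (h0 : 0 < χ.real (Iio x))
    (h1 : χ.real (Iio x) < χ.real univ) : x ∈ Ioo (-γ) γ := by
  constructor
  · by_contra hn
    refine h0.ne' ?_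
    rw [← measureReal_congr (h.Iio_ae_eq x), Ioo_eq_empty (not_lt.2 (not_lt.1 hn))]
    simp
  · by_contra hn
    refine h1.ne ?_
    refine measureReal_congr ?_
    filter_upwards [h.carrier_χ] with z hz
    exact propext ⟨fun _ => trivial, fun _ => hz.2.trans_le (not_lt.1 hn)⟩

/-- The increment bound makes Φ continuous. The two outer bounds are used where χ has mass θ and
where it has mass θ + C, with C the upper half of the mass of ξ: there Φ is at most, respectively at
least, θ. -/
lemma exists_eq_of_increments_le (h : HKData χ ξ γ d δ) {Φ : ℝ → ℝ}
    (hinc : ∀ x ∈ Ioo (-γ) γ, ∀ y ∈ Ioo (-γ) γ, x ≤ y →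
      |Φ y - Φ x| ≤ |χ.real (Iio y) - χ.real (Iio x)|)
    (hle : ∀ x ∈ Ioo (-γ) γ, Φ x ≤ χ.real (Iio x))
    (hge : ∀ x ∈ Ioo (-γ) γ, χ.real (Iio x) - (ξ.restrict (Ioi 0)).real univ ≤ Φ x)
    {θ : ℝ} (h0 : 0 < θ) (h1 : θ < (ξ.restrict (Ioi 0)).real univ) :
    ∃ x ∈ Ioo (-γ) γ, Φ x = θ := by
  have := h.finite_χ
  have := h.null_χ
  have hT := h.real_univ
  obtain ⟨x₁, hx₁⟩ := exists_real_Iio_eq (m := χ) h0 (by linarith)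
  obtain ⟨x₂, hx₂⟩ := exists_real_Iio_eq (m := χ)
    (θ := θ + (ξ.restrict (Ioi 0)).real univ) (by linarith) (by linarith)
  have m₁ := h.mem_of_real_Iio_χ (x := x₁) (by linarith) (by linarith)
  have m₂ := h.mem_of_real_Iio_χ (x := x₂) (by linarith) (by linarith)
  have hsub : uIcc x₁ x₂ ⊆ Ioo (-γ) γ := ordConnected_Ioo.uIcc_subset m₁ m₂
  have hc : ContinuousOn Φ (Ioo (-γ) γ) :=
    continuousOn_of_increments_le (continuous_real_Iio (m := χ)).continuousOn hinc
  have l1 := hle _ m₁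
  have l2 := hge _ m₂
  obtain ⟨x, hx, hxθ⟩ := intermediate_value_uIcc (hc.mono hsub)
    (show θ ∈ uIcc (Φ x₁) (Φ x₂) from mem_uIcc_of_le (by linarith) (by linarith))
  exact ⟨x, hsub hx, hxθ⟩

lemma isHKPair_mass (h : HKData χ ξ γ d δ) (hpq : IsHKPair χ ξ γ p q) {x : ℝ}
    (hx : x ∈ Ioo (-γ) γ) : χ.real (Iio x) = (ξ.restrict (Ioi 0)).real (Iio (-p x))
      + ((ξ.restrict (Ioi 0)).real univ - (ξ.restrict (Ioi 0)).real (Iio (q x))) :=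
  ((h.isHKPair_identities_iff (hpq.lt_q x hx)).1 ⟨hpq.mass x hx, hpq.mean x hx⟩).1

/-- The masses of the two branches are both nondecreasing in x and add up to the distribution
function of χ. Each is therefore continuous and takes every intermediate value, so jumps of p and q
skip no mass of ξ. -/
lemma range_isHKPair (h : HKData χ ξ γ d δ) (hpq : IsHKPair χ ξ γ p q) :
    ∀ᵐ y ∂ξ, ∃ x ∈ Ioo (-γ) γ, y = p x ∨ y = q x := by
  have := h.finite_χ
  have := h.finite_ξ
  have := h.null_ξ
  have hbd : ∀ y, d < y → (y : EReal) < δ → 0 < (ξ.restrict (Ioi 0)).real (Iio y) ∧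
      (ξ.restrict (Ioi 0)).real (Iio y) < (ξ.restrict (Ioi 0)).real univ := by
    intro y hy hyδ
    constructor
    · have := h.real_Iio_lt le_rfl ((EReal.coe_lt_coe_iff.2 hy).trans hyδ) hy
      rwa [h.real_Iio_d] at this
    · exact (h.real_Iio_lt hy.le hyδ (lt_add_one y)).trans_le (measureReal_mono (subset_univ _))
  have hp : ∀ x ∈ Ioo (-γ) γ, ∀ y ∈ Ioo (-γ) γ, x ≤ y →
      (ξ.restrict (Ioi 0)).real (Iio (-p x)) ≤ (ξ.restrict (Ioi 0)).real (Iio (-p y)) :=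
    fun x hx y hy hxy => monotone_real_Iio (neg_le_neg (hpq.anti_p hx hy hxy))
  have hq : ∀ x ∈ Ioo (-γ) γ, ∀ y ∈ Ioo (-γ) γ, x ≤ y →
      (ξ.restrict (Ioi 0)).real (Iio (q y)) ≤ (ξ.restrict (Ioi 0)).real (Iio (q x)) :=
    fun x hx y hy hxy => monotone_real_Iio (hpq.anti_q hx hy hxy)
  have hle : ∀ z : ℝ, (ξ.restrict (Ioi 0)).real (Iio z) ≤ (ξ.restrict (Ioi 0)).real univ :=
    fun z => measureReal_mono (subset_univ _)
  have hnn : ∀ z : ℝ, 0 ≤ (ξ.restrict (Ioi 0)).real (Iio z) := fun z => measureReal_nonneg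
  filter_upwards [h.carrier_ξ] with y hy
  have hd0 : 0 < d := h.γ_pos.trans_le h.γ_le
  rcases le_total 0 y with h0 | h0
  · rw [abs_of_nonneg h0] at hy
    obtain ⟨b1, b2⟩ := hbd y hy.1 hy.2
    obtain ⟨x, hx, hxy⟩ := h.exists_eq_of_increments_le
      (Φ := fun x => (ξ.restrict (Ioi 0)).real univ - (ξ.restrict (Ioi 0)).real (Iio (q x)))
      (θ := (ξ.restrict (Ioi 0)).real univ - (ξ.restrict (Ioi 0)).real (Iio y))
      (fun s hs t ht hst => by
        have e1 := h.isHKPair_mass hpq hs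
        have e2 := h.isHKPair_mass hpq ht
        have i1 := hp s hs t ht hst
        have i2 := hq s hs t ht hst
        rw [abs_of_nonneg (by linarith), abs_of_nonneg (by linarith)]; linarith)
      (fun s hs => by have := h.isHKPair_mass hpq hs; have := hnn (-p s); linarith)
      (fun s hs => by have := h.isHKPair_mass hpq hs; have := hle (-p s); linarith)
      (by linarith) (by linarith)
    exact ⟨x, hx, Or.inr (h.eq_of_real_Iio_eq hy.1 hy.2 (by linarith)).symm⟩
  · rw [abs_of_nonpos h0] at hy
    obtain ⟨b1, b2⟩ := hbd (-y) hy.1 hy.2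
    obtain ⟨x, hx, hxy⟩ := h.exists_eq_of_increments_le
      (Φ := fun x => (ξ.restrict (Ioi 0)).real (Iio (-p x)))
      (θ := (ξ.restrict (Ioi 0)).real (Iio (-y)))
      (fun s hs t ht hst => by
        have e1 := h.isHKPair_mass hpq hs
        have e2 := h.isHKPair_mass hpq ht
        have i1 := hp s hs t ht hst
        have i2 := hq s hs t ht hst
        rw [abs_of_nonneg (by linarith), abs_of_nonneg (by linarith)]; linarith)
      (fun s hs => by have := h.isHKPair_mass hpq hs; have := hle (q s); linarith)
      (fun s hs => by have := h.isHKPair_mass hpq hs; have := hnn (q s); linarith)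
      b1 b2
    have := h.eq_of_real_Iio_eq hy.1 hy.2 hxy
    exact ⟨x, hx, Or.inl (by linarith)⟩

/-- A Hobson–Klimmek kernel transports `χ` to `ξ`. -/
theorem bind_hkKernel (h : HKData χ ξ γ d δ) (hpq : IsHKPair χ ξ γ p q) :
    χ.bind (hkKernel p q) = ξ := by
  have := h.finite_χ
  have := h.finite_ξ
  have := h.null_ξ
  have hγ := h.γ_pos
  set I := Ioo (-γ) γ with hI
  have hcongr : hkKernel p q =ᵐ[χ] fun x => twoPoint (I.indicator p x) (I.indicator q x) x := by
    filter_upwards [h.carrier_χ] with x hx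
    have hx' : x ∈ I := hx
    simp only [indicator_of_mem hx', hkKernel]
  rw [Measure.bind_congr_right hcongr]
  have hdisj : ∀ x ∈ I, Disjoint (Ioo (p x) (-γ)) (Ioi (q x)) := fun x hx =>
    Set.disjoint_left.2 fun z h1 h2 => by
      have := hpq.lt_q x hx
      have h2' : q x < z := h2
      linarith [h1.2]
  refine bind_twoPoint_eq_of_branches (l := -γ) (r := γ) (c := 0)
    (A := fun x => Ioo (p x) (-γ)) (by linarith) h.carrier_χ h.integrable_ξ
    (measurable_piecewise_of_antitoneOn ordConnected_Ioo hpq.anti_p)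
    (measurable_piecewise_of_antitoneOn ordConnected_Ioo hpq.anti_q) ?_ ?_ ?_ ?_ ?_ ?_ ?_ ?_ ?_ ?_
    ?_ h.mass ?_ (h.integral_χ.trans h.integral_ξ.symm)
  · intro x hx; rw [indicator_of_mem hx]; exact (hpq.p_lt x hx).trans hx.1
  · intro x hx; rw [indicator_of_mem hx]; exact hx.2.trans (hpq.lt_q x hx)
  · intro x hx; rw [indicator_of_mem hx]; exact (hpq.p_lt x hx).trans (by linarith)
  · intro x hx; rw [indicator_of_mem hx]; exact hγ.trans (hpq.lt_q x hx)
  · intro x₀ hx₀ x hx hlt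
    rw [indicator_of_mem hx, indicator_of_mem hx₀]
    rcases (hpq.anti_p hx₀ hx hlt.le).lt_or_eq with h1 | h1
    · exact Or.inl ⟨h1, hpq.p_lt x₀ hx₀⟩
    · exact Or.inr h1.symm
  · intro x₀ hx₀ x hx hle
    rw [indicator_of_mem hx₀]
    exact fun hmem => absurd (hpq.anti_p hx hx₀ hle) (not_le.2 hmem.1)
  · exact fun x _ => measurableSet_Ioo
  · exact fun x hx z hz => hz.2.trans (by simpa using hγ)
  · intro s hs t ht hst
    rw [indicator_of_mem hs, indicator_of_mem ht]
    exact hpq.anti_q hs ht hst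
  · filter_upwards [h.range_isHKPair hpq] with y ⟨x, hx, hxy⟩
    refine ⟨x, hx, ?_⟩
    rwa [indicator_of_mem hx, indicator_of_mem hx]
  · intro x hx
    rw [indicator_of_mem hx, measure_union (hdisj x hx) measurableSet_Ioi, ← hpq.mass x hx,
      measure_congr (h.Iio_ae_eq x)]
  · intro x hx
    rw [indicator_of_mem hx, setIntegral_union (hdisj x hx) measurableSet_Ioi
      h.integrable_ξ.integrableOn h.integrable_ξ.integrableOn, ← hpq.mean x hx,
      setIntegral_congr_set (h.Iio_ae_eq x)]

end HKData

/-! ### Measures with densities -/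

section density

variable {h : ℝ → ℝ} {S : Set ℝ}

lemma law_eq_densityOn (ρ : ℝ → ℝ) : law ρ = densityOn ρ univ := by
  rw [law, densityOn, Measure.restrict_univ]

lemma densityOn_eq (hS : MeasurableSet S) :
    densityOn h S = volume.withDensity (S.indicator fun x => ENNReal.ofReal (h x)) := by
  rw [densityOn, withDensity_indicator hS]

instance : NullSingletonClass (densityOn h S) := by
  unfold densityOn; infer_instance

lemma isFiniteMeasure_densityOn (hh : Integrable h) : IsFiniteMeasure (densityOn h S) :=
  isFiniteMeasure_withDensity_ofReal hh.restrict.2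

lemma ae_densityOn (hm : Measurable h) (hS : MeasurableSet S) {p : ℝ → Prop}
    (hp : ∀ x ∈ S, 0 < h x → p x) : ∀ᵐ x ∂(densityOn h S), p x := by
  rw [densityOn, ae_withDensity_iff' hm.ennreal_ofReal.aemeasurable, ae_restrict_iff' hS]
  exact ae_of_all _ fun x hx h0 => hp x hx (by simpa using h0)

lemma setIntegral_densityOn (hm : Measurable h) (hS : MeasurableSet S)
    (h0 : ∀ x ∈ S, 0 ≤ h x) {s : Set ℝ} (hs : MeasurableSet s) (φ : ℝ → ℝ) :
    ∫ y in s, φ y ∂(densityOn h S) = ∫ y in s ∩ S, φ y * h y := by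
  rw [densityOn, setIntegral_withDensity_eq_setIntegral_toReal_smul hm.ennreal_ofReal
    (ae_of_all _ fun _ => ENNReal.ofReal_lt_top) _ hs, Measure.restrict_restrict hs]
  refine setIntegral_congr_fun (hs.inter hS) fun x hx => ?_
  simp only [ENNReal.toReal_ofReal (h0 x hx.2), smul_eq_mul, mul_comm]

lemma real_densityOn (hm : Measurable h) (hS : MeasurableSet S)
    (h0 : ∀ x ∈ S, 0 ≤ h x) {s : Set ℝ} (hs : MeasurableSet s) :
    (densityOn h S).real s = ∫ y in s ∩ S, h y := by
  have := setIntegral_densityOn hm hS h0 hs (fun _ => 1)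
  simpa using this

lemma integrable_densityOn (hm : Measurable h) (hS : MeasurableSet S) (h0 : ∀ x ∈ S, 0 ≤ h x)
    {φ : ℝ → ℝ} (hφ : Integrable fun y => φ y * h y) : Integrable φ (densityOn h S) := by
  rw [densityOn, integrable_withDensity_iff_integrable_smul' hm.ennreal_ofReal
    (ae_of_all _ fun _ => ENNReal.ofReal_lt_top)]
  refine (hφ.integrableOn (s := S)).congr ?_
  filter_upwards [ae_restrict_mem hS] with x hx
  simp only [ENNReal.toReal_ofReal (h0 x hx), smul_eq_mul, mul_comm]

lemma densityOn_map_neg (hS : MeasurableSet S) (hsymm : ∀ x, h (-x) = h x) :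
    (densityOn h S).map (fun x => -x) = densityOn h ((fun x => -x) ⁻¹' S) := by
  rw [densityOn_eq hS, densityOn_eq (measurable_neg hS)]
  ext s hs
  rw [Measure.map_apply measurable_neg hs, withDensity_apply _ hs,
    withDensity_apply _ (measurable_neg hs), ← lintegral_indicator hs,
    ← lintegral_indicator (measurable_neg hs), ← lintegral_neg_eq_self]
  refine lintegral_congr fun x => ?_
  by_cases h1 : x ∈ s <;> by_cases h2 : -x ∈ S <;> simp [indicator, h1, h2, hsymm]

lemma densityOn_symm (hS : MeasurableSet S) (hsymm : ∀ x, h (-x) = h x)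
    (hSsymm : ∀ x, -x ∈ S ↔ x ∈ S) : (densityOn h S).map (fun x => -x) = densityOn h S := by
  rw [densityOn_map_neg hS hsymm]
  congr 1
  ext x
  exact hSsymm x

lemma densityOn_ne_zero (hm : Measurable h) {s t : ℝ} (hst : s < t)
    (hsub : ∀ x ∈ Ioo s t, x ∈ S ∧ 0 < h x) {B : Set ℝ} (hB : Ioo s t ⊆ B) :
    densityOn h S B ≠ 0 := by
  intro h0
  have h1 : densityOn h S (Ioo s t) = 0 := measure_mono_null hB h0
  rw [densityOn, withDensity_apply _ measurableSet_Ioo, Measure.restrict_restrict measurableSet_Ioo,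
    inter_eq_left.2 fun x hx => (hsub x hx).1, lintegral_eq_zero_iff hm.ennreal_ofReal] at h1
  have h2 : ∀ᵐ x ∂(volume.restrict (Ioo s t)), False := by
    filter_upwards [h1, ae_restrict_mem measurableSet_Ioo] with x hx hxs
    have : ENNReal.ofReal (h x) = 0 := hx
    exact absurd (ENNReal.ofReal_eq_zero.1 this) (not_le.2 (hsub x hxs).2)
  rw [Filter.eventually_false_iff_eq_bot, ae_eq_bot, Measure.restrict_eq_zero,
    Real.volume_Ioo, ENNReal.ofReal_eq_zero] at h2
  linarith

end density

lemma HKData.of_density {h k : ℝ → ℝ} {S T : Set ℝ} {γ d : ℝ} {δ : EReal} (hm : Measurable h)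
    (km : Measurable k) (hi : Integrable h) (ki : Integrable k)
    (kzi : Integrable fun z => z * k z) (hS : MeasurableSet S) (hT : MeasurableSet T)
    (h0 : ∀ x ∈ S, 0 ≤ h x) (k0 : ∀ x ∈ T, 0 ≤ k x) (hsymm : ∀ x, h (-x) = h x)
    (ksymm : ∀ x, k (-x) = k x) (Ssymm : ∀ x, -x ∈ S ↔ x ∈ S) (Tsymm : ∀ x, -x ∈ T ↔ x ∈ T)
    (hγ : 0 < γ) (hγd : γ ≤ d) (hSγ : S ⊆ Ioo (-γ) γ)
    (hTd : ∀ y ∈ T, d < |y| ∧ ((|y| : ℝ) : EReal) < δ)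
    (hpos : ∃ c < γ, ∀ x ∈ Ioo c γ, x ∈ S ∧ 0 < h x)
    (kpos : ∀ y : ℝ, d < y → (y : EReal) < δ → y ∈ T ∧ 0 < k y)
    (hmass : ∫ x in S, h x = ∫ y in T, k y) :
    HKData (densityOn h S) (densityOn k T) γ d δ where
  finite_χ := isFiniteMeasure_densityOn hi
  finite_ξ := isFiniteMeasure_densityOn ki
  null_χ := inferInstance
  null_ξ := inferInstance
  symm_χ := densityOn_symm hS hsymm Ssymm
  symm_ξ := densityOn_symm hT ksymm Tsymm
  integrable_ξ := integrable_densityOn km hT k0 kzi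
  γ_pos := hγ
  γ_le := hγd
  carrier_χ := ae_densityOn hm hS fun x hx _ => hSγ hx
  carrier_ξ := ae_densityOn km hT fun y hy _ => hTd y hy
  -- Positivity of the density near γ reflects to positivity near -γ, and every half-line below a
  -- point of (-γ, γ) meets that neighbourhood inside (-γ, γ).
  pos_χ := by
    intro x hx
    obtain ⟨c, hc, hcS⟩ := hpos
    refine densityOn_ne_zero hm (s := -γ) (t := min x (-c)) (lt_min hx.1 (by linarith)) ?_ ?_
    · intro z hz
      have := hcS (-z) ⟨by linarith [hz.2, min_le_right x (-c)], by linarith [hz.1]⟩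
      rwa [Ssymm, hsymm] at this
    · exact fun z hz => hz.2.trans_le (min_le_left _ _)
  pos_ξ := by
    intro s t hds hst hsδ
    obtain ⟨r, hsr, hrδ⟩ : ∃ r, s < r ∧ (r : EReal) < δ := by
      obtain ⟨r, h1, h2⟩ := EReal.lt_iff_exists_real_btwn.1 hsδ
      exact ⟨r, EReal.coe_lt_coe_iff.1 h1, h2⟩
    refine densityOn_ne_zero km (s := s) (t := min r t) (lt_min hsr hst) ?_ ?_
    · intro z hz
      refine kpos z (hds.trans_lt hz.1) (lt_trans ?_ hrδ)
      exact EReal.coe_lt_coe_iff.2 (hz.2.trans_le (min_le_left _ _))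
    · exact fun z hz => ⟨hz.1, hz.2.trans_le (min_le_right _ _)⟩
  mass := by
    have e1 := real_densityOn hm hS h0 MeasurableSet.univ
    have e2 := real_densityOn km hT k0 MeasurableSet.univ
    rw [univ_inter] at e1 e2
    have := isFiniteMeasure_densityOn (S := S) hi
    have := isFiniteMeasure_densityOn (S := T) ki
    exact (ENNReal.toReal_eq_toReal_iff' (measure_ne_top _ _) (measure_ne_top _ _)).1
      (e1.trans (hmass.trans e2.symm))

/-! ### Consequences of dispersion -/

lemma measurableSet_symIoo (r : EReal) : MeasurableSet (symIoo r) :=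
  measurableSet_lt (measurable_coe_real_ereal.comp measurable_abs) measurable_const

lemma neg_mem_symIoo {r : EReal} {x : ℝ} : -x ∈ symIoo r ↔ x ∈ symIoo r := by
  simp [symIoo]

lemma mem_symIoo_of_abs_le {r : EReal} {x y : ℝ} (hy : y ∈ symIoo r) (h : |x| ≤ |y|) :
    x ∈ symIoo r :=
  lt_of_le_of_lt (EReal.coe_le_coe_iff.2 h) hy

lemma mem_symIoo_of_mem_Icc {r : EReal} {x y z : ℝ} (hx : x ∈ symIoo r) (hy : y ∈ symIoo r)
    (hz : z ∈ Icc x y) : z ∈ symIoo r := by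
  have := abs_le_max_abs_abs hz.1 hz.2
  rcases le_max_iff.1 this with h | h
  exacts [mem_symIoo_of_abs_le hx h, mem_symIoo_of_abs_le hy h]

lemma exists_gt_mem_symIoo {r : EReal} {x : ℝ} (hx : x ∈ symIoo r) :
    ∃ y, |x| < y ∧ y ∈ symIoo r := by
  obtain ⟨y, h1, h2⟩ := EReal.lt_iff_exists_real_btwn.1 (show ((|x| : ℝ) : EReal) < r from hx)
  have h1' := EReal.coe_lt_coe_iff.1 h1
  refine ⟨y, h1', ?_⟩
  rwa [symIoo, mem_ofPred_eq, abs_of_pos ((abs_nonneg x).trans_lt h1')]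

lemma mem_symIoo_of_nonneg {r : EReal} {x : ℝ} (hx : 0 ≤ x) : x ∈ symIoo r ↔ (x : EReal) < r := by
  rw [symIoo, mem_ofPred_eq, abs_of_nonneg hx]

lemma integrable_of_law {ρ φ : ℝ → ℝ} (hm : Measurable ρ) (h0 : ∀ x, 0 ≤ ρ x)
    (h : Integrable φ (law ρ)) : Integrable fun z => φ z * ρ z := by
  rw [law, integrable_withDensity_iff_integrable_smul' hm.ennreal_ofReal
    (ae_of_all _ fun _ => ENNReal.ofReal_lt_top)] at h
  refine h.congr (ae_of_all _ fun x => ?_)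
  simp only [ENNReal.toReal_ofReal (h0 x), smul_eq_mul, mul_comm]

lemma real_law {ρ : ℝ → ℝ} (hm : Measurable ρ) (h0 : ∀ x, 0 ≤ ρ x) {s : Set ℝ}
    (hs : MeasurableSet s) : (law ρ).real s = ∫ z in s, ρ z := by
  rw [law_eq_densityOn, real_densityOn hm MeasurableSet.univ (fun x _ => h0 x) hs, inter_univ]

lemma ae_eq_zero_of_law {ρ : ℝ → ℝ} (hm : Measurable ρ) (h0 : ∀ x, 0 ≤ ρ x) {s : Set ℝ}
    (h : ∀ᵐ x ∂(law ρ), x ∈ s) : ∀ᵐ x, x ∉ s → ρ x = 0 := by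
  rw [law, ae_withDensity_iff hm.ennreal_ofReal] at h
  filter_upwards [h] with x hx hn
  by_contra hne
  refine hn (hx ?_)
  simpa using lt_of_le_of_ne (h0 x) (Ne.symm hne)

namespace IsDispersed

variable {ρ η : ℝ → ℝ} {α β : EReal} {e : ℝ}

lemma integrable_ρ (D : IsDispersed ρ η α β e) : Integrable ρ := by
  have := D.prob_ρ
  simpa using integrable_of_law D.measurable_ρ D.nonneg_ρ (integrable_const (1 : ℝ))

lemma integrable_η (D : IsDispersed ρ η α β e) : Integrable η := by
  have := D.prob_η
  simpa using integrable_of_law D.measurable_η D.nonneg_η (integrable_const (1 : ℝ))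

lemma integrable_mul_ρ (D : IsDispersed ρ η α β e) : Integrable fun z => z * ρ z :=
  integrable_of_law D.measurable_ρ D.nonneg_ρ D.order.integrable_left

lemma integrable_mul_η (D : IsDispersed ρ η α β e) : Integrable fun z => z * η z :=
  integrable_of_law D.measurable_η D.nonneg_η D.order.integrable_right

lemma integral_ρ (D : IsDispersed ρ η α β e) : ∫ z, ρ z = 1 := by
  have := D.prob_ρ
  have h := real_law D.measurable_ρ D.nonneg_ρ MeasurableSet.univ
  rwa [Measure.restrict_univ, probReal_univ, eq_comm] at h

lemma integral_η (D : IsDispersed ρ η α β e) : ∫ z, η z = 1 := by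
  have := D.prob_η
  have h := real_law D.measurable_η D.nonneg_η MeasurableSet.univ
  rwa [Measure.restrict_univ, probReal_univ, eq_comm] at h

lemma ae_η (D : IsDispersed ρ η α β e) : ∀ᵐ x ∂(law η), x ∈ symIoo β := by
  have := D.prob_η
  exact (mem_ae_iff_prob_eq_one₀ (measurableSet_symIoo β).nullMeasurableSet).2 D.carrier_η

lemma ae_η_zero (D : IsDispersed ρ η α β e) : ∀ᵐ x, x ∉ symIoo β → η x = 0 :=
  ae_eq_zero_of_law D.measurable_η D.nonneg_η D.ae_η

/-- For finite β = r, convex order is tested on (|x| - r)⁺, whose integral under ν is zero. This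
confines μ to [-r, r], and the endpoints are null. -/
lemma ae_ρ (D : IsDispersed ρ η α β e) : ∀ᵐ x ∂(law ρ), x ∈ symIoo β := by
  induction β with
  | bot => exact absurd D.β_pos (by simp)
  | top => exact ae_of_all _ fun x => by simp [symIoo, EReal.coe_lt_top]
  | coe r =>
    have hc : ConvexOn ℝ univ fun x : ℝ => max (|x| - r) 0 :=
      (((convexOn_norm convex_univ).sub (concaveOn_const r convex_univ)).sup
        (convexOn_const 0 convex_univ)).congr fun x _ => by simp [Real.norm_eq_abs]
    have h := D.order.le _ hc
    have hη : ∫⁻ x, ENNReal.ofReal (max (|x| - r) 0) ∂(law η) = 0 := by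
      rw [lintegral_eq_zero_iff (by fun_prop)]
      filter_upwards [D.ae_η] with x hx
      have : |x| < r := EReal.coe_lt_coe_iff.1 hx
      simp [this.le]
    have hneg : ∀ m : Measure ℝ, ∫⁻ x, ENNReal.ofReal (-(max (|x| - r) 0)) ∂m = 0 := by
      intro m
      rw [lintegral_eq_zero_iff (by fun_prop)]
      exact ae_of_all _ fun x => by simp
    have hρ : ∫⁻ x, ENNReal.ofReal (max (|x| - r) 0) ∂(law ρ) = 0 := by
      rw [extIntegral, extIntegral, hη, hneg, hneg, if_neg ENNReal.zero_ne_top] at h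
      split_ifs at h with h1
      · simp at h
      · have h' : ((∫⁻ x, ENNReal.ofReal (max (|x| - r) 0) ∂(law ρ) : ℝ≥0∞) : EReal)
            ≤ ((0 : ℝ≥0∞) : EReal) := by simpa using h
        exact le_antisymm (EReal.coe_ennreal_le_coe_ennreal_iff.1 h') bot_le
    rw [lintegral_eq_zero_iff (by fun_prop)] at hρ
    have n1 : ∀ᵐ x ∂(law ρ), x ≠ r := by
      rw [law_eq_densityOn]; exact compl_mem_ae_iff.2 (measure_singleton _)
    have n2 : ∀ᵐ x ∂(law ρ), x ≠ -r := by
      rw [law_eq_densityOn]; exact compl_mem_ae_iff.2 (measure_singleton _)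
    filter_upwards [hρ, n1, n2] with x hx h1 h2
    have h3 : |x| ≤ r := by simpa using hx
    refine EReal.coe_lt_coe_iff.2 (lt_of_le_of_ne h3 fun h4 => ?_)
    rcases abs_choice x with h5 | h5
    · exact h1 (h5 ▸ h4)
    · exact h2 (by linarith)

lemma ae_ρ_zero (D : IsDispersed ρ η α β e) : ∀ᵐ x, x ∉ symIoo β → ρ x = 0 :=
  ae_eq_zero_of_law D.measurable_ρ D.nonneg_ρ D.ae_ρ

/-- Otherwise ρ > η on all of (-β, β), where η already has mass one, and μ would have mass greater
than one. -/
lemma e_mem (D : IsDispersed ρ η α β e) : e ∈ symIoo β := by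
  by_contra hn
  have hsub : symIoo β ⊆ Ioo (-e) e := by
    intro x hx
    rw [mem_symIoo_of_nonneg D.e_pos.le, not_lt] at hn
    exact abs_lt.1 (EReal.coe_lt_coe_iff.1 (lt_of_lt_of_le (show ((|x| : ℝ) : EReal) < β from hx) hn))
  have hpos : 0 < ∫ z in symIoo β, (ρ z - η z) := by
    refine setIntegral_pos_of_ae (measurableSet_symIoo β)
      (D.integrable_ρ.sub D.integrable_η).integrableOn
      (ae_of_all _ fun z hz => sub_pos.2 (D.center z (hsub hz))) ?_
    obtain ⟨y, h1, h2⟩ := exists_gt_mem_symIoo (r := β) (x := 0) (by simpa [symIoo] using D.β_pos)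
    rw [abs_zero] at h1
    have : Ioo 0 y ⊆ symIoo β := fun z hz => mem_symIoo_of_abs_le h2 (by
      rw [abs_of_pos hz.1, abs_of_pos h1]; exact hz.2.le)
    refine fun h0 => ?_
    have := measure_mono_null this h0
    rw [Real.volume_Ioo, ENNReal.ofReal_eq_zero] at this
    linarith
  rw [integral_sub D.integrable_ρ.integrableOn D.integrable_η.integrableOn] at hpos
  have h1 : ∫ z in symIoo β, η z = 1 := by
    rw [← D.integral_η]
    refine setIntegral_eq_integral_of_ae_compl_eq_zero ?_
    exact D.ae_η_zero
  have h2 : ∫ z in symIoo β, ρ z ≤ 1 := by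
    rw [← D.integral_ρ]
    exact setIntegral_le_integral D.integrable_ρ (ae_of_all _ D.nonneg_ρ)
  linarith

end IsDispersed

/-! ### Cumulative mass and mean -/

/-- The mass of the density `h` on `(-∞, t)`. -/
def cum (h : ℝ → ℝ) (t : ℝ) : ℝ := ∫ z in Iio t, h z

/-- The first moment of the density `h` on `(-∞, t)`. -/
def cumMean (h : ℝ → ℝ) (t : ℝ) : ℝ := ∫ z in Iio t, z * h z

/-- The density `h` and its first moment are integrable. -/
def HasMean (h : ℝ → ℝ) : Prop := Integrable h ∧ Integrable fun z => z * h z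

lemma setIntegral_Iio_sub {h : ℝ → ℝ} (hi : Integrable h) (s t : ℝ) :
    (∫ z in Iio t, h z) - ∫ z in Iio s, h z = ∫ z in s..t, h z := by
  rw [← integral_Iic_eq_integral_Iio, ← integral_Iic_eq_integral_Iio,
    intervalIntegral.integral_Iic_sub_Iic hi.integrableOn hi.integrableOn]

namespace HasMean

variable {h k : ℝ → ℝ} {s t c : ℝ}

lemma sub (H : HasMean h) (K : HasMean k) : HasMean fun z => h z - k z := by
  refine ⟨H.1.sub K.1, (H.2.sub K.2).congr (ae_of_all _ fun z => ?_)⟩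
  simp only [Pi.sub_apply]; ring

lemma cum_fun_sub (H : HasMean h) (K : HasMean k) (t : ℝ) :
    cum (fun z => h z - k z) t = cum h t - cum k t :=
  integral_sub H.1.integrableOn K.1.integrableOn

lemma cumMean_fun_sub (H : HasMean h) (K : HasMean k) (t : ℝ) :
    cumMean (fun z => h z - k z) t = cumMean h t - cumMean k t := by
  rw [cumMean, cumMean, cumMean, ← integral_sub H.2.integrableOn K.2.integrableOn]
  simp only [mul_sub]

lemma cum_sub_cum (H : HasMean h) (s t : ℝ) : cum h t - cum h s = ∫ z in s..t, h z :=
  setIntegral_Iio_sub H.1 s t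

lemma cumMean_sub_cumMean (H : HasMean h) (s t : ℝ) :
    cumMean h t - cumMean h s = ∫ z in s..t, z * h z :=
  setIntegral_Iio_sub H.2 s t

lemma shifted (H : HasMean h) (s t c : ℝ) :
    ∫ z in s..t, (z - c) * h z = cumMean h t - cumMean h s - c * (cum h t - cum h s) := by
  rw [H.cum_sub_cum, H.cumMean_sub_cumMean, ← intervalIntegral.integral_const_mul,
    ← intervalIntegral.integral_sub H.2.intervalIntegrable (H.1.const_mul c).intervalIntegrable]
  simp only [sub_mul]

lemma interval_nonneg {φ : ℝ → ℝ} (hst : s ≤ t) (h0 : ∀ z ∈ Ioo s t, 0 ≤ φ z) :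
    0 ≤ ∫ z in s..t, φ z := by
  rw [intervalIntegral.integral_of_le hst, integral_Ioc_eq_integral_Ioo]
  exact setIntegral_nonneg measurableSet_Ioo h0

lemma shifted_integrable (H : HasMean h) (c : ℝ) : Integrable fun z => (z - c) * h z :=
  (H.2.sub (H.1.const_mul c)).congr (ae_of_all _ fun z => by simp only [Pi.sub_apply]; ring)

lemma cum_le (H : HasMean h) (hst : s ≤ t) (h0 : ∀ z ∈ Ioo s t, 0 ≤ h z) : cum h s ≤ cum h t := by
  have := interval_nonneg hst h0
  rw [← H.cum_sub_cum] at this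
  linarith

lemma cum_lt (H : HasMean h) (hst : s < t) (h0 : ∀ z ∈ Ioo s t, 0 < h z) : cum h s < cum h t := by
  have := intervalIntegral.intervalIntegral_pos_of_pos_on H.1.intervalIntegrable h0 hst
  rw [← H.cum_sub_cum] at this
  linarith

/-- Mass to the right of c has first moment at least c times its size. This bound, its mirror image
and their strict forms are the only way in which the positions of masses are compared below. -/
lemma le_cumMean_sub (H : HasMean h) (hst : s ≤ t) (hc : c ≤ s) (h0 : ∀ z ∈ Ioo s t, 0 ≤ h z) :
    c * (cum h t - cum h s) ≤ cumMean h t - cumMean h s := by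
  have := interval_nonneg (φ := fun z => (z - c) * h z) hst
    fun z hz => mul_nonneg (by linarith [hz.1]) (h0 z hz)
  rw [H.shifted] at this
  linarith

lemma cumMean_sub_le (H : HasMean h) (hst : s ≤ t) (hc : t ≤ c) (h0 : ∀ z ∈ Ioo s t, 0 ≤ h z) :
    cumMean h t - cumMean h s ≤ c * (cum h t - cum h s) := by
  have := interval_nonneg (φ := fun z => -((z - c) * h z)) hst
    fun z hz => by have := h0 z hz; nlinarith [hz.2]
  rw [intervalIntegral.integral_neg, H.shifted] at this
  linarith

lemma lt_cumMean_sub (H : HasMean h) (hst : s < t) (hc : c ≤ s) (h0 : ∀ z ∈ Ioo s t, 0 < h z) :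
    c * (cum h t - cum h s) < cumMean h t - cumMean h s := by
  have := intervalIntegral.intervalIntegral_pos_of_pos_on
    (H.shifted_integrable c).intervalIntegrable
    (fun z hz => mul_pos (by linarith [hz.1]) (h0 z hz)) hst
  rw [H.shifted] at this
  linarith

lemma cumMean_sub_lt (H : HasMean h) (hst : s < t) (hc : t ≤ c) (h0 : ∀ z ∈ Ioo s t, 0 < h z) :
    cumMean h t - cumMean h s < c * (cum h t - cum h s) := by
  have := intervalIntegral.intervalIntegral_pos_of_pos_on
    (H.shifted_integrable c).neg.intervalIntegrable
    (fun z hz => by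
      have : (z - c) * h z < 0 := mul_neg_of_neg_of_pos (by linarith [hz.2]) (h0 z hz)
      simpa using this) hst
  simp only [Pi.neg_apply] at this
  rw [intervalIntegral.integral_neg, H.shifted] at this
  linarith

end HasMean

lemma setIntegral_Iio_neg {h : ℝ → ℝ} (hi : Integrable h) (t : ℝ) :
    ∫ z in Iio (-t), h (-z) = (∫ z, h z) - ∫ z in Iio t, h z := by
  rw [← integral_Iic_eq_integral_Iio, integral_comp_neg_Iic, neg_neg, ← compl_Iic,
    setIntegral_compl measurableSet_Iic hi, integral_Iic_eq_integral_Iio]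

lemma integral_mul_of_symm {h : ℝ → ℝ} (hs : ∀ x, h (-x) = h x) : ∫ z, z * h z = 0 := by
  have := integral_neg_eq_self (fun z => z * h z) (volume : Measure ℝ)
  simp only [hs, neg_mul, integral_neg] at this
  linarith

lemma cum_neg {h : ℝ → ℝ} (H : HasMean h) (hs : ∀ x, h (-x) = h x) (t : ℝ) :
    cum h (-t) = (∫ z, h z) - cum h t := by
  have := setIntegral_Iio_neg H.1 t
  simp only [hs] at this
  exact this

lemma cumMean_neg {h : ℝ → ℝ} (H : HasMean h) (hs : ∀ x, h (-x) = h x) (t : ℝ) :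
    cumMean h (-t) = cumMean h t := by
  have := setIntegral_Iio_neg H.2 t
  simp only [hs, neg_mul, integral_neg] at this
  rw [integral_mul_of_symm hs] at this
  rw [cumMean, cumMean]
  linarith

namespace IsDispersed

variable {ρ η : ℝ → ℝ} {α β : EReal} {e : ℝ}

lemma hasMean_ρ (D : IsDispersed ρ η α β e) : HasMean ρ := ⟨D.integrable_ρ, D.integrable_mul_ρ⟩

lemma hasMean_η (D : IsDispersed ρ η α β e) : HasMean η := ⟨D.integrable_η, D.integrable_mul_η⟩

lemma hasMean_sub (D : IsDispersed ρ η α β e) : HasMean fun z => η z - ρ z :=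
  D.hasMean_η.sub D.hasMean_ρ

lemma symm_sub (D : IsDispersed ρ η α β e) (x : ℝ) : η (-x) - ρ (-x) = η x - ρ x := by
  rw [D.symm_ρ, D.symm_η]

lemma cum_sub (D : IsDispersed ρ η α β e) (t : ℝ) :
    cum (fun z => η z - ρ z) t = cum η t - cum ρ t :=
  D.hasMean_η.cum_fun_sub D.hasMean_ρ t

lemma cumMean_sub (D : IsDispersed ρ η α β e) (t : ℝ) :
    cumMean (fun z => η z - ρ z) t = cumMean η t - cumMean ρ t :=
  D.hasMean_η.cumMean_fun_sub D.hasMean_ρ t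

lemma cum_ρ_neg (D : IsDispersed ρ η α β e) (t : ℝ) : cum ρ (-t) = 1 - cum ρ t := by
  rw [cum_neg D.hasMean_ρ D.symm_ρ, D.integral_ρ]

lemma cum_η_neg (D : IsDispersed ρ η α β e) (t : ℝ) : cum η (-t) = 1 - cum η t := by
  rw [cum_neg D.hasMean_η D.symm_η, D.integral_η]

lemma cumMean_ρ_neg (D : IsDispersed ρ η α β e) (t : ℝ) : cumMean ρ (-t) = cumMean ρ t :=
  cumMean_neg D.hasMean_ρ D.symm_ρ t

lemma cumMean_η_neg (D : IsDispersed ρ η α β e) (t : ℝ) : cumMean η (-t) = cumMean η t :=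
  cumMean_neg D.hasMean_η D.symm_η t

lemma cum_zero (D : IsDispersed ρ η α β e) : cum ρ 0 = 1 / 2 ∧ cum η 0 = 1 / 2 := by
  have h1 := D.cum_ρ_neg 0
  have h2 := D.cum_η_neg 0
  rw [neg_zero] at h1 h2
  constructor <;> linarith

lemma cum_ρ_mono (D : IsDispersed ρ η α β e) : Monotone (cum ρ) := fun _ _ h =>
  D.hasMean_ρ.cum_le h fun z _ => D.nonneg_ρ z

lemma cum_η_mono (D : IsDispersed ρ η α β e) : Monotone (cum η) := fun _ _ h =>
  D.hasMean_η.cum_le h fun z _ => D.nonneg_η z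

lemma η_pos_of_mem (D : IsDispersed ρ η α β e) {s t : ℝ} (hs : s ∈ symIoo β) (ht : t ∈ symIoo β) :
    ∀ z ∈ Ioo s t, 0 < η z := fun z hz =>
  D.pos_η z (mem_symIoo_of_mem_Icc hs ht (Ioo_subset_Icc_self hz))

lemma e_mem_α (D : IsDispersed ρ η α β e) : e ∈ symIoo α :=
  (mem_symIoo_of_nonneg D.e_pos.le).2 D.e_lt

lemma ρ_pos_of_mem (D : IsDispersed ρ η α β e) {x : ℝ} (h : x ∈ Icc (-e) e) : 0 < ρ x :=
  D.pos_ρ x (mem_symIoo_of_mem_Icc (neg_mem_symIoo.2 D.e_mem_α) D.e_mem_α h)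

lemma sub_pos_of_mem (D : IsDispersed ρ η α β e) {s t : ℝ} (hs : e ≤ s) (ht : t ∈ symIoo β) :
    ∀ z ∈ Ioo s t, 0 < η z - ρ z := fun z hz => by
  have hz0 : 0 < z := D.e_pos.trans_le (hs.trans hz.1.le)
  refine sub_pos.2 (D.tails z (mem_symIoo_of_abs_le ht ?_) ?_)
  · rw [abs_of_pos hz0, abs_of_pos (hz0.trans hz.2)]; exact hz.2.le
  · rw [abs_of_pos hz0]; exact hs.trans_lt hz.1

lemma sub_center (D : IsDispersed ρ η α β e) {s t : ℝ} (hs : -e ≤ s) (ht : t ≤ e) :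
    ∀ z ∈ Ioo s t, 0 < ρ z - η z := fun z hz =>
  sub_pos.2 (D.center z ⟨hs.trans_lt hz.1, hz.2.trans_le ht⟩)

lemma mem_Icc_symIoo (D : IsDispersed ρ η α β e) {x : ℝ} (h : x ∈ Icc (-e) e) : x ∈ symIoo β :=
  mem_symIoo_of_mem_Icc (neg_mem_symIoo.2 D.e_mem) D.e_mem h

end IsDispersed

/-! ### Curtain couplings: uniqueness and monotonicity -/

/-- The pair `(f, g)` is a value at `x` of the functions of the right-curtain coupling. -/
structure IsCurtainPoint (ρ η : ℝ → ℝ) (β : EReal) (x f g : ℝ) : Prop where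
  f_mem : f ∈ symIoo β
  g_mem : g ∈ symIoo β
  f_lt : f < x
  lt_g : x < g
  mass : cum ρ x = cum η f + (cum ρ g - cum η g)
  mean : cumMean ρ x = cumMean η f + (cumMean ρ g - cumMean η g)

namespace IsCurtainPoint

variable {ρ η : ℝ → ℝ} {α β : EReal} {e x f g x' f' g' : ℝ}

/-- If g ≤ e, the defining identities equate η on (f, x) with ρ - η on (x, g) in mass and first
moment; both are positive, and they lie on opposite sides of x. -/
lemma e_lt (D : IsDispersed ρ η α β e) (P : IsCurtainPoint ρ η β x f g) (hx0 : -e ≤ x)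
    (hxe : x < e) : e < g := by
  by_contra hn
  rw [not_lt] at hn
  have hx : x ∈ symIoo β := D.mem_Icc_symIoo ⟨hx0, hxe.le⟩
  have h1 := D.hasMean_η.cumMean_sub_lt P.f_lt le_rfl (D.η_pos_of_mem P.f_mem hx)
  have K := D.hasMean_ρ.sub D.hasMean_η
  have h2 := K.lt_cumMean_sub P.lt_g le_rfl (D.sub_center hx0 hn)
  simp only [D.hasMean_ρ.cum_fun_sub D.hasMean_η, D.hasMean_ρ.cumMean_fun_sub D.hasMean_η] at h2
  have := P.mass
  have := P.mean
  nlinarith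

/-- Subtracting the two systems equates ρ on (x, x') plus η on (f', f) with η - ρ on (g', g). The
former lies at or below x' < e and the latter above g' > e, so equality of moments forces all of
them to vanish. -/
lemma eq_of_f_le (D : IsDispersed ρ η α β e) (P : IsCurtainPoint ρ η β x f g)
    (P' : IsCurtainPoint ρ η β x' f' g') (hx0 : -e ≤ x) (hxx : x ≤ x') (hx' : x' < e)
    (hff : f' ≤ f) : x = x' ∧ f = f' := by
  by_contra hne
  have heg' := P'.e_lt D (by linarith) hx'
  have hρ : ∀ z ∈ Ioo x x', 0 < ρ z := fun z hz =>
    D.ρ_pos_of_mem ⟨by linarith [hz.1], by linarith [hz.2]⟩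
  have hη := D.η_pos_of_mem P'.f_mem P.f_mem
  have m1 := D.hasMean_ρ.cum_le hxx fun z hz => (hρ z hz).le
  have m2 := D.hasMean_η.cum_le hff fun z hz => (hη z hz).le
  have n1 := D.hasMean_ρ.cumMean_sub_le hxx le_rfl fun z hz => (hρ z hz).le
  have hfx : f ≤ x' := P.f_lt.le.trans hxx
  have n2 := D.hasMean_η.cumMean_sub_le hff hfx fun z hz => (hη z hz).le
  have hpos : 0 < (cum ρ x' - cum ρ x) + (cum η f - cum η f') := by
    rcases hxx.lt_or_eq with h | h
    · have := D.hasMean_ρ.cum_lt h hρ; linarith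
    · rcases hff.lt_or_eq with h' | h'
      · have := D.hasMean_η.cum_lt h' hη; linarith
      · exact absurd ⟨h, h'.symm⟩ hne
  have e1 := P.mass
  have e2 := P'.mass
  have e3 := P.mean
  have e4 := P'.mean
  have K := D.hasMean_sub
  have hgg : g' < g := by
    by_contra hn
    rw [not_lt] at hn
    have heg := P.e_lt D (by linarith) (hxx.trans_lt hx')
    have := K.cum_le hn fun z hz => (D.sub_pos_of_mem heg.le P'.g_mem z hz).le
    rw [D.cum_sub, D.cum_sub] at this
    linarith
  have n3 := K.le_cumMean_sub hgg.le heg'.le fun z hz => (D.sub_pos_of_mem heg'.le P.g_mem z hz).le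
  rw [D.cum_sub, D.cum_sub, D.cumMean_sub, D.cumMean_sub] at n3
  rw [show cum η g - cum ρ g - (cum η g' - cum ρ g')
    = (cum ρ x' - cum ρ x) + (cum η f - cum η f') by linarith] at n3
  have := mul_lt_mul_of_pos_right hx' hpos
  linarith

/-- Subtracting the two systems equates η on (f, f') with ρ on (x, x') plus η - ρ on (g, g'), which
lie to the right of x. If f' ≤ x the sides are separated by x. Otherwise the part on (x, f') is
cancelled first, which leaves η on (f, x) against positive masses to the right of x. -/
lemma eq_of_g_le (D : IsDispersed ρ η α β e) (P : IsCurtainPoint ρ η β x f g)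
    (P' : IsCurtainPoint ρ η β x' f' g') (hx0 : -e ≤ x) (hxx : x ≤ x') (hx' : x' < e)
    (hgg : g ≤ g') : x = x' ∧ g = g' := by
  by_contra hne
  have heg := P.e_lt D (by linarith) (hxx.trans_lt hx')
  have hρ : ∀ z ∈ Ioo x x', 0 < ρ z := fun z hz =>
    D.ρ_pos_of_mem ⟨by linarith [hz.1], by linarith [hz.2]⟩
  have K := D.hasMean_sub
  have hk := D.sub_pos_of_mem heg.le P'.g_mem
  have m1 := D.hasMean_ρ.cum_le hxx fun z hz => (hρ z hz).le
  have m2 := K.cum_le hgg fun z hz => (hk z hz).le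
  have n1 := D.hasMean_ρ.le_cumMean_sub hxx le_rfl fun z hz => (hρ z hz).le
  have n2 := K.le_cumMean_sub hgg P.lt_g.le fun z hz => (hk z hz).le
  have hstrict : cum ρ x' - cum ρ x + (cum (fun z => η z - ρ z) g' - cum (fun z => η z - ρ z) g) > 0 ∧
      x * (cum ρ x' - cum ρ x + (cum (fun z => η z - ρ z) g' - cum (fun z => η z - ρ z) g)) <
      cumMean ρ x' - cumMean ρ x
        + (cumMean (fun z => η z - ρ z) g' - cumMean (fun z => η z - ρ z) g) := by
    rcases hxx.lt_or_eq with h | h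
    · have l1 := D.hasMean_ρ.cum_lt h hρ
      have l2 := D.hasMean_ρ.lt_cumMean_sub h le_rfl hρ
      constructor <;> linarith
    · rcases hgg.lt_or_eq with h' | h'
      · have l1 := K.cum_lt h' hk
        have l2 := K.lt_cumMean_sub h' P.lt_g.le hk
        constructor <;> linarith
      · exact absurd ⟨h, h'⟩ hne
  rw [D.cum_sub, D.cum_sub] at m2 n2
  rw [D.cumMean_sub, D.cumMean_sub] at n2
  simp only [D.cum_sub, D.cumMean_sub] at hstrict
  have e1 := P.mass
  have e2 := P'.mass
  have e3 := P.mean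
  have e4 := P'.mean
  have hff : f < f' := by
    by_contra hn
    have := D.cum_η_mono (not_lt.1 hn)
    linarith [hstrict.1]
  rcases le_or_gt f' x with h | h
  · have l1 := D.hasMean_η.cumMean_sub_le hff.le h fun z _ => D.nonneg_η z
    rw [show cum η f' - cum η f
      = cum ρ x' - cum ρ x + (cum η g' - cum ρ g' - (cum η g - cum ρ g)) by linarith] at l1
    linarith [hstrict.2]
  · have l1 := D.hasMean_η.cumMean_sub_le P.f_lt.le le_rfl fun z _ => D.nonneg_η z
    have L := D.hasMean_ρ.sub D.hasMean_η
    have l2 := L.lt_cumMean_sub h le_rfl (D.sub_center (by linarith) (P'.f_lt.trans hx').le)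
    simp only [D.hasMean_ρ.cum_fun_sub D.hasMean_η, D.hasMean_ρ.cumMean_fun_sub D.hasMean_η] at l2
    have l3 := D.hasMean_ρ.le_cumMean_sub P'.f_lt.le h.le fun z _ => D.nonneg_ρ z
    rw [show cum η x - cum η f = (cum ρ f' - cum η f' - (cum ρ x - cum η x))
      + (cum ρ x' - cum ρ f') + (cum η g' - cum ρ g' - (cum η g - cum ρ g)) by linarith] at l1
    linarith

lemma unique (D : IsDispersed ρ η α β e) (P : IsCurtainPoint ρ η β x f g)
    (P' : IsCurtainPoint ρ η β x f' g') (hx0 : -e ≤ x) (hx' : x < e) : f = f' ∧ g = g' := by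
  constructor
  · rcases le_total f' f with h | h
    · exact (P.eq_of_f_le D P' hx0 le_rfl hx' h).2
    · exact (P'.eq_of_f_le D P hx0 le_rfl hx' h).2.symm
  · rcases le_total g g' with h | h
    · exact (P.eq_of_g_le D P' hx0 le_rfl hx' h).2
    · exact (P'.eq_of_g_le D P hx0 le_rfl hx' h).2.symm

lemma lt_lt (D : IsDispersed ρ η α β e) (P : IsCurtainPoint ρ η β x f g)
    (P' : IsCurtainPoint ρ η β x' f' g') (hx0 : -e ≤ x) (hxx : x < x') (hx' : x' < e) :
    f < f' ∧ g' < g := by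
  constructor
  · by_contra hn
    exact hxx.ne (P.eq_of_f_le D P' hx0 hxx.le hx' (not_lt.1 hn)).1
  · by_contra hn
    exact hxx.ne (P.eq_of_g_le D P' hx0 hxx.le hx' (not_lt.1 hn)).1

end IsCurtainPoint

/-! ### Curtain couplings: existence -/

lemma HasMean.setIntegral_Ioo {h : ℝ → ℝ} (H : HasMean h) {s t : ℝ} (hst : s ≤ t) :
    ∫ z in Ioo s t, h z = cum h t - cum h s := by
  rw [H.cum_sub_cum, intervalIntegral.integral_of_le hst, integral_Ioc_eq_integral_Ioo]

lemma HasMean.setIntegral_Ioi {h : ℝ → ℝ} (H : HasMean h) (t : ℝ) :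
    ∫ z in Ioi t, h z = (∫ z, h z) - cum h t := by
  rw [cum, ← integral_Iic_eq_integral_Iio, ← compl_Iic, setIntegral_compl measurableSet_Iic H.1]

namespace IsDispersed

variable {ρ η : ℝ → ℝ} {α β : EReal} {e : ℝ}

lemma integral_sub_eq_zero (D : IsDispersed ρ η α β e) : ∫ z, (η z - ρ z) = 0 := by
  rw [integral_sub D.integrable_η D.integrable_ρ, D.integral_η, D.integral_ρ, sub_self]

lemma cum_sub_neg (D : IsDispersed ρ η α β e) (t : ℝ) :
    cum (fun z => η z - ρ z) (-t) = -cum (fun z => η z - ρ z) t := by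
  rw [cum_neg D.hasMean_sub D.symm_sub, D.integral_sub_eq_zero, zero_sub]

lemma cumMean_sub_neg (D : IsDispersed ρ η α β e) (t : ℝ) :
    cumMean (fun z => η z - ρ z) (-t) = cumMean (fun z => η z - ρ z) t :=
  cumMean_neg D.hasMean_sub D.symm_sub t

lemma cum_sub_zero (D : IsDispersed ρ η α β e) : cum (fun z => η z - ρ z) 0 = 0 := by
  have := D.cum_sub_neg 0
  rw [neg_zero] at this
  linarith

lemma cum_sub_anti (D : IsDispersed ρ η α β e) {s t : ℝ} (hs : -e ≤ s) (hst : s < t)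
    (ht : t ≤ e) : cum (fun z => η z - ρ z) t < cum (fun z => η z - ρ z) s := by
  have := (D.hasMean_ρ.sub D.hasMean_η).cum_lt hst (D.sub_center hs ht)
  rw [D.hasMean_ρ.cum_fun_sub D.hasMean_η, D.hasMean_ρ.cum_fun_sub D.hasMean_η] at this
  rw [D.cum_sub, D.cum_sub]
  linarith

lemma cum_sub_e_neg (D : IsDispersed ρ η α β e) : cum (fun z => η z - ρ z) e < 0 := by
  have := D.cum_sub_anti (s := 0) (by linarith [D.e_pos]) D.e_pos le_rfl
  rwa [D.cum_sub_zero] at this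

lemma setIntegral_symIoo_inter (D : IsDispersed ρ η α β e) {s : Set ℝ} (hs : MeasurableSet s)
    (φ : ℝ → ℝ) : ∫ z in symIoo β ∩ s, φ z * (η z - ρ z) = ∫ z in s, φ z * (η z - ρ z) := by
  refine (setIntegral_eq_of_subset_of_ae_sdiff_eq_zero hs.nullMeasurableSet inter_subset_right
    ?_).symm
  filter_upwards [D.ae_η_zero, D.ae_ρ_zero] with z h1 h2 hz
  have : z ∉ symIoo β := fun h => hz.2 ⟨h, hz.1⟩
  rw [h1 this, h2 this, sub_zero, mul_zero]

lemma setIntegral_excess (D : IsDispersed ρ η α β e) {y : ℝ} (hy : 0 ≤ y) :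
    ∫ z in symIoo β ∩ (Iio (-y) ∪ Ioi y), (η z - ρ z) = -(2 * cum (fun z => η z - ρ z) y) := by
  have hd : Disjoint (Iio (-y)) (Ioi y) := by
    rw [Set.disjoint_left]
    intro z h1 h2
    have h1' : z < -y := h1
    have h2' : y < z := h2
    linarith
  have h1 := D.setIntegral_symIoo_inter (s := Iio (-y) ∪ Ioi y)
    (measurableSet_Iio.union measurableSet_Ioi) (fun _ => 1)
  simp only [one_mul] at h1
  rw [h1, setIntegral_union hd measurableSet_Ioi D.hasMean_sub.1.integrableOn
      D.hasMean_sub.1.integrableOn, D.hasMean_sub.setIntegral_Ioi, D.integral_sub_eq_zero]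
  have := D.cum_sub_neg y
  rw [cum] at this
  rw [this]; ring

lemma excess_mem (D : IsDispersed ρ η α β e) {y : ℝ} (hy : e ≤ y) :
    ∀ z ∈ symIoo β ∩ (Iio (-y) ∪ Ioi y), 0 < η z - ρ z ∧ y < |z| ∧ ((|z| : ℝ) : EReal) < β := by
  rintro z ⟨hz, h⟩
  have : y < |z| := by
    rcases h with h | h
    · exact lt_abs.2 (Or.inr (by have h' : z < -y := h; linarith))
    · exact lt_abs.2 (Or.inl h)
  exact ⟨sub_pos.2 (D.tails z hz (hy.trans_lt this)), this, hz⟩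

lemma measurableSet_excess (y y' : ℝ) : MeasurableSet (symIoo β ∩ (Iio y ∪ Ioi y')) :=
  (measurableSet_symIoo β).inter (measurableSet_Iio.union measurableSet_Ioi)

lemma neg_mem_excess {y z : ℝ} : -z ∈ symIoo β ∩ (Iio (-y) ∪ Ioi y)
    ↔ z ∈ symIoo β ∩ (Iio (-y) ∪ Ioi y) := by
  simp only [mem_inter_iff, neg_mem_symIoo, mem_union, mem_Iio, mem_Ioi, neg_lt_neg_iff]
  rw [or_comm, lt_neg]

/-- The Hobson–Klimmek coupling of the whole surplus of `μ` over `ν` with the whole surplus of `ν`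
over `μ`. -/
lemma hkData_core (D : IsDispersed ρ η α β e) :
    HKData (chiThreeDegenerate ρ η e) (excessBeyond ρ η β e) e e β := by
  refine HKData.of_density (D.measurable_ρ.sub D.measurable_η) (D.measurable_η.sub D.measurable_ρ)
    (D.hasMean_ρ.sub D.hasMean_η).1 D.hasMean_sub.1 D.hasMean_sub.2 measurableSet_Ioo
    (measurableSet_excess _ _) (fun x hx => (sub_pos.2 (D.center x hx)).le)
    (fun y hy => (D.excess_mem le_rfl y hy).1.le) (fun x => by rw [D.symm_ρ, D.symm_η]) D.symm_sub
    (fun x => by simp only [mem_Ioo]; constructor <;> rintro ⟨h1, h2⟩ <;> constructor <;> linarith)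
    (fun y => neg_mem_excess) D.e_pos le_rfl subset_rfl
    (fun y hy => (D.excess_mem le_rfl y hy).2)
    ⟨0, D.e_pos, fun x hx => ?_⟩ (fun y h1 h2 => ?_) ?_
  · have : x ∈ Ioo (-e) e := ⟨by linarith [hx.1, D.e_pos], hx.2⟩
    exact ⟨this, sub_pos.2 (D.center x this)⟩
  · have : y ∈ symIoo β ∩ (Iio (-e) ∪ Ioi e) :=
      ⟨(mem_symIoo_of_nonneg (D.e_pos.trans h1).le).2 h2, Or.inr h1⟩
    exact ⟨this, (D.excess_mem le_rfl y this).1⟩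
  · rw [D.setIntegral_excess D.e_pos.le,
      (D.hasMean_ρ.sub D.hasMean_η).setIntegral_Ioo (by linarith [D.e_pos]),
      D.hasMean_ρ.cum_fun_sub D.hasMean_η, D.hasMean_ρ.cum_fun_sub D.hasMean_η, D.cum_sub,
      D.cum_ρ_neg, D.cum_η_neg]
    ring

/-- Below -e the density η - ρ is almost everywhere nonnegative, and it is positive just below t,
which makes the inequality strict. -/
lemma cumMean_lt_of_tail (D : IsDispersed ρ η α β e) {t : ℝ} (ht : t ≤ -e) (htβ : t ∈ symIoo β) :
    cumMean (fun z => η z - ρ z) t < t * cum (fun z => η z - ρ z) t := by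
  obtain ⟨y, hy, hyβ⟩ := exists_gt_mem_symIoo htβ
  have hyt : -y < t := by linarith [neg_abs_le t]
  have hae : ∀ᵐ z, z ∈ Iio (-y) → 0 ≤ η z - ρ z := by
    filter_upwards [D.ae_η_zero, D.ae_ρ_zero] with z h1 h2 hz
    have hz' : z < -y := hz
    by_cases hzβ : z ∈ symIoo β
    · exact (sub_pos.2 (D.tails z hzβ (lt_abs.2 (Or.inr (by linarith))))).le
    · rw [h1 hzβ, h2 hzβ, sub_zero]
  have h1 : 0 ≤ cum (fun z => η z - ρ z) (-y) :=
    setIntegral_nonneg_of_ae_restrict ((ae_restrict_iff' measurableSet_Iio).2 hae)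
  have h2 : 0 ≤ ∫ z in Iio (-y), -((z - t) * (η z - ρ z)) :=
    setIntegral_nonneg_of_ae_restrict ((ae_restrict_iff' measurableSet_Iio).2 <| by
      filter_upwards [hae] with z h hz
      have hz' : z < -y := hz
      have := h hz
      simp only [Pi.zero_apply]
      nlinarith)
  rw [integral_neg] at h2
  have h3 : ∫ z in Iio (-y), (z - t) * (η z - ρ z)
      = cumMean (fun z => η z - ρ z) (-y) - t * cum (fun z => η z - ρ z) (-y) := by
    rw [cumMean, cum, ← integral_const_mul, ← integral_sub D.hasMean_sub.2.integrableOn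
      (D.hasMean_sub.1.const_mul t).integrableOn]
    simp only [sub_mul]
  have h4 := D.hasMean_sub.cumMean_sub_lt hyt le_rfl fun z hz => by
    refine sub_pos.2 (D.tails z (mem_symIoo_of_mem_Icc (neg_mem_symIoo.2 hyβ) htβ
      (Ioo_subset_Icc_self hz)) (lt_abs.2 (Or.inr (by linarith [hz.2]))))
  linarith

lemma symIoo_α_subset (D : IsDispersed ρ η α β e) : symIoo α ⊆ symIoo β := by
  intro x hx
  by_contra hn
  obtain ⟨y, hy, hyα⟩ := exists_gt_mem_symIoo hx
  have hsub : Ioo |x| y ⊆ {z | ¬ (z ∉ symIoo β → ρ z = 0)} := by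
    intro z hz h0
    have hz0 : 0 < z := (abs_nonneg x).trans_lt hz.1
    have h1 : z ∉ symIoo β := fun h => hn (mem_symIoo_of_abs_le h (by
      rw [abs_of_pos hz0]; exact hz.1.le))
    refine (D.pos_ρ z (mem_symIoo_of_abs_le hyα ?_)).ne' (h0 h1)
    rw [abs_of_pos hz0, abs_of_pos (hz0.trans hz.2)]; exact hz.2.le
  have := measure_mono_null hsub D.ae_ρ_zero
  rw [Real.volume_Ioo, ENNReal.ofReal_eq_zero] at this
  linarith

lemma mem_symIoo_of_cum (D : IsDispersed ρ η α β e) {f : ℝ} (h0 : 0 < cum η f)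
    (h1 : cum η f < 1) : f ∈ symIoo β := by
  by_contra hn
  rcases le_total 0 f with hf | hf
  · refine h1.ne ?_
    rw [cum, ← D.integral_η]
    refine setIntegral_eq_integral_of_ae_compl_eq_zero ?_
    filter_upwards [D.ae_η_zero] with z hz hzf
    refine hz fun h => hn (mem_symIoo_of_abs_le h ?_)
    have : f ≤ z := not_lt.1 hzf
    rw [abs_of_nonneg hf, abs_of_nonneg (hf.trans this)]; exact this
  · refine h0.ne' ?_
    rw [cum]
    refine setIntegral_eq_zero_of_ae_eq_zero ?_
    filter_upwards [D.ae_η_zero] with z hz hzf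
    refine hz fun h => hn (mem_symIoo_of_abs_le h ?_)
    have : z < f := hzf
    rw [abs_of_nonpos hf, abs_of_nonpos (this.le.trans hf)]; linarith

lemma injOn_cum_η (D : IsDispersed ρ η α β e) : InjOn (cum η) (symIoo β) := by
  intro s hs t ht hst
  rcases lt_trichotomy s t with h | h | h
  · exact absurd hst (D.hasMean_η.cum_lt h (D.η_pos_of_mem hs ht)).ne
  · exact h
  · exact absurd hst (D.hasMean_η.cum_lt h (D.η_pos_of_mem ht hs)).ne'

end IsDispersed

/-! ### Existence of curtain points by an intermediate value argument. -/

namespace IsDispersed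

variable {ρ η : ℝ → ℝ} {α β : EReal} {e : ℝ}

lemma setIntegral_upper (D : IsDispersed ρ η α β e) {s : Set ℝ} (hs : MeasurableSet s)
    (φ : ℝ → ℝ) : ∫ y in s, φ y ∂((excessBeyond ρ η β e).restrict (Ioi 0))
      = ∫ y in s ∩ Ioi e, φ y * (η y - ρ y) := by
  rw [Measure.restrict_restrict hs, excessBeyond, setIntegral_densityOn
    (h := fun z => η z - ρ z) (D.measurable_η.sub D.measurable_ρ)
    (measurableSet_excess _ _) (fun y hy => (D.excess_mem le_rfl y hy).1.le)
    (hs.inter measurableSet_Ioi), ← D.setIntegral_symIoo_inter (hs.inter measurableSet_Ioi)]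
  congr 2
  have := D.e_pos
  ext z
  simp only [mem_inter_iff, mem_Ioi, mem_union, mem_Iio]
  constructor
  · rintro ⟨⟨h1, h2⟩, h3, h4 | h4⟩
    · linarith
    · exact ⟨h3, h1, h4⟩
  · rintro ⟨h1, h2, h3⟩
    exact ⟨⟨h2, by linarith⟩, h1, Or.inr h3⟩

lemma Iio_inter_Ioi (y : ℝ) : Iio y ∩ Ioi e = Ioo e y := by
  rw [inter_comm, Ioi_inter_Iio]

lemma real_upper (D : IsDispersed ρ η α β e) {y : ℝ} (hy : e ≤ y) :
    ((excessBeyond ρ η β e).restrict (Ioi 0)).real (Iio y)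
      = cum (fun z => η z - ρ z) y - cum (fun z => η z - ρ z) e := by
  have := D.setIntegral_upper (measurableSet_Iio (a := y)) (fun _ => 1)
  simp only [one_mul, setIntegral_const, smul_eq_mul, mul_one] at this
  rw [this, Iio_inter_Ioi, D.hasMean_sub.setIntegral_Ioo hy]

lemma real_upper_univ (D : IsDispersed ρ η α β e) :
    ((excessBeyond ρ η β e).restrict (Ioi 0)).real univ = -cum (fun z => η z - ρ z) e := by
  have := D.setIntegral_upper MeasurableSet.univ (fun _ => 1)
  simp only [one_mul, setIntegral_const, smul_eq_mul, mul_one] at this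
  rw [this, univ_inter, D.hasMean_sub.setIntegral_Ioi, D.integral_sub_eq_zero, zero_sub]

lemma mean_upper (D : IsDispersed ρ η α β e) {y : ℝ} (hy : e ≤ y) :
    ∫ z in Iio y, z ∂((excessBeyond ρ η β e).restrict (Ioi 0))
      = cumMean (fun z => η z - ρ z) y - cumMean (fun z => η z - ρ z) e := by
  rw [D.setIntegral_upper measurableSet_Iio (fun z => z), Iio_inter_Ioi,
    D.hasMean_sub.cumMean_sub_cumMean, intervalIntegral.integral_of_le hy,
    integral_Ioc_eq_integral_Ioo]

lemma mean_upper_univ (D : IsDispersed ρ η α β e) :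
    ∫ z, z ∂((excessBeyond ρ η β e).restrict (Ioi 0)) = -cumMean (fun z => η z - ρ z) e := by
  rw [← setIntegral_univ, D.setIntegral_upper MeasurableSet.univ (fun z => z), univ_inter, cumMean,
    ← compl_Iic, setIntegral_compl measurableSet_Iic D.hasMean_sub.2,
    integral_Iic_eq_integral_Iio, integral_mul_of_symm (h := fun z => η z - ρ z) D.symm_sub,
    zero_sub]

/-- The cumulative surplus of ν over μ decreases on [-e, 0] to its value 0 at the origin. Further
left it is, by reflection, the surplus above a point beyond e. -/
lemma cum_sub_nonneg (D : IsDispersed ρ η α β e) {x : ℝ} (hx0 : x ≤ 0) :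
    0 ≤ cum (fun z => η z - ρ z) x := by
  have he := D.e_pos
  rcases le_or_gt (-e) x with h | h
  · rcases hx0.lt_or_eq with h0 | h0
    · have := D.cum_sub_anti h h0 he.le
      rw [D.cum_sub_zero] at this
      exact this.le
    · rw [h0, D.cum_sub_zero]
  · rw [← neg_neg x, D.cum_sub_neg, neg_nonneg, ← neg_neg (-x), neg_neg]
    have h1 : cum (fun z => η z - ρ z) (-x) ≤ 0 := by
      have := (hkData_core D).finite_ξ
      have h2 : ((excessBeyond ρ η β e).restrict (Ioi 0)).real (Iio (-x))
        ≤ ((excessBeyond ρ η β e).restrict (Ioi 0)).real univ := measureReal_mono (subset_univ _)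
      rw [D.real_upper (by linarith), D.real_upper_univ] at h2
      linarith
    exact h1

/-- This is the extreme choice g = e in the curtain equations: the target uses the whole surplus
beyond e, and its first moment is too large. After cancellation, η on (f, x) and ρ - η on (x, e)
have the same net mass, and the latter has the larger moment. -/
lemma first_moment_below (D : IsDispersed ρ η α β e) {x f : ℝ} (hx : x ∈ symIoo β) (hxe : x < e)
    (hf : cum η f = cum ρ x + cum (fun z => η z - ρ z) e) :
    cumMean ρ x + cumMean (fun z => η z - ρ z) e < cumMean η f := by
  have he := D.e_pos
  have L := D.hasMean_ρ.sub D.hasMean_η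
  have hL := D.hasMean_ρ.cum_fun_sub D.hasMean_η
  have hL1 := D.hasMean_ρ.cumMean_fun_sub D.hasMean_η
  rw [D.cum_sub] at hf
  rw [D.cumMean_sub]
  have h1 : cumMean η x - cumMean η f ≤ x * (cum η x - cum η f) := by
    rcases le_total f x with h | h
    · exact D.hasMean_η.cumMean_sub_le h le_rfl fun z _ => D.nonneg_η z
    · have := D.hasMean_η.le_cumMean_sub h le_rfl fun z _ => D.nonneg_η z
      linarith
  have h2 : x * ((cum ρ e - cum η e) - (cum ρ x - cum η x))
      < (cumMean ρ e - cumMean η e) - (cumMean ρ x - cumMean η x) := by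
    rcases le_or_gt (-e) x with h | h
    · have := L.lt_cumMean_sub hxe le_rfl (D.sub_center h le_rfl)
      simpa only [hL, hL1] using this
    · have K := D.hasMean_sub
      -- For x < -e the density ρ - η on (-e, e) has first moment zero by symmetry, so only the
      -- surplus of η on (x, -e), which lies to the left of -e, contributes.
      have k1 := K.cumMean_sub_le (s := x) (t := -e) h.le le_rfl fun z hz =>
        (sub_pos.2 (D.tails z (mem_symIoo_of_mem_Icc hx (neg_mem_symIoo.2 D.e_mem)
          (Ioo_subset_Icc_self hz)) (lt_abs.2 (Or.inr (by linarith [hz.2]))))).le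
      have k2 := D.cumMean_sub_neg e
      have k3 := D.cum_sub_neg e
      have k4 := D.cum_sub_e_neg
      have k5 := D.cum_sub_nonneg (x := x) (by linarith)
      simp only [D.cum_sub, D.cumMean_sub] at k1 k2 k3 k4 k5
      nlinarith
  have e1 : cum η x - cum η f = (cum ρ e - cum η e) - (cum ρ x - cum η x) := by linarith
  rw [e1] at h1
  linarith

/-- This is the opposite extreme, with no surplus used: the whole source goes to ν below f and the
first moment is too small. Here f ≤ x because ν has at least the mass of μ below x. -/
lemma first_moment_above (D : IsDispersed ρ η α β e) {x f : ℝ} (hx : x ∈ symIoo β) (hx0 : x ≤ 0)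
    (hfβ : f ∈ symIoo β) (hf : cum η f = cum ρ x) : cumMean η f < cumMean ρ x := by
  have he := D.e_pos
  have hfx : f ≤ x := by
    by_contra hn
    rw [not_le] at hn
    have h1 := D.hasMean_η.cum_lt hn (D.η_pos_of_mem hx hfβ)
    have h2 := D.cum_sub_nonneg hx0
    rw [D.cum_sub] at h2
    linarith
  have h1 := D.hasMean_ρ.le_cumMean_sub hfx le_rfl fun z _ => D.nonneg_ρ z
  have h2 : cumMean (fun z => η z - ρ z) f < f * cum (fun z => η z - ρ z) f := by
    rcases le_or_gt f (-e) with h | h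
    · exact D.cumMean_lt_of_tail h hfβ
    · have t1 := D.cumMean_lt_of_tail le_rfl (neg_mem_symIoo.2 D.e_mem)
      have L := D.hasMean_ρ.sub D.hasMean_η
      have t2 := L.le_cumMean_sub h.le le_rfl fun z hz =>
        (D.sub_center le_rfl (hfx.trans (hx0.trans he.le)) z hz).le
      have t3 := D.cum_sub_nonneg (hfx.trans hx0)
      simp only [D.hasMean_ρ.cum_fun_sub D.hasMean_η, D.hasMean_ρ.cumMean_fun_sub D.hasMean_η,
        D.cum_sub, D.cumMean_sub] at t1 t2 t3 ⊢
      nlinarith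
  rw [D.cum_sub, D.cumMean_sub] at h2
  nlinarith

/-- The unknown is v, the mass of ν below f. The mass equation then determines g by a quantile of
the surplus beyond e, and the first moment is matched by choosing v. -/
lemma exists_isCurtainPoint (D : IsDispersed ρ η α β e) {x : ℝ} (hxα : x ∈ symIoo α)
    (hxe : x < e) : ∃ f g, IsCurtainPoint ρ η β x f g := by
  have he := D.e_pos
  have hx := D.symIoo_α_subset hxα
  have C := D.hkData_core
  have := C.finite_ξ
  have := C.null_ξ
  have := D.prob_η
  set m := (excessBeyond ρ η β e).restrict (Ioi 0) with hm
  have nη : NullSingletonClass (law η) := by rw [law_eq_densityOn]; infer_instance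
  have hF : ∀ f, (law η).real (Iio f) = cum η f := fun f =>
    real_law D.measurable_η D.nonneg_η measurableSet_Iio
  obtain ⟨V, hV, hVs⟩ := exists_lowerMean (m := law η) D.ae_η
    (by simpa only [hF] using D.injOn_cum_η) D.order.integrable_right
  obtain ⟨W, hW, hWs⟩ := exists_lowerMean (m := m) C.carrier_restrict C.injOn
    C.integrable_ξ.restrict
  have hV' : ∀ f, V (cum η f) = cumMean η f := by
    intro f
    rw [← hF, hVs _ (isLowerSet_Iio f), law_eq_densityOn, setIntegral_densityOn D.measurable_η
      MeasurableSet.univ (fun z _ => D.nonneg_η z) measurableSet_Iio, inter_univ, cumMean]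
  have hV0 : V 0 = 0 := by simpa using hVs ∅ isLowerSet_empty
  have hW0 : W 0 = 0 := by simpa using hWs ∅ isLowerSet_empty
  have hWT : W (m.real univ) = -cumMean (fun z => η z - ρ z) e := by
    rw [hWs univ isLowerSet_univ, setIntegral_univ, D.mean_upper_univ]
  have hWy : ∀ y, e ≤ y → W (cum (fun z => η z - ρ z) y - cum (fun z => η z - ρ z) e)
      = cumMean (fun z => η z - ρ z) y - cumMean (fun z => η z - ρ z) e := by
    intro y hy
    rw [← D.real_upper hy, hWs _ (isLowerSet_Iio y), D.mean_upper hy]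
  set MR := m.real univ with hMR
  have hMRe : MR = -cum (fun z => η z - ρ z) e := D.real_upper_univ
  have hMR0 : 0 < MR := by linarith [D.cum_sub_e_neg]
  set u := cum ρ x with hu
  obtain ⟨y, hxy, hyα⟩ := exists_gt_mem_symIoo hxα
  have hρpos : ∀ {s t : ℝ}, s ∈ symIoo α → t ∈ symIoo α → ∀ z ∈ Ioo s t, 0 < ρ z :=
    fun hs ht z hz => D.pos_ρ z (mem_symIoo_of_mem_Icc hs ht (Ioo_subset_Icc_self hz))
  have hyx : -y < x := by linarith [neg_abs_le x]
  have hu0 : 0 < u ∧ cumMean ρ x ≤ x * u := by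
    have h1 := D.hasMean_ρ.cum_lt hyx (hρpos (neg_mem_symIoo.2 hyα) hxα)
    have h2 : 0 ≤ cum ρ (-y) := setIntegral_nonneg measurableSet_Iio fun z _ => D.nonneg_ρ z
    have h3 : 0 ≤ ∫ z in Iio x, -((z - x) * ρ z) :=
      setIntegral_nonneg measurableSet_Iio fun z hz => by
        have hz' : z < x := hz
        have := D.nonneg_ρ z
        nlinarith
    have h4 : ∫ z in Iio x, -((z - x) * ρ z) = x * cum ρ x - cumMean ρ x := by
      rw [cumMean, cum, ← integral_const_mul, ← integral_sub
        (D.integrable_ρ.const_mul x).integrableOn D.integrable_mul_ρ.integrableOn]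
      refine integral_congr_ae (ae_of_all _ fun z => ?_)
      simp only; ring
    exact ⟨by linarith, by linarith⟩
  have hu1 : u < 1 := by
    have h1 := D.hasMean_ρ.cum_lt (show x < y by linarith [le_abs_self x]) (hρpos hxα hyα)
    have h2 : cum ρ y ≤ 1 := by
      rw [← D.integral_ρ]
      exact setIntegral_le_integral D.integrable_ρ (ae_of_all _ D.nonneg_ρ)
    linarith
  -- Source moment minus target moment: the surplus above g has mass u - v, hence mass v + MR - u
  -- lies between e and g.
  set H : ℝ → ℝ := fun v => cumMean ρ x - V v + W (v + MR - u)
    + cumMean (fun z => η z - ρ z) e with hH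
  have hHc : Continuous H := by fun_prop
  -- The lower end is v = 0, where ν contributes nothing, or v = u - MR, where the surplus is used
  -- up and g = e.
  have hlow : H (max 0 (u - MR)) < 0 := by
    rcases le_total u MR with h | h
    · rw [max_eq_left (by linarith)]
      have h1 := lowerMean_sub_ge hWs C.integrable_ξ.restrict
        (C.carrier_restrict.mono fun y hy => hy.1.le) (θ := MR - u) (θ' := MR) (by linarith)
        (by linarith [hu0.1]) le_rfl
      have h2 : x * u < e * u := mul_lt_mul_of_pos_right hxe hu0.1
      simp only [hH, hV0, zero_add]
      linarith [hu0.2]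
    · rw [max_eq_right (by linarith)]
      have e0 : u - MR + MR - u = 0 := by ring
      simp only [hH, e0, hW0]
      rcases h.lt_or_eq with h' | h'
      · obtain ⟨f, hf⟩ := exists_real_Iio_eq (m := law η) (θ := u - MR) (by linarith)
          (by rw [probReal_univ]; linarith)
        rw [hF] at hf
        rw [← hf, hV']
        have := D.first_moment_below hx hxe (f := f) (by rw [hf, hMRe]; ring)
        linarith
      · rw [h', sub_self, hV0]
        have h2 : x * u < e * u := mul_lt_mul_of_pos_right hxe hu0.1
        have h1 := lowerMean_sub_ge hWs C.integrable_ξ.restrict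
          (C.carrier_restrict.mono fun y hy => hy.1.le) (θ := 0) (θ' := MR) le_rfl hMR0.le le_rfl
        have h3 : e * MR = e * u := by rw [h']
        rw [hW0] at h1
        linarith [hu0.2]
  -- The upper end is v = u, where no surplus is used, for x ≤ 0. For x > 0 it is v = cum η x, where
  -- f = x; then η - ρ on (e, g) and ρ - η on (x, e) have equal mass, and the former has the larger
  -- first moment.
  have hup : max 0 (u - MR) < min u (cum η x) ∧ 0 < H (min u (cum η x)) := by
    have hlo : max 0 (u - MR) < u := max_lt hu0.1 (by linarith)
    rcases le_or_gt x 0 with h0 | h0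
    · have h1 := D.cum_sub_nonneg h0
      rw [D.cum_sub] at h1
      rw [min_eq_left (by linarith)]
      refine ⟨hlo, ?_⟩
      obtain ⟨f, hf⟩ := exists_real_Iio_eq (m := law η) (θ := u) hu0.1
        (by rw [probReal_univ]; linarith)
      rw [hF] at hf
      have e0 : u + MR - u = MR := by ring
      simp only [hH, e0, hWT]
      have h2 := D.first_moment_above hx h0 (D.mem_symIoo_of_cum (by linarith) (by linarith)) hf
      rw [← hf, hV']
      linarith
    · have h1 := D.cum_sub_anti (by linarith) h0 hxe.le
      rw [D.cum_sub_zero] at h1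
      have h2 := D.cum_sub_anti (by linarith) hxe le_rfl
      have hk := D.cum_sub x
      have hηx : 0 < cum η x := by
        have := D.cum_η_mono h0.le
        rw [D.cum_zero.2] at this
        linarith
      rw [min_eq_right (by linarith)]
      refine ⟨max_lt hηx (by linarith), ?_⟩
      obtain ⟨g, hg⟩ := exists_real_Iio_eq (m := m) (θ := cum η x + MR - u) (by linarith)
        (by linarith)
      obtain ⟨hge, hgβ⟩ := C.mem_of_real_Iio (y := g) (by rw [← hm, hg]; linarith)
        (by rw [← hm, hg]; linarith)
      rw [D.real_upper hge.le] at hg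
      simp only [hH]
      rw [hV', ← hg, hWy g hge.le]
      have hgm : g ∈ symIoo β := (mem_symIoo_of_nonneg (he.trans hge).le).2 hgβ
      have t1 := D.hasMean_sub.lt_cumMean_sub hge le_rfl (D.sub_pos_of_mem le_rfl hgm)
      have L := D.hasMean_ρ.sub D.hasMean_η
      have t2 := L.cumMean_sub_lt hxe le_rfl (D.sub_center (by linarith) le_rfl)
      simp only [D.hasMean_ρ.cum_fun_sub D.hasMean_η, D.hasMean_ρ.cumMean_fun_sub D.hasMean_η,
        D.cum_sub, D.cumMean_sub] at t1 t2 hg hMRe ⊢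
      have e1 : cum η g - cum ρ g - (cum η e - cum ρ e)
        = cum ρ e - cum η e - (cum ρ x - cum η x) := by linarith
      rw [e1] at t1
      linarith
  obtain ⟨v, ⟨hv1, hv2⟩, hv⟩ := intermediate_value_Ioo hup.1.le hHc.continuousOn ⟨hlow, hup.2⟩
  have hv0 : 0 < v := (le_max_left _ _).trans_lt hv1
  have hv0' : u - MR < v := (le_max_right _ _).trans_lt hv1
  have hvu : v < u := hv2.trans_le (min_le_left _ _)
  have hvη : v < cum η x := hv2.trans_le (min_le_right _ _)
  obtain ⟨f, hf⟩ := exists_real_Iio_eq (m := law η) hv0 (by rw [probReal_univ]; linarith)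
  rw [hF] at hf
  obtain ⟨g, hg⟩ := exists_real_Iio_eq (m := m) (θ := v + MR - u) (by linarith) (by linarith)
  obtain ⟨hge, hgβ⟩ := C.mem_of_real_Iio (y := g) (by rw [← hm, hg]; linarith)
    (by rw [← hm, hg]; linarith)
  rw [D.real_upper hge.le] at hg
  simp only [hH] at hv
  rw [← hf, hV', hf, ← hg, hWy g hge.le, D.cumMean_sub, D.cumMean_sub] at hv
  simp only [D.cum_sub] at hg hMRe
  refine ⟨f, g, D.mem_symIoo_of_cum (by linarith) (by linarith),
    (mem_symIoo_of_nonneg (he.trans hge).le).2 hgβ, ?_, hxe.trans hge, by linarith, by linarith⟩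
  by_contra hn
  have := D.cum_η_mono (not_lt.1 hn)
  linarith

end IsDispersed

/-! ### Curtain couplings: regularity -/

section curtain

variable {ρ η : ℝ → ℝ} {α β : EReal} {e : ℝ}

lemma isOpen_symIoo (r : EReal) : IsOpen (symIoo r) :=
  isOpen_Iio.preimage (continuous_coe_real_ereal.comp continuous_abs)

lemma HasMean.continuous_cum {h : ℝ → ℝ} (H : HasMean h) : Continuous (cum h) := by
  have : cum h = fun t => (∫ z in (0 : ℝ)..t, h z) + cum h 0 := by
    ext t; rw [← H.cum_sub_cum]; ring
  rw [this]
  exact (intervalIntegral.continuous_primitive (fun _ _ => H.1.intervalIntegrable) 0).add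
    continuous_const

lemma isCurtainPoint_iff (D : IsDispersed ρ η α β e) {x f g : ℝ} :
    IsCurtainPoint ρ η β x f g ↔ f ∈ symIoo β ∧ g ∈ symIoo β ∧ f < x ∧ x < g ∧
      (∫ z in x..g, ρ z = ∫ z in f..g, η z) ∧ (∫ z in x..g, z * ρ z = ∫ z in f..g, z * η z) := by
  rw [← D.hasMean_ρ.cum_sub_cum, ← D.hasMean_η.cum_sub_cum, ← D.hasMean_ρ.cumMean_sub_cumMean,
    ← D.hasMean_η.cumMean_sub_cumMean]
  constructor
  · rintro ⟨h1, h2, h3, h4, h5, h6⟩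
    exact ⟨h1, h2, h3, h4, by linarith, by linarith⟩
  · rintro ⟨h1, h2, h3, h4, h5, h6⟩
    exact ⟨h1, h2, h3, h4, by linarith, by linarith⟩

lemma isRightCurtain_iff (D : IsDispersed ρ η α β e) {f g : ℝ → ℝ} :
    IsRightCurtain ρ η α β e f g ↔
      ∀ x ∈ symIoo α, x < e → IsCurtainPoint ρ η β x (f x) (g x) := by
  simp only [IsRightCurtain, isCurtainPoint_iff D]

/-- Reflection sends (x, f, g) to (-x, -g, -f) and, by symmetry of the laws, turns the left curtain
into the right one; only the latter is studied. -/
lemma isLeftCurtain_iff (D : IsDispersed ρ η α β e) {f g : ℝ → ℝ} :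
    IsLeftCurtain ρ η α β e f g ↔
      ∀ x ∈ symIoo α, -e < x → IsCurtainPoint ρ η β (-x) (-g x) (-f x) := by
  refine forall_congr' fun x => imp_congr_right fun _ => imp_congr_right fun _ => ?_
  rw [← D.hasMean_ρ.cum_sub_cum, ← D.hasMean_η.cum_sub_cum, ← D.hasMean_ρ.cumMean_sub_cumMean,
    ← D.hasMean_η.cumMean_sub_cumMean]
  have e1 := D.cum_ρ_neg x
  have e2 := D.cum_ρ_neg (f x)
  have e3 := D.cum_η_neg (f x)
  have e4 := D.cum_η_neg (g x)
  have e5 := D.cumMean_ρ_neg x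
  have e6 := D.cumMean_ρ_neg (f x)
  have e7 := D.cumMean_η_neg (f x)
  have e8 := D.cumMean_η_neg (g x)
  constructor
  · rintro ⟨h1, h2, h3, h4, h5, h6⟩
    exact ⟨neg_mem_symIoo.2 h2, neg_mem_symIoo.2 h1, by linarith, by linarith, by linarith,
      by linarith⟩
  · rintro ⟨h1, h2, h3, h4, h5, h6⟩
    exact ⟨neg_mem_symIoo.1 h2, neg_mem_symIoo.1 h1, by linarith, by linarith, by linarith,
      by linarith⟩

lemma mem_α_of_mem_Ioo (D : IsDispersed ρ η α β e) {x : ℝ} (hx : x ∈ Ioo (-e) e) :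
    x ∈ symIoo α :=
  mem_symIoo_of_mem_Icc (neg_mem_symIoo.2 D.e_mem_α) D.e_mem_α (Ioo_subset_Icc_self hx)

/-- The right-curtain coupling on `(-e, e)`. -/
def IsCentralCurtain (ρ η : ℝ → ℝ) (β : EReal) (e : ℝ) (f g : ℝ → ℝ) : Prop :=
  ∀ x ∈ Ioo (-e) e, IsCurtainPoint ρ η β x (f x) (g x)

lemma IsCurtainData.central (D : IsDispersed ρ η α β e) {fR gR fL gL : ℝ → ℝ} {x₀ : ℝ}
    (h : IsCurtainData ρ η α β e fR gR fL gL x₀) : IsCentralCurtain ρ η β e fR gR := fun x hx =>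
  (isRightCurtain_iff D).1 h.right x (mem_α_of_mem_Ioo D hx) hx.2

/-- The given left and right functions are unrelated a priori; uniqueness of curtain points makes
them mirror images of each other on the central interval. -/
lemma IsCurtainData.left_eq (D : IsDispersed ρ η α β e) {fR gR fL gL : ℝ → ℝ} {x₀ : ℝ}
    (h : IsCurtainData ρ η α β e fR gR fL gL x₀) {x : ℝ} (hx : x ∈ Ioo (-e) e) :
    fL (-x) = -gR x ∧ gL (-x) = -fR x := by
  have hx' : -x ∈ Ioo (-e) e := ⟨by linarith [hx.2], by linarith [hx.1]⟩
  have h1 := (isLeftCurtain_iff D).1 h.left (-x) (mem_α_of_mem_Ioo D hx') hx'.1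
  rw [neg_neg] at h1
  obtain ⟨h2, h3⟩ := h1.unique D (h.central D x hx) hx.1.le hx.2
  constructor <;> linarith

namespace IsCentralCurtain

variable {f g : ℝ → ℝ}

lemma strictMonoOn (D : IsDispersed ρ η α β e) (h : IsCentralCurtain ρ η β e f g) :
    StrictMonoOn f (Ioo (-e) e) := fun x hx y hy hxy =>
  ((h x hx).lt_lt D (h y hy) hx.1.le hxy hy.2).1

lemma strictAntiOn (D : IsDispersed ρ η α β e) (h : IsCentralCurtain ρ η β e f g) :
    StrictAntiOn g (Ioo (-e) e) := fun x hx y hy hxy =>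
  ((h x hx).lt_lt D (h y hy) hx.1.le hxy hy.2).2

lemma e_lt (D : IsDispersed ρ η α β e) (h : IsCentralCurtain ρ η β e f g) {x : ℝ}
    (hx : x ∈ Ioo (-e) e) : e < g x := (h x hx).e_lt D hx.1.le hx.2

lemma increments (D : IsDispersed ρ η α β e) (h : IsCentralCurtain ρ η β e f g) {x y : ℝ}
    (hx : x ∈ Ioo (-e) e) (hy : y ∈ Ioo (-e) e) (hxy : x ≤ y) :
    cum η (f x) ≤ cum η (f y) ∧
      cum (fun z => η z - ρ z) (g y) ≤ cum (fun z => η z - ρ z) (g x) := by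
  refine ⟨D.cum_η_mono ((h.strictMonoOn D).monotoneOn hx hy hxy), ?_⟩
  exact D.hasMean_sub.cum_le ((h.strictAntiOn D).antitoneOn hx hy hxy) fun z hz =>
    (D.sub_pos_of_mem (h.e_lt D hy).le (h x hx).g_mem z hz).le

/-- The mass equation splits increments of `cum ρ` into those of `cum η` at f and of the surplus at
g, both of one sign. Thus `cum η` at f is continuous, and so is f. -/
lemma continuousOn_f (D : IsDispersed ρ η α β e) (h : IsCentralCurtain ρ η β e f g) :
    ContinuousOn f (Ioo (-e) e) := by
  refine continuousOn_of_strictMonoOn_comp (F := cum η) (isOpen_symIoo β)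
    (fun _ hs _ ht hst => D.hasMean_η.cum_lt hst (D.η_pos_of_mem hs ht)) (fun x hx => (h x hx).f_mem)
    (continuousOn_of_increments_le D.hasMean_ρ.continuous_cum.continuousOn fun x hx y hy hxy => ?_)
  have h1 := h.increments D hx hy hxy
  have h2 := (h x hx).mass
  have h3 := (h y hy).mass
  rw [D.cum_sub, D.cum_sub] at h1
  rw [abs_of_nonneg (by linarith [h1.1]), abs_of_nonneg (by linarith [D.cum_ρ_mono hxy])]
  linarith [h1.2]

lemma strictMonoOn_cum_sub (D : IsDispersed ρ η α β e) :
    StrictMonoOn (cum fun z => η z - ρ z) (Ioi e ∩ symIoo β) := fun _ hs _ ht hst =>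
  D.hasMean_sub.cum_lt hst (D.sub_pos_of_mem (le_of_lt hs.1) ht.2)

lemma continuousOn_g (D : IsDispersed ρ η α β e) (h : IsCentralCurtain ρ η β e f g) :
    ContinuousOn g (Ioo (-e) e) := by
  refine continuousOn_of_strictMonoOn_comp (F := cum fun z => η z - ρ z)
    (isOpen_Ioi.inter (isOpen_symIoo β)) (strictMonoOn_cum_sub D)
    (fun x hx => ⟨h.e_lt D hx, (h x hx).g_mem⟩)
    (continuousOn_of_increments_le D.hasMean_ρ.continuous_cum.continuousOn fun x hx y hy hxy => ?_)
  have h1 := h.increments D hx hy hxy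
  have h2 := (h x hx).mass
  have h3 := (h y hy).mass
  rw [D.cum_sub, D.cum_sub] at h1
  rw [D.cum_sub, D.cum_sub, abs_of_nonpos (by linarith [h1.2]),
    abs_of_nonneg (by linarith [D.cum_ρ_mono hxy])]
  linarith [h1.1]

lemma eventually_mem (D : IsDispersed ρ η α β e) : ∀ᶠ x in nhdsWithin e (Iio e), x ∈ Ioo (-e) e :=
  Ioo_mem_nhdsLT (by linarith [D.e_pos])

/-- Let k be the cumulative surplus of ν over μ. Since g x > e, the mass equation gives cum η (f x)
≥ cum η x - (k x - k e), which tends to cum η e as x tends to e. -/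
lemma eventually_lt_f (D : IsDispersed ρ η α β e) (h : IsCentralCurtain ρ η β e f g) {c : ℝ}
    (hc : c < e) : ∀ᶠ x in nhdsWithin e (Iio e), c < f x := by
  set c' := max c (-e) with hc'
  have he := D.e_pos
  have hc'e : c' < e := max_lt hc (by linarith)
  have h0 : cum η c' < cum η e :=
    D.hasMean_η.cum_lt hc'e (D.η_pos_of_mem
      (D.mem_Icc_symIoo ⟨le_max_right _ _, hc'e.le⟩) D.e_mem)
  have hcont : Continuous fun x => cum η x - (cum (fun z => η z - ρ z) x
      - cum (fun z => η z - ρ z) e) :=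
    D.hasMean_η.continuous_cum.sub (D.hasMean_sub.continuous_cum.sub continuous_const)
  have := (hcont.tendsto e).eventually (lt_mem_nhds (a := cum η c') (by simpa using h0))
  filter_upwards [nhdsWithin_le_nhds this, eventually_mem D] with x h1 hx
  have h2 := (h x hx).mass
  have h3 := D.hasMean_sub.cum_le (h.e_lt D hx).le
    fun z hz => (D.sub_pos_of_mem le_rfl (h x hx).g_mem z hz).le
  simp only [D.cum_sub] at h1 h3
  by_contra hn
  have := D.cum_η_mono ((not_lt.1 hn).trans (le_max_left c (-e)))
  rw [← hc'] at this
  linarith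

/-- Since f x < x, the mass equation bounds the cumulative surplus at g x by the one at x, which
tends to its value at e; beyond e the cumulative surplus is strictly increasing. -/
lemma eventually_g_lt (D : IsDispersed ρ η α β e) (h : IsCentralCurtain ρ η β e f g) {c : ℝ}
    (hc : e < c) : ∀ᶠ x in nhdsWithin e (Iio e), g x < c := by
  obtain ⟨y, hy, hyβ⟩ := exists_gt_mem_symIoo D.e_mem
  have he := D.e_pos
  rw [abs_of_pos he] at hy
  set c' := min c y with hc'
  have hec' : e < c' := lt_min hc hy
  have hc'β : c' ∈ symIoo β := mem_symIoo_of_mem_Icc D.e_mem hyβ ⟨hec'.le, min_le_right _ _⟩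
  have h0 := D.hasMean_sub.cum_lt hec' (D.sub_pos_of_mem le_rfl hc'β)
  have := (D.hasMean_sub.continuous_cum.tendsto e).eventually (gt_mem_nhds h0)
  filter_upwards [nhdsWithin_le_nhds this, eventually_mem D] with x h1 hx
  have h2 := (h x hx).mass
  have h3 := D.cum_η_mono (h x hx).f_lt.le
  by_contra hn
  have h4 : c' ≤ g x := (min_le_left _ _).trans (not_lt.1 hn)
  have h5 := D.hasMean_sub.cum_le h4
    fun z hz => (D.sub_pos_of_mem hec'.le (h x hx).g_mem z hz).le
  simp only [D.cum_sub] at h1 h5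
  linarith

lemma exists_f_eq (D : IsDispersed ρ η α β e) (h : IsCentralCurtain ρ η β e f g) {s y : ℝ}
    (hs : s ∈ Ioo (-e) e) (h1 : f s < y) (h2 : y < e) : ∃ x ∈ Ioo s e, f x = y := by
  have h3 : ∀ᶠ x in nhdsWithin e (Iio e), x ∈ Ioo s e := Ioo_mem_nhdsLT hs.2
  obtain ⟨t, ht, hst⟩ := ((h.eventually_lt_f D h2).and h3).exists
  obtain ⟨x, hx, hxy⟩ := intermediate_value_Ioo hst.1.le
    ((h.continuousOn_f D).mono fun z hz => ⟨hs.1.trans_le hz.1, hz.2.trans_lt hst.2⟩) ⟨h1, ht⟩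
  exact ⟨x, ⟨hx.1, hx.2.trans hst.2⟩, hxy⟩

lemma exists_g_eq (D : IsDispersed ρ η α β e) (h : IsCentralCurtain ρ η β e f g) {s y : ℝ}
    (hs : s ∈ Ioo (-e) e) (h1 : y < g s) (h2 : e < y) : ∃ x ∈ Ioo s e, g x = y := by
  have h3 : ∀ᶠ x in nhdsWithin e (Iio e), x ∈ Ioo s e := Ioo_mem_nhdsLT hs.2
  obtain ⟨t, ht, hst⟩ := ((h.eventually_g_lt D h2).and h3).exists
  obtain ⟨x, hx, hxy⟩ := intermediate_value_Ioo' hst.1.le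
    ((h.continuousOn_g D).mono fun z hz => ⟨hs.1.trans_le hz.1, hz.2.trans_lt hst.2⟩) ⟨ht, h1⟩
  exact ⟨x, ⟨hx.1, hx.2.trans hst.2⟩, hxy⟩

end IsCentralCurtain

/-- The curtain functions and the point `x₀` exist. -/
theorem exists_isCurtainData (D : IsDispersed ρ η α β e) :
    ∃ (fR gR fL gL : ℝ → ℝ) (x₀ : ℝ), IsCurtainData ρ η α β e fR gR fL gL x₀ := by
  choose! f g hfg using fun x (hx : x ∈ symIoo α ∧ x < e) => D.exists_isCurtainPoint hx.1 hx.2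
  have hR : IsRightCurtain ρ η α β e f g :=
    (isRightCurtain_iff D).2 fun x h1 h2 => hfg x ⟨h1, h2⟩
  have hL : IsLeftCurtain ρ η α β e (fun x => -g (-x)) (fun x => -f (-x)) :=
    (isLeftCurtain_iff D).2 fun x h1 h2 => by
      rw [neg_neg, neg_neg]
      exact hfg (-x) ⟨neg_mem_symIoo.2 h1, by linarith⟩
  have hC : IsCentralCurtain ρ η β e f g := fun x hx => hfg x ⟨mem_α_of_mem_Ioo D hx, hx.2⟩
  have he := D.e_pos
  have h0 : (0 : ℝ) ∈ Ioo (-e) e := ⟨by linarith, he⟩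
  obtain ⟨x₀, hx₀, hfx₀⟩ := hC.exists_f_eq D h0 (hC 0 h0).f_lt he
  exact ⟨f, g, _, _, x₀, hR, hL, hx₀, hfx₀⟩

end curtain

/-! ### Transport of measures by kernels -/

section transport

variable {E : Type*} [MeasurableSpace E]

/-- The kernel `κ` is measurable on `χ` and transports `χ` to `ξ`. -/
def Transports (χ : Measure E) (κ : E → Measure ℝ) (ξ : Measure ℝ) : Prop :=
  AEMeasurable κ χ ∧ χ.bind κ = ξ

lemma Transports.add {χ χ' : Measure E} {κ : E → Measure ℝ} {ξ ξ' : Measure ℝ}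
    (h : Transports χ κ ξ) (h' : Transports χ' κ ξ') : Transports (χ + χ') κ (ξ + ξ') := by
  refine ⟨h.1.add_measure h'.1, ?_⟩
  rw [← h.2, ← h'.2]
  ext s hs
  rw [Measure.bind_apply hs (h.1.add_measure h'.1), lintegral_add_measure, Measure.add_apply,
    Measure.bind_apply hs h.1, Measure.bind_apply hs h'.1]

lemma Transports.congr {χ : Measure E} {κ κ' : E → Measure ℝ} {ξ : Measure ℝ}
    (h : Transports χ κ ξ) (hκ : κ =ᵐ[χ] κ') : Transports χ κ' ξ :=
  ⟨h.1.congr hκ, by rw [← h.2, Measure.bind_congr_right hκ]⟩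

lemma Transports.ae {χ : Measure E} {κ : E → Measure ℝ} {ξ : Measure ℝ}
    (h : Transports χ κ ξ) {p : ℝ → Prop} (hp : ∀ᵐ y ∂ξ, p y) : ∀ᵐ x ∂χ, ∀ᵐ y ∂(κ x), p y :=
  Measure.ae_ae_of_ae_bind h.1 (by rwa [h.2])

lemma transports_dirac (χ : Measure ℝ) : Transports χ (fun x => Measure.dirac x) χ :=
  ⟨Measure.measurable_dirac.aemeasurable, Measure.bind_dirac⟩

lemma Transports.reflect {χ ξ : Measure ℝ} {κ : ℝ → Measure ℝ} (h : Transports χ κ ξ) :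
    Transports (χ.map fun x => -x) (fun x => (κ (-x)).map fun y => -y) (ξ.map fun x => -x) := by
  have hneg : Measurable fun x : ℝ => -x := measurable_neg
  have hmeas : AEMeasurable (fun x => (κ (-x)).map fun y => -y) (χ.map fun x => -x) := by
    refine (Measure.measurable_map _ hneg).comp_aemeasurable ?_
    refine AEMeasurable.comp_measurable ?_ hneg
    rw [Measure.map_map hneg hneg]
    simpa using h.1
  refine ⟨hmeas, ?_⟩
  ext s hs
  have hmap := (MeasurableEquiv.neg ℝ).measurableEmbedding.lintegral_map (μ := χ)
    (fun x => (κ (-x)).map (fun y => -y) s)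
  rw [Measure.bind_apply hs hmeas, Measure.map_apply hneg hs, ← h.2,
    Measure.bind_apply (hneg hs) h.1]
  refine hmap.trans (lintegral_congr fun x => ?_)
  simp only [MeasurableEquiv.neg_apply, neg_neg]
  rw [Measure.map_apply hneg hs]

lemma twoPoint_map_neg (c d x : ℝ) :
    (twoPoint c d x).map (fun y => -y) = twoPoint (-d) (-c) (-x) := by
  have hneg : Measurable fun x : ℝ => -x := measurable_neg
  rw [twoPoint, Measure.map_add _ _ hneg, Measure.map_smul, Measure.map_smul,
    Measure.map_dirac' hneg, Measure.map_dirac' hneg, twoPoint, add_comm]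
  congr 3 <;> ring_nf

lemma Transports.prod_snd {χ ξ : Measure ℝ} [SFinite χ] {κ : ℝ → Measure ℝ}
    (h : Transports χ κ ξ) :
    Transports ((volume.restrict (Ioo (0 : ℝ) 1)).prod χ) (fun w => κ w.2) ξ := by
  have hp : IsProbabilityMeasure (volume.restrict (Ioo (0 : ℝ) 1)) := ⟨by simp⟩
  have hmp := measurePreserving_snd (μ := volume.restrict (Ioo (0 : ℝ) 1)) (ν := χ)
  have hm : AEMeasurable (fun w : ℝ × ℝ => κ w.2) ((volume.restrict (Ioo (0 : ℝ) 1)).prod χ) :=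
    h.1.comp_quasiMeasurePreserving hmp.quasiMeasurePreserving
  refine ⟨hm, ?_⟩
  ext s hs
  rw [Measure.bind_apply hs hm, ← h.2, Measure.bind_apply hs h.1]
  have hf : AEMeasurable (fun x => κ x s) χ := (Measure.measurable_coe hs).comp_aemeasurable h.1
  have := lintegral_map' (by rwa [hmp.map_eq]) measurable_snd.aemeasurable (f := fun x => κ x s)
    (μ := (volume.restrict (Ioo (0 : ℝ) 1)).prod χ) (g := Prod.snd)
  rw [hmp.map_eq] at this
  exact this.symm

end transport

/-! ### Sums of measures with densities -/

section sums

variable {h k : ℝ → ℝ}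

lemma densityOn_union {S T : Set ℝ} (hT : MeasurableSet T)
    (hd : Disjoint S T) : densityOn h (S ∪ T) = densityOn h S + densityOn h T := by
  rw [densityOn, Measure.restrict_union hd hT, withDensity_add_measure]; rfl

lemma densityOn_congr {S T : Set ℝ} (hST : S =ᵐ[volume] T) : densityOn h S = densityOn h T := by
  rw [densityOn, Measure.restrict_congr_set hST]; rfl

lemma densityOn_Ioo_add_Ioo {s t u : ℝ} (hst : s ≤ t) (htu : t ≤ u) :
    densityOn h (Ioo s t) + densityOn h (Ioo t u) = densityOn h (Ioo s u) := by
  rw [densityOn_congr (Ioo_ae_eq_Ioc (a := s)), densityOn_congr (Ioo_ae_eq_Ioc (a := t)),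
    densityOn_congr (Ioo_ae_eq_Ioc (a := s) (b := u)),
    ← densityOn_union measurableSet_Ioc (Ioc_disjoint_Ioc_of_le le_rfl),
    Ioc_union_Ioc_eq_Ioc hst htu]

lemma densityOn_Ioo_add_Ioi {s t : ℝ} (hst : s ≤ t) :
    densityOn h (Ioo s t) + densityOn h (Ioi t) = densityOn h (Ioi s) := by
  rw [densityOn_congr (Ioo_ae_eq_Ioc (a := s)), ← densityOn_union
    measurableSet_Ioi (Set.disjoint_left.2 fun z h1 h2 => not_lt.2 h1.2 h2),
    Ioc_union_Ioi_eq_Ioi hst]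

lemma densityOn_Iio_add_Ioo {s t : ℝ} (hst : s ≤ t) :
    densityOn h (Iio s) + densityOn h (Ioo s t) = densityOn h (Iio t) := by
  rw [densityOn_congr (Ioo_ae_eq_Ico (a := s)), ← densityOn_union
    measurableSet_Ico (Set.disjoint_left.2 fun z (h1 : z ∈ Iio s) (h2 : z ∈ Ico s t) =>
      absurd (mem_Iio.1 h1) (not_lt.2 h2.1)),
    Iio_union_Ico_eq_Iio hst]

lemma densityOn_Iio_add_Ioi (t : ℝ) : densityOn h (Iio t) + densityOn h (Ioi t) = law h := by
  rw [densityOn_congr Ioi_ae_eq_Ici, ← densityOn_union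
    measurableSet_Ici (Set.disjoint_left.2 fun z (h1 : z ∈ Iio t) (h2 : z ∈ Ici t) =>
      absurd (mem_Iio.1 h1) (not_lt.2 (mem_Ici.1 h2))),
    Iio_union_Ici, law_eq_densityOn]

lemma densityOn_sub_add {S : Set ℝ} (hS : MeasurableSet S) (hm : Measurable h) (km : Measurable k)
    (h0 : ∀ x, 0 ≤ h x) (hae : ∀ᵐ z, z ∈ S → h z ≤ k z) :
    densityOn (fun z => k z - h z) S + densityOn h S = densityOn k S := by
  rw [densityOn, densityOn, densityOn, ← withDensity_add_left (by fun_prop)]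
  refine withDensity_congr_ae ?_
  filter_upwards [(ae_restrict_iff' hS).2 hae] with z hz
  rw [Pi.add_apply, ← ENNReal.ofReal_add (by linarith) (h0 z), sub_add_cancel]

end sums

/-! ### The transport by the curtain couplings -/

section curtain

variable {ρ η : ℝ → ℝ} {α β : EReal} {e : ℝ} {f g : ℝ → ℝ}

lemma HasMean.setIntegral_mul_Ioo {h : ℝ → ℝ} (H : HasMean h) {s t : ℝ} (hst : s ≤ t) :
    ∫ z in Ioo s t, z * h z = cumMean h t - cumMean h s := by
  rw [H.cumMean_sub_cumMean, intervalIntegral.integral_of_le hst, integral_Ioc_eq_integral_Ioo]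

lemma IsCentralCurtain.exists_measurable (D : IsDispersed ρ η α β e)
    (h : IsCentralCurtain ρ η β e f g) {s : ℝ} (hs : -e ≤ s) :
    ∃ f' g' : ℝ → ℝ, Measurable f' ∧ Measurable g' ∧ ∀ x ∈ Ioo s e, f' x = f x ∧ g' x = g x := by
  have hsub : Ioo s e ⊆ Ioo (-e) e := Ioo_subset_Ioo_left hs
  exact ⟨_, _, measurable_piecewise_of_monotoneOn ordConnected_Ioo
    ((h.strictMonoOn D).monotoneOn.mono hsub), measurable_piecewise_of_antitoneOn ordConnected_Ioo
    ((h.strictAntiOn D).antitoneOn.mono hsub), fun x hx =>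
    ⟨indicator_of_mem hx _, indicator_of_mem hx _⟩⟩

/-- The right-curtain coupling transports `μ` on `(s, e)` to `ν` on `(f s, e)` and `ν - μ` on
`(e, g s)`. -/
lemma IsCentralCurtain.transports (D : IsDispersed ρ η α β e)
    (h : IsCentralCurtain ρ η β e f g) {s : ℝ} (hs : s ∈ Ioo (-e) e) :
    Transports (densityOn ρ (Ioo s e)) (fun x => twoPoint (f x) (g x) x)
      (densityOn η (Ioo (f s) e) + densityOn (fun z => η z - ρ z) (Ioo e (g s))) := by
  obtain ⟨f', g', hf', hg', hfg⟩ := h.exists_measurable D hs.1.le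
  have hsub : Ioo s e ⊆ Ioo (-e) e := Ioo_subset_Ioo_left hs.1.le
  have hfe : ∀ x ∈ Ioo s e, f x < e := fun x hx => (h x (hsub hx)).f_lt.trans hx.2
  have hge : ∀ x ∈ Ioo s e, e < g x := fun x hx => h.e_lt D (hsub hx)
  have hfse : f s < e := (h s hs).f_lt.trans hs.2
  have hgse : e < g s := h.e_lt D hs
  have fρ := isFiniteMeasure_densityOn (S := Ioo s e) D.integrable_ρ
  have fη := isFiniteMeasure_densityOn (S := Ioo (f s) e) D.integrable_η
  have fk := isFiniteMeasure_densityOn (S := Ioo e (g s)) D.hasMean_sub.1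
  have k0 : ∀ z ∈ Ioo e (g s), 0 ≤ η z - ρ z := fun z hz =>
    (D.sub_pos_of_mem le_rfl (h s hs).g_mem z hz).le
  have km : Measurable fun z => η z - ρ z := D.measurable_η.sub D.measurable_ρ
  have iη : Integrable (fun y : ℝ => y) (densityOn η (Ioo (f s) e)) :=
    integrable_densityOn D.measurable_η measurableSet_Ioo (fun z _ => D.nonneg_η z)
      D.integrable_mul_η
  have ik : Integrable (fun y : ℝ => y) (densityOn (fun z => η z - ρ z) (Ioo e (g s))) :=
    integrable_densityOn km measurableSet_Ioo k0 D.hasMean_sub.2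
  have iξ := iη.add_measure ik
  have hnull : NullSingletonClass
      (densityOn η (Ioo (f s) e) + densityOn (fun z => η z - ρ z) (Ioo e (g s))) :=
    ⟨fun x => by simp⟩
  have hm := measurable_twoPoint hf' hg' measurable_id
  have hcarrier : ∀ᵐ x ∂(densityOn ρ (Ioo s e)), x ∈ Ioo s e :=
    ae_densityOn D.measurable_ρ measurableSet_Ioo fun x hx _ => hx
  refine Transports.congr (κ := fun x => twoPoint (f' x) (g' x) x) ⟨hm.aemeasurable, ?_⟩ ?_
  swap
  · filter_upwards [hcarrier] with x hx
    rw [(hfg x hx).1, (hfg x hx).2]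
  have hsetη : ∀ x ∈ Ioo s e, (Iio (f x) ∪ Ioi (g x)) ∩ Ioo (f s) e = Ioo (f s) (f x) := by
    intro x hx
    ext z
    have := hfe x hx
    have := hge x hx
    simp only [mem_inter_iff, mem_union, mem_Iio, mem_Ioi, mem_Ioo]
    constructor
    · rintro ⟨h1 | h1, h2⟩
      · exact ⟨h2.1, h1⟩
      · linarith [h2.2]
    · exact fun h1 => ⟨Or.inl h1.2, h1.1, h1.2.trans (hfe x hx)⟩
  have hsetk : ∀ x ∈ Ioo s e, (Iio (f x) ∪ Ioi (g x)) ∩ Ioo e (g s) = Ioo (g x) (g s) := by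
    intro x hx
    ext z
    have := hfe x hx
    have := hge x hx
    simp only [mem_inter_iff, mem_union, mem_Iio, mem_Ioi, mem_Ioo]
    constructor
    · rintro ⟨h1 | h1, h2⟩
      · linarith [h2.1]
      · exact ⟨h1, h2.2⟩
    · exact fun h1 => ⟨Or.inr h1.1, (hge x hx).trans h1.1, h1.2⟩
  have hsetρ : ∀ x ∈ Ioo s e, Iio x ∩ Ioo s e = Ioo s x := by
    intro x hx
    ext z
    simp only [mem_inter_iff, mem_Iio, mem_Ioo]
    exact ⟨fun h1 => ⟨h1.2.1, h1.1⟩, fun h1 => ⟨h1.2, h1.1, h1.2.trans hx.2⟩⟩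
  have hfs : ∀ x ∈ Ioo s e, f s < f x ∧ g x < g s := fun x hx =>
    ⟨h.strictMonoOn D hs (hsub hx) hx.1, h.strictAntiOn D hs (hsub hx) hx.1⟩
  have hPs := h s hs
  -- The lower branch increases to e and the upper one decreases to e, so the endpoints used before
  -- x are those below f x and above g x. Together the branches cover (f s, e) and (e, g s).
  refine bind_twoPoint_eq_of_branches (l := s) (r := e) (c := e) (A := fun x => Iio (f x))
    hs.2 hcarrier iξ hf' hg' ?_ ?_ ?_ ?_ ?_ ?_ ?_ ?_ ?_ ?_ ?_ ?_ ?_ ?_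
  · intro x hx; rw [(hfg x hx).1]; exact (h x (hsub hx)).f_lt
  · intro x hx; rw [(hfg x hx).2]; exact (h x (hsub hx)).lt_g
  · intro x hx; rw [(hfg x hx).1]; exact hfe x hx
  · intro x hx; rw [(hfg x hx).2]; exact hge x hx
  · intro x₀ hx₀ x hx hlt
    rw [(hfg x₀ hx₀).1]
    exact Or.inl (h.strictMonoOn D (hsub hx₀) (hsub hx) hlt)
  · intro x₀ hx₀ x hx hle hmem
    rw [(hfg x₀ hx₀).1] at hmem
    exact absurd ((h.strictMonoOn D).monotoneOn (hsub hx) (hsub hx₀) hle) (not_le.2 hmem)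
  · exact fun x _ => measurableSet_Iio
  · exact fun x hx => Iio_subset_Iio (hfe x hx).le
  · intro x hx y hy hxy
    rw [(hfg x hx).2, (hfg y hy).2]
    exact (h.strictAntiOn D).antitoneOn (hsub hx) (hsub hy) hxy
  · rw [ae_add_measure_iff]
    constructor
    · refine ae_densityOn D.measurable_η measurableSet_Ioo fun y hy _ => ?_
      obtain ⟨x, hx, hxy⟩ := h.exists_f_eq D hs hy.1 hy.2
      exact ⟨x, hx, Or.inl (by rw [(hfg x hx).1, hxy])⟩
    · refine ae_densityOn km measurableSet_Ioo fun y hy _ => ?_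
      obtain ⟨x, hx, hxy⟩ := h.exists_g_eq D hs hy.2 hy.1
      exact ⟨x, hx, Or.inr (by rw [(hfg x hx).2, hxy])⟩
  · intro x hx
    have hms : MeasurableSet (Iio (f x) ∪ Ioi (g x)) := measurableSet_Iio.union measurableSet_Ioi
    rw [(hfg x hx).2, ← ENNReal.toReal_eq_toReal_iff' (measure_ne_top _ _) (measure_ne_top _ _)]
    change (densityOn ρ (Ioo s e)).real _ = Measure.real (_ + _) _
    rw [measureReal_add_apply, real_densityOn D.measurable_ρ measurableSet_Ioo
      (fun z _ => D.nonneg_ρ z) measurableSet_Iio, real_densityOn D.measurable_η measurableSet_Ioo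
      (fun z _ => D.nonneg_η z) hms, real_densityOn km measurableSet_Ioo k0 hms, hsetη x hx,
      hsetk x hx, hsetρ x hx, D.hasMean_ρ.setIntegral_Ioo hx.1.le,
      D.hasMean_η.setIntegral_Ioo (hfs x hx).1.le, D.hasMean_sub.setIntegral_Ioo (hfs x hx).2.le,
      D.cum_sub, D.cum_sub]
    have h1 := (h x (hsub hx)).mass
    have h2 := hPs.mass
    linarith
  · rw [← ENNReal.toReal_eq_toReal_iff' (measure_ne_top _ _) (measure_ne_top _ _)]
    change (densityOn ρ (Ioo s e)).real _ = Measure.real (_ + _) _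
    rw [measureReal_add_apply, real_densityOn D.measurable_ρ measurableSet_Ioo
      (fun z _ => D.nonneg_ρ z) MeasurableSet.univ, real_densityOn D.measurable_η measurableSet_Ioo
      (fun z _ => D.nonneg_η z) MeasurableSet.univ, real_densityOn km measurableSet_Ioo k0
      MeasurableSet.univ, univ_inter, univ_inter, univ_inter, D.hasMean_ρ.setIntegral_Ioo hs.2.le,
      D.hasMean_η.setIntegral_Ioo hfse.le, D.hasMean_sub.setIntegral_Ioo hgse.le,
      D.cum_sub, D.cum_sub]
    have h2 := hPs.mass
    linarith
  · intro x hx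
    have hms : MeasurableSet (Iio (f x) ∪ Ioi (g x)) := measurableSet_Iio.union measurableSet_Ioi
    rw [(hfg x hx).2, Measure.restrict_add, integral_add_measure iη.restrict ik.restrict,
      setIntegral_densityOn D.measurable_ρ measurableSet_Ioo (fun z _ => D.nonneg_ρ z)
        measurableSet_Iio, setIntegral_densityOn D.measurable_η measurableSet_Ioo
      (fun z _ => D.nonneg_η z) hms, setIntegral_densityOn km measurableSet_Ioo k0 hms, hsetη x hx,
      hsetk x hx, hsetρ x hx, D.hasMean_ρ.setIntegral_mul_Ioo hx.1.le,
      D.hasMean_η.setIntegral_mul_Ioo (hfs x hx).1.le,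
      D.hasMean_sub.setIntegral_mul_Ioo (hfs x hx).2.le, D.cumMean_sub, D.cumMean_sub]
    have h1 := (h x (hsub hx)).mean
    have h2 := hPs.mean
    linarith
  · rw [integral_add_measure iη ik, ← setIntegral_univ, ← setIntegral_univ (μ := densityOn η _),
      ← setIntegral_univ (μ := densityOn (fun z => η z - ρ z) _),
      setIntegral_densityOn D.measurable_ρ measurableSet_Ioo (fun z _ => D.nonneg_ρ z)
        MeasurableSet.univ, setIntegral_densityOn D.measurable_η measurableSet_Ioo
      (fun z _ => D.nonneg_η z) MeasurableSet.univ, setIntegral_densityOn km measurableSet_Ioo k0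
      MeasurableSet.univ, univ_inter, univ_inter, univ_inter,
      D.hasMean_ρ.setIntegral_mul_Ioo hs.2.le, D.hasMean_η.setIntegral_mul_Ioo hfse.le,
      D.hasMean_sub.setIntegral_mul_Ioo hgse.le, D.cumMean_sub, D.cumMean_sub]
    have h2 := hPs.mean
    linarith

end curtain

/-! ### Full curtain kernels, their reflections, and randomization. -/

section outer

variable {ρ η : ℝ → ℝ} {α β : EReal} {e : ℝ} {f g fL gL : ℝ → ℝ}

lemma IsDispersed.ae_le_of_e_le (D : IsDispersed ρ η α β e) {s : ℝ} (hs : e ≤ s) :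
    ∀ᵐ z, z ∈ Ioi s → ρ z ≤ η z := by
  filter_upwards [D.ae_η_zero, D.ae_ρ_zero] with z h1 h2 hz
  by_cases hβ : z ∈ symIoo β
  · exact (D.tails z hβ (lt_abs.2 (Or.inl (hs.trans_lt hz)))).le
  · rw [h1 hβ, h2 hβ]

/-- The right-curtain kernel transports `μ` on `(s, ∞)` to `ν` on `(f s, g s)` and `μ` on
`(g s, ∞)`. -/
lemma IsCentralCurtain.transports_rightKernel (D : IsDispersed ρ η α β e)
    (h : IsCentralCurtain ρ η β e f g) {s : ℝ} (hs : s ∈ Ioo (-e) e) :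
    Transports (densityOn ρ (Ioi s)) (rightKernel e f g)
      (densityOn η (Ioo (f s) (g s)) + densityOn ρ (Ioi (g s))) := by
  have hge := h.e_lt D hs
  have T1 : Transports (densityOn ρ (Ioo s e)) (rightKernel e f g) _ :=
    (h.transports D hs).congr <| by
      filter_upwards [ae_densityOn D.measurable_ρ measurableSet_Ioo (p := fun x => x ∈ Ioo s e)
        fun x hx _ => hx] with x hx
      rw [rightKernel, if_neg (not_le.2 hx.2)]
  have T2 : Transports (densityOn ρ (Ioi e)) (rightKernel e f g) (densityOn ρ (Ioi e)) :=
    (transports_dirac _).congr <| by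
      filter_upwards [ae_densityOn D.measurable_ρ measurableSet_Ioi (p := fun x => x ∈ Ioi e)
        fun x hx _ => hx] with x hx
      rw [rightKernel, if_pos (le_of_lt hx)]
  have T := T1.add T2
  rw [densityOn_Ioo_add_Ioi hs.2.le] at T
  -- Adding μ on (e, g s), which stays put, completes ν - μ to ν on that interval.
  have e1 := densityOn_sub_add (S := Ioo e (g s)) measurableSet_Ioo D.measurable_ρ D.measurable_η
    D.nonneg_ρ ((D.ae_le_of_e_le le_rfl).mono fun z hz hz' => hz hz'.1)
  have e2 := densityOn_Ioo_add_Ioo (h := η) ((h s hs).f_lt.trans hs.2).le hge.le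
  rw [← densityOn_Ioo_add_Ioi (h := ρ) hge.le, add_assoc, ← add_assoc (densityOn _ (Ioo e (g s))),
    e1, ← add_assoc, e2] at T
  exact T

lemma neg_preimage_Ioi (s : ℝ) : (fun x : ℝ => -x) ⁻¹' Ioi s = Iio (-s) := by
  ext x; simp

lemma neg_preimage_Ioo (s t : ℝ) : (fun x : ℝ => -x) ⁻¹' Ioo s t = Ioo (-t) (-s) := by
  ext x; simp [and_comm]

lemma IsCentralCurtain.transports_leftKernel (D : IsDispersed ρ η α β e)
    (h : IsCentralCurtain ρ η β e f g)
    (hL : ∀ x ∈ Ioo (-e) e, fL (-x) = -g x ∧ gL (-x) = -f x) {s : ℝ} (hs : s ∈ Ioo (-e) e) :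
    Transports (densityOn ρ (Iio (-s))) (leftKernel e fL gL)
      (densityOn η (Ioo (-g s) (-f s)) + densityOn ρ (Iio (-g s))) := by
  have T := (h.transports_rightKernel D hs).reflect
  rw [Measure.map_add _ _ measurable_neg, densityOn_map_neg measurableSet_Ioi D.symm_ρ,
    densityOn_map_neg measurableSet_Ioi D.symm_ρ, densityOn_map_neg measurableSet_Ioo D.symm_η,
    neg_preimage_Ioi, neg_preimage_Ioi, neg_preimage_Ioo] at T
  refine T.congr ?_
  filter_upwards [ae_densityOn D.measurable_ρ measurableSet_Iio (p := fun x => x ∈ Iio (-s))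
    fun x hx _ => hx] with x hx
  rw [rightKernel, leftKernel]
  by_cases hxe : e ≤ -x
  · rw [if_pos hxe, if_pos (by linarith), Measure.map_dirac' measurable_neg, neg_neg]
  · have hx' : x < -s := hx
    have hmem : -x ∈ Ioo (-e) e := ⟨by linarith [hs.1], not_le.1 hxe⟩
    have := hL (-x) hmem
    rw [neg_neg] at this
    rw [if_neg hxe, if_neg (by intro h'; exact hxe (by linarith)), twoPoint_map_neg, neg_neg,
      this.1, this.2]

lemma IsCentralCurtain.step_rightKernel (h : IsCentralCurtain ρ η β e f g) {x : ℝ} (hx : -e < x) :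
    IsMartingaleStep (rightKernel e f g x) x := by
  rw [rightKernel]
  split_ifs with h'
  · exact isMartingaleStep_dirac x
  · have P := h x ⟨hx, not_le.1 h'⟩
    exact isMartingaleStep_twoPoint P.f_lt P.lt_g

lemma IsCentralCurtain.step_leftKernel (h : IsCentralCurtain ρ η β e f g)
    (hL : ∀ x ∈ Ioo (-e) e, fL (-x) = -g x ∧ gL (-x) = -f x) {x : ℝ} (hx : x < e) :
    IsMartingaleStep (leftKernel e fL gL x) x := by
  rw [leftKernel]
  split_ifs with h'
  · exact isMartingaleStep_dirac x
  · have hm : -x ∈ Ioo (-e) e := ⟨by linarith, by linarith [not_le.1 h']⟩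
    have P := h (-x) hm
    have := hL (-x) hm
    rw [neg_neg] at this
    rw [this.1, this.2]
    exact isMartingaleStep_twoPoint (by linarith [P.lt_g]) (by linarith [P.f_lt])

lemma IsHKPair.step {χ ξ : Measure ℝ} {γ : ℝ} {p q : ℝ → ℝ} (hpq : IsHKPair χ ξ γ p q) {x : ℝ}
    (hx : x ∈ Ioo (-γ) γ) : IsMartingaleStep (hkKernel p q x) x :=
  isMartingaleStep_twoPoint ((hpq.p_lt x hx).trans hx.1) (hx.2.trans (hpq.lt_q x hx))

lemma HKData.transports {χ ξ : Measure ℝ} {γ d : ℝ} {δ : EReal} {p q : ℝ → ℝ}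
    (h : HKData χ ξ γ d δ) (hpq : IsHKPair χ ξ γ p q) : Transports χ (hkKernel p q) ξ := by
  obtain ⟨κ, hκ, hκe⟩ := exists_measurable_hkKernel hpq
  exact ⟨hκ.aemeasurable.congr (h.carrier_χ.mono fun x hx => hκe x hx), h.bind_hkKernel hpq⟩

/-- Staying put with probability `η / ρ`, and moving by the kernel `κ` otherwise. -/
lemma transports_randomized {K : Set ℝ} (hK : MeasurableSet K) (hρ : Measurable ρ)
    (hη : Measurable η) (h0 : ∀ x, 0 ≤ η x) (hlt : ∀ x ∈ K, η x < ρ x) [SFinite (densityOn ρ K)]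
    {κ : ℝ → Measure ℝ} {ξ : Measure ℝ} (hκ : Measurable κ)
    (hT : Transports (densityOn (fun x => ρ x - η x) K) κ ξ) :
    Transports ((volume.restrict (Ioo (0 : ℝ) 1)).prod (densityOn ρ K))
      (fun w => (if w.1 ≤ η w.2 / ρ w.2 then Measure.dirac w.2 else κ w.2 : Measure ℝ))
      (densityOn η K + ξ) := by
  have hset : MeasurableSet {w : ℝ × ℝ | w.1 ≤ η w.2 / ρ w.2} :=
    measurableSet_le measurable_fst ((hη.comp measurable_snd).div (hρ.comp measurable_snd))
  have hm : Measurable fun w : ℝ × ℝ =>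
      (if w.1 ≤ η w.2 / ρ w.2 then Measure.dirac w.2 else κ w.2 : Measure ℝ) :=
    Measurable.ite hset (Measure.measurable_dirac.comp measurable_snd) (hκ.comp measurable_snd)
  refine ⟨hm.aemeasurable, ?_⟩
  ext s hs
  have hκs : Measurable fun x => κ x s := (Measure.measurable_coe hs).comp hκ
  have hms : Measurable fun w : ℝ × ℝ =>
      (if w.1 ≤ η w.2 / ρ w.2 then Measure.dirac w.2 else κ w.2 : Measure ℝ) s :=
    (Measure.measurable_coe hs).comp hm
  -- Integrating over u, the fraction η/ρ of the mass stays and contributes η, and the remaining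
  -- fraction contributes ρ - η.
  have hinner : ∀ x ∈ K, ENNReal.ofReal (ρ x) * ∫⁻ u in Ioo (0 : ℝ) 1,
      (if u ≤ η x / ρ x then Measure.dirac x else κ x : Measure ℝ) s
      = ENNReal.ofReal (η x) * s.indicator 1 x + ENNReal.ofReal (ρ x - η x) * κ x s := by
    intro x hx
    have hρx : 0 < ρ x := (h0 x).trans_lt (hlt x hx)
    have ht0 : 0 ≤ η x / ρ x := div_nonneg (h0 x) hρx.le
    have ht1 : η x / ρ x < 1 := (div_lt_one hρx).2 (hlt x hx)
    have h1 : ∀ u, (if u ≤ η x / ρ x then Measure.dirac x else κ x : Measure ℝ) s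
        = (Iic (η x / ρ x)).indicator (fun _ => s.indicator 1 x) u
          + (Ioi (η x / ρ x)).indicator (fun _ => κ x s) u := by
      intro u
      by_cases hu : u ≤ η x / ρ x
      · simp [hu, Measure.dirac_apply' _ hs]
      · simp [hu, not_le.1 hu]
    have v1 : (volume.restrict (Ioo (0 : ℝ) 1)) (Iic (η x / ρ x)) = ENNReal.ofReal (η x / ρ x) := by
      rw [Measure.restrict_apply measurableSet_Iic]
      have : Iic (η x / ρ x) ∩ Ioo 0 1 = Ioc 0 (η x / ρ x) := by
        ext u
        simp only [mem_inter_iff, mem_Iic, mem_Ioo, mem_Ioc]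
        exact ⟨fun h => ⟨h.2.1, h.1⟩, fun h => ⟨h.2, h.1, h.2.trans_lt ht1⟩⟩
      rw [this, Real.volume_Ioc, sub_zero]
    have v2 : (volume.restrict (Ioo (0 : ℝ) 1)) (Ioi (η x / ρ x))
        = ENNReal.ofReal (1 - η x / ρ x) := by
      rw [Measure.restrict_apply measurableSet_Ioi]
      have : Ioi (η x / ρ x) ∩ Ioo 0 1 = Ioo (η x / ρ x) 1 := by
        ext u
        simp only [mem_inter_iff, mem_Ioi, mem_Ioo]
        exact ⟨fun h => ⟨h.1, h.2.2⟩, fun h => ⟨h.1, ht0.trans_lt h.1, h.2⟩⟩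
      rw [this, Real.volume_Ioo]
    simp only [h1]
    rw [lintegral_add_left (measurable_const.indicator measurableSet_Iic),
      lintegral_indicator measurableSet_Iic, lintegral_indicator measurableSet_Ioi,
      lintegral_const, lintegral_const, Measure.restrict_apply_univ, Measure.restrict_apply_univ,
      v1, v2, mul_add, mul_comm (s.indicator 1 x), mul_comm (κ x s), ← mul_assoc, ← mul_assoc,
      ← ENNReal.ofReal_mul hρx.le, ← ENNReal.ofReal_mul hρx.le, mul_div_cancel₀ _ hρx.ne',
      mul_sub, mul_one, mul_div_cancel₀ _ hρx.ne']
  rw [Measure.bind_apply hs hm.aemeasurable, lintegral_prod_symm _ hms.aemeasurable,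
    Measure.add_apply, ← hT.2, Measure.bind_apply hs hT.1, densityOn, densityOn, densityOn,
    lintegral_withDensity_eq_lintegral_mul _ hρ.ennreal_ofReal hms.lintegral_prod_left',
    lintegral_withDensity_eq_lintegral_mul _ (f := fun x => ENNReal.ofReal (ρ x - η x))
      (hρ.sub hη).ennreal_ofReal hκs,
    withDensity_apply _ hs, ← lintegral_indicator hs, ← lintegral_add_left
      (hη.ennreal_ofReal.indicator hs)]
  refine setLIntegral_congr_fun hK fun x hx => ?_
  simp only [Pi.mul_apply]
  rw [hinner x hx]
  by_cases hxs : x ∈ s <;> simp [hxs]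

end outer

/-! ### The Hobson–Klimmek couplings of the three cases -/

section instances

variable {ρ η h : ℝ → ℝ} {α β : EReal} {e : ℝ} {f g fL gL : ℝ → ℝ}

/-- The pair of intervals `(-t, -s) ∪ (s, t)`. -/
def pairIoo (s t : ℝ) : Set ℝ := Ioo (-t) (-s) ∪ Ioo s t

lemma measurableSet_pairIoo (s t : ℝ) : MeasurableSet (pairIoo s t) :=
  measurableSet_Ioo.union measurableSet_Ioo

lemma neg_mem_pairIoo {s t z : ℝ} : -z ∈ pairIoo s t ↔ z ∈ pairIoo s t := by
  simp only [pairIoo, mem_union, mem_Ioo]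
  constructor
  · rintro (⟨h1, h2⟩ | ⟨h1, h2⟩)
    · exact Or.inr ⟨by linarith, by linarith⟩
    · exact Or.inl ⟨by linarith, by linarith⟩
  · rintro (⟨h1, h2⟩ | ⟨h1, h2⟩)
    · exact Or.inr ⟨by linarith, by linarith⟩
    · exact Or.inl ⟨by linarith, by linarith⟩

lemma abs_of_mem_pairIoo {s t z : ℝ} (hs : 0 ≤ s) (hz : z ∈ pairIoo s t) : s < |z| ∧ |z| < t := by
  rcases hz with ⟨h1, h2⟩ | ⟨h1, h2⟩
  · rw [abs_of_neg (by linarith)]; constructor <;> linarith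
  · rw [abs_of_pos (by linarith)]; exact ⟨h1, h2⟩

lemma disjoint_pairIoo {s t : ℝ} (hs : 0 ≤ s) : Disjoint (Ioo (-t) (-s)) (Ioo s t) :=
  Set.disjoint_left.2 fun z h1 h2 => by linarith [h1.2, h2.1]

lemma setIntegral_pairIoo (H : HasMean h) (hsymm : ∀ x, h (-x) = h x) {s t : ℝ} (hs : 0 ≤ s)
    (hst : s ≤ t) : ∫ z in pairIoo s t, h z = 2 * (cum h t - cum h s) := by
  rw [pairIoo, setIntegral_union (disjoint_pairIoo hs) measurableSet_Ioo H.1.integrableOn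
    H.1.integrableOn, H.setIntegral_Ioo (by linarith), H.setIntegral_Ioo hst, cum_neg H hsymm,
    cum_neg H hsymm]
  ring

lemma setIntegral_symm_Ioo (H : HasMean h) (hsymm : ∀ x, h (-x) = h x) {s : ℝ} (hs : 0 ≤ s) :
    ∫ z in Ioo (-s) s, h z = 2 * cum h s - ∫ z, h z := by
  rw [H.setIntegral_Ioo (by linarith), cum_neg H hsymm]
  ring

lemma neg_mem_symm_Ioo {s z : ℝ} : -z ∈ Ioo (-s) s ↔ z ∈ Ioo (-s) s := by
  simp only [mem_Ioo]
  constructor <;> rintro ⟨h1, h2⟩ <;> constructor <;> linarith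

/-- Hobson–Klimmek data with second marginal `ν - μ` beyond `y`. -/
lemma IsDispersed.hkData_excess (D : IsDispersed ρ η α β e) {S : Set ℝ} {γ y : ℝ}
    (hm : Measurable h) (hi : Integrable h) (hS : MeasurableSet S) (h0 : ∀ x ∈ S, 0 ≤ h x)
    (hsymm : ∀ x, h (-x) = h x) (Ssymm : ∀ x, -x ∈ S ↔ x ∈ S) (hγ : 0 < γ) (hγy : γ ≤ y)
    (hey : e ≤ y) (hSγ : S ⊆ Ioo (-γ) γ) (hpos : ∃ c < γ, ∀ x ∈ Ioo c γ, x ∈ S ∧ 0 < h x)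
    (hmass : ∫ x in S, h x = -(2 * cum (fun z => η z - ρ z) y)) :
    HKData (densityOn h S) (excessBeyond ρ η β y) γ y β := by
  have hy : 0 ≤ y := D.e_pos.le.trans hey
  refine HKData.of_density hm (D.measurable_η.sub D.measurable_ρ) hi D.hasMean_sub.1
    D.hasMean_sub.2 hS (measurableSet_excess _ _) h0
    (fun z hz => (D.excess_mem hey z hz).1.le) hsymm D.symm_sub Ssymm (fun z => neg_mem_excess)
    hγ hγy hSγ (fun z hz => (D.excess_mem hey z hz).2) hpos (fun z h1 h2 => ?_) ?_
  · have : z ∈ symIoo β ∩ (Iio (-y) ∪ Ioi y) :=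
      ⟨(mem_symIoo_of_nonneg (hy.trans h1.le)).2 h2, Or.inr h1⟩
    exact ⟨this, (D.excess_mem hey z this).1⟩
  · rw [D.setIntegral_excess hy, hmass]

/-- Hobson–Klimmek data with second marginal `ν - μ` on `(-t, -s) ∪ (s, t)`. -/
lemma IsDispersed.hkData_pairIoo (D : IsDispersed ρ η α β e) {S : Set ℝ} {γ s t : ℝ}
    (hm : Measurable h) (hi : Integrable h) (hS : MeasurableSet S) (h0 : ∀ x ∈ S, 0 ≤ h x)
    (hsymm : ∀ x, h (-x) = h x) (Ssymm : ∀ x, -x ∈ S ↔ x ∈ S) (hγ : 0 < γ) (hγs : γ ≤ s)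
    (hes : e ≤ s) (hst : s ≤ t) (htβ : t ∈ symIoo β) (hSγ : S ⊆ Ioo (-γ) γ)
    (hpos : ∃ c < γ, ∀ x ∈ Ioo c γ, x ∈ S ∧ 0 < h x)
    (hmass : ∫ x in S, h x
      = 2 * (cum (fun z => η z - ρ z) t - cum (fun z => η z - ρ z) s)) :
    HKData (densityOn h S) (densityOn (fun z => η z - ρ z) (pairIoo s t)) γ s t := by
  have hs : 0 ≤ s := D.e_pos.le.trans hes
  have ht : 0 ≤ t := hs.trans hst
  have key : ∀ z ∈ pairIoo s t, 0 < η z - ρ z := fun z hz => by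
    obtain ⟨h1, h2⟩ := abs_of_mem_pairIoo hs hz
    refine sub_pos.2 (D.tails z (mem_symIoo_of_abs_le htβ ?_) (hes.trans_lt h1))
    rw [abs_of_nonneg ht]; exact h2.le
  refine HKData.of_density hm (D.measurable_η.sub D.measurable_ρ) hi D.hasMean_sub.1
    D.hasMean_sub.2 hS (measurableSet_pairIoo _ _) h0
    (fun z hz => (key z hz).le) hsymm D.symm_sub Ssymm (fun z => neg_mem_pairIoo)
    hγ hγs hSγ (fun z hz => ?_) hpos (fun z h1 h2 => ?_) ?_
  · obtain ⟨h1, h2⟩ := abs_of_mem_pairIoo hs hz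
    exact ⟨h1, EReal.coe_lt_coe_iff.2 h2⟩
  · have : z ∈ pairIoo s t := Or.inr ⟨h1, EReal.coe_lt_coe_iff.1 h2⟩
    exact ⟨this, key z this⟩
  · rw [setIntegral_pairIoo D.hasMean_sub D.symm_sub hs hst, hmass]

lemma densityOn_symm_add_pairIoo {s t : ℝ} (hs : 0 ≤ s) (hst : s ≤ t) :
    densityOn h (Ioo (-s) s) + densityOn h (pairIoo s t) = densityOn h (Ioo (-t) t) := by
  rw [pairIoo, densityOn_union measurableSet_Ioo (disjoint_pairIoo hs), add_left_comm,
    densityOn_Ioo_add_Ioo (by linarith) hst, densityOn_Ioo_add_Ioo (by linarith) (by linarith)]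

lemma densityOn_pairIoo_add {s t : ℝ} (hs : 0 ≤ s) (hst : s ≤ t) :
    densityOn h (pairIoo s t) + (densityOn h (Iio (-t)) + densityOn h (Ioi t))
      = densityOn h (Iio (-s)) + densityOn h (Ioi s) := by
  rw [pairIoo, densityOn_union measurableSet_Ioo (disjoint_pairIoo hs), add_add_add_comm,
    densityOn_Ioo_add_Ioi hst, add_comm (densityOn h (Ioo (-t) (-s))),
    densityOn_Iio_add_Ioo (by linarith)]

lemma densityOn_source {s : ℝ} (hs : 0 ≤ s) :
    densityOn h (Iio (-s)) + densityOn h (Ioo (-s) s) + densityOn h (Ioi s) = law h := by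
  rw [densityOn_Iio_add_Ioo (by linarith), densityOn_Iio_add_Ioi]

lemma IsDispersed.excessBeyond_eq (D : IsDispersed ρ η α β e) {y : ℝ} (hy : 0 ≤ y) :
    excessBeyond ρ η β y = densityOn (fun z => η z - ρ z) (Iio (-y))
      + densityOn (fun z => η z - ρ z) (Ioi y) := by
  have hd : Disjoint (Iio (-y)) (Ioi y) := Set.disjoint_left.2 fun z h1 h2 => by
    have h1' : z < -y := h1
    have h2' : y < z := h2
    linarith
  have hm : MeasurableSet (Iio (-y) ∪ Ioi y) := measurableSet_Iio.union measurableSet_Ioi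
  rw [← densityOn_union measurableSet_Ioi hd, excessBeyond, densityOn_eq
    (measurableSet_excess _ _), densityOn_eq hm]
  refine withDensity_congr_ae ?_
  filter_upwards [D.ae_η_zero, D.ae_ρ_zero] with z h1 h2
  by_cases hβ : z ∈ symIoo β
  · simp [indicator, hβ]
  · simp [indicator, hβ, h1 hβ, h2 hβ]

/-- Accounting for the whole target: with s and t the curtain endpoints f and g at the boundary of
the middle region, the outer lines are the images of the two curtains. The middle one is therefore
what the central part has to fill. -/
lemma IsDispersed.target_eq (D : IsDispersed ρ η α β e) {s t : ℝ} (hs : 0 ≤ s) (hst : s ≤ t)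
    (het : e ≤ t) :
    (densityOn η (Ioo (-t) (-s)) + densityOn ρ (Iio (-t)))
      + (densityOn η (Ioo (-s) s) + (densityOn (fun z => η z - ρ z) (Iio (-t))
        + densityOn (fun z => η z - ρ z) (Ioi t)))
      + (densityOn η (Ioo s t) + densityOn ρ (Ioi t)) = law η := by
  have e1 : densityOn (fun z => η z - ρ z) (Ioi t) + densityOn ρ (Ioi t) = densityOn η (Ioi t) :=
    densityOn_sub_add measurableSet_Ioi D.measurable_ρ D.measurable_η D.nonneg_ρ
      (D.ae_le_of_e_le het)
  have e2 : densityOn (fun z => η z - ρ z) (Iio (-t)) + densityOn ρ (Iio (-t))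
      = densityOn η (Iio (-t)) := by
    refine densityOn_sub_add measurableSet_Iio D.measurable_ρ D.measurable_η D.nonneg_ρ ?_
    filter_upwards [D.ae_η_zero, D.ae_ρ_zero] with z h1 h2 hz
    have hz' : z < -t := hz
    by_cases hβ : z ∈ symIoo β
    · exact (D.tails z hβ (lt_abs.2 (Or.inr (by linarith)))).le
    · rw [h1 hβ, h2 hβ]
  rw [← densityOn_source (h := η) (hs.trans hst), ← densityOn_symm_add_pairIoo (h := η) hs hst,
    pairIoo, densityOn_union measurableSet_Ioo (disjoint_pairIoo hs), ← e1, ← e2]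
  abel

lemma IsCentralCurtain.cum_sub_g (D : IsDispersed ρ η α β e)
    (H : IsCentralCurtain ρ η β e f g) {s : ℝ} (hs : s ∈ Ioo (-e) e) :
    cum (fun z => η z - ρ z) (g s) = cum η (f s) - cum ρ s := by
  have := (H s hs).mass
  rw [D.cum_sub]
  linarith

end instances

/-! ### Convex functions and lines -/

section convex

variable {φ h₁ h₂ : ℝ → ℝ} {L : ℝ → ℝ}

lemma convexOn_three (h : ConvexOn ℝ univ φ) {x y z : ℝ} (hxy : x ≤ y) (hyz : y ≤ z) :
    (z - x) * φ y ≤ (z - y) * φ x + (y - x) * φ z := by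
  rcases hxy.eq_or_lt with rfl | hxy
  · linarith
  have hzx : 0 < z - x := by linarith
  have := h.2 (mem_univ x) (mem_univ z)
    (show 0 ≤ (z - y) / (z - x) from div_nonneg (by linarith) hzx.le)
    (show 0 ≤ (y - x) / (z - x) from div_nonneg (by linarith) hzx.le) (by field_simp; ring)
  simp only [smul_eq_mul] at this
  rw [show (z - y) / (z - x) * x + (y - x) / (z - x) * z = y by field_simp; ring] at this
  have h2 := mul_le_mul_of_nonneg_left this hzx.le
  rw [mul_add, ← mul_assoc, ← mul_assoc, mul_div_cancel₀ _ hzx.ne', mul_div_cancel₀ _ hzx.ne'] at h2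
  exact h2

lemma convexOn_of_three (h : ∀ x y z : ℝ, x < y → y < z →
    (z - x) * φ y ≤ (z - y) * φ x + (y - x) * φ z) : ConvexOn ℝ univ φ := by
  refine convexOn_of_slope_mono_adjacent convex_univ fun {x y z} _ _ hxy hyz => ?_
  rw [div_le_div_iff₀ (by linarith) (by linarith)]
  have := h x y z hxy hyz
  linarith

/-- Two convex functions, the left one of which dominates the right one to the left of a common
point, glue to a convex function. -/
lemma convexOn_glue (c₁ : ConvexOn ℝ univ h₁) (c₂ : ConvexOn ℝ univ h₂) {c : ℝ}
    (hle : ∀ x < c, h₂ x ≤ h₁ x) (hc : h₁ c = h₂ c) :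
    ConvexOn ℝ univ fun x => if x < c then h₁ x else h₂ x := by
  refine convexOn_of_three fun x y z hxy hyz => ?_
  by_cases hx : x < c
  · by_cases hy : y < c
    · by_cases hz : z < c
      · simp only [if_pos hx, if_pos hy, if_pos hz]
        exact convexOn_three c₁ hxy.le hyz.le
      · simp only [if_pos hx, if_pos hy, if_neg hz]
        rw [not_lt] at hz
        -- Only this configuration, with x and y to the left of c and z to the right, combines both
        -- functions: convexity of h₁ on x, y, c is chained through c with convexity of h₂ on x, c,
        -- z.
        have t1 := convexOn_three c₁ hxy.le hy.le
        have t2 := convexOn_three c₂ hx.le hz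
        have t3 := mul_le_mul_of_nonneg_left (hle x hx) (sub_nonneg.2 hz)
        rw [← hc] at t2
        refine le_of_mul_le_mul_left ?_ (sub_pos.2 hx)
        have t4 := mul_le_mul_of_nonneg_left t1 (show 0 ≤ z - x by linarith)
        have t5 := mul_le_mul_of_nonneg_left (t2.trans (by linarith)) (show 0 ≤ y - x by linarith)
          (c := (z - c) * h₁ x + (c - x) * h₂ z)
        linarith
    · have hz : ¬ z < c := fun h => hy (hyz.trans h)
      simp only [if_pos hx, if_neg hy, if_neg hz]
      have t1 := convexOn_three c₂ hxy.le hyz.le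
      have t2 := mul_le_mul_of_nonneg_left (hle x hx) (sub_nonneg.2 hyz.le)
      linarith
  · have hy : ¬ y < c := fun h => hx (hxy.trans h)
    have hz : ¬ z < c := fun h => hy (hyz.trans h)
    simp only [if_neg hx, if_neg hy, if_neg hz]
    exact convexOn_three c₂ hxy.le hyz.le

lemma convexOn_comp_abs (h : ConvexOn ℝ univ φ) (hm : MonotoneOn φ (Ici 0)) :
    ConvexOn ℝ univ fun x => φ |x| := by
  have hc : ConvexOn ℝ univ fun x : ℝ => ‖x‖ := convexOn_norm convex_univ
  refine ⟨convex_univ, fun x _ y _ s t hs ht hst => ?_⟩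
  have h1 := hc.2 (mem_univ x) (mem_univ y) hs ht hst
  have h2 := h.2 (mem_univ |x|) (mem_univ |y|) hs ht hst
  exact (hm (mem_Ici.2 (abs_nonneg _)) (mem_Ici.2 ((abs_nonneg _).trans h1)) h1).trans h2

lemma monotoneOn_of_symm (h : ConvexOn ℝ univ φ) (hs : ∀ x, φ (-x) = φ x) :
    MonotoneOn φ (Ici 0) := by
  intro x hx y hy hxy
  have hx' : 0 ≤ x := hx
  rcases hxy.eq_or_lt with rfl | hlt
  · exact le_rfl
  have := convexOn_three h (x := -y) (y := x) (z := y) (by linarith) hxy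
  rw [hs] at this
  refine le_of_mul_le_mul_left (?_ : (y - -y) * φ x ≤ (y - -y) * φ y) (by linarith)
  linarith

/-- The graph of `L` is a line. -/
def IsLine (L : ℝ → ℝ) : Prop := ∃ c m : ℝ, ∀ t, L t = c + m * t

lemma isLine_chord (x u y v : ℝ) : IsLine (chord x u y v) :=
  ⟨u - (v - u) / (y - x) * x, (v - u) / (y - x), fun t => by rw [chord]; ring⟩

lemma chord_left (x u y v : ℝ) : chord x u y v x = u := by simp [chord]

lemma chord_right {x y : ℝ} (hxy : x < y) (u v : ℝ) : chord x u y v y = v := by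
  rw [chord, div_mul_cancel₀ _ (by linarith)]; ring

lemma IsLine.three (hL : IsLine L) (x y z : ℝ) :
    (z - x) * L y = (z - y) * L x + (y - x) * L z := by
  obtain ⟨c, m, h⟩ := hL
  rw [h, h, h]; ring

lemma IsLine.convexOn (hL : IsLine L) : ConvexOn ℝ univ L :=
  convexOn_of_three fun x y z _ _ => (hL.three x y z).le

lemma IsLine.le_between (hL : IsLine L) (h : ConvexOn ℝ univ φ) {p q t : ℝ} (hp : φ p ≤ L p)
    (hq : φ q ≤ L q) (hpt : p ≤ t) (htq : t ≤ q) : φ t ≤ L t := by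
  rcases (hpt.trans htq).eq_or_lt with rfl | hpq
  · rwa [le_antisymm htq hpt]
  have t1 := convexOn_three h hpt htq
  have t2 := hL.three p t q
  have t3 := mul_le_mul_of_nonneg_left hp (sub_nonneg.2 htq)
  have t4 := mul_le_mul_of_nonneg_left hq (sub_nonneg.2 hpt)
  exact le_of_mul_le_mul_left (by linarith) (sub_pos.2 hpq)

lemma IsLine.le_right (hL : IsLine L) (h : ConvexOn ℝ univ φ) {p q t : ℝ} (hp : φ p ≤ L p)
    (hq : L q ≤ φ q) (hpq : p < q) (hqt : q ≤ t) : L t ≤ φ t := by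
  have t1 := convexOn_three h hpq.le hqt
  have t2 := hL.three p q t
  have t3 := mul_le_mul_of_nonneg_left hp (sub_nonneg.2 hqt)
  have t4 := mul_le_mul_of_nonneg_left hq (show 0 ≤ t - p by linarith)
  exact le_of_mul_le_mul_left (by linarith) (sub_pos.2 hpq)

lemma IsLine.le_left (hL : IsLine L) (h : ConvexOn ℝ univ φ) {p q t : ℝ} (hp : L p ≤ φ p)
    (hq : φ q ≤ L q) (hpq : p < q) (htp : t ≤ p) : L t ≤ φ t := by
  have t1 := convexOn_three h htp hpq.le
  have t2 := hL.three t p q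
  have t3 := mul_le_mul_of_nonneg_left hp (show 0 ≤ q - t by linarith)
  have t4 := mul_le_mul_of_nonneg_left hq (sub_nonneg.2 htp)
  exact le_of_mul_le_mul_left (by linarith) (sub_pos.2 hpq)

lemma IsLine.mono (hL : IsLine L) {p q : ℝ} (hpq : p < q) (h : L p ≤ L q) : Monotone L := by
  obtain ⟨c, m, hcm⟩ := hL
  have hm : 0 ≤ m := by
    rw [hcm, hcm] at h
    by_contra hn
    nlinarith [not_le.1 hn]
  intro s t hst
  rw [hcm, hcm]
  nlinarith

end convex

/-! ### Exercise at time 1 along the curtains -/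

section curtain

variable {ρ η ψ : ℝ → ℝ} {α β : EReal} {e : ℝ} {f g fL gL : ℝ → ℝ}

/-- By monotonicity of f and g, every curtain started after s has its endpoints in [f s, g s], so
one line serves all of them. Where the kernel stays put, the slope is irrelevant. -/
lemma IsCentralCurtain.affine_rightKernel (D : IsDispersed ρ η α β e)
    (H : IsCentralCurtain ρ η β e f g) {s : ℝ} (hs : s ∈ Ioo (-e) e) {L : ℝ → ℝ} (hL : IsLine L)
    (hψ : ∀ y ∈ Icc (f s) (g s), ψ y = L y) {x : ℝ} (hx : s ≤ x) :
    ∃ q, ∀ᵐ y ∂(rightKernel e f g x), ψ y = ψ x + q * (y - x) := by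
  rw [rightKernel]
  split_ifs with h'
  · refine ⟨0, ?_⟩
    rw [ae_dirac_eq]
    simp
  · obtain ⟨c, m, hcm⟩ := hL
    have hxI : x ∈ Ioo (-e) e := ⟨hs.1.trans_le hx, not_le.1 h'⟩
    have P := H x hxI
    have h1 : f s ≤ f x := (H.strictMonoOn D).monotoneOn hs hxI hx
    have h2 : g x ≤ g s := (H.strictAntiOn D).antitoneOn hs hxI hx
    have h3 := P.f_lt
    have h4 := P.lt_g
    refine ⟨m, ae_twoPoint ?_ ?_⟩
    · rw [hψ _ ⟨h1, by linarith⟩, hψ x ⟨by linarith, by linarith⟩, hcm, hcm]; ring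
    · rw [hψ _ ⟨by linarith, h2⟩, hψ x ⟨by linarith, by linarith⟩, hcm, hcm]; ring

lemma IsCentralCurtain.affine_leftKernel (D : IsDispersed ρ η α β e)
    (H : IsCentralCurtain ρ η β e f g)
    (hK : ∀ x ∈ Ioo (-e) e, fL (-x) = -g x ∧ gL (-x) = -f x) {s : ℝ} (hs : s ∈ Ioo (-e) e)
    {L : ℝ → ℝ} (hL : IsLine L) (hψ : ∀ y ∈ Icc (f s) (g s), ψ y = L y)
    (hsymm : ∀ y, ψ (-y) = ψ y) {x : ℝ} (hx : x ≤ -s) :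
    ∃ q, ∀ᵐ y ∂(leftKernel e fL gL x), ψ y = ψ x + q * (y - x) := by
  rw [leftKernel]
  split_ifs with h'
  · refine ⟨0, ?_⟩
    rw [ae_dirac_eq]
    simp
  · obtain ⟨c, m, hcm⟩ := hL
    have hxI : -x ∈ Ioo (-e) e := ⟨by linarith [hs.1], by linarith [not_le.1 h']⟩
    have P := H (-x) hxI
    have h1 : f s ≤ f (-x) := (H.strictMonoOn D).monotoneOn hs hxI (by linarith)
    have h2 : g (-x) ≤ g s := (H.strictAntiOn D).antitoneOn hs hxI (by linarith)
    have h3 := P.f_lt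
    have h4 := P.lt_g
    have h5 := hK (-x) hxI
    rw [neg_neg] at h5
    rw [h5.1, h5.2]
    refine ⟨-m, ae_twoPoint ?_ ?_⟩
    · rw [hsymm, ← hsymm x, hψ _ ⟨by linarith, h2⟩, hψ (-x) ⟨by linarith, by linarith⟩, hcm, hcm]
      ring
    · rw [hsymm, ← hsymm x, hψ _ ⟨h1, by linarith⟩, hψ (-x) ⟨by linarith, by linarith⟩, hcm, hcm]
      ring

end curtain

/-! ### The payoffs -/

namespace IsPayoffPair

variable {a b : ℝ → ℝ} {β : EReal}

lemma symm_sup (P : IsPayoffPair a b β) (x : ℝ) : (a ⊔ b) (-x) = (a ⊔ b) x := by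
  simp only [Pi.sup_apply, P.symm_a, P.symm_b]

lemma b_le (x : ℝ) : b x ≤ (a ⊔ b) x := le_sup_right

lemma mono_b (P : IsPayoffPair a b β) : MonotoneOn b (Ici 0) := monotoneOn_of_symm P.convex_b P.symm_b

lemma mono_sup (P : IsPayoffPair a b β) : MonotoneOn (a ⊔ b) (Ici 0) :=
  monotoneOn_of_symm P.convex_sup P.symm_sup

lemma measurable_b (P : IsPayoffPair a b β) : Measurable b :=
  (continuous_of_convexOn P.convex_b).measurable

lemma b_abs (P : IsPayoffPair a b β) (x : ℝ) : b |x| = b x := by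
  rcases abs_choice x with h | h <;> rw [h]
  exact P.symm_b x

lemma sup_abs (P : IsPayoffPair a b β) (x : ℝ) : (a ⊔ b) |x| = (a ⊔ b) x := by
  rcases abs_choice x with h | h <;> rw [h]
  exact P.symm_sup x

end IsPayoffPair

/-! ### Assembling the transport -/

section assemble

variable {ρ η h : ℝ → ℝ} {α β : EReal} {e : ℝ} {f g fL gL : ℝ → ℝ}

/-- A density that is positive on S has there exactly the null sets of Lebesgue measure. Transport
facts for a part of μ, or for μ - ν, thus become facts about μ. -/
lemma ae_law_of_densityOn (ρ : ℝ → ℝ) {S : Set ℝ} (hm : Measurable h) (hS : MeasurableSet S)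
    (hpos : ∀ x ∈ S, 0 < h x) {Q : ℝ → Prop} (hQ : ∀ᵐ x ∂(densityOn h S), Q x) :
    ∀ᵐ x ∂(law ρ), x ∈ S → Q x := by
  rw [densityOn, ae_withDensity_iff' hm.ennreal_ofReal.aemeasurable, ae_restrict_iff' hS] at hQ
  refine (withDensity_absolutelyContinuous _ _) (hQ.mono fun x hx hxS => ?_)
  exact hx hxS (by simpa using hpos x hxS)

lemma ae_law_ne (ρ : ℝ → ℝ) (c : ℝ) : ∀ᵐ x ∂(law ρ), x ≠ c := by
  rw [law_eq_densityOn]; exact compl_mem_ae_iff.2 (measure_singleton _)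

lemma IsDispersed.integral_law_ρ (D : IsDispersed ρ η α β e) : ∫ x, x ∂(law ρ) = 0 := by
  rw [law_eq_densityOn, ← setIntegral_univ, setIntegral_densityOn D.measurable_ρ MeasurableSet.univ
    (fun z _ => D.nonneg_ρ z) MeasurableSet.univ, univ_inter, setIntegral_univ,
    integral_mul_of_symm D.symm_ρ]

/-- Once the curtains are used outside (-s, s), the construction of a case is reduced to the balance
on (-s, s). -/
lemma IsCentralCurtain.transports_law (D : IsDispersed ρ η α β e)
    (H : IsCentralCurtain ρ η β e f g)
    (hK : ∀ x ∈ Ioo (-e) e, fL (-x) = -g x ∧ gL (-x) = -f x) {s : ℝ} (hs : s ∈ Ioo 0 e)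
    (hfs : 0 ≤ f s) {κ : ℝ → Measure ℝ}
    (hl : ∀ x < -s, κ x = leftKernel e fL gL x) (hr : ∀ x > s, κ x = rightKernel e f g x)
    (hm : Transports (densityOn ρ (Ioo (-s) s)) κ (densityOn η (Ioo (-f s) (f s))
      + (densityOn (fun z => η z - ρ z) (Iio (-g s))
        + densityOn (fun z => η z - ρ z) (Ioi (g s))))) :
    Transports (law ρ) κ (law η) := by
  have hs' : s ∈ Ioo (-e) e := ⟨by linarith [hs.1, D.e_pos], hs.2⟩
  have hge := H.e_lt D hs'
  have hfg : f s ≤ g s := ((H s hs').f_lt.trans (H s hs').lt_g).le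
  have T1 : Transports (densityOn ρ (Iio (-s))) κ _ :=
    (H.transports_leftKernel D hK hs').congr <| by
      filter_upwards [ae_densityOn D.measurable_ρ measurableSet_Iio (p := fun x => x ∈ Iio (-s))
        fun x hx _ => hx] with x hx using (hl x hx).symm
  have T2 : Transports (densityOn ρ (Ioi s)) κ _ :=
    (H.transports_rightKernel D hs').congr <| by
      filter_upwards [ae_densityOn D.measurable_ρ measurableSet_Ioi (p := fun x => x ∈ Ioi s)
        fun x hx _ => hx] with x hx using (hr x hx).symm
  have T := (T1.add hm).add T2
  rwa [densityOn_source hs.1.le, D.target_eq hfs hfg hge.le] at T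

end assemble

/-! ### First case -/

section one

variable {ρ η a b : ℝ → ℝ} {α β : EReal} {e x₀ : ℝ} {fR gR fL gL p q : ℝ → ℝ}

lemma IsCurtainData.mem_central (D : IsDispersed ρ η α β e)
    (h : IsCurtainData ρ η α β e fR gR fL gL x₀) : x₀ ∈ Ioo (-e) e :=
  ⟨by linarith [h.mem.1, D.e_pos], h.mem.2⟩

lemma IsCurtainData.cum_sub_g (D : IsDispersed ρ η α β e)
    (h : IsCurtainData ρ η α β e fR gR fL gL x₀) :
    cum (fun z => η z - ρ z) (gR x₀) = 1 / 2 - cum ρ x₀ := by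
  rw [(h.central D).cum_sub_g D (h.mem_central D), h.zero, D.cum_zero.2]

lemma IsCurtainData.hkData_one (D : IsDispersed ρ η α β e)
    (h : IsCurtainData ρ η α β e fR gR fL gL x₀) :
    HKData (chiOne ρ x₀) (xiOne ρ η β fL gR x₀) x₀ (gR x₀) β := by
  have hx := h.mem_central D
  have hge := (h.central D).e_lt D hx
  have hx1 := h.mem.1
  have hx2 := h.mem.2
  have hpos : ∀ x ∈ Ioo (-x₀) x₀, 0 < ρ x := fun x hx' =>
    D.ρ_pos_of_mem ⟨by linarith [hx'.1], by linarith [hx'.2]⟩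
  rw [xiOne, (h.left_eq D hx).1]
  refine D.hkData_excess D.measurable_ρ D.integrable_ρ measurableSet_Ioo (fun x _ => D.nonneg_ρ x)
    D.symm_ρ (fun x => neg_mem_symm_Ioo) hx1 (by linarith) hge.le subset_rfl
    ⟨0, hx1, fun x hx' => ?_⟩ ?_
  · have : x ∈ Ioo (-x₀) x₀ := ⟨by linarith [hx'.1], hx'.2⟩
    exact ⟨this, hpos x this⟩
  · rw [setIntegral_symm_Ioo D.hasMean_ρ D.symm_ρ hx1.le, h.cum_sub_g D, D.integral_ρ]
    ring

lemma IsCurtainData.transports_one (D : IsDispersed ρ η α β e)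
    (h : IsCurtainData ρ η α β e fR gR fL gL x₀)
    (hpq : IsHKPair (chiOne ρ x₀) (xiOne ρ η β fL gR x₀) x₀ p q) :
    Transports (law ρ) (kernelOne e fR gR fL gL x₀ p q) (law η) := by
  have hx := h.mem_central D
  have hx1 := h.mem.1
  have hge := (h.central D).e_lt D hx
  refine (h.central D).transports_law D (fun x hx => h.left_eq D hx) h.mem h.zero.ge
    (fun x hx' => by rw [kernelOne, if_pos hx'.le])
    (fun x hx' => by rw [kernelOne, if_neg (by linarith), if_pos (le_of_lt hx')]) ?_
  have T := (h.hkData_one D).transports hpq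
  have e1 : xiOne ρ η β fL gR x₀ = excessBeyond ρ η β (gR x₀) := by
    rw [xiOne, (h.left_eq D hx).1, excessBeyond]
  rw [e1, D.excessBeyond_eq (by linarith [D.e_pos])] at T
  rw [h.zero, neg_zero, Ioo_self]
  have e2 : densityOn η ∅ = 0 := by simp [densityOn]
  rw [e2, zero_add]
  refine T.congr ?_
  filter_upwards [(h.hkData_one D).carrier_χ] with x hx'
  rw [kernelOne, if_neg (not_le.2 hx'.1), if_neg (not_le.2 hx'.2)]

lemma IsCurtainData.step_outer (D : IsDispersed ρ η α β e)
    (h : IsCurtainData ρ η α β e fR gR fL gL x₀) {s x : ℝ} (hs : s ∈ Ioo 0 e) :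
    (x ≤ -s → IsMartingaleStep (leftKernel e fL gL x) x) ∧
      (s ≤ x → IsMartingaleStep (rightKernel e fR gR x) x) :=
  ⟨fun hx => (h.central D).step_leftKernel (fun x hx => h.left_eq D hx)
    (by linarith [hs.1, D.e_pos]), fun hx => (h.central D).step_rightKernel
    (by linarith [hs.1, D.e_pos])⟩

/-- As l(0) ≥ A(0) and l meets A at x₀, convexity gives A ≤ l on [0, x₀] and l ≤ A beyond; similarly
b ≤ l up to g(x₀) and l ≤ b beyond. The bound l(0) ≤ A(x₀) makes l nondecreasing, so ψ* is max(b, l)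
on the positive half-line. Curtain endpoints from the right lie in [0, g(x₀)], where ψ* = l;
Hobson–Klimmek endpoints lie beyond ±g(x₀), where ψ* = b. -/
theorem IsCurtainData.optimal_one (D : IsDispersed ρ η α β e) (P : IsPayoffPair a b β)
    (h : IsCurtainData ρ η α β e fR gR fL gL x₀)
    (h1 : (a ⊔ b) 0 ≤ payoffLine (a ⊔ b) b gR x₀ 0)
    (h2 : payoffLine (a ⊔ b) b gR x₀ 0 ≤ (a ⊔ b) x₀)
    (hpq : IsHKPair (chiOne ρ x₀) (xiOne ρ η β fL gR x₀) x₀ p q) :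
    OptimalWithoutOrder.{u} (law ρ) (law η) a b
      (canonicalModel (coupling (law ρ) (kernelOne e fR gR fL gL x₀ p q)))
      (exerciseOutside x₀) (psiOne b (payoffLine (a ⊔ b) b gR x₀)) := by
  have := D.prob_ρ
  have hx := h.mem_central D
  have hx1 := h.mem.1
  have hC := h.central D
  have hge := hC.e_lt D hx
  have hxg : x₀ < gR x₀ := h.mem.2.trans hge
  set l := payoffLine (a ⊔ b) b gR x₀ with hl
  have hline : IsLine l := isLine_chord _ _ _ _
  have lx : l x₀ = (a ⊔ b) x₀ := chord_left _ _ _ _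
  have lg : l (gR x₀) = b (gR x₀) := chord_right hxg _ _
  have lmono : Monotone l := hline.mono hx1 (by rw [lx]; exact h2)
  have hT := h.transports_one D hpq
  have hψ0 : ∀ x, 0 ≤ x → psiOne b l x = max (b x) (l x) := fun x hx0 => by
    rw [psiOne, max_eq_left (a := l x) (lmono (by linarith))]
  have hψs : ∀ x, psiOne b l (-x) = psiOne b l x := fun x => by
    rw [psiOne, psiOne, P.symm_b, neg_neg, max_comm (l (-x))]
  have hb0 : b 0 ≤ l 0 := (IsPayoffPair.b_le 0).trans h1
  have hψl : ∀ y ∈ Icc (fR x₀) (gR x₀), psiOne b l y = l y := by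
    intro y hy
    rw [h.zero] at hy
    rw [hψ0 y hy.1, max_eq_right (hline.le_between P.convex_b hb0 lg.ge hy.1 hy.2)]
  have hψabs : ∀ x, psiOne b l |x| = psiOne b l x := fun x => by
    rcases abs_choice x with h | h <;> rw [h]
    exact hψs x
  have hψb : ∀ y, gR x₀ ≤ |y| → psiOne b l y = b y := by
    intro y hy
    rw [← hψabs, hψ0 _ (abs_nonneg y), max_eq_left
      (hline.le_right P.convex_b hb0 lg.le (by linarith) hy), P.b_abs]
  have hcl : ConvexOn ℝ univ fun x => l (-x) := by
    obtain ⟨c, m, hcm⟩ := hline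
    exact IsLine.convexOn ⟨c, -m, fun t => by simp only [hcm]; ring⟩
  refine optimal_canonicalModel hT.1 hT.2 D.order.integrable_left D.order.integrable_right
    D.integral_law_ρ (ae_of_all _ fun x => ?_) (C := (Ioo (-x₀) x₀)ᶜ) measurableSet_Ioo.compl
    (fun ω hω => if_neg hω) (fun ω hω => if_pos (not_not.1 hω)) P.measurable_a P.measurable_b
    P.nonneg_a P.nonneg_b P.convex_b (P.convex_b.sup (hline.convexOn.sup hcl))
    (fun x => le_max_left _ _) (ae_of_all _ fun x hxC => ⟨?_, ?_⟩) ?_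
  · have hout := h.step_outer D h.mem (x := x)
    rw [kernelOne]
    split_ifs with c1 c2
    · exact hout.1 c1
    · exact hout.2 c2
    · exact hpq.step ⟨not_le.1 c1, not_le.1 c2⟩
  · have hxx : x₀ ≤ |x| := by
      by_contra hn
      exact hxC (abs_lt.1 (not_le.1 hn))
    rw [← hψabs, ← P.sup_abs, hψ0 _ (abs_nonneg x)]
    exact max_le (IsPayoffPair.b_le _) (hline.le_right P.convex_sup h1 lx.le hx1 hxx)
  · rw [kernelOne]
    split_ifs with c1 c2
    · exact hC.affine_leftKernel D (fun x hx => h.left_eq D hx) hx hline hψl hψs c1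
    · exact hC.affine_rightKernel D hx hline hψl c2
    · exact absurd ⟨not_le.1 c1, not_le.1 c2⟩ hxC
  · have hae := ((h.hkData_one D).transports hpq).ae (p := fun y => psiOne b l y = b y)
      ((h.hkData_one D).carrier_ξ.mono fun y hy => hψb y hy.1.le)
    have hρ : ∀ x ∈ Ioo (-x₀) x₀, 0 < ρ x := fun x hx' =>
      D.ρ_pos_of_mem ⟨by linarith [hx'.1, h.mem.2], by linarith [hx'.2, h.mem.2]⟩
    filter_upwards [ae_law_of_densityOn ρ D.measurable_ρ measurableSet_Ioo hρ hae] with x hx' hxC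
    have hxI : x ∈ Ioo (-x₀) x₀ := not_not.1 hxC
    refine ⟨?_, ?_⟩
    · rw [← hψabs, ← P.sup_abs, hψ0 _ (abs_nonneg x)]
      exact le_max_of_le_right (hline.le_between P.convex_sup h1 lx.ge (abs_nonneg x)
        (abs_lt.2 hxI).le)
    · rw [kernelOne, if_neg (not_le.2 hxI.1), if_neg (not_le.2 hxI.2)]
      exact hx' hxI

end one

/-! ### Second case -/

section level

variable {ρ η a b : ℝ → ℝ} {α β : EReal} {e x₀ x₁ y₁ : ℝ} {fR gR fL gL : ℝ → ℝ}

lemma IsDispersed.cum_sub_lt_zero (D : IsDispersed ρ η α β e) {y : ℝ} (h : e ≤ y)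
    (hy : y ∈ symIoo β) : cum (fun z => η z - ρ z) y < 0 := by
  obtain ⟨t, ht, htβ⟩ := exists_gt_mem_symIoo hy
  have h0 : 0 ≤ y := D.e_pos.le.trans h
  rw [abs_of_nonneg h0] at ht
  have h1 := D.hasMean_sub.cum_lt ht (D.sub_pos_of_mem h htβ)
  have h2 := D.cum_sub_nonneg (x := -t) (by linarith)
  rw [D.cum_sub_neg] at h2
  linarith

lemma IsDispersed.exists_cum_sub_eq (D : IsDispersed ρ η α β e) {θ : ℝ}
    (h0 : cum (fun z => η z - ρ z) e < θ) (h1 : θ < 0) :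
    ∃ y, e < y ∧ y ∈ symIoo β ∧ cum (fun z => η z - ρ z) y = θ := by
  have C := hkData_core D
  have := C.finite_ξ
  have := C.null_ξ
  obtain ⟨y, hy⟩ := exists_real_Iio_eq (m := (excessBeyond ρ η β e).restrict (Ioi 0))
    (θ := θ - cum (fun z => η z - ρ z) e) (by linarith) (by rw [D.real_upper_univ]; linarith)
  obtain ⟨h2, h3⟩ := C.mem_of_real_Iio (y := y) (by rw [hy]; linarith)
    (by rw [hy, D.real_upper_univ]; linarith)
  rw [D.real_upper h2.le] at hy
  exact ⟨y, h2, (mem_symIoo_of_nonneg (D.e_pos.trans h2).le).2 h3, by linarith⟩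

lemma IsDispersed.strictMonoOn_cum_ρ (D : IsDispersed ρ η α β e) :
    StrictMonoOn (cum ρ) (Ioo (-e) e) := fun _ hs _ ht hst =>
  D.hasMean_ρ.cum_lt hst fun _ hz => D.ρ_pos_of_mem ⟨(hs.1.trans hz.1).le, (hz.2.trans ht.2).le⟩

lemma IsCurtainData.level_mass_iff (D : IsDispersed ρ η α β e)
    (h : IsCurtainData ρ η α β e fR gR fL gL x₀) (h1 : x₁ ≤ x₀) (h2 : gR x₀ ≤ y₁) :
    (law ρ).real (Ioo x₁ x₀) = (law η).real (Ioo (gR x₀) y₁) - (law ρ).real (Ioo (gR x₀) y₁) ↔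
      cum ρ x₁ = 1 / 2 - cum (fun z => η z - ρ z) y₁ := by
  rw [real_law D.measurable_ρ D.nonneg_ρ measurableSet_Ioo,
    real_law D.measurable_ρ D.nonneg_ρ measurableSet_Ioo,
    real_law D.measurable_η D.nonneg_η measurableSet_Ioo, D.hasMean_ρ.setIntegral_Ioo h1,
    D.hasMean_ρ.setIntegral_Ioo h2, D.hasMean_η.setIntegral_Ioo h2, D.cum_sub]
  have := h.cum_sub_g D
  rw [D.cum_sub] at this
  constructor <;> intro <;> linarith

/-- The mass condition defines a continuous X(t), equal to x₀ at t = g(x₀) and small for t near β.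
The level condition is a zero of b(t) - A(X(t)), which is negative at g(x₀) and positive near β
because b exceeds A(0) there. -/
theorem IsCurtainData.exists_isLevel (D : IsDispersed ρ η α β e) (P : IsPayoffPair a b β)
    (h : IsCurtainData ρ η α β e fR gR fL gL x₀)
    (hl : (a ⊔ b) x₀ < payoffLine (a ⊔ b) b gR x₀ 0) :
    ∃ x₁ y₁ : ℝ, IsLevel ρ η (a ⊔ b) b β gR x₀ x₁ y₁ := by
  have he := D.e_pos
  have hx := h.mem_central D
  have hx1 := h.mem.1
  have hge := (h.central D).e_lt D hx
  have hgβ := (h.central D x₀ hx).g_mem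
  have hxg : x₀ < gR x₀ := hx.2.trans hge
  -- The line starts at 0 above its value at x₀, so it descends and is lower still at g(x₀).
  have hbA : b (gR x₀) < (a ⊔ b) x₀ := by
    have t := (isLine_chord x₀ ((a ⊔ b) x₀) (gR x₀) (b (gR x₀))).three 0 x₀ (gR x₀)
    rw [chord_left, chord_right hxg] at t
    rw [payoffLine] at hl
    have := mul_lt_mul_of_pos_left hl (sub_pos.2 hxg)
    refine lt_of_mul_lt_mul_left ?_ hx1.le
    linarith
  obtain ⟨y', hy'0, hy'β, hy'⟩ := P.nontrivial
  have hAc : Continuous (a ⊔ b) := continuous_of_convexOn P.convex_sup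
  obtain ⟨δ, hδ, hδA⟩ := Metric.eventually_nhds_iff.1
    (hAc.continuousAt.eventually_lt continuousAt_const hy' : ∀ᶠ x in nhds 0, (a ⊔ b) x < b y')
  set d := min (δ / 2) x₀ with hd
  have hd0 : 0 < d := lt_min (by linarith) hx1
  have hdm : d ∈ Ioo (-e) e := ⟨by linarith, (min_le_right _ _).trans_lt hx.2⟩
  have hd1 : 1 / 2 < cum ρ d := by
    rw [← D.cum_zero.1]
    exact D.strictMonoOn_cum_ρ ⟨by linarith, he⟩ hdm hd0
  -- Half of a negative number exceeds it: this level is negative, above the surplus value at e, and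
  -- above 1/2 - cum ρ d, which forces X below d.
  obtain ⟨y, hye, hyβ, hy⟩ := D.exists_cum_sub_eq
    (θ := max (cum (fun z => η z - ρ z) e) (1 / 2 - cum ρ d) / 2)
    (by have := D.cum_sub_e_neg; have := le_max_left (cum (fun z => η z - ρ z) e) (1 / 2 - cum ρ d)
        linarith)
    (by have : max (cum (fun z => η z - ρ z) e) (1 / 2 - cum ρ d) < 0 :=
          max_lt D.cum_sub_e_neg (by linarith)
        linarith)
  have hyd : 1 / 2 - cum (fun z => η z - ρ z) y < cum ρ d := by
    have h1 : max (cum (fun z => η z - ρ z) e) (1 / 2 - cum ρ d) < 0 :=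
      max_lt D.cum_sub_e_neg (by linarith)
    have h2 := le_max_right (cum (fun z => η z - ρ z) e) (1 / 2 - cum ρ d)
    rw [hy]; linarith
  -- Far enough out for X(y₂) < d, for y₂ ≥ g(x₀), and for b(y₂) ≥ b(y'), which exceeds A within δ
  -- of 0.
  set y₂ := max y (max (gR x₀) y') with hy₂
  have hyy : y ≤ y₂ := le_max_left _ _
  have hgy : gR x₀ ≤ y₂ := (le_max_left _ _).trans (le_max_right _ _)
  have hy'y : y' ≤ y₂ := (le_max_right _ _).trans (le_max_right _ _)
  have hy₂β : y₂ ∈ symIoo β := by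
    rw [hy₂]
    rcases max_choice y (max (gR x₀) y') with h | h <;> rw [h]
    · exact hyβ
    · rcases max_choice (gR x₀) y' with h | h <;> rw [h]
      · exact hgβ
      · exact (mem_symIoo_of_nonneg hy'0.le).2 hy'β
  have hmem : ∀ t ∈ Icc (gR x₀) y₂, t ∈ symIoo β := fun t ht =>
    mem_symIoo_of_mem_Icc hgβ hy₂β ht
  have hkg := h.cum_sub_g D
  have hρc := D.hasMean_ρ.continuous_cum
  have hX : ∀ t ∈ Icc (gR x₀) y₂, ∃ x ∈ Icc 0 x₀,
      cum ρ x = 1 / 2 - cum (fun z => η z - ρ z) t := by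
    intro t ht
    have h1 := D.cum_sub_lt_zero (hge.le.trans ht.1) (hmem t ht)
    have h2 := D.hasMean_sub.cum_le ht.1 fun z hz => (D.sub_pos_of_mem hge.le (hmem t ht) z hz).le
    exact intermediate_value_Icc hx1.le hρc.continuousOn
      ⟨by rw [D.cum_zero.1]; linarith, by linarith⟩
  choose! X hXm hX using hX
  have hXe : MapsTo X (Icc (gR x₀) y₂) (Ioo (-e) e) := fun t ht =>
    ⟨by linarith [(hXm t ht).1], (hXm t ht).2.trans_lt hx.2⟩
  have hXc : ContinuousOn X (Icc (gR x₀) y₂) :=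
    continuousOn_of_strictMonoOn_comp isOpen_Ioo D.strictMonoOn_cum_ρ hXe
      ((continuousOn_const.sub D.hasMean_sub.continuous_cum.continuousOn).congr hX)
  have hX0 : X (gR x₀) = x₀ := by
    have hm : gR x₀ ∈ Icc (gR x₀) y₂ := ⟨le_rfl, hgy⟩
    refine D.strictMonoOn_cum_ρ.injOn (hXe hm) hx ?_
    rw [hX _ hm, hkg]; ring
  have hy₂A : (a ⊔ b) (X y₂) < b y₂ := by
    have hm : y₂ ∈ Icc (gR x₀) y₂ := ⟨hgy, le_rfl⟩
    have h1 : cum (fun z => η z - ρ z) y ≤ cum (fun z => η z - ρ z) y₂ :=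
      D.hasMean_sub.cum_le hyy fun z hz => (D.sub_pos_of_mem hye.le hy₂β z hz).le
    have h2 : X y₂ < d := D.cum_ρ_mono.reflect_lt (by rw [hX _ hm]; linarith)
    have h3 : dist (X y₂) 0 < δ := by
      rw [Real.dist_eq, sub_zero, abs_of_nonneg (hXm _ hm).1]
      linarith [min_le_left (δ / 2) x₀]
    exact (hδA h3).trans_le (P.mono_b hy'0.le (hy'0.le.trans hy'y) hy'y)
  have hlt : gR x₀ < y₂ := by
    refine lt_of_le_of_ne hgy fun hne => ?_
    rw [← hne, hX0] at hy₂A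
    linarith
  have hbc := continuous_of_convexOn P.convex_b
  obtain ⟨t, ht, ht0⟩ := intermediate_value_Ioo hgy (f := fun y => b y - (a ⊔ b) (X y))
    (hbc.continuousOn.sub (hAc.comp_continuousOn hXc))
    (show (0 : ℝ) ∈ Ioo _ _ from ⟨by rw [hX0]; linarith, by linarith⟩)
  have htm := Ioo_subset_Icc_self ht
  have hXt := hX t htm
  have k1 := D.cum_sub_lt_zero (hge.le.trans ht.1.le) (hmem t htm)
  have k2 := D.hasMean_sub.cum_lt ht.1 fun z hz => D.sub_pos_of_mem hge.le (hmem t htm) z hz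
  have hpos : 0 < t := he.trans (hge.trans ht.1)
  refine ⟨X t, t, ⟨D.cum_ρ_mono.reflect_lt ?_, D.cum_ρ_mono.reflect_lt ?_⟩, ht.1.le,
    (mem_symIoo_of_nonneg hpos.le).1 (hmem t htm), ?_, ?_⟩
  · rw [hXt, D.cum_zero.1]; linarith
  · rw [hXt]; linarith
  · exact (h.level_mass_iff D (hXm t htm).2 ht.1.le).2 hXt
  · have : b t - (a ⊔ b) (X t) = 0 := ht0
    linarith

end level

/-! ### Second case: couplings and optimality. -/

section two

variable {ρ η a b : ℝ → ℝ} {α β : EReal} {e x₀ x₁ y₁ : ℝ} {fR gR fL gL p₀ q₀ p₁ q₁ : ℝ → ℝ}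

lemma IsCurtainData.cum_level (D : IsDispersed ρ η α β e)
    (h : IsCurtainData ρ η α β e fR gR fL gL x₀) (V : IsLevel ρ η (a ⊔ b) b β gR x₀ x₁ y₁) :
    cum ρ x₁ = 1 / 2 - cum (fun z => η z - ρ z) y₁ :=
  (h.level_mass_iff D V.mem.2.le V.le).1 V.mass

lemma IsCurtainData.hkData_two_outer (D : IsDispersed ρ η α β e)
    (h : IsCurtainData ρ η α β e fR gR fL gL x₀) (V : IsLevel ρ η (a ⊔ b) b β gR x₀ x₁ y₁) :
    HKData (chiTwoOuter ρ x₀ x₁) (xiTwoOuter ρ η fL gR x₀ y₁) x₀ (gR x₀) y₁ := by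
  have hx := h.mem_central D
  have hge := (h.central D).e_lt D hx
  have hx1 := V.mem.1
  have hx2 := V.mem.2
  have hx3 := h.mem.2
  have he := D.e_pos
  have hV := h.cum_level D V
  rw [xiTwoOuter, (h.left_eq D hx).1]
  refine D.hkData_pairIoo D.measurable_ρ D.integrable_ρ (measurableSet_pairIoo x₁ x₀)
    (fun x _ => D.nonneg_ρ x) D.symm_ρ (fun x => neg_mem_pairIoo) h.mem.1 (by linarith) hge.le V.le
    ((mem_symIoo_of_nonneg (by linarith [V.le])).2 V.lt)
    (fun x hx' => abs_lt.1 (abs_of_mem_pairIoo hx1.le hx').2)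
    ⟨x₁, hx2, fun x hx' => ⟨Or.inr hx', D.ρ_pos_of_mem ⟨by linarith [hx'.1], by linarith [hx'.2]⟩⟩⟩
    ?_
  rw [← pairIoo, setIntegral_pairIoo D.hasMean_ρ D.symm_ρ hx1.le hx2.le, h.cum_sub_g D, hV]
  ring

lemma IsCurtainData.hkData_two_inner (D : IsDispersed ρ η α β e)
    (h : IsCurtainData ρ η α β e fR gR fL gL x₀) (V : IsLevel ρ η (a ⊔ b) b β gR x₀ x₁ y₁) :
    HKData (chiTwoInner ρ x₁) (excessBeyond ρ η β y₁) x₁ y₁ β := by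
  have hx := h.mem_central D
  have hge := (h.central D).e_lt D hx
  have hx1 := V.mem.1
  have hx2 := V.mem.2
  have hx3 := h.mem.2
  have hV := h.cum_level D V
  have hgy := V.le
  refine D.hkData_excess D.measurable_ρ D.integrable_ρ measurableSet_Ioo (fun x _ => D.nonneg_ρ x)
    D.symm_ρ (fun x => neg_mem_symm_Ioo) hx1 (by linarith) (by linarith) subset_rfl
    ⟨0, hx1, fun x hx' => ⟨⟨by linarith [hx'.1], hx'.2⟩,
      D.ρ_pos_of_mem ⟨by linarith [hx'.1, D.e_pos], by linarith [hx'.2]⟩⟩⟩ ?_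
  rw [setIntegral_symm_Ioo D.hasMean_ρ D.symm_ρ hx1.le, hV, D.integral_ρ]
  ring

lemma IsCurtainData.transports_two (D : IsDispersed ρ η α β e)
    (h : IsCurtainData ρ η α β e fR gR fL gL x₀) (V : IsLevel ρ η (a ⊔ b) b β gR x₀ x₁ y₁)
    (hpq₀ : IsHKPair (chiTwoOuter ρ x₀ x₁) (xiTwoOuter ρ η fL gR x₀ y₁) x₀ p₀ q₀)
    (hpq₁ : IsHKPair (chiTwoInner ρ x₁) (excessBeyond ρ η β y₁) x₁ p₁ q₁) :
    Transports (law ρ) (kernelTwo e fR gR fL gL x₀ x₁ p₀ q₀ p₁ q₁) (law η) := by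
  have hx := h.mem_central D
  have hx1 := V.mem.1
  have hx2 := V.mem.2
  have hge := (h.central D).e_lt D hx
  have he := D.e_pos
  refine (h.central D).transports_law D (fun x hx => h.left_eq D hx) h.mem h.zero.ge
    (fun x hx' => by rw [kernelTwo, if_pos hx'.le])
    (fun x hx' => by rw [kernelTwo, if_neg (by linarith [h.mem.1]), if_pos (le_of_lt hx')]) ?_
  have T1 : Transports (chiTwoInner ρ x₁) (kernelTwo e fR gR fL gL x₀ x₁ p₀ q₀ p₁ q₁)
      (excessBeyond ρ η β y₁) := by
    refine ((h.hkData_two_inner D V).transports hpq₁).congr ?_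
    filter_upwards [(h.hkData_two_inner D V).carrier_χ] with x hx'
    rw [kernelTwo, if_neg (by linarith [hx'.1]), if_neg (by linarith [hx'.2]), if_pos hx']
  have T0 : Transports (chiTwoOuter ρ x₀ x₁) (kernelTwo e fR gR fL gL x₀ x₁ p₀ q₀ p₁ q₁)
      (xiTwoOuter ρ η fL gR x₀ y₁) := by
    refine ((h.hkData_two_outer D V).transports hpq₀).congr ?_
    filter_upwards [ae_densityOn D.measurable_ρ (measurableSet_pairIoo x₁ x₀)
      (p := fun x => x ∈ pairIoo x₁ x₀) fun x hx _ => hx] with x hx'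
    obtain ⟨h1, h2⟩ := abs_of_mem_pairIoo hx1.le hx'
    have h3 := abs_lt.1 h2
    rw [kernelTwo, if_neg (by linarith), if_neg (by linarith),
      if_neg fun hn : x ∈ Ioo (-x₁) x₁ => h1.not_gt (abs_lt.2 hn)]
  have T := T1.add T0
  rw [chiTwoInner, chiTwoOuter, ← pairIoo, densityOn_symm_add_pairIoo hx1.le hx2.le, xiTwoOuter,
    (h.left_eq D hx).1, ← pairIoo, add_comm (excessBeyond ρ η β y₁),
    D.excessBeyond_eq (by linarith [V.le]), densityOn_pairIoo_add (by linarith) V.le] at T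
  rw [h.zero, neg_zero, Ioo_self]
  have e2 : densityOn η ∅ = 0 := by simp [densityOn]
  rwa [e2, zero_add]

/-- The level identity b(y₁) = A(x₁) makes ψ* constant on [-y₁, y₁] and equal to b beyond. Curtain
endpoints and the endpoints of the outer Hobson–Klimmek coupling that matter at exercise stay in the
flat part; those of the inner coupling lie where ψ* = b. -/
theorem IsCurtainData.optimal_two (D : IsDispersed ρ η α β e) (P : IsPayoffPair a b β)
    (h : IsCurtainData ρ η α β e fR gR fL gL x₀) (V : IsLevel ρ η (a ⊔ b) b β gR x₀ x₁ y₁)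
    (hpq₀ : IsHKPair (chiTwoOuter ρ x₀ x₁) (xiTwoOuter ρ η fL gR x₀ y₁) x₀ p₀ q₀)
    (hpq₁ : IsHKPair (chiTwoInner ρ x₁) (excessBeyond ρ η β y₁) x₁ p₁ q₁) :
    OptimalWithoutOrder.{u} (law ρ) (law η) a b
      (canonicalModel (coupling (law ρ) (kernelTwo e fR gR fL gL x₀ x₁ p₀ q₀ p₁ q₁)))
      (exerciseOutside x₁) (psiTwo (a ⊔ b) b x₁) := by
  have := D.prob_ρ
  have hx := h.mem_central D
  have hx1 := V.mem.1
  have hx2 := V.mem.2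
  have hC := h.central D
  have hge := hC.e_lt D hx
  have hxg : x₀ < gR x₀ := h.mem.2.trans hge
  have hgy := V.le
  have hT := h.transports_two D V hpq₀ hpq₁
  have hψs : ∀ x, psiTwo (a ⊔ b) b x₁ (-x) = psiTwo (a ⊔ b) b x₁ x := fun x => by
    rw [psiTwo, P.symm_b]; rfl
  have hψc : ∀ y, |y| ≤ y₁ → psiTwo (a ⊔ b) b x₁ y = (a ⊔ b) x₁ := by
    intro y hy
    rw [psiTwo, max_eq_right]
    rw [← P.b_abs, ← V.level]
    exact P.mono_b (abs_nonneg y) ((abs_nonneg y).trans hy) hy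
  have hψb : ∀ y, y₁ ≤ |y| → psiTwo (a ⊔ b) b x₁ y = b y := by
    intro y hy
    rw [psiTwo, max_eq_left]
    rw [← P.b_abs y, ← V.level]
    exact P.mono_b (by linarith : (0 : ℝ) ≤ y₁) (abs_nonneg y) hy
  have hline : IsLine fun _ => (a ⊔ b) x₁ := ⟨(a ⊔ b) x₁, 0, fun t => by ring⟩
  have hψl : ∀ y ∈ Icc (fR x₀) (gR x₀), psiTwo (a ⊔ b) b x₁ y = (a ⊔ b) x₁ := by
    intro y hy
    rw [h.zero] at hy
    exact hψc y (by rw [abs_of_nonneg hy.1]; exact hy.2.trans hgy)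
  have hρ : ∀ x, |x| < x₀ → 0 < ρ x := fun x hx' => by
    have := abs_lt.1 hx'
    exact D.ρ_pos_of_mem ⟨by linarith [h.mem.2], by linarith [h.mem.2]⟩
  have hO := ae_law_of_densityOn ρ D.measurable_ρ (measurableSet_pairIoo x₁ x₀)
    (fun x hx' => hρ x (abs_of_mem_pairIoo hx1.le hx').2)
    (((h.hkData_two_outer D V).transports hpq₀).ae
      (p := fun y => psiTwo (a ⊔ b) b x₁ y = (a ⊔ b) x₁)
      ((h.hkData_two_outer D V).carrier_ξ.mono fun y hy =>
        hψc y (EReal.coe_le_coe_iff.1 hy.2.le)))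
  have hI := ae_law_of_densityOn ρ D.measurable_ρ measurableSet_Ioo
    (fun x hx' => hρ x ((abs_lt.2 hx').trans hx2))
    (((h.hkData_two_inner D V).transports hpq₁).ae
      (p := fun y => psiTwo (a ⊔ b) b x₁ y = b y)
      ((h.hkData_two_inner D V).carrier_ξ.mono fun y hy => hψb y hy.1.le))
  refine optimal_canonicalModel hT.1 hT.2 D.order.integrable_left D.order.integrable_right
    D.integral_law_ρ (ae_of_all _ fun x => ?_) (C := (Ioo (-x₁) x₁)ᶜ) measurableSet_Ioo.compl
    (fun ω hω => if_neg hω) (fun ω hω => if_pos (not_not.1 hω)) P.measurable_a P.measurable_b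
    P.nonneg_a P.nonneg_b P.convex_b (P.convex_b.sup (convexOn_const _ convex_univ))
    (fun x => le_max_left _ _) ?_ ?_
  · have hout := h.step_outer D h.mem (x := x)
    rw [kernelTwo]
    split_ifs with c1 c2 c3
    · exact hout.1 c1
    · exact hout.2 c2
    · exact hpq₁.step c3
    · exact hpq₀.step ⟨not_le.1 c1, not_le.1 c2⟩
  · filter_upwards [hO, ae_law_ne ρ x₁, ae_law_ne ρ (-x₁)] with x hxO hne hne' hxC
    have hxx : x₁ ≤ |x| := by
      by_contra hn
      exact hxC (abs_lt.1 (not_le.1 hn))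
    have hAx : (a ⊔ b) x₁ ≤ (a ⊔ b) x := by
      rw [← P.sup_abs x]
      exact P.mono_sup hx1.le (abs_nonneg x) hxx
    refine ⟨max_le (IsPayoffPair.b_le _) hAx, ?_⟩
    rw [kernelTwo]
    split_ifs with c1 c2 c3
    · exact hC.affine_leftKernel D (fun x hx => h.left_eq D hx) hx hline hψl hψs c1
    · exact hC.affine_rightKernel D hx hline hψl c2
    · exact absurd c3 hxC
    · refine ⟨0, ?_⟩
      have hxm : x ∈ pairIoo x₁ x₀ := by
        rcases le_abs.1 hxx with h' | h'
        · exact Or.inr ⟨lt_of_le_of_ne h' hne.symm, not_le.1 c2⟩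
        · exact Or.inl ⟨not_le.1 c1, lt_of_le_of_ne (by linarith) hne'⟩
      have hlt := (abs_of_mem_pairIoo hx1.le hxm).2
      filter_upwards [hxO hxm] with y hy
      rw [hy, hψc x (by linarith)]
      ring
  · filter_upwards [hI] with x hx' hxC
    have hxI : x ∈ Ioo (-x₁) x₁ := not_not.1 hxC
    refine ⟨?_, ?_⟩
    · rw [← P.sup_abs x]
      exact le_max_of_le_right (P.mono_sup (abs_nonneg x) hx1.le (abs_lt.2 hxI).le)
    · rw [kernelTwo, if_neg (by linarith [hxI.1]), if_neg (by linarith [hxI.2]), if_pos hxI]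
      exact hx' hxI

end two

/-! ### Randomized couplings -/

section randomized

variable {ρ η : ℝ → ℝ} {α β : EReal} {e : ℝ} {f g fL gL p q : ℝ → ℝ}

lemma ae_prod_snd {χ : Measure ℝ} [SFinite χ] {Q : ℝ → Prop} (h : ∀ᵐ x ∂χ, Q x) :
    ∀ᵐ w ∂((volume.restrict (Ioo (0 : ℝ) 1)).prod χ), Q w.2 :=
  Measure.quasiMeasurePreserving_snd.ae h

/-- Graphs are null for the product with Lebesgue measure, so ties U = η/ρ between staying and
moving can be ignored. -/
lemma ae_prod_ne {χ : Measure ℝ} [SFinite χ] {φ : ℝ → ℝ} (hφ : Measurable φ) :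
    ∀ᵐ w ∂((volume.restrict (Ioo (0 : ℝ) 1)).prod χ), w.1 ≠ φ w.2 := by
  have hS : MeasurableSet {w : ℝ × ℝ | w.1 = φ w.2} :=
    measurableSet_eq_fun measurable_fst (hφ.comp measurable_snd)
  have h0 : ((volume.restrict (Ioo (0 : ℝ) 1)).prod χ) {w : ℝ × ℝ | w.1 = φ w.2} = 0 := by
    rw [Measure.prod_apply_symm hS]
    refine lintegral_eq_zero_of_ae_eq_zero (ae_of_all _ fun x => ?_)
    have : (fun u : ℝ => (u, x)) ⁻¹' {w : ℝ × ℝ | w.1 = φ w.2} = {φ x} := by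
      ext u; simp
    simp only [this, Pi.zero_apply]
    exact measure_singleton _
  exact compl_mem_ae_iff.2 h0

lemma HKData.transports_randomized (D : IsDispersed ρ η α β e) {s d : ℝ} {δ : EReal} (hs : s ≤ e)
    {ξ : Measure ℝ} (h : HKData (densityOn (fun x => ρ x - η x) (Ioo (-s) s)) ξ s d δ)
    (hpq : IsHKPair (densityOn (fun x => ρ x - η x) (Ioo (-s) s)) ξ s p q)
    {κ : ℝ × ℝ → Measure ℝ} (hκ : ∀ w : ℝ × ℝ, w.2 ∈ Ioo (-s) s →
      κ w = if w.1 ≤ η w.2 / ρ w.2 then Measure.dirac w.2 else hkKernel p q w.2) :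
    Transports ((volume.restrict (Ioo (0 : ℝ) 1)).prod (densityOn ρ (Ioo (-s) s))) κ
      (densityOn η (Ioo (-s) s) + ξ) := by
  have := isFiniteMeasure_densityOn (S := Ioo (-s) s) D.integrable_ρ
  obtain ⟨K, hK, hKe⟩ := exists_measurable_hkKernel hpq
  refine (Bermudan.transports_randomized measurableSet_Ioo D.measurable_ρ D.measurable_η D.nonneg_η
    (fun x hx => D.center x ⟨by linarith [hx.1], by linarith [hx.2]⟩) hK
    ((h.transports hpq).congr (h.carrier_χ.mono fun x hx => (hKe x hx).symm))).congr ?_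
  filter_upwards [ae_prod_snd (ae_densityOn D.measurable_ρ measurableSet_Ioo
    (p := fun x => x ∈ Ioo (-s) s) fun x hx _ => hx)] with w hw
  rw [hκ w hw, hKe _ hw]

/-- Kernels equal to the curtain kernels outside `(-s, s)`. -/
lemma IsCentralCurtain.transports_prod_law (D : IsDispersed ρ η α β e)
    (H : IsCentralCurtain ρ η β e f g)
    (hK : ∀ x ∈ Ioo (-e) e, fL (-x) = -g x ∧ gL (-x) = -f x) {s : ℝ} (hs : s ∈ Ioo 0 e)
    (hfs : 0 ≤ f s) {κ : ℝ × ℝ → Measure ℝ}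
    (hl : ∀ w : ℝ × ℝ, w.2 < -s → κ w = leftKernel e fL gL w.2)
    (hr : ∀ w : ℝ × ℝ, w.2 > s → κ w = rightKernel e f g w.2)
    (hm : Transports ((volume.restrict (Ioo (0 : ℝ) 1)).prod (densityOn ρ (Ioo (-s) s))) κ
      (densityOn η (Ioo (-f s) (f s)) + (densityOn (fun z => η z - ρ z) (Iio (-g s))
        + densityOn (fun z => η z - ρ z) (Ioi (g s))))) :
    Transports ((volume.restrict (Ioo (0 : ℝ) 1)).prod (law ρ)) κ (law η) := by
  have hs' : s ∈ Ioo (-e) e := ⟨by linarith [hs.1, D.e_pos], hs.2⟩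
  have hge := H.e_lt D hs'
  have hfg : f s ≤ g s := ((H s hs').f_lt.trans (H s hs').lt_g).le
  have i1 := isFiniteMeasure_densityOn (S := Ioo (-s) s) D.integrable_ρ
  have i2 := isFiniteMeasure_densityOn (S := Iio (-s)) D.integrable_ρ
  have i3 := isFiniteMeasure_densityOn (S := Ioi s) D.integrable_ρ
  have T1 := (H.transports_leftKernel D hK hs').prod_snd.congr (κ' := κ) <| by
    filter_upwards [ae_prod_snd (ae_densityOn D.measurable_ρ measurableSet_Iio
      (p := fun x => x ∈ Iio (-s)) fun x hx _ => hx)] with w hw using (hl w hw).symm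
  have T2 := (H.transports_rightKernel D hs').prod_snd.congr (κ' := κ) <| by
    filter_upwards [ae_prod_snd (ae_densityOn D.measurable_ρ measurableSet_Ioi
      (p := fun x => x ∈ Ioi s) fun x hx _ => hx)] with w hw using (hr w hw).symm
  have T := (T1.add hm).add T2
  rwa [← Measure.prod_add, ← Measure.prod_add, densityOn_source hs.1.le,
    D.target_eq hfs hfg hge.le] at T

end randomized

/-! ### Third case, contact at `e` -/

section degenerate

variable {ρ η a b : ℝ → ℝ} {α β : EReal} {e : ℝ} {p q : ℝ → ℝ}

lemma IsDispersed.transports_threeDegenerate (D : IsDispersed ρ η α β e)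
    (hpq : IsHKPair (chiThreeDegenerate ρ η e) (excessBeyond ρ η β e) e p q) :
    Transports ((volume.restrict (Ioo (0 : ℝ) 1)).prod (law ρ))
      (fun w => kernelThreeDegenerate ρ η e p q w.1 w.2) (law η) := by
  have he := D.e_pos
  have T1 := D.hkData_core.transports_randomized D le_rfl hpq
    (κ := fun w => kernelThreeDegenerate ρ η e p q w.1 w.2) fun w hw => by
      by_cases hu : w.1 ≤ η w.2 / ρ w.2
      · simp only [kernelThreeDegenerate]
        rw [if_neg fun h => h.2.not_ge hu, if_pos hu]
      · simp only [kernelThreeDegenerate]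
        rw [if_pos ⟨hw, not_le.1 hu⟩, if_neg hu]
  have i1 := isFiniteMeasure_densityOn (S := Ioo (-e) e) D.integrable_ρ
  have i2 := isFiniteMeasure_densityOn (S := Iio (-e)) D.integrable_ρ
  have i3 := isFiniteMeasure_densityOn (S := Ioi e) D.integrable_ρ
  have key : ∀ {S : Set ℝ} [IsFiniteMeasure (densityOn ρ S)], MeasurableSet S →
      (∀ x ∈ S, x ∉ Ioo (-e) e) → Transports ((volume.restrict (Ioo (0 : ℝ) 1)).prod
        (densityOn ρ S)) (fun w => kernelThreeDegenerate ρ η e p q w.1 w.2) (densityOn ρ S) := by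
    intro S _ hS hSe
    refine (transports_dirac _).prod_snd.congr ?_
    filter_upwards [ae_prod_snd (ae_densityOn D.measurable_ρ hS (p := fun x => x ∈ S)
      fun x hx _ => hx)] with w hw
    rw [kernelThreeDegenerate, if_neg fun h => hSe _ hw h.1]
  have T2 := key (S := Iio (-e)) measurableSet_Iio fun x hx hx' => (mem_Iio.1 hx).not_gt hx'.1
  have T3 := key (S := Ioi e) measurableSet_Ioi fun x hx hx' => (mem_Ioi.1 hx).not_gt hx'.2
  have T := (T2.add T1).add T3
  have e0 := D.target_eq (s := e) (t := e) he.le le_rfl le_rfl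
  have z : densityOn η ∅ = 0 := by simp [densityOn]
  rw [Ioo_self, Ioo_self, z, zero_add, zero_add, ← D.excessBeyond_eq he.le] at e0
  rwa [← Measure.prod_add, ← Measure.prod_add, densityOn_source he.le, e0] at T

/-- Since b ≤ A with contact at e, replacing A by b beyond e keeps convexity. Exercise means staying
put, where affinity is trivial and ψ* ≤ A; the moved mass lands beyond ±e, where ψ* = b. -/
theorem IsDispersed.optimal_threeDegenerate (D : IsDispersed ρ η α β e) (P : IsPayoffPair a b β)
    (heq : (a ⊔ b) e = b e)
    (hpq : IsHKPair (chiThreeDegenerate ρ η e) (excessBeyond ρ η β e) e p q) :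
    OptimalWithoutOrder.{u} (law ρ) (law η) a b
      (randomizedModel (randomizedCoupling (law ρ) (kernelThreeDegenerate ρ η e p q)))
      (exerciseThreeDegenerate ρ η e) (psiThreeDegenerate (a ⊔ b) b e) := by
  have := D.prob_ρ
  have he := D.e_pos
  have hT := D.transports_threeDegenerate hpq
  have hφ := convexOn_glue P.convex_sup P.convex_b (fun x _ => IsPayoffPair.b_le x) heq
  have hφm : MonotoneOn (fun x => if x < e then (a ⊔ b) x else b x) (Ici 0) := by
    intro s hs t ht hst
    by_cases h1 : s < e <;> by_cases h2 : t < e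
    · simp only [if_pos h1, if_pos h2]
      exact P.mono_sup hs ht hst
    · simp only [if_pos h1, if_neg h2]
      refine (P.mono_sup hs (mem_Ici.2 he.le) h1.le).trans (heq.le.trans ?_)
      exact P.mono_b (mem_Ici.2 he.le) ht (not_lt.1 h2)
    · exact absurd (hst.trans_lt h2) h1
    · simp only [if_neg h1, if_neg h2]
      exact P.mono_b hs ht hst
  have hψ : psiThreeDegenerate (a ⊔ b) b e = fun x => if |x| < e then (a ⊔ b) |x| else b |x| := by
    ext x
    rw [psiThreeDegenerate, P.sup_abs, P.b_abs]
    by_cases h : |x| < e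
    · rw [if_pos h, if_pos (show x ∈ Icc (-e) e from abs_le.1 h.le)]
    · rw [if_neg h]
      split_ifs with h'
      · have : |x| = e := le_antisymm (abs_le.2 h') (not_lt.1 h)
        rw [← P.sup_abs, ← P.b_abs, this, heq]
      · rfl
  have hin : ∀ x, |x| ≤ e → psiThreeDegenerate (a ⊔ b) b e x = (a ⊔ b) x := fun x hx => by
    rw [psiThreeDegenerate, if_pos (show x ∈ Icc (-e) e from abs_le.1 hx)]
  have hout : ∀ x, e < |x| → psiThreeDegenerate (a ⊔ b) b e x = b x := fun x hx => by
    rw [psiThreeDegenerate, if_neg fun h : x ∈ Icc (-e) e => hx.not_ge (abs_le.2 h)]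
  have hset : MeasurableSet {w : ℝ × ℝ | w.2 ∈ Ioo (-e) e ∧ η w.2 / ρ w.2 < w.1} :=
    (measurableSet_Ioo.preimage measurable_snd).inter (measurableSet_lt
      ((D.measurable_η.comp measurable_snd).div (D.measurable_ρ.comp measurable_snd)) measurable_fst)
  have hI := ae_law_of_densityOn ρ (D.measurable_ρ.sub D.measurable_η) measurableSet_Ioo
    (fun x hx' => sub_pos.2 (D.center x hx'))
    ((D.hkData_core.transports hpq).ae (p := fun y => psiThreeDegenerate (a ⊔ b) b e y = b y)
      (D.hkData_core.carrier_ξ.mono fun y hy => hout y hy.1))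
  refine optimal_randomizedModel hT.1 hT.2 D.order.integrable_left D.order.integrable_right
    D.integral_law_ρ (ae_of_all _ fun w => ?_)
    (C := {w : ℝ × ℝ | w.2 ∈ Ioo (-e) e ∧ η w.2 / ρ w.2 < w.1}ᶜ) hset.compl
    (fun ω hω => if_neg hω) (fun ω hω => if_pos (not_not.1 hω)) P.measurable_a P.measurable_b
    P.nonneg_a P.nonneg_b P.convex_b (by rw [hψ]; exact convexOn_comp_abs hφ hφm) (fun x => ?_)
    (ae_of_all _ fun w hw => ⟨?_, 0, ?_⟩) ?_
  · rw [kernelThreeDegenerate]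
    split_ifs with c
    · exact hpq.step c.1
    · exact isMartingaleStep_dirac _
  · rw [psiThreeDegenerate]
    split_ifs
    · exact IsPayoffPair.b_le x
    · exact le_rfl
  · rw [psiThreeDegenerate]
    split_ifs
    · exact le_rfl
    · exact IsPayoffPair.b_le _
  · rw [kernelThreeDegenerate, if_neg (show ¬ (w.2 ∈ Ioo (-e) e ∧ η w.2 / ρ w.2 < w.1) from hw),
      ae_dirac_eq]
    simp
  · filter_upwards [ae_prod_snd hI] with w hw hwC
    have hc : w.2 ∈ Ioo (-e) e ∧ η w.2 / ρ w.2 < w.1 := not_not.1 hwC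
    refine ⟨(hin _ (abs_lt.2 hc.1).le).ge, ?_⟩
    rw [kernelThreeDegenerate, if_pos hc]
    exact hw hc.1

end degenerate

/-! ### Third case -/

section tangency

variable {ρ η a b : ℝ → ℝ} {α β : EReal} {e x₀ x₃ x₄ : ℝ} {fR gR fL gL : ℝ → ℝ}

lemma IsDispersed.tangency_mass_iff (D : IsDispersed ρ η α β e) {s t : ℝ} (hs : 0 ≤ s) :
    (law ρ).real (Ioo 0 s) - (law η).real (Ioo 0 s)
        = (law η).real (Ioi t) - (law ρ).real (Ioi t) ↔
      cum (fun z => η z - ρ z) t = cum (fun z => η z - ρ z) s := by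
  rw [real_law D.measurable_ρ D.nonneg_ρ measurableSet_Ioo,
    real_law D.measurable_ρ D.nonneg_ρ measurableSet_Ioi,
    real_law D.measurable_η D.nonneg_η measurableSet_Ioo,
    real_law D.measurable_η D.nonneg_η measurableSet_Ioi, D.hasMean_ρ.setIntegral_Ioo hs,
    D.hasMean_η.setIntegral_Ioo hs, D.hasMean_ρ.setIntegral_Ioi, D.hasMean_η.setIntegral_Ioi,
    D.cum_sub, D.cum_sub, D.integral_ρ, D.integral_η, D.cum_zero.1, D.cum_zero.2]
  constructor <;> intro <;> linarith

/-- The defect ℓ_x(f x) - A(f x) is negative at x₀, where f = 0. Near e the points f x < x < g x are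
all close to e, so b(g x) < A(x) and ℓ_x descends; at f x it is then above A(x) ≥ A(f x). A zero of
the defect is x₃, and x₄ is a quantile of the surplus of ν beyond e. -/
theorem IsCurtainData.exists_isTangency (D : IsDispersed ρ η α β e) (P : IsPayoffPair a b β)
    (h : IsCurtainData ρ η α β e fR gR fL gL x₀)
    (hl : payoffLine (a ⊔ b) b gR x₀ 0 < (a ⊔ b) 0) (hbe : b e < (a ⊔ b) e) :
    ∃ x₃ x₄ : ℝ, IsTangency ρ η (a ⊔ b) b β e fR gR x₀ x₃ x₄ := by
  have he := D.e_pos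
  have hx := h.mem_central D
  have H := h.central D
  set A := a ⊔ b with hA
  have hAc : Continuous A := continuous_of_convexOn P.convex_sup
  have hbc : Continuous b := continuous_of_convexOn P.convex_b
  -- The value v separates b slightly to the right of e from A slightly to the left of e.
  obtain ⟨v, hbv, hvA⟩ := exists_between hbe
  obtain ⟨c, hec, hcv⟩ : ∃ c, e < c ∧ b c < v := by
    have h1 : ∀ᶠ c in nhdsWithin e (Ioi e), b c < v :=
      (hbc.continuousAt.tendsto.mono_left nhdsWithin_le_nhds).eventually (gt_mem_nhds hbv)
    obtain ⟨c, h2, h3⟩ := (h1.and self_mem_nhdsWithin).exists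
    exact ⟨c, h3, h2⟩
  have hev : ∀ᶠ x in nhdsWithin e (Iio e), v < A x :=
    (hAc.continuousAt.tendsto.mono_left nhdsWithin_le_nhds).eventually (lt_mem_nhds hvA)
  obtain ⟨t, ⟨hgt, hAt⟩, htI⟩ := (((H.eventually_g_lt D hec).and hev).and
    (Ioo_mem_nhdsLT hx.2 : Ioo x₀ e ∈ nhdsWithin e (Iio e))).exists
  have hsub : Icc x₀ t ⊆ Ioo (-e) e := fun z hz => ⟨hx.1.trans_le hz.1, hz.2.trans_lt htI.2⟩
  have htm : t ∈ Ioo (-e) e := hsub ⟨htI.1.le, le_rfl⟩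
  have hf : ∀ x ∈ Ioc x₀ t, 0 < fR x := fun x hx' => by
    rw [← h.zero]
    exact H.strictMonoOn D hx (hsub ⟨hx'.1.le, hx'.2⟩) hx'.1
  have hfc := (H.continuousOn_f D).mono hsub
  have hgc := (H.continuousOn_g D).mono hsub
  have hFc : ContinuousOn (fun x => payoffLine A b gR x (fR x) - A (fR x)) (Icc x₀ t) := by
    simp only [payoffLine, chord]
    refine ((hAc.continuousOn.add ((((hbc.comp_continuousOn hgc).sub hAc.continuousOn).div
      (hgc.sub continuousOn_id) fun x hx' => ?_).mul (hfc.sub continuousOn_id)))).sub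
      (hAc.comp_continuousOn hfc)
    exact (sub_pos.2 (H x (hsub hx')).lt_g).ne'
  have hFt : 0 < payoffLine A b gR t (fR t) - A (fR t) := by
    have h1 := (H t htm).f_lt
    have h2 := (H t htm).lt_g
    have h3 : A (fR t) ≤ A t :=
      P.mono_sup (hf t ⟨htI.1, le_rfl⟩).le (mem_Ici.2 ((hf t ⟨htI.1, le_rfl⟩).le.trans h1.le)) h1.le
    have h4 : b (gR t) ≤ b c := P.mono_b (mem_Ici.2 (he.trans (H.e_lt D htm)).le)
      (mem_Ici.2 (he.trans hec).le) hgt.le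
    have h5 : 0 < (b (gR t) - A t) / (gR t - t) * (fR t - t) :=
      mul_pos_of_neg_of_neg (div_neg_of_neg_of_pos (by linarith) (by linarith)) (by linarith)
    rw [payoffLine, chord]
    linarith
  obtain ⟨x₃, h3, h30⟩ := intermediate_value_Ioo htI.1.le hFc
    (show (0 : ℝ) ∈ Ioo _ _ from ⟨by rw [h.zero]; linarith, hFt⟩)
  have h3m : x₃ ∈ Ioo (-e) e := hsub (Ioo_subset_Icc_self h3)
  have hf3 : 0 < fR x₃ := hf x₃ ⟨h3.1, h3.2.le⟩
  have hf3x := (H x₃ h3m).f_lt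
  obtain ⟨x₄, h4, h4β, h4c⟩ := D.exists_cum_sub_eq (θ := cum (fun z => η z - ρ z) (fR x₃))
    (D.cum_sub_anti (by linarith) (hf3x.trans h3m.2) le_rfl)
    (by rw [← D.cum_sub_zero]; exact D.cum_sub_anti (by linarith) hf3 (hf3x.trans h3m.2).le)
  refine ⟨x₃, x₄, ⟨h3.1, h3m.2⟩, by linarith, ?_, (mem_symIoo_of_nonneg (he.trans h4).le).1 h4β,
    (D.tangency_mass_iff hf3.le).2 h4c⟩
  -- With k the cumulative surplus of ν over μ, k(g x₃) = cum η (f x₃) - cum ρ x₃ is less than k(f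
  -- x₃) = k(x₄), because f x₃ < x₃. As k increases beyond e, this forces g x₃ < x₄.
  by_contra hn
  have k1 := D.hasMean_sub.cum_le (not_lt.1 hn) fun z hz =>
    (D.sub_pos_of_mem h4.le (H x₃ h3m).g_mem z hz).le
  rw [h4c, H.cum_sub_g D h3m, D.cum_sub] at k1
  have k2 := D.strictMonoOn_cum_ρ ⟨by linarith, hf3x.trans h3m.2⟩ h3m hf3x
  linarith

end tangency

/-! ### Third case with a chord meeting the payoff twice: couplings and optimality. -/

section three

variable {ρ η a b : ℝ → ℝ} {α β : EReal} {e x₀ x₃ x₄ : ℝ} {fR gR fL gL p₃ q₃ p₄ q₄ : ℝ → ℝ}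

lemma IsTangency.mem_central (D : IsDispersed ρ η α β e)
    (h : IsCurtainData ρ η α β e fR gR fL gL x₀)
    (T : IsTangency ρ η (a ⊔ b) b β e fR gR x₀ x₃ x₄) : x₃ ∈ Ioo (-e) e :=
  ⟨(h.mem_central D).1.trans T.mem.1, T.mem.2⟩

lemma IsTangency.f_pos (D : IsDispersed ρ η α β e)
    (h : IsCurtainData ρ η α β e fR gR fL gL x₀)
    (T : IsTangency ρ η (a ⊔ b) b β e fR gR x₀ x₃ x₄) : 0 < fR x₃ := by
  rw [← h.zero]
  exact (h.central D).strictMonoOn D (h.mem_central D) (T.mem_central D h) T.mem.1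

lemma IsTangency.cum_eq (D : IsDispersed ρ η α β e)
    (h : IsCurtainData ρ η α β e fR gR fL gL x₀)
    (T : IsTangency ρ η (a ⊔ b) b β e fR gR x₀ x₃ x₄) :
    cum (fun z => η z - ρ z) x₄ = cum (fun z => η z - ρ z) (fR x₃) :=
  (D.tangency_mass_iff (T.f_pos D h).le).1 T.mass

lemma IsTangency.hkData_outer (D : IsDispersed ρ η α β e)
    (h : IsCurtainData ρ η α β e fR gR fL gL x₀)
    (T : IsTangency ρ η (a ⊔ b) b β e fR gR x₀ x₃ x₄) :
    HKData (chiThree ρ gL fR x₃) (xiThree ρ η fL gR x₃ x₄) x₃ (gR x₃) x₄ := by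
  have hx := T.mem_central D h
  have H := h.central D
  have hge := H.e_lt D hx
  have hf := T.f_pos D h
  have hfx := (H x₃ hx).f_lt
  have he := D.e_pos
  have hlt := T.lt
  have hx2 := hx.2
  rw [xiThree, chiThree, (h.left_eq D hx).1, (h.left_eq D hx).2]
  refine D.hkData_pairIoo D.measurable_ρ D.integrable_ρ (measurableSet_pairIoo (fR x₃) x₃)
    (fun x _ => D.nonneg_ρ x) D.symm_ρ (fun x => neg_mem_pairIoo) (by linarith) (by linarith) hge.le
    hlt.le ((mem_symIoo_of_nonneg (by linarith)).2 T.lt_β)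
    (fun x hx' => abs_lt.1 (abs_of_mem_pairIoo hf.le hx').2)
    ⟨fR x₃, hfx, fun x hx' => ⟨Or.inr hx',
      D.ρ_pos_of_mem ⟨by linarith [hx'.1], by linarith [hx'.2]⟩⟩⟩ ?_
  rw [← pairIoo, setIntegral_pairIoo D.hasMean_ρ D.symm_ρ hf.le hfx.le, T.cum_eq D h,
    H.cum_sub_g D hx, D.cum_sub]
  ring

lemma IsTangency.hkData_inner (D : IsDispersed ρ η α β e)
    (h : IsCurtainData ρ η α β e fR gR fL gL x₀)
    (T : IsTangency ρ η (a ⊔ b) b β e fR gR x₀ x₃ x₄) :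
    HKData (chiFour ρ η gL fR x₃) (excessBeyond ρ η β x₄) (fR x₃) x₄ β := by
  have hx := T.mem_central D h
  have H := h.central D
  have hge := H.e_lt D hx
  have hf := T.f_pos D h
  have hfx := (H x₃ hx).f_lt
  have hlt := T.lt
  have hx2 := hx.2
  rw [chiFour, (h.left_eq D hx).2]
  have hc : ∀ x ∈ Ioo (-fR x₃) (fR x₃), 0 < ρ x - η x := fun x hx' =>
    sub_pos.2 (D.center x ⟨by linarith [hx'.1], by linarith [hx'.2]⟩)
  refine D.hkData_excess (D.measurable_ρ.sub D.measurable_η) (D.hasMean_ρ.sub D.hasMean_η).1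
    measurableSet_Ioo (fun x hx' => (hc x hx').le) (fun x => by rw [D.symm_ρ, D.symm_η])
    (fun x => neg_mem_symm_Ioo) hf (by linarith) (by linarith) subset_rfl
    ⟨0, hf, fun x hx' => ?_⟩ ?_
  · have : x ∈ Ioo (-fR x₃) (fR x₃) := ⟨by linarith [hx'.1], hx'.2⟩
    exact ⟨this, hc x this⟩
  · rw [setIntegral_symm_Ioo (D.hasMean_ρ.sub D.hasMean_η) (fun x => by rw [D.symm_ρ, D.symm_η])
      hf.le, D.hasMean_ρ.cum_fun_sub D.hasMean_η, T.cum_eq D h, D.cum_sub,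
      integral_sub D.integrable_ρ D.integrable_η, D.integral_ρ, D.integral_η]
    ring

lemma IsTangency.transports (D : IsDispersed ρ η α β e)
    (h : IsCurtainData ρ η α β e fR gR fL gL x₀)
    (T : IsTangency ρ η (a ⊔ b) b β e fR gR x₀ x₃ x₄)
    (hpq₃ : IsHKPair (chiThree ρ gL fR x₃) (xiThree ρ η fL gR x₃ x₄) x₃ p₃ q₃)
    (hpq₄ : IsHKPair (chiFour ρ η gL fR x₃) (excessBeyond ρ η β x₄) (fR x₃) p₄ q₄) :
    Transports ((volume.restrict (Ioo (0 : ℝ) 1)).prod (law ρ))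
      (fun w => kernelThree ρ η e fR gR fL gL x₃ p₃ q₃ p₄ q₄ w.1 w.2) (law η) := by
  have hx := T.mem_central D h
  have H := h.central D
  have hge := H.e_lt D hx
  have hf := T.f_pos D h
  have hfx := (H x₃ hx).f_lt
  have hlt := T.lt
  have hx2 := hx.2
  have hL := h.left_eq D hx
  have O := T.hkData_outer D h
  have I := T.hkData_inner D h
  have he := D.e_pos
  refine H.transports_prod_law D (fun x hx => h.left_eq D hx) ⟨by linarith, hx2⟩ hf.le
    (fun w hw => by rw [kernelThree, if_pos hw.le])
    (fun w hw => by rw [kernelThree, if_neg (by linarith), if_pos (le_of_lt hw)]) ?_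
  have T1 : Transports ((volume.restrict (Ioo (0 : ℝ) 1)).prod
      (densityOn ρ (Ioo (-fR x₃) (fR x₃))))
      (fun w => kernelThree ρ η e fR gR fL gL x₃ p₃ q₃ p₄ q₄ w.1 w.2)
      (densityOn η (Ioo (-fR x₃) (fR x₃)) + excessBeyond ρ η β x₄) := by
    rw [chiFour, hL.2] at I hpq₄
    refine I.transports_randomized D (by linarith) hpq₄ fun w hw => ?_
    rw [kernelThree, hL.2, if_neg (by linarith [hw.1]), if_neg (by linarith [hw.2]), if_pos hw]
  have i1 := isFiniteMeasure_densityOn (S := Ioo (-fR x₃) (fR x₃)) D.integrable_ρ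
  have i2 := isFiniteMeasure_densityOn (S := pairIoo (fR x₃) x₃) D.integrable_ρ
  have T0 : Transports ((volume.restrict (Ioo (0 : ℝ) 1)).prod
      (densityOn ρ (pairIoo (fR x₃) x₃)))
      (fun w => kernelThree ρ η e fR gR fL gL x₃ p₃ q₃ p₄ q₄ w.1 w.2)
      (densityOn (fun z => η z - ρ z) (pairIoo (gR x₃) x₄)) := by
    rw [chiThree, xiThree, hL.1, hL.2, ← pairIoo, ← pairIoo] at O hpq₃
    refine (O.transports hpq₃).prod_snd.congr ?_
    filter_upwards [ae_prod_snd (ae_densityOn D.measurable_ρ (measurableSet_pairIoo (fR x₃) x₃)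
      (p := fun x => x ∈ pairIoo (fR x₃) x₃) fun x hx _ => hx)] with w hw
    obtain ⟨h1, h2⟩ := abs_of_mem_pairIoo hf.le hw
    have h3 := abs_lt.1 h2
    rw [kernelThree, hL.2, if_neg (by linarith), if_neg (by linarith),
      if_neg fun hn : w.2 ∈ Ioo (-fR x₃) (fR x₃) => h1.not_gt (abs_lt.2 hn)]
  have T' := T1.add T0
  rwa [← Measure.prod_add, densityOn_symm_add_pairIoo hf.le hfx.le, add_assoc,
    add_comm (excessBeyond ρ η β x₄), D.excessBeyond_eq (by linarith),
    densityOn_pairIoo_add (by linarith) hlt.le] at T'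

/-- The line meets A at f(x₃) and at x₃, hence lies above A between these points and below it
outside; it also dominates b exactly up to its contact at g(x₃), seen from f(x₃). Exercise is along
curtains, where ψ* is the line, or by staying put where ψ* = A. Both Hobson–Klimmek couplings are
used for continuation and land beyond ±g(x₃), where ψ* = b. -/
theorem IsTangency.optimal (D : IsDispersed ρ η α β e) (P : IsPayoffPair a b β)
    (h : IsCurtainData ρ η α β e fR gR fL gL x₀)
    (T : IsTangency ρ η (a ⊔ b) b β e fR gR x₀ x₃ x₄)
    (hpq₃ : IsHKPair (chiThree ρ gL fR x₃) (xiThree ρ η fL gR x₃ x₄) x₃ p₃ q₃)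
    (hpq₄ : IsHKPair (chiFour ρ η gL fR x₃) (excessBeyond ρ η β x₄) (fR x₃) p₄ q₄) :
    OptimalWithoutOrder.{u} (law ρ) (law η) a b
      (randomizedModel (randomizedCoupling (law ρ)
        (kernelThree ρ η e fR gR fL gL x₃ p₃ q₃ p₄ q₄)))
      (exerciseThree ρ η gL fR x₃)
      (psiThree (a ⊔ b) b (payoffLine (a ⊔ b) b gR x₃) fR gR x₃) := by
  have := D.prob_ρ
  have hx := T.mem_central D h
  have H := h.central D
  have hge := H.e_lt D hx
  have hf := T.f_pos D h
  have hfx := (H x₃ hx).f_lt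
  have hxg := (H x₃ hx).lt_g
  have hlt := T.lt
  have hx2 := hx.2
  have he := D.e_pos
  have hL := h.left_eq D hx
  have O := T.hkData_outer D h
  have I := T.hkData_inner D h
  have hT := T.transports D h hpq₃ hpq₄
  set l := payoffLine (a ⊔ b) b gR x₃ with hl
  have hline : IsLine l := isLine_chord _ _ _ _
  have lx : l x₃ = (a ⊔ b) x₃ := chord_left _ _ _ _
  have lg : l (gR x₃) = b (gR x₃) := chord_right hxg _ _
  have lf : l (fR x₃) = (a ⊔ b) (fR x₃) := T.meet.symm
  have lmono : Monotone l := hline.mono hfx <| by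
    rw [lx, lf]
    exact P.mono_sup (mem_Ici.2 hf.le) (mem_Ici.2 (hf.trans hfx).le) hfx.le
  have hbf : b (fR x₃) ≤ l (fR x₃) := (IsPayoffPair.b_le _).trans lf.ge
  have b_le_l : ∀ t ∈ Icc (fR x₃) (gR x₃), b t ≤ l t := fun t ht =>
    hline.le_between P.convex_b hbf lg.ge ht.1 ht.2
  have l_le_b : ∀ t, gR x₃ ≤ t → l t ≤ b t := fun t ht =>
    hline.le_right P.convex_b hbf lg.le (hfx.trans hxg) ht
  have l_le_A : ∀ t, x₃ ≤ t → l t ≤ (a ⊔ b) t := fun t ht =>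
    hline.le_right P.convex_sup lf.ge lx.le hfx ht
  have l_le_A' : ∀ t, t ≤ fR x₃ → l t ≤ (a ⊔ b) t := fun t ht =>
    hline.le_left P.convex_sup lf.le lx.ge hfx ht
  -- On the positive half-line ψ* is A followed by max(l, b). The maximum makes the second corner
  -- convex automatically, and the gluing at f(x₃) uses that l and b are at most A to its left.
  set G : ℝ → ℝ := fun t => if t < fR x₃ then (a ⊔ b) t else max (l t) (b t) with hG
  have Gin : ∀ t, t < fR x₃ → G t = (a ⊔ b) t := fun t ht => if_pos ht
  have Gmid : ∀ t ∈ Icc (fR x₃) (gR x₃), G t = l t := fun t ht =>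
    (if_neg (not_lt.2 ht.1)).trans (max_eq_left (b_le_l t ht))
  have Gout : ∀ t, gR x₃ ≤ t → G t = b t := fun t ht =>
    (if_neg (not_lt.2 ((hfx.trans hxg).le.trans ht))).trans (max_eq_right (l_le_b t ht))
  have hGc : ConvexOn ℝ univ G :=
    convexOn_glue P.convex_sup (hline.convexOn.sup P.convex_b)
      (fun t ht => max_le (l_le_A' t ht.le) (IsPayoffPair.b_le t))
      (by rw [← lf]; exact (max_eq_left hbf).symm)
  have hGm : MonotoneOn G (Ici 0) := by
    intro s hs t ht hst
    have out : ∀ s t : ℝ, 0 ≤ s → s ≤ t → max (l s) (b s) ≤ max (l t) (b t) := fun s t hs hst =>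
      max_le_max (lmono hst) (P.mono_b (mem_Ici.2 hs) (mem_Ici.2 (hs.trans hst)) hst)
    by_cases h1 : s < fR x₃ <;> by_cases h2 : t < fR x₃
    · rw [Gin s h1, Gin t h2]
      exact P.mono_sup hs ht hst
    · rw [Gin s h1, hG]
      simp only [if_neg h2]
      refine (P.mono_sup hs (mem_Ici.2 hf.le) h1.le).trans ?_
      rw [← lf]
      exact le_max_of_le_left (lmono (not_lt.1 h2))
    · exact absurd (hst.trans_lt h2) h1
    · rw [hG]
      simp only [if_neg h1, if_neg h2]
      exact out s t hs hst
  have hψ : psiThree (a ⊔ b) b l fR gR x₃ = fun x => G |x| := by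
    ext x
    rw [psiThree]
    split_ifs with c1 c2 c3
    · have : gR x₃ < |x| := lt_abs.2 (c1.symm.imp_right fun h => by linarith)
      rw [Gout _ this.le, P.b_abs]
    · rw [Gin _ (abs_lt.2 c2), P.sup_abs]
    · rw [not_or, not_lt, not_lt] at c1
      rw [abs_of_nonpos (by linarith), Gmid _ ⟨by linarith, by linarith [c1.1]⟩]
    · rw [not_or, not_lt, not_lt] at c1
      have hfx' : fR x₃ ≤ x := by
        by_contra hn
        exact c2 ⟨not_le.1 c3, not_le.1 hn⟩
      rw [abs_of_nonneg (by linarith), Gmid _ ⟨hfx', c1.2⟩]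
  rw [hψ]
  have hψs : ∀ x : ℝ, G |-x| = G |x| := fun x => by rw [abs_neg]
  have hψl : ∀ y ∈ Icc (fR x₃) (gR x₃), G |y| = l y := fun y hy => by
    rw [abs_of_nonneg (hf.le.trans hy.1), Gmid y hy]
  have hψb : ∀ y, gR x₃ ≤ |y| → G |y| = b y := fun y hy => by rw [Gout _ hy, P.b_abs]
  have hset : MeasurableSet {w : ℝ × ℝ | w.2 ∉ Ioo (-x₃) x₃ ∨
      (w.2 ∈ Ioo (gL (-x₃)) (fR x₃) ∧ w.1 < η w.2 / ρ w.2)} :=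
    (measurableSet_Ioo.preimage measurable_snd).compl.union
      ((measurableSet_Ioo.preimage measurable_snd).inter (measurableSet_lt measurable_fst
        ((D.measurable_η.comp measurable_snd).div (D.measurable_ρ.comp measurable_snd))))
  have hO : ∀ᵐ x ∂(law ρ), x ∈ pairIoo (fR x₃) x₃ → ∀ᵐ y ∂hkKernel p₃ q₃ x, G |y| = b y := by
    have := (O.transports hpq₃).ae (p := fun y => G |y| = b y)
      (O.carrier_ξ.mono fun y hy => hψb y hy.1.le)
    rw [chiThree, hL.2, ← pairIoo] at this
    refine ae_law_of_densityOn ρ D.measurable_ρ (measurableSet_pairIoo _ _) (fun x hx' => ?_) this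
    have h3 := abs_lt.1 (abs_of_mem_pairIoo hf.le hx').2
    exact D.ρ_pos_of_mem ⟨by linarith, by linarith⟩
  have hI : ∀ᵐ x ∂(law ρ), x ∈ Ioo (-fR x₃) (fR x₃) → ∀ᵐ y ∂hkKernel p₄ q₄ x, G |y| = b y := by
    have := (I.transports hpq₄).ae (p := fun y => G |y| = b y)
      (I.carrier_ξ.mono fun y hy => hψb y (hlt.trans hy.1).le)
    rw [chiFour, hL.2] at this
    exact ae_law_of_densityOn ρ (D.measurable_ρ.sub D.measurable_η) measurableSet_Ioo
      (fun x hx' => sub_pos.2 (D.center x ⟨by linarith [hx'.1], by linarith [hx'.2]⟩)) this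
  refine optimal_randomizedModel hT.1 hT.2 D.order.integrable_left D.order.integrable_right
    D.integral_law_ρ ?_ hset (fun ω hω => if_pos hω) (fun ω hω => if_neg hω) P.measurable_a
    P.measurable_b P.nonneg_a P.nonneg_b P.convex_b (convexOn_comp_abs hGc hGm) (fun x => ?_)
    (ae_of_all _ fun w hw => ⟨?_, ?_⟩) ?_
  · refine ae_of_all _ fun w => ?_
    have hout := h.step_outer D (s := x₃) (x := w.2) ⟨hf.trans hfx, hx2⟩
    rw [kernelThree, hL.2]
    split_ifs with c1 c2 c3 c4
    · exact hout.1 c1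
    · exact hout.2 c2
    · exact isMartingaleStep_dirac _
    · exact hpq₄.step c3
    · exact hpq₃.step ⟨not_le.1 c1, not_le.1 c2⟩
  · show b x ≤ G |x|
    rw [← P.b_abs x]
    by_cases h1 : |x| < fR x₃
    · rw [Gin _ h1]
      exact IsPayoffPair.b_le _
    · exact (le_max_right _ _).trans (if_neg h1).ge
  · rw [← P.sup_abs w.2]
    rcases hw with hw | hw
    · have hxx : x₃ ≤ |w.2| := by
        by_contra hn
        exact hw (abs_lt.1 (not_le.1 hn))
      refine (if_neg (by linarith)).trans_le (max_le (l_le_A _ hxx) (IsPayoffPair.b_le _))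
    · rw [hL.2] at hw
      exact (Gin _ (abs_lt.2 hw.1)).le
  · rw [kernelThree, hL.2]
    rw [hL.2] at hw
    split_ifs with c1 c2 c3 c4
    · exact H.affine_leftKernel D (ψ := fun x => G |x|) (fun x hx => h.left_eq D hx) hx hline hψl
        hψs c1
    · exact H.affine_rightKernel D (ψ := fun x => G |x|) hx hline hψl c2
    · refine ⟨0, ?_⟩
      rw [ae_dirac_eq]
      simp
    · rcases hw with hw | hw
      · exact absurd ⟨not_le.1 c1, not_le.1 c2⟩ hw
      · exact absurd hw.2.le c4
    · rcases hw with hw | hw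
      · exact absurd ⟨not_le.1 c1, not_le.1 c2⟩ hw
      · exact absurd hw.1 c3
  -- Excluded null sets: the points ±f(x₃), which belong to neither source, and the ties U = η/ρ, at
  -- which the kernel stays put although the rule does not exercise.
  · filter_upwards [ae_prod_snd hO, ae_prod_snd hI, ae_prod_snd (ae_law_ne ρ (fR x₃)),
      ae_prod_snd (ae_law_ne ρ (-fR x₃)),
      ae_prod_ne (χ := law ρ) (D.measurable_η.div D.measurable_ρ)] with w h1 h2 h3 h4 h5 hwC
    have hwC' : ¬ (w.2 ∉ Ioo (-x₃) x₃ ∨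
      (w.2 ∈ Ioo (gL (-x₃)) (fR x₃) ∧ w.1 < η w.2 / ρ w.2)) := hwC
    rw [not_or, not_not, hL.2] at hwC'
    obtain ⟨hm, hn⟩ := hwC'
    rw [kernelThree, hL.2, if_neg (not_le.2 hm.1), if_neg (not_le.2 hm.2), ← P.sup_abs w.2]
    by_cases hc : w.2 ∈ Ioo (-fR x₃) (fR x₃)
    · have hu : ¬ w.1 ≤ η w.2 / ρ w.2 := fun hle => hn ⟨hc, lt_of_le_of_ne hle h5⟩
      rw [if_pos hc, if_neg hu]
      exact ⟨(Gin _ (abs_lt.2 hc)).ge, h2 hc⟩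
    · have hab : fR x₃ ≤ |w.2| := by
        by_contra hn
        exact hc (abs_lt.1 (not_le.1 hn))
      have hab' := abs_lt.2 hm
      rw [if_neg hc]
      refine ⟨?_, h1 ?_⟩
      · rw [Gmid _ ⟨hab, by linarith⟩]
        exact hline.le_between P.convex_sup lf.ge lx.ge hab hab'.le
      · rcases le_abs.1 hab with h' | h'
        · exact Or.inr ⟨lt_of_le_of_ne h' h3.symm, hm.2⟩
        · exact Or.inl ⟨hm.1, lt_of_le_of_ne (by linarith) h4⟩

end three

/-! ### Duality -/

lemma IsOptimal.primalValue_eq_dualValue {μ ν : Measure ℝ} {a b ψ : ℝ → ℝ} {M : MarketModel.{0}}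
    {τ : M.Ω → Fin 3} (h : IsOptimal.{0} μ ν a b M τ ψ) :
    (primalValue μ ν a b : EReal) = dualValue μ ν a b := by
  have h1 : primalValue μ ν a b = M.expectedPayoff τ a b := by
    refine le_antisymm (sSup_le ?_) (le_sSup ⟨M, τ, h.consistent, h.exercise, rfl⟩)
    rintro _ ⟨M', τ', hM, hτ, rfl⟩
    exact h.highest M' τ' hM hτ
  have h2 : dualValue μ ν a b = hedgingCost μ ν (generatedPhi a ψ) ψ := by
    refine le_antisymm (sInf_le ⟨_, _, _, _, h.superhedge, rfl⟩) (le_sInf ?_)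
    rintro _ ⟨φ', ψ', θ₁, θ₂, hs, rfl⟩
    exact h.cheapest φ' ψ' θ₁ θ₂ hs
  rw [h1, h2, h.payoff_eq_cost]

theorem IsDispersed.primalValue_eq_dualValue {ρ η a b : ℝ → ℝ} {α β : EReal} {e : ℝ}
    (D : IsDispersed ρ η α β e) (P : IsPayoffPair a b β) :
    (primalValue (law ρ) (law η) a b : EReal) = dualValue (law ρ) (law η) a b := by
  obtain ⟨fR, gR, fL, gL, x₀, h⟩ := exists_isCurtainData D
  rcases lt_or_ge (payoffLine (a ⊔ b) b gR x₀ 0) ((a ⊔ b) 0) with h1 | h1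
  · rcases (IsPayoffPair.b_le (a := a) (b := b) e).lt_or_eq with h2 | h2
    · obtain ⟨x₃, x₄, T⟩ := h.exists_isTangency D P h1 h2
      obtain ⟨p₃, q₃, h3⟩ := (T.hkData_outer D h).exists_isHKPair
      obtain ⟨p₄, q₄, h4⟩ := (T.hkData_inner D h).exists_isHKPair
      exact (T.optimal D P h h3 h4).2.1.primalValue_eq_dualValue
    · obtain ⟨p, q, h3⟩ := D.hkData_core.exists_isHKPair
      exact (D.optimal_threeDegenerate P h2.symm h3).2.1.primalValue_eq_dualValue
  · rcases le_or_gt (payoffLine (a ⊔ b) b gR x₀ 0) ((a ⊔ b) x₀) with h2 | h2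
    · obtain ⟨p, q, h3⟩ := (h.hkData_one D).exists_isHKPair
      exact (h.optimal_one D P h1 h2 h3).2.1.primalValue_eq_dualValue
    · obtain ⟨x₁, y₁, V⟩ := h.exists_isLevel D P h2
      obtain ⟨p₀, q₀, h3⟩ := (h.hkData_two_outer D V).exists_isHKPair
      obtain ⟨p₁, q₁, h4⟩ := (h.hkData_two_inner D V).exists_isHKPair
      exact (h.optimal_two D P V h3 h4).2.1.primalValue_eq_dualValue

end Bermudan

end

/-! ### The main theorem. -/

open Bermudan in
theorem theorem5 (ρ η a b : ℝ → ℝ) (α β : EReal) (e : ℝ)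
    (hlaw : IsDispersed ρ η α β e) (hpay : IsPayoffPair a b β) :
    -- there is no duality gap
    (primalValue (law ρ) (law η) a b : EReal) = dualValue (law ρ) (law η) a b ∧
    -- the curtain functions and the point `x₀` exist
    (∃ (fR gR fL gL : ℝ → ℝ) (x₀ : ℝ), IsCurtainData ρ η α β e fR gR fL gL x₀) ∧
    ∀ (fR gR fL gL : ℝ → ℝ) (x₀ : ℝ), IsCurtainData ρ η α β e fR gR fL gL x₀ →
      -- one of the three cases holds
      (((a ⊔ b) 0 ≤ payoffLine (a ⊔ b) b gR x₀ 0 ∧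
          payoffLine (a ⊔ b) b gR x₀ 0 ≤ (a ⊔ b) x₀) ∨
        (a ⊔ b) x₀ < payoffLine (a ⊔ b) b gR x₀ 0 ∨
        payoffLine (a ⊔ b) b gR x₀ 0 < (a ⊔ b) 0) ∧
      -- first case
      ((a ⊔ b) 0 ≤ payoffLine (a ⊔ b) b gR x₀ 0 →
        payoffLine (a ⊔ b) b gR x₀ 0 ≤ (a ⊔ b) x₀ →
        (∃ p q : ℝ → ℝ, IsHKPair (chiOne ρ x₀) (xiOne ρ η β fL gR x₀) x₀ p q) ∧
        ∀ p q : ℝ → ℝ, IsHKPair (chiOne ρ x₀) (xiOne ρ η β fL gR x₀) x₀ p q →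
          OptimalWithoutOrder.{u} (law ρ) (law η) a b
            (canonicalModel (coupling (law ρ) (kernelOne e fR gR fL gL x₀ p q)))
            (exerciseOutside x₀)
            (psiOne b (payoffLine (a ⊔ b) b gR x₀))) ∧
      -- second case
      ((a ⊔ b) x₀ < payoffLine (a ⊔ b) b gR x₀ 0 →
        (∃ x₁ y₁ : ℝ, IsLevel ρ η (a ⊔ b) b β gR x₀ x₁ y₁) ∧
        ∀ x₁ y₁ : ℝ, IsLevel ρ η (a ⊔ b) b β gR x₀ x₁ y₁ →
          (∃ p₀ q₀ : ℝ → ℝ,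
            IsHKPair (chiTwoOuter ρ x₀ x₁) (xiTwoOuter ρ η fL gR x₀ y₁) x₀ p₀ q₀) ∧
          (∃ p₁ q₁ : ℝ → ℝ,
            IsHKPair (chiTwoInner ρ x₁) (excessBeyond ρ η β y₁) x₁ p₁ q₁) ∧
          ∀ p₀ q₀ p₁ q₁ : ℝ → ℝ,
            IsHKPair (chiTwoOuter ρ x₀ x₁) (xiTwoOuter ρ η fL gR x₀ y₁) x₀ p₀ q₀ →
            IsHKPair (chiTwoInner ρ x₁) (excessBeyond ρ η β y₁) x₁ p₁ q₁ →
            OptimalWithoutOrder.{u} (law ρ) (law η) a b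
              (canonicalModel (coupling (law ρ) (kernelTwo e fR gR fL gL x₀ x₁ p₀ q₀ p₁ q₁)))
              (exerciseOutside x₁)
              (psiTwo (a ⊔ b) b x₁)) ∧
      -- third case, with `(a ∨ b)(e) > b(e)`
      (payoffLine (a ⊔ b) b gR x₀ 0 < (a ⊔ b) 0 → b e < (a ⊔ b) e →
        (∃ x₃ x₄ : ℝ, IsTangency ρ η (a ⊔ b) b β e fR gR x₀ x₃ x₄) ∧
        ∀ x₃ x₄ : ℝ, IsTangency ρ η (a ⊔ b) b β e fR gR x₀ x₃ x₄ →
          (∃ p₃ q₃ : ℝ → ℝ,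
            IsHKPair (chiThree ρ gL fR x₃) (xiThree ρ η fL gR x₃ x₄) x₃ p₃ q₃) ∧
          (∃ p₄ q₄ : ℝ → ℝ,
            IsHKPair (chiFour ρ η gL fR x₃) (excessBeyond ρ η β x₄) (fR x₃) p₄ q₄) ∧
          ∀ p₃ q₃ p₄ q₄ : ℝ → ℝ,
            IsHKPair (chiThree ρ gL fR x₃) (xiThree ρ η fL gR x₃ x₄) x₃ p₃ q₃ →
            IsHKPair (chiFour ρ η gL fR x₃) (excessBeyond ρ η β x₄) (fR x₃) p₄ q₄ →
            OptimalWithoutOrder.{u} (law ρ) (law η) a b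
              (randomizedModel (randomizedCoupling (law ρ)
                (kernelThree ρ η e fR gR fL gL x₃ p₃ q₃ p₄ q₄)))
              (exerciseThree ρ η gL fR x₃)
              (psiThree (a ⊔ b) b (payoffLine (a ⊔ b) b gR x₃) fR gR x₃)) ∧
      -- third case, with `(a ∨ b)(e) = b(e)`
      (payoffLine (a ⊔ b) b gR x₀ 0 < (a ⊔ b) 0 → (a ⊔ b) e = b e →
        (∃ p q : ℝ → ℝ,
          IsHKPair (chiThreeDegenerate ρ η e) (excessBeyond ρ η β e) e p q) ∧
        ∀ p q : ℝ → ℝ,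
          IsHKPair (chiThreeDegenerate ρ η e) (excessBeyond ρ η β e) e p q →
          OptimalWithoutOrder.{u} (law ρ) (law η) a b
            (randomizedModel (randomizedCoupling (law ρ)
              (kernelThreeDegenerate ρ η e p q)))
            (exerciseThreeDegenerate ρ η e)
            (psiThreeDegenerate (a ⊔ b) b e)) := by
  refine ⟨hlaw.primalValue_eq_dualValue hpay, exists_isCurtainData hlaw,
    fun fR gR fL gL x₀ h => ⟨?_, ?_, ?_, ?_, ?_⟩⟩
  · rcases lt_or_ge (payoffLine (a ⊔ b) b gR x₀ 0) ((a ⊔ b) 0) with h1 | h1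
    · exact Or.inr (Or.inr h1)
    · rcases le_or_gt (payoffLine (a ⊔ b) b gR x₀ 0) ((a ⊔ b) x₀) with h2 | h2
      · exact Or.inl ⟨h1, h2⟩
      · exact Or.inr (Or.inl h2)
  · exact fun h1 h2 => ⟨(h.hkData_one hlaw).exists_isHKPair, fun p q hpq =>
      h.optimal_one hlaw hpay h1 h2 hpq⟩
  · exact fun h1 => ⟨h.exists_isLevel hlaw hpay h1, fun x₁ y₁ V =>
      ⟨(h.hkData_two_outer hlaw V).exists_isHKPair, (h.hkData_two_inner hlaw V).exists_isHKPair,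
        fun _ _ _ _ h3 h4 => h.optimal_two hlaw hpay V h3 h4⟩⟩
  · exact fun h1 h2 => ⟨h.exists_isTangency hlaw hpay h1 h2, fun x₃ x₄ T =>
      ⟨(T.hkData_outer hlaw h).exists_isHKPair, (T.hkData_inner hlaw h).exists_isHKPair,
        fun _ _ _ _ h3 h4 => T.optimal hlaw hpay h h3 h4⟩⟩
  · exact fun _ h2 => ⟨hlaw.hkData_core.exists_isHKPair, fun _ _ h3 =>
      hlaw.optimal_threeDegenerate hpay h2 h3⟩
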